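/- **Setting.** Let $d\in\{2,3\}$, let $\ell\in\mathbb{N}_0$ with $\ell<d$, and let $\beta\in\left(-\frac{d-\ell}{2},\frac{d-\ell}{2}\right)$. Let $\Omega\subset\mathbb{R}^d$ be a bounded, open, connected set with Lipschitz boundary. *Singular set.* Let $\Lambda\subset\Omega$ be a nonempty union of $N$ sets $f_i([0,1]^\ell)$, where for some $\rho_i>0$ and $K\ge 1$ one has $\frac{\rho_i}{K}|s-t|\le|f_i(s)-f_i(t)|\le K\rho_i|s-t|$ for all $s,t\in[0,1]^\ell$. (Points for $\ell=0$, polygonal lines for $\ell=1$, polygons for $\ell=2$, and compact $\ell$-dimensional $C^1$ submanifolds are of this form.) Let $d_\Lambda(x)=\operatorname{dist}(x,\Lambda)$ and $\|g\|_{L^2_\beta(\Omega)}=\left(\int_\Omega|g|^2d_\Lambda^{2\beta}\,dx\right)^{1/2}$. Let $H^1_\beta(\Omega)$ be the space of $u\in L^2_\beta(\Omega)$ with weak gradient in $L^2_\beta(\Omega;\mathbb{R}^d)$, and $H^1_{0,\beta}(\Omega)$ the closure of $C_c^\infty(\Omega)$ in it. *Coefficient.* Let $A$ be a measurable, symmetric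 matrix field on $\Omega$ with $\gamma_1|\xi|^2\le A\xi\cdot\xi\le\gamma_2|\xi|^2$ for all $\xi\in\mathbb{R}^d$, almost everywhere in $\Omega$, where $\gamma_1>0$. *Mesh.* Let $\mathcal{T}_H$ be a finite conforming simplicial mesh of $\overline\Omega$ such that each $T\in\mathcal{T}_H$ (a closed simplex) satisfies $\operatorname{diam}T\le H$ and contains a closed ball of radius $H/\sigma$, where $H>0$ and $\sigma\ge1$. Suppose that $\Lambda\subset T$ for some $T\in\mathcal{T}_H$. Let $\mathcal{N}_{int}$ be the set of mesh vertices in $\Omega$, $\lambda_{\bf v}$ the $\mathbb{P}_1$ nodal basis function of ${\bf v}$, and $V_H$ the space of continuous functions on $\overline\Omega$ that are affine on each $T\in\mathcal{T}_H$ and vanish on $\partial\Omega$. The patches are $\omega_{\bf v}=\omega_{{\bf v},0}=\Omega\cap\bigcup_{T\ni{\bf v}}T$ and $\omega_{{\bf v},k}=\Omega\cap\operatorname{int}\bigcup\{T\in\mathcal{T}_H : T\cap\overline{\omega_{{\bf v},k-1}}\ne\emptyset\}$ for $k\ge1$. *Fine-scale spaces.* For ${\bf v}\in\mathcal{N}_{int}$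 let $\mathcal{P}_{\bf v}u\in V_H|_{\omega_{\bf v}}$ be the projection of $u$ determined by $\int_{\omega_{\bf v}}(\mathcal{P}_{\bf v}u)\,v_H\,d_\Lambda^{2\beta}\,dx=\int_{\omega_{\bf v}}u\,v_H\,d_\Lambda^{2\beta}\,dx$ for all $v_H\in V_H$. Let $\mathcal{I}^\beta_Hu=\sum_{{\bf v}\in\mathcal{N}_{int}}(\mathcal{P}_{\bf v}u)({\bf v})\lambda_{\bf v}$. Put $V^f_\beta=\{u\in H^1_{0,\beta}(\Omega):\mathcal{I}^\beta_Hu=0\}$ and $V^f_\beta(\omega)=\{u\in V^f_\beta: u=0 \text{ a.e. on }\Omega\setminus\omega\}$. *Correctors.* For $u_H\in V_H$ the ideal corrector $Q^\beta_\Omega(u_H)\in V^f_\beta$ is defined by $$\int_\Omega A\nabla Q^\beta_\Omega(u_H)\cdot\nabla w\,d_\Lambda^{2\beta}\,dx=\int_\Omega A\nabla u_H\cdot\nabla w\,d_\Lambda^{2\beta}\,dx\quad\text{for all }w\in V^f_\beta.$$ With $\hat\lambda_{\bf v}=\lambda_{\bf v}/\sum_{{\bf v}'\in\mathcal{N}_{int}}\lambda_{{\bf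 v}'}$ (set to $0$ where the denominator vanishes), the localized correctors $Q^\beta_{{\bf v},k}(u_H)\in V^f_\beta(\omega_{{\bf v},k})$, ${\bf v}\in\mathcal{N}_{int}$, are defined by $$\int_{\omega_{{\bf v},k}}A\nabla Q^\beta_{{\bf v},k}(u_H)\cdot\nabla w\,d_\Lambda^{2\beta}\,dx=\int_{\omega_{\bf v}}\hat\lambda_{\bf v}\,A\nabla u_H\cdot\nabla w\,d_\Lambda^{2\beta}\,dx\quad\text{for all }w\in V^f_\beta(\omega_{{\bf v},k}),$$ and $Q^\beta_k(u_H)=\sum_{{\bf v}\in\mathcal{N}_{int}}Q^\beta_{{\bf v},k}(u_H)$. **Claim.** There are $C>0$ and $\theta\in(0,1)$, depending only on $d,\ell,\beta,\Omega,\gamma_1,\gamma_2,\sigma,N,K$ (in particular not on the mesh, $H$, $k$, $u_H$, and on $A$ and $\Lambda$ only through these parameters), such that for all $\Lambda$, $A$, $\mathcal{T}_H$ as above, all $u_H\in V_H$ and all integers $k\ge1$, the correctors exist and $$\left\|\nabla\left(Q^\beta_\Omega(u_H)-Q^\beta_k(u_H)\right)\right\|_{L^2_\beta(\Omega)}\le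 C\,k^{d/2}\,\theta^k\,\|\nabla u_H\|_{L^2_\beta(\Omega)}.$$ -/

import Mathlib

open Set Filter Topology MeasureTheory
open scoped ContDiff RealInnerProductSpace

noncomputable section

namespace WeightedLOD

/-- Euclidean space of dimension `d`. -/
abbrev Space (d : ℕ) := EuclideanSpace ℝ (Fin d)

/-! ### Domain, singular set, coefficient -/

/-- `Ω` has Lipschitz boundary: near every boundary point, `Ω` is, after a choice of a unit
direction `e`, the strict epigraph of a Lipschitz function of the projection onto `e`-perp. -/
def HasLipschitzBoundary {d : ℕ} (Ω : Set (Space d)) : Prop :=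
  ∀ x ∈ frontier Ω, ∃ (e : Space d) (L : NNReal) (φ : Space d → ℝ) (r : ℝ),
    ‖e‖ = 1 ∧ LipschitzWith L φ ∧ 0 < r ∧
      ∀ y ∈ Metric.ball x r, (y ∈ Ω ↔ φ (y - ⟪y, e⟫ • e) < ⟪y, e⟫)

/-- A bounded Lipschitz domain: bounded, open, connected, with Lipschitz boundary. -/
structure IsLipschitzDomain {d : ℕ} (Ω : Set (Space d)) : Prop where
  isOpen : IsOpen Ω
  isConnected : IsConnected Ω
  isBounded : Bornology.IsBounded Ω
  lipschitz : HasLipschitzBoundary Ω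

/-- The closed unit cube `[0,1]^ℓ` (a single point for `ℓ = 0`). -/
def unitCube (ℓ : ℕ) : Set (Space ℓ) := {s | ∀ j, s j ∈ Icc (0 : ℝ) 1}

/-- `Λ` is a piecewise Lipschitz surface of dimension `ℓ`: a nonempty union of `N` patches, each
the image of `[0,1]^ℓ` under a map which, up to a scale `ρ i`, is bi-Lipschitz with constant `K`.
Points, polygonal lines, polygons, and all compact `C^1` submanifolds (with or without boundary)
are of this form. -/
def IsSource {d : ℕ} (ℓ N : ℕ) (K : ℝ) (Λ : Set (Space d)) : Prop :=
  Λ.Nonempty ∧ ∃ (f : Fin N → Space ℓ → Space d) (ρ : Fin N → ℝ),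
    (∀ i, 0 < ρ i) ∧
    (∀ i, ∀ s ∈ unitCube ℓ, ∀ t ∈ unitCube ℓ,
      ρ i / K * dist s t ≤ dist (f i s) (f i t) ∧ dist (f i s) (f i t) ≤ K * ρ i * dist s t) ∧
    Λ = ⋃ i, f i '' unitCube ℓ

/-- A measurable symmetric coefficient on `Ω` with spectral bounds `γ₁`, `γ₂`. -/
structure IsCoefficient {d : ℕ} (Ω : Set (Space d)) (γ₁ γ₂ : ℝ)
    (A : Space d → Space d →L[ℝ] Space d) : Prop where
  measurable : AEStronglyMeasurable A (volume.restrict Ω)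
  symm : ∀ᵐ x ∂(volume.restrict Ω), ∀ ξ η : Space d, ⟪A x ξ, η⟫ = ⟪ξ, A x η⟫
  bounds : ∀ᵐ x ∂(volume.restrict Ω), ∀ ξ : Space d,
    γ₁ * ‖ξ‖ ^ 2 ≤ ⟪A x ξ, ξ⟫ ∧ ⟪A x ξ, ξ⟫ ≤ γ₂ * ‖ξ‖ ^ 2

/-! ### Weighted Sobolev spaces -/

/-- The weight `d_Λ^{2β}`, where `d_Λ` is the distance to `Λ`. -/
def weight {d : ℕ} (Λ : Set (Space d)) (β : ℝ) (x : Space d) : ℝ :=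
  Metric.infDist x Λ ^ (2 * β)

/-- The measure `d_Λ^{2β} dx` on `Ω`. -/
def weightedMeasure {d : ℕ} (Ω Λ : Set (Space d)) (β : ℝ) : Measure (Space d) :=
  (volume.restrict Ω).withDensity (fun x => ENNReal.ofReal (weight Λ β x))

/-- The norm of `L²_β(Ω; ℝ^d)`. -/
def weightedNorm {d : ℕ} (Ω Λ : Set (Space d)) (β : ℝ) (g : Space d → Space d) : ℝ :=
  √(∫ x in Ω, ‖g x‖ ^ 2 * weight Λ β x)

/-- Smooth test functions with compact support in `Ω`. -/
def IsTestFunction {d : ℕ} (Ω : Set (Space d)) (φ : Space d → ℝ) : Prop :=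
  ContDiff ℝ ∞ φ ∧ HasCompactSupport φ ∧ tsupport φ ⊆ Ω

/-- `g` is a weak (distributional) gradient of `u` on `Ω`. -/
def HasWeakGradient {d : ℕ} (Ω : Set (Space d)) (u : Space d → ℝ) (g : Space d → Space d) :
    Prop :=
  LocallyIntegrableOn u Ω ∧ LocallyIntegrableOn g Ω ∧
    ∀ φ, IsTestFunction Ω φ → ∀ e : Space d,
      ∫ x in Ω, u x * fderiv ℝ φ x e = -∫ x in Ω, ⟪g x, e⟫ * φ x

open Classical in
/-- The weak gradient of `u` on `Ω` (unique almost everywhere; `0` if there is none). -/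
def weakGradient {d : ℕ} (Ω : Set (Space d)) (u : Space d → ℝ) : Space d → Space d :=
  if h : ∃ g, HasWeakGradient Ω u g then h.choose else 0

/-- Membership in `H¹_β(Ω)`. -/
structure MemH1 {d : ℕ} (Ω Λ : Set (Space d)) (β : ℝ) (u : Space d → ℝ) : Prop where
  memLp : MemLp u 2 (weightedMeasure Ω Λ β)
  hasWeakGradient : HasWeakGradient Ω u (weakGradient Ω u)
  memLp_grad : MemLp (weakGradient Ω u) 2 (weightedMeasure Ω Λ β)

/-- Membership in `H¹_{0,β}(Ω)`: `u` vanishes on the boundary, in the sense that it is the limit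
in `H¹_β(Ω)` of smooth functions with compact support in `Ω`. -/
structure MemH10 {d : ℕ} (Ω Λ : Set (Space d)) (β : ℝ) (u : Space d → ℝ) : Prop
    extends MemH1 Ω Λ β u where
  approx : ∃ φ : ℕ → Space d → ℝ, (∀ n, IsTestFunction Ω (φ n)) ∧
    Tendsto (fun n => eLpNorm (u - φ n) 2 (weightedMeasure Ω Λ β)) atTop (𝓝 0) ∧
    Tendsto (fun n => eLpNorm (weakGradient Ω u - gradient (φ n)) 2 (weightedMeasure Ω Λ β))
      atTop (𝓝 0)

/-! ### Simplicial meshes and `P₁` finite elements -/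

/-- A conforming finite simplicial mesh of `Ω`: a finite simplicial complex filling the closure
of `Ω`, each face of which is a face of a simplex of full dimension. -/
structure Mesh {d : ℕ} (Ω : Set (Space d)) extends
    Geometry.SimplicialComplex ℝ (Space d) where
  finite_faces : faces.Finite
  pure : ∀ s ∈ faces, ∃ t ∈ faces, s ⊆ t ∧ t.card = d + 1
  space_eq : toSimplicialComplex.space = closure Ω

namespace Mesh

variable {d : ℕ} {Ω : Set (Space d)} (M : Mesh Ω)

/-- The full-dimensional simplices `T` of the mesh, each given by its finite set of corners. -/
def cells : Set (Finset (Space d)) := {t | t ∈ M.faces ∧ t.card = d + 1}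

/-- Shape regularity and quasi-uniformity with mesh size `H` and constant `σ`. -/
def IsQuasiUniform (H σ : ℝ) : Prop :=
  0 < H ∧ ∀ t ∈ M.cells, Metric.diam (convexHull ℝ (t : Set (Space d))) ≤ H ∧
    ∃ x, Metric.closedBall x (H / σ) ⊆ convexHull ℝ (t : Set (Space d))

theorem finite_vertices : M.vertices.Finite := by
  have h : M.vertices ⊆ ⋃ s ∈ M.faces, (s : Set (Space d)) := fun x hx =>
    mem_biUnion (show {x} ∈ M.faces from hx) (by simp)
  exact (M.finite_faces.biUnion fun s _ => s.finite_toSet).subset h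

/-- The interior nodes: mesh vertices that do not lie on the boundary of `Ω`. -/
def innerNodes : Finset (Space d) :=
  (M.finite_vertices.inter_of_left Ω).toFinset

/-- The finite element space `V_H`: functions that are affine on each simplex of the mesh and
vanish on the boundary of `Ω` (extended by zero outside `Ω`). -/
def coarseSpace : Set (Space d → ℝ) :=
  {u | (∀ t ∈ M.cells, ∃ a : Space d →ᵃ[ℝ] ℝ,
      EqOn u a (convexHull ℝ (t : Set (Space d)))) ∧ ∀ x, x ∉ Ω → u x = 0}

/-- The nodal basis function of the vertex `v`: at `x` in a simplex with corner `v` its value is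
the barycentric coordinate of `x` with respect to `v` (the set below is then a singleton);
elsewhere its value is `0` (the set below is then empty). -/
def hat (v x : Space d) : ℝ :=
  sSup {c | ∃ t ∈ M.cells, v ∈ t ∧ ∃ w : Space d → ℝ,
    (∀ y ∈ t, 0 ≤ w y) ∧ ∑ y ∈ t, w y = 1 ∧ ∑ y ∈ t, w y • y = x ∧ c = w v}

/-- The normalized basis function `λ_v / ∑_{v'} λ_{v'}`, the sum being over interior nodes. -/
def hatNormalized (v x : Space d) : ℝ := M.hat v x / ∑ v' ∈ M.innerNodes, M.hat v' x

/-- The patches `ω_{v,k}`. -/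
def patch (v : Space d) : ℕ → Set (Space d)
  | 0 => (⋃ t ∈ {t | t ∈ M.cells ∧ v ∈ t}, convexHull ℝ (t : Set (Space d))) ∩ Ω
  | k + 1 => interior (⋃ t ∈ {t | t ∈ M.cells ∧
      (convexHull ℝ (t : Set (Space d)) ∩ closure (patch v k)).Nonempty},
      convexHull ℝ (t : Set (Space d))) ∩ Ω

variable (Λ : Set (Space d)) (β : ℝ)

/-- `p ∈ V_H` represents the weighted `L²` projection of `u` onto `V_H` restricted to `ω_v`. -/
def IsLocalProjection (v : Space d) (u p : Space d → ℝ) : Prop :=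
  p ∈ M.coarseSpace ∧ ∀ q ∈ M.coarseSpace,
    ∫ x in M.patch v 0, p x * q x * weight Λ β x = ∫ x in M.patch v 0, u x * q x * weight Λ β x

open Classical in
/-- The weighted local projection `P_v u` (unique on `ω_v`). -/
def localProjection (v : Space d) (u : Space d → ℝ) : Space d → ℝ :=
  if h : ∃ p, M.IsLocalProjection Λ β v u p then h.choose else 0

/-- The quasi-interpolation `∑_v (P_v u)(v) λ_v`, the sum being over interior nodes. -/
def quasiInterpolation (u : Space d → ℝ) (x : Space d) : ℝ :=
  ∑ v ∈ M.innerNodes, M.localProjection Λ β v u v * M.hat v x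

/-- The fine-scale space `V^f_β`: the kernel of the quasi-interpolation in `H¹_{0,β}(Ω)`. -/
def fineSpace : Set (Space d → ℝ) :=
  {u | MemH10 Ω Λ β u ∧ ∀ x, M.quasiInterpolation Λ β u x = 0}

/-- The localized fine-scale space `V^f_β(D)`: elements of `V^f_β` vanishing on `Ω \ D`. -/
def localFineSpace (D : Set (Space d)) : Set (Space d → ℝ) :=
  {u | u ∈ M.fineSpace Λ β ∧ ∀ᵐ x ∂(volume.restrict Ω), x ∉ D → u x = 0}

variable (A : Space d → Space d →L[ℝ] Space d)

/-- `q` is the ideal corrector `Q^β_Ω(u)`. -/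
def IsIdealCorrector (u q : Space d → ℝ) : Prop :=
  q ∈ M.fineSpace Λ β ∧ ∀ w ∈ M.fineSpace Λ β,
    ∫ x in Ω, ⟪A x (weakGradient Ω q x), weakGradient Ω w x⟫ * weight Λ β x =
      ∫ x in Ω, ⟪A x (weakGradient Ω u x), weakGradient Ω w x⟫ * weight Λ β x

/-- `q` is the localized corrector `Q^β_{v,k}(u)`. -/
def IsLocalCorrector (v : Space d) (k : ℕ) (u q : Space d → ℝ) : Prop :=
  q ∈ M.localFineSpace Λ β (M.patch v k) ∧ ∀ w ∈ M.localFineSpace Λ β (M.patch v k),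
    ∫ x in M.patch v k, ⟪A x (weakGradient Ω q x), weakGradient Ω w x⟫ * weight Λ β x =
      ∫ x in M.patch v 0, M.hatNormalized v x *
        ⟪A x (weakGradient Ω u x), weakGradient Ω w x⟫ * weight Λ β x

end Mesh

end WeightedLOD

end

open WeightedLOD

noncomputable section

namespace WeightedLOD

/-! ### Geometry of Lipschitz domains -/

section Domain

variable {d : ℕ} {Ω : Set (Space d)}

/-- The projection onto the orthogonal complement of a unit vector is Lipschitz. -/
theorem norm_sub_inner_smul_le {e : Space d} (he : ‖e‖ = 1) (h : Space d) :
    ‖h - ⟪h, e⟫ • e‖ ≤ 2 * ‖h‖ := by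
  have h1 : ‖⟪h, e⟫ • e‖ ≤ ‖h‖ := by
    rw [norm_smul, he, mul_one]
    simpa [he] using norm_inner_le_norm (𝕜 := ℝ) h e
  linarith [norm_sub_le h (⟪h, e⟫ • e)]

theorem exterior_ball_of_chart {e : Space d} {L : NNReal} {φ : Space d → ℝ} {z : Space d} {s : ℝ}
    (he : ‖e‖ = 1) (hφ : LipschitzWith L φ) (hs : 0 < s)
    (hball : ∀ y ∈ Metric.ball z s, (y ∈ Ω ↔ φ (y - ⟪y, e⟫ • e) < ⟪y, e⟫)) (hz : z ∉ Ω) :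
    Metric.ball (z - (s / 2) • e) (1 / (4 * (L + 1)) * s) ⊆ Metric.ball z s \ Ω := by
  intro p hp
  set c : ℝ := 1 / (4 * (L + 1)) with hc
  have hL : (0 : ℝ) ≤ L := L.2
  have hc0 : 0 < c := by positivity
  have hc1 : 4 * ((L : ℝ) + 1) * c = 1 := by rw [hc]; field_simp
  set h : Space d := p - (z - (s / 2) • e) with hh
  have hph : p = z - (s / 2) • e + h := by rw [hh]; abel
  have hhn : ‖h‖ < c * s := by rw [Metric.mem_ball, dist_eq_norm] at hp; exact hp
  have hcL : 0 ≤ c * L := by positivity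
  have hpz : p ∈ Metric.ball z s := by
    rw [Metric.mem_ball, dist_eq_norm, hph]
    have : z - (s / 2) • e + h - z = h - (s / 2) • e := by abel
    rw [this]
    have h2 : ‖(s / 2) • e‖ = s / 2 := by
      rw [norm_smul, he, mul_one, Real.norm_of_nonneg (by linarith)]
    have h3 := norm_sub_le h ((s / 2) • e)
    nlinarith
  refine ⟨hpz, fun hpΩ => ?_⟩
  have h1 := (hball p hpz).1 hpΩ
  have h2 : φ (z - ⟪z, e⟫ • e) ≥ ⟪z, e⟫ := by
    by_contra hcon
    exact hz ((hball z (Metric.mem_ball_self hs)).2 (not_le.1 hcon))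
  have hee : ⟪e, e⟫ = (1 : ℝ) := by rw [real_inner_self_eq_norm_sq, he]; norm_num
  have hpe : ⟪p, e⟫ = ⟪z, e⟫ - s / 2 + ⟪h, e⟫ := by
    rw [hph, inner_add_left, inner_sub_left, inner_smul_left, hee]; simp
  have hpp : p - ⟪p, e⟫ • e = (z - ⟪z, e⟫ • e) + (h - ⟪h, e⟫ • e) := by
    rw [hpe]; nth_rewrite 1 [hph]; module
  have h3 : dist (φ (p - ⟪p, e⟫ • e)) (φ (z - ⟪z, e⟫ • e)) ≤ L * (2 * ‖h‖) := by
    refine (hφ.dist_le_mul _ _).trans ?_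
    rw [hpp, dist_eq_norm, add_sub_cancel_left]
    exact mul_le_mul_of_nonneg_left (norm_sub_inner_smul_le he h) hL
  have h4 : |⟪h, e⟫| ≤ ‖h‖ := by simpa [he] using abs_real_inner_le_norm h e
  rw [Real.dist_eq] at h3
  have h5 := (abs_le.1 h3).1
  have h6 := (abs_le.1 h4).2
  have h7 : (2 * (L : ℝ) + 1) * ‖h‖ ≤ (2 * L + 1) * (c * s) := by gcongr
  nlinarith

theorem exists_exterior_ball_local (h : HasLipschitzBoundary Ω) (hb : Bornology.IsBounded Ω)
    (ho : IsOpen Ω) :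
    ∃ c > (0 : ℝ), ∃ r > (0 : ℝ), ∀ z ∈ frontier Ω, ∀ s, 0 < s → s ≤ r →
      ∃ y, Metric.ball y (c * s) ⊆ Metric.ball z s \ Ω := by
  have hcomp : IsCompact (frontier Ω) :=
    hb.isCompact_closure.of_isClosed_subset isClosed_frontier frontier_subset_closure
  refine hcomp.induction_on (p := fun S => ∃ c > (0 : ℝ), ∃ r > (0 : ℝ), ∀ z ∈ S, ∀ s, 0 < s →
    s ≤ r → ∃ y, Metric.ball y (c * s) ⊆ Metric.ball z s \ Ω) ?_ ?_ ?_ ?_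
  · exact ⟨1, one_pos, 1, one_pos, by simp⟩
  · rintro S T hST ⟨c, hc, r, hr, H⟩
    exact ⟨c, hc, r, hr, fun z hz => H z (hST hz)⟩
  · rintro S T ⟨c, hc, r, hr, H⟩ ⟨c', hc', r', hr', H'⟩
    refine ⟨min c c', lt_min hc hc', min r r', lt_min hr hr', ?_⟩
    rintro z (hz | hz) s hs hsr
    · obtain ⟨y, hy⟩ := H z hz s hs (hsr.trans (min_le_left _ _))
      exact ⟨y, (Metric.ball_subset_ball (by gcongr; exact min_le_left _ _)).trans hy⟩
    · obtain ⟨y, hy⟩ := H' z hz s hs (hsr.trans (min_le_right _ _))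
      exact ⟨y, (Metric.ball_subset_ball (by gcongr; exact min_le_right _ _)).trans hy⟩
  · intro z hz
    obtain ⟨e, L, φ, r, he, hφ, hr, hball⟩ := h z hz
    refine ⟨Metric.ball z (r / 2) ∩ frontier Ω, ?_, 1 / (4 * (L + 1)), by positivity, r / 2,
      by positivity, ?_⟩
    · exact inter_mem (mem_nhdsWithin_of_mem_nhds (Metric.ball_mem_nhds z (by positivity)))
        self_mem_nhdsWithin
    · rintro z' ⟨hz', hz'f⟩ s hs hsr
      refine ⟨_, exterior_ball_of_chart he hφ hs (fun y hy => hball y ?_) ?_⟩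
      · rw [Metric.mem_ball] at *
        linarith [dist_triangle y z' z]
      · rw [ho.frontier_eq] at hz'f; exact hz'f.2

/-- Uniform exterior ball condition up to the scale `R`. -/
theorem IsLipschitzDomain.exists_exterior_ball (hΩ : IsLipschitzDomain Ω) (R : ℝ) (hR : 0 < R) :
    ∃ c > (0 : ℝ), ∀ z ∈ frontier Ω, ∀ s, 0 < s → s ≤ R →
      ∃ y, Metric.ball y (c * s) ⊆ Metric.ball z s \ Ω := by
  obtain ⟨c, hc, r, hr, H⟩ := exists_exterior_ball_local hΩ.lipschitz hΩ.isBounded hΩ.isOpen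
  refine ⟨c * (r / (R + r)), by positivity, fun z hz s hs hsR => ?_⟩
  have h1 : r / (R + r) * s ≤ r := by
    rw [div_mul_eq_mul_div, div_le_iff₀ (by positivity)]; nlinarith
  have h2 : r / (R + r) * s ≤ s := by
    have : r / (R + r) ≤ 1 := by rw [div_le_one (by positivity)]; linarith
    nlinarith
  obtain ⟨y, hy⟩ := H z hz (r / (R + r) * s) (by positivity) h1
  refine ⟨y, ?_⟩
  rw [mul_assoc]
  exact hy.trans (sdiff_subset_sdiff_left (Metric.ball_subset_ball h2))

theorem IsLipschitzDomain.interior_closure_eq (hΩ : IsLipschitzDomain Ω) :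
    interior (closure Ω) = Ω := by
  refine Subset.antisymm (fun z hz => ?_) (interior_maximal subset_closure hΩ.isOpen)
  by_contra hzΩ
  have hzf : z ∈ frontier Ω := by
    rw [hΩ.isOpen.frontier_eq]; exact ⟨interior_subset hz, hzΩ⟩
  obtain ⟨c, hc, H⟩ := hΩ.exists_exterior_ball 1 one_pos
  obtain ⟨ε, hε, hεb⟩ := Metric.mem_nhds_iff.1 (mem_interior_iff_mem_nhds.1 hz)
  have hs : 0 < min ε 1 := lt_min hε one_pos
  obtain ⟨y, hy⟩ := H z hzf (min ε 1) hs (min_le_right _ _)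
  have hy0 := hy (Metric.mem_ball_self (mul_pos hc hs))
  have hyc : y ∈ closure Ω := hεb (Metric.ball_subset_ball (min_le_left _ _) hy0.1)
  obtain ⟨w, hw, hwΩ⟩ := mem_closure_iff.1 hyc _ Metric.isOpen_ball
    (Metric.mem_ball_self (mul_pos hc hs))
  exact (hy hw).2 hwΩ

/-- Functions that are nonexpansive along segments contained in `S`. -/
def NonexpansiveAlongSegments (S : Set (Space d)) (f : Space d → ℝ) : Prop :=
  ∀ a b, segment ℝ a b ⊆ S → |f a - f b| ≤ dist a b

theorem abs_sub_le_of_chart {e : Space d} {L : NNReal} {φ : Space d → ℝ} {z : Space d} {r : ℝ}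
    (he : ‖e‖ = 1) (hφ : LipschitzWith L φ)
    (hball : ∀ y ∈ Metric.ball z r, (y ∈ Ω ↔ φ (y - ⟪y, e⟫ • e) < ⟪y, e⟫))
    {x y : Space d} (hx : x ∈ Metric.ball z (r / (2 * (L + 1)))) (hxΩ : x ∈ Ω)
    (hy : y ∈ Metric.ball z (r / (2 * (L + 1)))) (hyΩ : y ∈ Ω) {f : Space d → ℝ}
    (hf : NonexpansiveAlongSegments (closure Ω) f) :
    |f x - f y| ≤ (2 * L + 1) * dist x y := by
  have hL : (0 : ℝ) ≤ L := L.2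
  set r' : ℝ := r / (2 * (L + 1)) with hr'
  have hrr : r = 2 * (L + 1) * r' := by rw [hr']; field_simp
  have hr0 : 0 < r' := by rw [Metric.mem_ball] at hx; exact dist_nonneg.trans_lt hx
  set s : ℝ := L * dist x y with hs
  have hs0 : 0 ≤ s := by positivity
  have hxy : dist x y ≤ 2 * r' := by
    rw [Metric.mem_ball] at hx hy
    linarith [dist_triangle_right x y z]
  have hsr : s ≤ 2 * L * r' := by rw [hs]; nlinarith
  have hee : ⟪e, e⟫ = (1 : ℝ) := by rw [real_inner_self_eq_norm_sq, he]; norm_num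
  have hup : ∀ w ∈ Metric.ball z r', ∀ τ, 0 ≤ τ → τ ≤ s → w + τ • e ∈ Metric.ball z r := by
    intro w hw τ h0 h1
    rw [Metric.mem_ball, dist_eq_norm] at *
    have : w + τ • e - z = (w - z) + τ • e := by abel
    rw [this]
    have h2 : ‖τ • e‖ = τ := by rw [norm_smul, he, mul_one, Real.norm_of_nonneg h0]
    have := norm_add_le (w - z) (τ • e)
    nlinarith
  have hvert : ∀ w ∈ Metric.ball z r', w ∈ Ω → |f w - f (w + s • e)| ≤ s := by
    intro w hw hwΩ
    have hwr : w ∈ Metric.ball z r := by simpa using hup w hw 0 le_rfl hs0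
    have h1 := (hball w hwr).1 hwΩ
    refine (hf _ _ fun p hp => subset_closure ?_).trans ?_
    · rw [segment_eq_image'] at hp
      obtain ⟨θ, ⟨h0, h1'⟩, rfl⟩ := hp
      have hpe : w + θ • (w + s • e - w) = w + (θ * s) • e := by module
      simp only [hpe]
      refine (hball _ (hup w hw _ (by positivity) (by nlinarith))).2 ?_
      have h2 : ⟪w + (θ * s) • e, e⟫ = ⟪w, e⟫ + θ * s := by
        rw [inner_add_left, inner_smul_left, hee]; simp
      have h3 : w + (θ * s) • e - ⟪w + (θ * s) • e, e⟫ • e = w - ⟪w, e⟫ • e := by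
        rw [h2]; module
      rw [h3, h2]
      nlinarith [mul_nonneg h0 hs0]
    · rw [dist_eq_norm, sub_add_cancel_left, norm_neg, norm_smul, he, mul_one,
        Real.norm_of_nonneg hs0]
  have hhor : |f (x + s • e) - f (y + s • e)| ≤ dist x y := by
    refine (hf _ _ fun p hp => subset_closure ?_).trans (by simp)
    have hpr : p ∈ Metric.ball z r := (convex_ball z r).segment_subset
      (hup x hx s hs0 le_rfl) (hup y hy s hs0 le_rfl) hp
    obtain ⟨a, b, ha, hb, hab, rfl⟩ := hp
    refine (hball _ hpr).2 ?_
    have hxr : x ∈ Metric.ball z r := by simpa using hup x hx 0 le_rfl hs0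
    have hyr : y ∈ Metric.ball z r := by simpa using hup y hy 0 le_rfl hs0
    have h1 := (hball x hxr).1 hxΩ
    have h2 := (hball y hyr).1 hyΩ
    set p := a • (x + s • e) + b • (y + s • e) with hp
    have hpe : ⟪p, e⟫ = a * ⟪x, e⟫ + b * ⟪y, e⟫ + s := by
      rw [hp]
      simp only [inner_add_left, inner_smul_left, hee]
      simp only [conj_trivial]
      linear_combination s * hab
    have hab' : b = 1 - a := by linarith
    have hp1 : p - ⟪p, e⟫ • e - (x - ⟪x, e⟫ • e) =
        b • ((y - x) - ⟪y - x, e⟫ • e) := by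
      rw [hpe, hp, inner_sub_left, hab']; module
    have hp2 : p - ⟪p, e⟫ • e - (y - ⟪y, e⟫ • e) =
        a • ((x - y) - ⟪x - y, e⟫ • e) := by
      rw [hpe, hp, inner_sub_left, hab']; module
    have h3 : φ (p - ⟪p, e⟫ • e) ≤ φ (x - ⟪x, e⟫ • e) + L * (b * (2 * dist x y)) := by
      have := hφ.dist_le_mul (p - ⟪p, e⟫ • e) (x - ⟪x, e⟫ • e)
      rw [dist_eq_norm (p - _), hp1, norm_smul, Real.norm_of_nonneg hb, Real.dist_eq] at this
      have h4 : ‖y - x - ⟪y - x, e⟫ • e‖ ≤ 2 * dist x y := by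
        rw [dist_comm, dist_eq_norm]; exact norm_sub_inner_smul_le he (y - x)
      have h5 : (L : ℝ) * (b * ‖y - x - ⟪y - x, e⟫ • e‖) ≤ L * (b * (2 * dist x y)) := by gcongr
      linarith [(abs_le.1 this).2]
    have h4 : φ (p - ⟪p, e⟫ • e) ≤ φ (y - ⟪y, e⟫ • e) + L * (a * (2 * dist x y)) := by
      have := hφ.dist_le_mul (p - ⟪p, e⟫ • e) (y - ⟪y, e⟫ • e)
      rw [dist_eq_norm (p - _), hp2, norm_smul, Real.norm_of_nonneg ha, Real.dist_eq] at this
      have h4 : ‖x - y - ⟪x - y, e⟫ • e‖ ≤ 2 * dist x y := by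
        rw [dist_eq_norm]; exact norm_sub_inner_smul_le he (x - y)
      have h5 : (L : ℝ) * (a * ‖x - y - ⟪x - y, e⟫ • e‖) ≤ L * (a * (2 * dist x y)) := by gcongr
      linarith [(abs_le.1 this).2]
    have h5 : a * φ (x - ⟪x, e⟫ • e) + b * φ (y - ⟪y, e⟫ • e) < a * ⟪x, e⟫ + b * ⟪y, e⟫ := by
      rcases ha.eq_or_lt with ha0 | ha0
      · have hb1 : b = 1 := by linarith
        rw [← ha0, hb1]; linarith
      · nlinarith
    have h6 : φ (p - ⟪p, e⟫ • e) ≤ a * φ (x - ⟪x, e⟫ • e) + b * φ (y - ⟪y, e⟫ • e)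
        + 4 * (a * b) * s := by
      have h7 := add_le_add (mul_le_mul_of_nonneg_left h3 ha) (mul_le_mul_of_nonneg_left h4 hb)
      have h8 : a * φ (p - ⟪p, e⟫ • e) + b * φ (p - ⟪p, e⟫ • e) = φ (p - ⟪p, e⟫ • e) := by
        rw [← add_mul, hab, one_mul]
      rw [h8] at h7
      refine h7.trans (le_of_eq ?_)
      rw [hs]; ring
    have h7 : 4 * (a * b) * s ≤ s := by
      have : 4 * (a * b) ≤ 1 := by nlinarith [sq_nonneg (a - b)]
      nlinarith
    refine h6.trans_lt ?_
    rw [hpe]; linarith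
  have h1 := hvert x hx hxΩ
  have h2 := hvert y hy hyΩ
  rw [abs_le] at *
  constructor <;> · rw [hs] at *; linarith [h1.1, h1.2, h2.1, h2.2, hhor.1, hhor.2]

theorem IsLipschitzDomain.locally_quasiconvex (hΩ : IsLipschitzDomain Ω) :
    ∀ z ∈ closure Ω, ∃ r > (0 : ℝ), ∃ C ≥ (0 : ℝ), ∀ x ∈ Metric.ball z r, x ∈ Ω →
      ∀ y ∈ Metric.ball z r, y ∈ Ω → ∀ f, NonexpansiveAlongSegments (closure Ω) f →
        |f x - f y| ≤ C * dist x y := by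
  intro z hz
  by_cases hzΩ : z ∈ Ω
  · obtain ⟨ε, hε, hεb⟩ := Metric.isOpen_iff.1 hΩ.isOpen z hzΩ
    refine ⟨ε, hε, 1, zero_le_one, fun x hx _ y hy _ f hf => ?_⟩
    rw [one_mul]
    exact hf _ _ (((convex_ball z ε).segment_subset hx hy).trans (hεb.trans subset_closure))
  · obtain ⟨e, L, φ, r, he, hφ, hr, hball⟩ := hΩ.lipschitz z
      (by rw [hΩ.isOpen.frontier_eq]; exact ⟨hz, hzΩ⟩)
    exact ⟨r / (2 * (L + 1)), by positivity, 2 * L + 1, by positivity,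
      fun x hx hxΩ y hy hyΩ f hf => abs_sub_le_of_chart he hφ hball hx hxΩ hy hyΩ hf⟩

/-- Lipschitz domains are quasiconvex; the path metric enters through the functions that are
nonexpansive along segments. -/
theorem IsLipschitzDomain.quasiconvex (hΩ : IsLipschitzDomain Ω) :
    ∃ C ≥ (0 : ℝ), ∀ f, NonexpansiveAlongSegments (closure Ω) f →
      ∀ x ∈ Ω, ∀ y ∈ Ω, |f x - f y| ≤ C * dist x y := by
  have hloc := hΩ.locally_quasiconvex
  have hcomp := hΩ.isBounded.isCompact_closure
  obtain ⟨x₀, hx₀⟩ := hΩ.isConnected.nonempty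
  have hfin : Ω ⊆ {y | y ∈ Ω ∧ ∃ B, ∀ f, NonexpansiveAlongSegments (closure Ω) f →
      |f y - f x₀| ≤ B} := by
    refine hΩ.isConnected.isPreconnected.subset_of_closure_inter_subset ?_ ?_ ?_
    · refine Metric.isOpen_iff.2 ?_
      rintro y ⟨hy, B, hB⟩
      obtain ⟨r, hr, C, hC, H⟩ := hloc y (subset_closure hy)
      obtain ⟨ε, hε, hεb⟩ := Metric.isOpen_iff.1 hΩ.isOpen y hy
      refine ⟨min r ε, lt_min hr hε, fun w hw => ?_⟩
      have hwΩ := hεb (Metric.ball_subset_ball (min_le_right _ _) hw)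
      refine ⟨hwΩ, C * dist w y + B, fun f hf => ?_⟩
      have h1 := H w (Metric.ball_subset_ball (min_le_left _ _) hw) hwΩ y
        (Metric.mem_ball_self hr) hy f hf
      exact (abs_sub_le _ _ _).trans (add_le_add h1 (hB f hf))
    · exact ⟨x₀, hx₀, hx₀, 0, by simp⟩
    · rintro y ⟨hyc, hy⟩
      refine ⟨hy, ?_⟩
      obtain ⟨r, hr, C, hC, H⟩ := hloc y (subset_closure hy)
      obtain ⟨w, hw, hwΩ, B, hB⟩ := mem_closure_iff.1 hyc _ Metric.isOpen_ball
        (Metric.mem_ball_self hr)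
      refine ⟨C * dist y w + B, fun f hf => ?_⟩
      have h1 := H y (Metric.mem_ball_self hr) hy w hw hwΩ f hf
      exact (abs_sub_le _ _ _).trans (add_le_add h1 (hB f hf))
  have hbdd : ∃ B ≥ (0 : ℝ), ∀ y ∈ closure Ω, y ∈ Ω → ∀ f,
      NonexpansiveAlongSegments (closure Ω) f → |f y - f x₀| ≤ B := by
    refine hcomp.induction_on (p := fun S => ∃ B ≥ (0 : ℝ), ∀ y ∈ S, y ∈ Ω → ∀ f,
      NonexpansiveAlongSegments (closure Ω) f → |f y - f x₀| ≤ B) ⟨0, le_rfl, by simp⟩ ?_ ?_ ?_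
    · rintro S T hST ⟨B, h0, hB⟩
      exact ⟨B, h0, fun y hy => hB y (hST hy)⟩
    · rintro S T ⟨B, h0, hB⟩ ⟨B', h0', hB'⟩
      refine ⟨max B B', le_max_of_le_left h0, ?_⟩
      rintro y (hy | hy) hyΩ f hf
      · exact (hB y hy hyΩ f hf).trans (le_max_left _ _)
      · exact (hB' y hy hyΩ f hf).trans (le_max_right _ _)
    · intro z hz
      obtain ⟨r, hr, C, hC, H⟩ := hloc z hz
      refine ⟨Metric.ball z r, mem_nhdsWithin_of_mem_nhds (Metric.ball_mem_nhds z hr), ?_⟩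
      obtain ⟨w, hw, hwΩ⟩ := mem_closure_iff.1 hz _ Metric.isOpen_ball (Metric.mem_ball_self hr)
      obtain ⟨-, B, hB⟩ := hfin hwΩ
      refine ⟨max (C * (2 * r) + B) 0, le_max_right _ _, fun y hy hyΩ f hf => ?_⟩
      have h1 := H y hy hyΩ w hw hwΩ f hf
      have h2 : dist y w ≤ 2 * r := by
        rw [Metric.mem_ball] at hw hy
        linarith [dist_triangle_right y w z]
      have h3 : C * dist y w ≤ C * (2 * r) := by gcongr
      have h4 := abs_sub_le (f y) (f w) (f x₀)
      have h5 := hB f hf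
      exact le_max_of_le_left (by linarith)
  have hunif : ∃ δ > (0 : ℝ), ∃ C ≥ (0 : ℝ), ∀ x ∈ closure Ω, x ∈ Ω → ∀ y ∈ Ω, dist x y < δ → ∀ f,
      NonexpansiveAlongSegments (closure Ω) f → |f x - f y| ≤ C * dist x y := by
    refine hcomp.induction_on (p := fun S => ∃ δ > (0 : ℝ), ∃ C ≥ (0 : ℝ), ∀ x ∈ S, x ∈ Ω →
      ∀ y ∈ Ω, dist x y < δ → ∀ f, NonexpansiveAlongSegments (closure Ω) f →
        |f x - f y| ≤ C * dist x y) ⟨1, one_pos, 0, le_rfl, by simp⟩ ?_ ?_ ?_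
    · rintro S T hST ⟨δ, hδ, C, h0, hB⟩
      exact ⟨δ, hδ, C, h0, fun y hy => hB y (hST hy)⟩
    · rintro S T ⟨δ, hδ, C, h0, hB⟩ ⟨δ', hδ', C', h0', hB'⟩
      refine ⟨min δ δ', lt_min hδ hδ', max C C', le_max_of_le_left h0, ?_⟩
      rintro x (hx | hx) hxΩ y hyΩ hxy f hf
      · exact (hB x hx hxΩ y hyΩ (hxy.trans_le (min_le_left _ _)) f hf).trans
          (by gcongr; exact le_max_left _ _)
      · exact (hB' x hx hxΩ y hyΩ (hxy.trans_le (min_le_right _ _)) f hf).trans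
          (by gcongr; exact le_max_right _ _)
    · intro z hz
      obtain ⟨r, hr, C, hC, H⟩ := hloc z hz
      refine ⟨Metric.ball z (r / 2), mem_nhdsWithin_of_mem_nhds
        (Metric.ball_mem_nhds z (by positivity)), r / 2, by positivity, C, hC, ?_⟩
      intro x hx hxΩ y hyΩ hxy f hf
      rw [Metric.mem_ball] at hx
      refine H x ?_ hxΩ y ?_ hyΩ f hf
      · rw [Metric.mem_ball]; linarith
      · rw [Metric.mem_ball]; linarith [dist_triangle_left y z x]
  obtain ⟨B, hB0, hB⟩ := hbdd
  obtain ⟨δ, hδ, C, hC, H⟩ := hunif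
  refine ⟨max C (2 * B / δ), le_max_of_le_left hC, fun f hf x hx y hy => ?_⟩
  rcases lt_or_ge (dist x y) δ with h | h
  · exact (H x (subset_closure hx) hx y hy h f hf).trans (by gcongr; exact le_max_left _ _)
  · have h1 := hB x (subset_closure hx) hx f hf
    have h2 := hB y (subset_closure hy) hy f hf
    have h3 : |f x - f y| ≤ 2 * B := by
      rw [abs_le] at *; constructor <;> linarith [h1.1, h1.2, h2.1, h2.2]
    calc |f x - f y| ≤ 2 * B := h3
      _ = 2 * B / δ * δ := by field_simp
      _ ≤ 2 * B / δ * dist x y := by gcongr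
      _ ≤ _ := by gcongr; exact le_max_right _ _

end Domain

end WeightedLOD

end

noncomputable section

namespace WeightedLOD

/-! ### The weight satisfies the Muckenhoupt condition -/

section Weight

variable {d ℓ : ℕ}

/-- The volume of the unit ball. -/
def unitBallVolume (d : ℕ) : ℝ := (volume (Metric.ball (0 : Space d) 1)).toReal

theorem unitBallVolume_pos (d : ℕ) : 0 < unitBallVolume d :=
  ENNReal.toReal_pos (Metric.measure_ball_pos _ _ one_pos).ne' measure_ball_lt_top.ne

theorem volume_ball_eq (x : Space d) {r : ℝ} (hr : 0 < r) :
    volume (Metric.ball x r) = ENNReal.ofReal (unitBallVolume d * r ^ d) := by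
  rw [Measure.addHaar_ball_of_pos volume x hr, mul_comm (unitBallVolume d),
    ENNReal.ofReal_mul (by positivity), unitBallVolume,
    ENNReal.ofReal_toReal measure_ball_lt_top.ne, finrank_euclideanSpace_fin]

theorem isClosed_unitCube (ℓ : ℕ) : IsClosed (unitCube ℓ) := by
  simp only [unitCube, ofPred_forall]
  exact isClosed_iInter fun j => isClosed_Icc.preimage (by fun_prop)

theorem convex_unitCube (ℓ : ℕ) : Convex ℝ (unitCube ℓ) := by
  intro x hx y hy a b ha hb hab j
  exact convex_Icc (0 : ℝ) 1 (hx j) (hy j) ha hb hab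

theorem dist_le_of_mem_unitCube {s t : Space ℓ} (hs : s ∈ unitCube ℓ) (ht : t ∈ unitCube ℓ) :
    dist s t ≤ √ℓ := by
  rw [EuclideanSpace.dist_eq]
  refine Real.sqrt_le_sqrt ?_
  calc ∑ i, dist (s i) (t i) ^ 2 ≤ ∑ i : Fin ℓ, (1 : ℝ) := by
        refine Finset.sum_le_sum fun i _ => ?_
        have := Real.dist_le_of_mem_Icc_01 (hs i) (ht i)
        nlinarith [dist_nonneg (x := s i) (y := t i)]
    _ = ℓ := by simp

theorem volume_unitCube_pos (ℓ : ℕ) : 0 < volume (unitCube ℓ) := by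
  have ho : IsOpen {s : Space ℓ | ∀ j, s j ∈ Ioo (0 : ℝ) 1} := by
    simp only [ofPred_forall]
    exact isOpen_iInter_of_finite fun j => isOpen_Ioo.preimage (by fun_prop)
  have hne : {s : Space ℓ | ∀ j, s j ∈ Ioo (0 : ℝ) 1}.Nonempty :=
    ⟨WithLp.toLp 2 fun _ => 1 / 2, fun j => by norm_num⟩
  exact (ho.measure_pos volume hne).trans_le
    (measure_mono fun s hs j => Ioo_subset_Icc_self (hs j))

theorem volume_unitCube_lt_top (ℓ : ℕ) : volume (unitCube ℓ) < ⊤ := by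
  refine Bornology.IsBounded.measure_lt_top (Metric.isBounded_iff.2 ⟨√ℓ, ?_⟩)
  exact fun s hs t ht => dist_le_of_mem_unitCube hs ht

theorem exists_le_volume_unitCube_inter_ball (ℓ : ℕ) :
    ∃ c > (0 : ℝ), ∀ t ∈ unitCube ℓ, ∀ h, 0 < h → h ≤ 1 →
      ENNReal.ofReal (c * h ^ ℓ) ≤ volume (unitCube ℓ ∩ Metric.ball t h) := by
  set v := (volume (unitCube ℓ)).toReal with hv
  have hv0 : 0 < v := ENNReal.toReal_pos (volume_unitCube_pos ℓ).ne' (volume_unitCube_lt_top ℓ).ne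
  refine ⟨v * (1 / (√ℓ + 1)) ^ ℓ, by positivity, fun t ht h h0 h1 => ?_⟩
  set τ : ℝ := h / (√ℓ + 1) with hτ
  have hs : 0 ≤ √(ℓ : ℝ) := Real.sqrt_nonneg _
  have hτ0 : 0 < τ := by positivity
  have hτ1 : τ ≤ 1 := by rw [hτ, div_le_one (by positivity)]; linarith
  have hsub : AffineMap.homothety t τ '' unitCube ℓ ⊆ unitCube ℓ ∩ Metric.ball t h := by
    rintro _ ⟨s, hs', rfl⟩
    constructor
    · rw [AffineMap.homothety_apply]
      have : τ • (s -ᵥ t) +ᵥ t = (1 - τ) • t + τ • s := by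
        simp only [vsub_eq_sub, vadd_eq_add]; module
      rw [this]
      exact convex_unitCube ℓ ht hs' (by linarith) hτ0.le (by ring)
    · rw [Metric.mem_ball, dist_homothety_center, Real.norm_of_nonneg hτ0.le]
      have h2 := dist_le_of_mem_unitCube ht hs'
      have h3 : τ * (√ℓ + 1) = h := by rw [hτ]; field_simp
      nlinarith
  refine le_trans (le_of_eq ?_) (measure_mono hsub)
  rw [Measure.addHaar_image_homothety, finrank_euclideanSpace_fin, abs_of_pos (by positivity),
    ← ENNReal.ofReal_toReal (volume_unitCube_lt_top ℓ).ne, ← hv,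
    ← ENNReal.ofReal_mul (by positivity), hτ]
  congr 1
  rw [div_pow, div_pow, one_pow]; field_simp

/-- Volume of the neighborhoods of one patch of the singular set. -/
theorem exists_volume_thickening_patch_le (d ℓ : ℕ) (hℓ : ℓ < d) (K : ℝ) (hK : 1 ≤ K) :
    ∃ C > (0 : ℝ), ∀ (f : Space ℓ → Space d) (ρ : ℝ), 0 < ρ →
      (∀ s ∈ unitCube ℓ, ∀ t ∈ unitCube ℓ,
        ρ / K * dist s t ≤ dist (f s) (f t) ∧ dist (f s) (f t) ≤ K * ρ * dist s t) →
      ∀ (z : Space d) (R s : ℝ), 0 < s → s ≤ R →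
        volume ({x | ∃ t ∈ unitCube ℓ, dist x (f t) < 2 * s} ∩ Metric.ball z R) ≤
          ENNReal.ofReal (C * (s ^ (d - ℓ) * R ^ ℓ)) := by
  classical
  obtain ⟨c, hc, hcube⟩ := exists_le_volume_unitCube_inter_ball ℓ
  set v := (volume (unitCube ℓ)).toReal with hv
  have hv0 : 0 < v := ENNReal.toReal_pos (volume_unitCube_pos ℓ).ne' (volume_unitCube_lt_top ℓ).ne
  have hvv : volume (unitCube ℓ) = ENNReal.ofReal v :=
    (ENNReal.ofReal_toReal (volume_unitCube_lt_top ℓ).ne).symm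
  have hV := unitBallVolume_pos d
  have hV' := unitBallVolume_pos ℓ
  set C₁ : ℝ := unitBallVolume d * 3 ^ d * v / c with hC₁
  set C₂ : ℝ := unitBallVolume d * 3 ^ d * (unitBallVolume ℓ * (8 * K ^ 2) ^ ℓ) / c with hC₂
  have hC₁0 : 0 < C₁ := by positivity
  have hC₂0 : 0 < C₂ := by positivity
  refine ⟨max C₁ C₂, lt_max_of_lt_left hC₁0, fun f ρ hρ hf z R s hs hsR => ?_⟩
  have hR : 0 < R := hs.trans_le hsR
  have hK0 : 0 < K := one_pos.trans_le hK
  have hfc : ContinuousOn f (unitCube ℓ) := by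
    have : LipschitzOnWith (K * ρ).toNNReal f (unitCube ℓ) :=
      LipschitzOnWith.of_dist_le_mul fun s hs t ht => by
        rw [Real.coe_toNNReal _ (by positivity)]; exact (hf s hs t ht).2
    exact this.continuousOn
  set F : Space ℓ → Space d := (unitCube ℓ).piecewise f 0 with hF
  have hFm : Measurable F := hfc.measurable_piecewise continuousOn_const (isClosed_unitCube ℓ).measurableSet
  have hFf : ∀ t ∈ unitCube ℓ, F t = f t := fun t ht => piecewise_eq_of_mem _ _ _ ht
  set E := {x | ∃ t ∈ unitCube ℓ, dist x (f t) < 2 * s} ∩ Metric.ball z R with hE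
  set h := min (s / (K * ρ)) 1 with hh
  have hh0 : 0 < h := lt_min (by positivity) one_pos
  set S : Set (Space d × Space ℓ) := {p | p.2 ∈ unitCube ℓ ∧ dist p.1 (F p.2) < 3 * s} with hS
  have hSm : MeasurableSet S := by
    refine MeasurableSet.inter ((isClosed_unitCube ℓ).measurableSet.preimage measurable_snd) ?_
    exact measurableSet_lt (measurable_fst.dist (hFm.comp measurable_snd)) measurable_const
  have hlow : ∀ x ∈ E, ENNReal.ofReal (c * h ^ ℓ) ≤ volume (Prod.mk x ⁻¹' S) := by
    rintro x ⟨⟨t, ht, hxt⟩, -⟩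
    refine (hcube t ht h hh0 (min_le_right _ _)).trans (measure_mono ?_)
    rintro t' ⟨ht', hd⟩
    refine ⟨ht', ?_⟩
    simp only
    rw [hFf t' ht']
    have h1 := (hf t ht t' ht').2
    rw [Metric.mem_ball, dist_comm] at hd
    have h2 : K * ρ * dist t t' ≤ s := by
      have h3 : dist t t' ≤ s / (K * ρ) := hd.le.trans (min_le_left _ _)
      rwa [le_div_iff₀ (by positivity), mul_comm] at h3
    linarith [dist_triangle x (f t) (f t')]
  have hmark : ENNReal.ofReal (c * h ^ ℓ) * volume E ≤
      ((volume.restrict (Metric.ball z R)).prod volume) S := by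
    rw [Measure.prod_apply hSm]
    have h1 : volume E ≤ (volume.restrict (Metric.ball z R))
        {x | ENNReal.ofReal (c * h ^ ℓ) ≤ volume (Prod.mk x ⁻¹' S)} := by
      rw [Measure.restrict_apply
        (measurableSet_le measurable_const (measurable_measure_prodMk_left hSm))]
      exact measure_mono fun x hx => ⟨hlow x hx, hx.2⟩
    refine (mul_le_mul_right h1 _).trans ?_
    exact mul_meas_ge_le_lintegral (measurable_measure_prodMk_left hSm) _
  set P : Set (Space ℓ) := {t | t ∈ unitCube ℓ ∧ dist (F t) z < R + 3 * s} with hP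
  have hPm : MeasurableSet P := by
    refine MeasurableSet.inter (isClosed_unitCube ℓ).measurableSet ?_
    exact measurableSet_lt (hFm.dist measurable_const) measurable_const
  have hup : ((volume.restrict (Metric.ball z R)).prod volume) S ≤
      ENNReal.ofReal (unitBallVolume d * (3 * s) ^ d) * volume P := by
    rw [Measure.prod_apply_symm hSm, ← lintegral_indicator_const hPm]
    refine lintegral_mono fun t => ?_
    rw [Measure.restrict_apply (measurable_prodMk_right hSm)]
    by_cases htP : t ∈ P
    · rw [indicator_of_mem htP, ← volume_ball_eq (F t) (by positivity)]
      exact measure_mono fun x hx => hx.1.2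
    · rw [indicator_of_notMem htP, nonpos_iff_eq_zero]
      convert measure_empty (μ := (volume : Measure (Space d)))
      refine eq_empty_of_forall_notMem ?_
      rintro x ⟨⟨hx1, hx2⟩, hx3⟩
      refine htP ⟨hx1, ?_⟩
      simp only at hx2
      rw [Metric.mem_ball] at hx3
      linarith [dist_triangle_left (F t) z x]
  have hPball : volume P ≤ ENNReal.ofReal (unitBallVolume ℓ * (8 * K * R / ρ) ^ ℓ) := by
    rcases P.eq_empty_or_nonempty with h0 | ⟨t₀, ht₀⟩
    · rw [h0]; simp
    · rw [← volume_ball_eq t₀ (by positivity)]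
      refine measure_mono fun t ht => ?_
      rw [Metric.mem_ball, lt_div_iff₀ hρ]
      have h1 := (hf t ht.1 t₀ ht₀.1).1
      rw [← hFf t ht.1, ← hFf t₀ ht₀.1] at h1
      have h2 := dist_triangle_right (F t) (F t₀) z
      have h3 := ht.2
      have h4 := ht₀.2
      have h5 : ρ / K * dist t t₀ < 8 * R := by linarith
      rw [div_mul_eq_mul_div, div_lt_iff₀ hK0] at h5
      linarith
  have hPcube : volume P ≤ ENNReal.ofReal v := by
    rw [← hvv]; exact measure_mono fun t ht => ht.1
  have hmain : ∀ p, 0 ≤ p → volume P ≤ ENNReal.ofReal p →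
      volume E ≤ ENNReal.ofReal (unitBallVolume d * (3 * s) ^ d * p / (c * h ^ ℓ)) := by
    intro p hp0 hp
    have h1 := hmark.trans (hup.trans (mul_le_mul_right hp _))
    rw [← ENNReal.ofReal_mul (by positivity)] at h1
    rw [ENNReal.ofReal_div_of_pos (by positivity), ENNReal.le_div_iff_mul_le, mul_comm]
    · exact h1
    · left; simp only [ne_eq, ENNReal.ofReal_eq_zero, not_le]; positivity
    · left; exact ENNReal.ofReal_ne_top
  have hsplit : s ^ d = s ^ (d - ℓ) * s ^ ℓ := by rw [← pow_add]; congr 1; omega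
  rcases le_total 1 (s / (K * ρ)) with h1 | h1
  · have hh1 : h = 1 := min_eq_right h1
    refine (hmain v hv0.le hPcube).trans (ENNReal.ofReal_le_ofReal ?_)
    calc unitBallVolume d * (3 * s) ^ d * v / (c * h ^ ℓ) = C₁ * (s ^ (d - ℓ) * s ^ ℓ) := by
          rw [hh1, hC₁, mul_pow, hsplit, one_pow]; field_simp
      _ ≤ max C₁ C₂ * (s ^ (d - ℓ) * R ^ ℓ) := by
          gcongr
          exact le_max_left _ _
  · have hh1 : h = s / (K * ρ) := min_eq_left h1
    refine (hmain _ (by positivity) hPball).trans (ENNReal.ofReal_le_ofReal ?_)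
    calc unitBallVolume d * (3 * s) ^ d * (unitBallVolume ℓ * (8 * K * R / ρ) ^ ℓ) / (c * h ^ ℓ)
        = C₂ * (s ^ (d - ℓ) * R ^ ℓ) := by
          rw [hh1, hC₂, mul_pow 3 s, hsplit]
          simp only [div_pow, mul_pow]
          field_simp
          ring
      _ ≤ max C₁ C₂ * (s ^ (d - ℓ) * R ^ ℓ) := by
          gcongr
          exact le_max_right _ _

theorem exists_volume_infDist_le (d ℓ : ℕ) (hℓ : ℓ < d) (N : ℕ) (K : ℝ) (hK : 1 ≤ K) :
    ∃ C > (0 : ℝ), ∀ Λ : Set (Space d), IsSource ℓ N K Λ →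
      ∀ (z : Space d) (R s : ℝ), 0 < s → s ≤ R →
        volume ({x | Metric.infDist x Λ ≤ s} ∩ Metric.ball z R) ≤
          ENNReal.ofReal (C * (s ^ (d - ℓ) * R ^ ℓ)) := by
  obtain ⟨C, hC, H⟩ := exists_volume_thickening_patch_le d ℓ hℓ K hK
  refine ⟨(N + 1) * C, by positivity, ?_⟩
  rintro Λ ⟨hne, f, ρ, hρ, hf, rfl⟩ z R s hs hsR
  have hsub : {x | Metric.infDist x (⋃ i, f i '' unitCube ℓ) ≤ s} ∩ Metric.ball z R ⊆
      ⋃ i, ({x | ∃ t ∈ unitCube ℓ, dist x (f i t) < 2 * s} ∩ Metric.ball z R) := by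
    rintro x ⟨hx, hxz⟩
    have hx' : Metric.infDist x (⋃ i, f i '' unitCube ℓ) < 2 * s := by
      have : Metric.infDist x (⋃ i, f i '' unitCube ℓ) ≤ s := hx
      linarith
    obtain ⟨y, hy, hxy⟩ := (Metric.infDist_lt_iff hne).1 hx'
    obtain ⟨i, t, ht, rfl⟩ := mem_iUnion.1 hy
    exact mem_iUnion.2 ⟨i, ⟨t, ht, hxy⟩, hxz⟩
  have hR : 0 < R := hs.trans_le hsR
  calc _ ≤ _ := measure_mono hsub
    _ ≤ ∑ i : Fin N, volume ({x | ∃ t ∈ unitCube ℓ, dist x (f i t) < 2 * s} ∩ Metric.ball z R) :=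
        measure_iUnion_fintype_le _ _
    _ ≤ ∑ i : Fin N, ENNReal.ofReal (C * (s ^ (d - ℓ) * R ^ ℓ)) :=
        Finset.sum_le_sum fun i _ => H (f i) (ρ i) (hρ i) (hf i) z R s hs hsR
    _ = ENNReal.ofReal (N * (C * (s ^ (d - ℓ) * R ^ ℓ))) := by
        rw [Finset.sum_const, Finset.card_univ, Fintype.card_fin, nsmul_eq_mul,
          ENNReal.ofReal_mul (p := (N : ℝ)) (by positivity), ENNReal.ofReal_natCast]
    _ ≤ _ := by
        refine ENNReal.ofReal_le_ofReal ?_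
        have : 0 ≤ C * (s ^ (d - ℓ) * R ^ ℓ) := by positivity
        nlinarith

/-- The weight as an extended nonnegative function. -/
def eweight (Λ : Set (Space d)) (β : ℝ) (x : Space d) : ENNReal :=
  ENNReal.ofReal (weight Λ β x)

theorem measurable_weight (Λ : Set (Space d)) (β : ℝ) : Measurable (weight Λ β) :=
  (Metric.continuous_infDist_pt Λ).measurable.pow_const _

theorem measurable_eweight (Λ : Set (Space d)) (β : ℝ) : Measurable (eweight Λ β) :=
  (measurable_weight Λ β).ennreal_ofReal

theorem weight_nonneg (Λ : Set (Space d)) (β : ℝ) (x : Space d) : 0 ≤ weight Λ β x :=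
  Real.rpow_nonneg Metric.infDist_nonneg _

/-- The weight `d_Λ^{2β}` belongs to the Muckenhoupt class `A₂`, with constant `CA`. -/
structure IsMuckenhoupt (Λ : Set (Space d)) (β CA : ℝ) : Prop where
  null : volume {x | Metric.infDist x Λ = 0} = 0
  a2 : ∀ (z : Space d) (R : ℝ), 0 < R →
    (∫⁻ x in Metric.ball z R, eweight Λ β x) * (∫⁻ x in Metric.ball z R, eweight Λ (-β) x) ≤
      ENNReal.ofReal (CA * R ^ (2 * d))

theorem IsMuckenhoupt.neg {Λ : Set (Space d)} {β CA : ℝ} (h : IsMuckenhoupt Λ (-β) CA) :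
    IsMuckenhoupt Λ β CA :=
  ⟨h.null, fun z R hR => by simpa [mul_comm] using h.a2 z R hR⟩

theorem exists_lintegral_infDist_neg_rpow_le (d ℓ : ℕ) (hℓ : ℓ < d) (N : ℕ) (K : ℝ) (hK : 1 ≤ K)
    (a : ℝ) (ha : 0 ≤ a) (had : a < (d : ℝ) - ℓ) :
    ∃ C > (0 : ℝ), ∀ Λ : Set (Space d), IsSource ℓ N K Λ → ∀ (z : Space d) (R : ℝ), 0 < R →
      ∫⁻ x in Metric.ball z R, ENNReal.ofReal (Metric.infDist x Λ ^ (-a)) ≤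
        ENNReal.ofReal (C * (R ^ d * R ^ (-a))) := by
  obtain ⟨CV, hCV, HV⟩ := exists_volume_infDist_le d ℓ hℓ N K hK
  have hV := unitBallVolume_pos d
  set n : ℝ := (d : ℝ) - ℓ with hn
  have hnn : ((d - ℓ : ℕ) : ℝ) = n := by rw [Nat.cast_sub hℓ.le]
  set q : ℝ := (1 / 2 : ℝ) ^ (n - a) with hq
  have hq0 : 0 < q := by positivity
  have hq1 : q < 1 := Real.rpow_lt_one (by norm_num) (by norm_num) (by linarith)
  have h1q : 0 < 1 - q := by linarith
  refine ⟨unitBallVolume d + 2 ^ a * CV * (1 - q)⁻¹, by positivity, fun Λ hΛ z R hR => ?_⟩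
  have hmeas : ∀ j : ℕ, MeasurableSet {x | Metric.infDist x Λ ≤ R * (1 / 2) ^ j} := fun j =>
    measurableSet_le (Metric.continuous_infDist_pt Λ).measurable measurable_const
  have hpt : ∀ x, ENNReal.ofReal (Metric.infDist x Λ ^ (-a)) ≤ ENNReal.ofReal (R ^ (-a)) +
      ∑' j : ℕ, {x | Metric.infDist x Λ ≤ R * (1 / 2) ^ j}.indicator
        (fun _ => ENNReal.ofReal ((R * (1 / 2) ^ (j + 1)) ^ (-a))) x := by
    intro x
    set δ := Metric.infDist x Λ with hδ
    have hδ0 : 0 ≤ δ := Metric.infDist_nonneg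
    rcases le_or_gt R δ with h | h
    · refine le_add_right (ENNReal.ofReal_le_ofReal ?_)
      exact Real.rpow_le_rpow_of_nonpos hR h (by linarith)
    rcases hδ0.eq_or_lt with h0 | h0
    · rcases ha.eq_or_lt with ha0 | ha0
      · refine le_add_right ?_
        simp [← ha0]
      · rw [← h0, Real.zero_rpow (by linarith)]; simp
    · refine le_add_left ?_
      obtain ⟨j, hj1, hj2⟩ := exists_nat_pow_near_of_lt_one (x := δ / R) (y := (1 / 2 : ℝ))
        (by positivity) (by rw [div_le_one hR]; exact h.le) (by norm_num) (by norm_num)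
      rw [div_le_iff₀ hR, mul_comm] at hj2
      rw [lt_div_iff₀ hR, mul_comm] at hj1
      refine le_trans ?_ (ENNReal.le_tsum j)
      rw [indicator_of_mem (by exact hj2)]
      refine ENNReal.ofReal_le_ofReal ?_
      exact Real.rpow_le_rpow_of_nonpos (by positivity) hj1.le (by linarith)
  have hterm : ∀ j : ℕ, ∫⁻ x in Metric.ball z R, {x | Metric.infDist x Λ ≤ R * (1 / 2) ^ j}.indicator
        (fun _ => ENNReal.ofReal ((R * (1 / 2) ^ (j + 1)) ^ (-a))) x ≤
      ENNReal.ofReal (2 ^ a * CV * (R ^ d * R ^ (-a)) * q ^ j) := by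
    intro j
    rw [lintegral_indicator_const (hmeas j), Measure.restrict_apply (hmeas j)]
    have h1 : (1 / 2 : ℝ) ^ j ≤ 1 := pow_le_one₀ (by norm_num) (by norm_num)
    refine (mul_le_mul_right (HV Λ hΛ z R (R * (1 / 2) ^ j) (by positivity) (by nlinarith)) _).trans ?_
    rw [← ENNReal.ofReal_mul (by positivity)]
    refine ENNReal.ofReal_le_ofReal (le_of_eq ?_)
    have e1 : (R * (1 / 2 : ℝ) ^ (j + 1)) ^ (-a) = R ^ (-a) * (2 ^ a * ((1 / 2 : ℝ) ^ j) ^ (-a)) := by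
      rw [Real.mul_rpow hR.le (by positivity), pow_succ, Real.mul_rpow (by positivity) (by norm_num),
        one_div, Real.inv_rpow (by norm_num : (0 : ℝ) ≤ 2) (-a), Real.rpow_neg (by norm_num : (0:ℝ) ≤ 2), inv_inv]
      ring
    have e2 : q ^ j = ((1 / 2 : ℝ) ^ j) ^ (d - ℓ) * ((1 / 2 : ℝ) ^ j) ^ (-a) := by
      rw [hq, ← Real.rpow_natCast (((1 / 2 : ℝ) ^ j)) (d - ℓ), hnn, ← Real.rpow_add (by positivity),
        ← Real.rpow_natCast, ← Real.rpow_mul (by norm_num), ← Real.rpow_natCast,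
        ← Real.rpow_mul (by norm_num)]
      ring_nf
    have e3 : R ^ d = R ^ (d - ℓ) * R ^ ℓ := by rw [← pow_add]; congr 1; omega
    rw [e1, e2, e3, mul_pow]
    ring
  calc ∫⁻ x in Metric.ball z R, ENNReal.ofReal (Metric.infDist x Λ ^ (-a))
      ≤ ∫⁻ x in Metric.ball z R, (ENNReal.ofReal (R ^ (-a)) +
      ∑' j : ℕ, {x | Metric.infDist x Λ ≤ R * (1 / 2) ^ j}.indicator
        (fun _ => ENNReal.ofReal ((R * (1 / 2) ^ (j + 1)) ^ (-a))) x) := lintegral_mono hpt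
    _ = ENNReal.ofReal (R ^ (-a)) * volume (Metric.ball z R) +
        ∑' j : ℕ, ∫⁻ x in Metric.ball z R, {x | Metric.infDist x Λ ≤ R * (1 / 2) ^ j}.indicator
        (fun _ => ENNReal.ofReal ((R * (1 / 2) ^ (j + 1)) ^ (-a))) x := by
        rw [lintegral_add_left measurable_const, lintegral_tsum, lintegral_const,
          Measure.restrict_apply MeasurableSet.univ, univ_inter]
        exact fun j => (measurable_const.indicator (hmeas j)).aemeasurable
    _ ≤ ENNReal.ofReal (R ^ (-a)) * ENNReal.ofReal (unitBallVolume d * R ^ d) +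
        ∑' j : ℕ, ENNReal.ofReal (2 ^ a * CV * (R ^ d * R ^ (-a)) * q ^ j) := by
        rw [volume_ball_eq z hR]
        gcongr with j
        exact hterm j
    _ = ENNReal.ofReal ((unitBallVolume d + 2 ^ a * CV * (1 - q)⁻¹) * (R ^ d * R ^ (-a))) := by
        rw [← ENNReal.ofReal_tsum_of_nonneg (fun j => by positivity)
          ((summable_geometric_of_lt_one hq0.le hq1).mul_left _), tsum_mul_left,
          tsum_geometric_of_lt_one hq0.le hq1, ← ENNReal.ofReal_mul (by positivity),
          ← ENNReal.ofReal_add (by positivity) (by positivity)]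
        congr 1; ring

theorem exists_isMuckenhoupt_of_nonneg (d ℓ : ℕ) (hℓ : ℓ < d) (N : ℕ) (K : ℝ) (hK : 1 ≤ K)
    (β : ℝ) (hβ0 : 0 ≤ β) (hβ : 2 * β < (d : ℝ) - ℓ) :
    ∃ C > (0 : ℝ), ∀ Λ : Set (Space d), IsSource ℓ N K Λ → IsMuckenhoupt Λ β C := by
  obtain ⟨CV, hCV, HV⟩ := exists_volume_infDist_le d ℓ hℓ N K hK
  obtain ⟨CI, hCI, HI⟩ := exists_lintegral_infDist_neg_rpow_le d ℓ hℓ N K hK (2 * β)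
    (by linarith) hβ
  have hV := unitBallVolume_pos d
  set C₁ : ℝ := (2 ^ (2 * β) * unitBallVolume d) ^ 2 with hC₁
  set C₂ : ℝ := 3 ^ (2 * β) * unitBallVolume d * CI with hC₂
  have hC₁0 : 0 < C₁ := by positivity
  have hC₂0 : 0 < C₂ := by positivity
  refine ⟨max C₁ C₂, lt_max_of_lt_left hC₁0, fun Λ hΛ => ⟨?_, fun z R hR => ?_⟩⟩
  · refine measure_null_of_locally_null _ fun x _ => ?_
    refine ⟨{x | Metric.infDist x Λ = 0} ∩ Metric.ball x 1,
      inter_mem self_mem_nhdsWithin (mem_nhdsWithin_of_mem_nhds (Metric.ball_mem_nhds x one_pos)), ?_⟩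
    have hlim : Tendsto (fun s : ℝ => ENNReal.ofReal (CV * (s ^ (d - ℓ) * 1 ^ ℓ))) (𝓝[>] 0) (𝓝 0) := by
      have h1 : Tendsto (fun s : ℝ => CV * (s ^ (d - ℓ) * 1 ^ ℓ)) (𝓝 0)
          (𝓝 (CV * (0 ^ (d - ℓ) * 1 ^ ℓ))) := by
        apply Continuous.tendsto; fun_prop
      rw [zero_pow (by omega), zero_mul, mul_zero] at h1
      simpa using ENNReal.tendsto_ofReal (h1.mono_left nhdsWithin_le_nhds)
    refine le_antisymm (ge_of_tendsto hlim ?_) zero_le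
    filter_upwards [Ioc_mem_nhdsGT (zero_lt_one' ℝ)] with s hs
    refine (measure_mono ?_).trans (HV Λ hΛ x 1 s hs.1 hs.2)
    rintro y ⟨hy, hyx⟩
    exact ⟨(show Metric.infDist y Λ = 0 from hy).le.trans hs.1.le, hyx⟩
  · have hRd : R ^ (2 * d) = R ^ d * R ^ d := by rw [two_mul, pow_add]
    have hint : ∀ (b c : ℝ), 0 ≤ c → (∀ x ∈ Metric.ball z R, weight Λ b x ≤ c) →
        ∫⁻ x in Metric.ball z R, eweight Λ b x ≤
          ENNReal.ofReal (c * (unitBallVolume d * R ^ d)) := by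
      intro b c hc H
      calc ∫⁻ x in Metric.ball z R, eweight Λ b x
          ≤ ∫⁻ x in Metric.ball z R, ENNReal.ofReal c :=
            setLIntegral_mono measurable_const fun x hx => ENNReal.ofReal_le_ofReal (H x hx)
        _ = _ := by
            rw [setLIntegral_const, volume_ball_eq z hR, ← ENNReal.ofReal_mul hc]
    set δ := Metric.infDist z Λ with hδ
    have hlip : ∀ x ∈ Metric.ball z R, |Metric.infDist x Λ - δ| ≤ R := by
      intro x hx
      have := (Metric.lipschitz_infDist_pt Λ).dist_le_mul x z
      rw [Real.dist_eq, NNReal.coe_one, one_mul] at this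
      exact this.trans (Metric.mem_ball.1 hx).le
    rcases le_or_gt (2 * R) δ with h | h
    · have hδ0 : 0 < δ := by linarith
      have hc : ∀ x ∈ Metric.ball z R, weight Λ β x ≤ 2 ^ (2 * β) * δ ^ (2 * β) := by
        intro x hx
        have := abs_le.1 (hlip x hx)
        rw [weight, ← Real.mul_rpow (by norm_num) hδ0.le]
        exact Real.rpow_le_rpow Metric.infDist_nonneg (by linarith [this.2]) (by linarith)
      have hc' : ∀ x ∈ Metric.ball z R, weight Λ (-β) x ≤ 2 ^ (2 * β) * δ ^ (-(2 * β)) := by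
        intro x hx
        have := abs_le.1 (hlip x hx)
        have h2 : (2 : ℝ) ^ (2 * β) = (1 / 2 : ℝ) ^ (-(2 * β)) := by
          rw [one_div, Real.inv_rpow (by norm_num), Real.rpow_neg (by norm_num), inv_inv]
        rw [weight, h2, ← Real.mul_rpow (by norm_num) hδ0.le, mul_neg]
        exact Real.rpow_le_rpow_of_nonpos (by positivity) (by linarith [this.1]) (by linarith)
      refine (mul_le_mul' (hint _ _ (by positivity) hc) (hint _ _ (by positivity) hc')).trans ?_
      rw [← ENNReal.ofReal_mul (by positivity)]
      refine ENNReal.ofReal_le_ofReal ?_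
      have h3 : δ ^ (2 * β) * δ ^ (-(2 * β)) = 1 := by
        rw [← Real.rpow_add hδ0]; simp
      calc _ = C₁ * R ^ (2 * d) * (δ ^ (2 * β) * δ ^ (-(2 * β))) := by rw [hC₁, hRd]; ring
        _ = C₁ * R ^ (2 * d) := by rw [h3, mul_one]
        _ ≤ _ := by gcongr; exact le_max_left _ _
    · have hc : ∀ x ∈ Metric.ball z R, weight Λ β x ≤ 3 ^ (2 * β) * R ^ (2 * β) := by
        intro x hx
        have := abs_le.1 (hlip x hx)
        rw [weight, ← Real.mul_rpow (by norm_num) hR.le]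
        exact Real.rpow_le_rpow Metric.infDist_nonneg (by linarith [this.2]) (by linarith)
      have hI : ∫⁻ x in Metric.ball z R, eweight Λ (-β) x ≤
          ENNReal.ofReal (CI * (R ^ d * R ^ (-(2 * β)))) := by
        refine le_trans (le_of_eq ?_) (HI Λ hΛ z R hR)
        simp only [eweight, weight, mul_neg]
      refine (mul_le_mul' (hint _ _ (by positivity) hc) hI).trans ?_
      rw [← ENNReal.ofReal_mul (by positivity)]
      refine ENNReal.ofReal_le_ofReal ?_
      have h3 : R ^ (2 * β) * R ^ (-(2 * β)) = 1 := by
        rw [← Real.rpow_add hR]; simp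
      calc _ = C₂ * R ^ (2 * d) * (R ^ (2 * β) * R ^ (-(2 * β))) := by rw [hC₂, hRd]; ring
        _ = C₂ * R ^ (2 * d) := by rw [h3, mul_one]
        _ ≤ _ := by gcongr; exact le_max_right _ _

theorem exists_isMuckenhoupt (d ℓ : ℕ) (hℓ : ℓ < d) (N : ℕ) (K : ℝ) (hK : 1 ≤ K)
    (β : ℝ) (hβ : β ∈ Ioo (-(((d : ℝ) - ℓ) / 2)) (((d : ℝ) - ℓ) / 2)) :
    ∃ C > (0 : ℝ), ∀ Λ : Set (Space d), IsSource ℓ N K Λ → IsMuckenhoupt Λ β C := by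
  rcases le_total 0 β with h | h
  · exact exists_isMuckenhoupt_of_nonneg d ℓ hℓ N K hK β h (by linarith [hβ.2])
  · obtain ⟨C, hC, H⟩ := exists_isMuckenhoupt_of_nonneg d ℓ hℓ N K hK (-β) (by linarith)
      (by linarith [hβ.1])
    exact ⟨C, hC, fun Λ hΛ => (H Λ hΛ).neg⟩

end Weight

end WeightedLOD

end

noncomputable section

namespace WeightedLOD

/-! ### Weighted Poincaré inequality on balls -/

section Poincare

theorem sq_lintegral_mul_le {α : Type*} [MeasurableSpace α] (μ : Measure α) {f g : α → ENNReal}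
    (hf : AEMeasurable f μ) (hg : AEMeasurable g μ) :
    (∫⁻ x, f x * g x ∂μ) ^ 2 ≤ (∫⁻ x, f x ^ 2 ∂μ) * ∫⁻ x, g x ^ 2 ∂μ := by
  have h := ENNReal.lintegral_mul_le_Lp_mul_Lq μ Real.HolderConjugate.two_two hf hg
  simp only [Pi.mul_apply, ENNReal.rpow_two] at h
  calc (∫⁻ x, f x * g x ∂μ) ^ 2
      ≤ ((∫⁻ x, f x ^ 2 ∂μ) ^ (1 / 2 : ℝ) * (∫⁻ x, g x ^ 2 ∂μ) ^ (1 / 2 : ℝ)) ^ 2 := by gcongr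
    _ = _ := by
      rw [mul_pow, ← ENNReal.rpow_natCast, ← ENNReal.rpow_mul, ← ENNReal.rpow_natCast,
        ← ENNReal.rpow_mul]
      norm_num

theorem sq_lintegral_le_of_one_le_mul {α : Type*} [MeasurableSpace α] (μ : Measure α)
    {g W W' : α → ENNReal} (hg : AEMeasurable g μ) (hW : AEMeasurable W μ)
    (hW' : AEMeasurable W' μ) (h : ∀ᵐ x ∂μ, 1 ≤ W x * W' x) :
    (∫⁻ x, g x ∂μ) ^ 2 ≤ (∫⁻ x, g x ^ 2 * W x ∂μ) * ∫⁻ x, W' x ∂μ := by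
  have hs : ∀ a : ENNReal, (a ^ (1 / 2 : ℝ)) ^ 2 = a := fun a => by
    rw [← ENNReal.rpow_natCast, ← ENNReal.rpow_mul]; norm_num
  calc (∫⁻ x, g x ∂μ) ^ 2
      ≤ (∫⁻ x, (g x * W x ^ (1 / 2 : ℝ)) * W' x ^ (1 / 2 : ℝ) ∂μ) ^ 2 := by
        gcongr 1
        refine lintegral_mono_ae ?_
        filter_upwards [h] with x hx
        rw [mul_assoc, ← ENNReal.mul_rpow_of_nonneg _ _ (by norm_num)]
        exact le_mul_of_one_le_right zero_le (ENNReal.one_le_rpow hx (by norm_num))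
    _ ≤ _ := sq_lintegral_mul_le μ (hg.mul (hW.pow_const _)) (hW'.pow_const _)
    _ = _ := by simp only [mul_pow, hs]

variable {d : ℕ}

theorem enorm_sub_le_lintegral_fderiv {u : Space d → ℝ} (hu : ContDiff ℝ 1 u) (x y : Space d) :
    ‖u x - u y‖ₑ ≤ ‖y - x‖ₑ * ∫⁻ t in Ioc (0 : ℝ) 1, ‖fderiv ℝ u (x + t • (y - x))‖ₑ := by
  have hd : ∀ t : ℝ, HasDerivAt (fun t : ℝ => u (x + t • (y - x)))
      (fderiv ℝ u (x + t • (y - x)) (y - x)) t := by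
    intro t
    have h1 : HasDerivAt (fun t : ℝ => x + t • (y - x)) (y - x) t := by
      simpa using ((hasDerivAt_id t).smul_const (y - x)).const_add x
    exact ((hu.differentiable one_ne_zero).differentiableAt.hasFDerivAt).comp_hasDerivAt t h1
  have hc : Continuous fun t : ℝ => fderiv ℝ u (x + t • (y - x)) (y - x) := by
    have := hu.continuous_fderiv one_ne_zero
    fun_prop
  have hi := intervalIntegral.integral_eq_sub_of_hasDerivAt (fun t _ => hd t)
    (hc.intervalIntegrable 0 1)
  have h2 : u x - u y = -∫ t in Ioc (0 : ℝ) 1, fderiv ℝ u (x + t • (y - x)) (y - x) := by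
    rw [← intervalIntegral.integral_of_le zero_le_one, hi]; simp
  rw [h2, enorm_neg, ← lintegral_const_mul']
  · refine (enorm_integral_le_lintegral_enorm _).trans (lintegral_mono fun t => ?_)
    rw [mul_comm]
    exact ContinuousLinearMap.le_opENorm _ _
  · exact enorm_ne_top

theorem lintegral_comp_homothety {F : Space d → ENNReal} (hF : Measurable F) (x : Space d) {t : ℝ}
    (ht : 0 < t) :
    ∫⁻ y, F (x + t • (y - x)) = ENNReal.ofReal ((t ^ d)⁻¹) * ∫⁻ p, F p := by
  have h1 : ∀ y, F (x + t • (y - x)) = F (t • (y + (t⁻¹ • x - x))) := by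
    intro y; congr 1
    simp only [smul_add, smul_sub, smul_smul, mul_inv_cancel₀ ht.ne', one_smul]; abel
  simp only [h1]
  rw [lintegral_add_right_eq_self (μ := (volume : Measure (Space d))) (fun y => F (t • y))]
  have h2 : ∫⁻ y, F (t • y) = ∫⁻ p, F p ∂(Measure.map (fun y : Space d => t • y) volume) :=
    (lintegral_map hF (measurable_const_smul t)).symm
  rw [h2, Measure.map_addHaar_smul volume ht.ne', lintegral_smul_measure,
    finrank_euclideanSpace_fin, abs_of_pos (by positivity), smul_eq_mul]

section
variable {W W' : Space d → ENNReal} {CA : ℝ} {g : Space d → ENNReal} {x₀ : Space d} {R : ℝ}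

/-- The averages of `g` over the sets `x + t (D - x)`, for a ball `D`, are bounded in weighted
`L²`, uniformly in `t`. -/
theorem lintegral_homothety_average_le (hW : Measurable W) (hW' : Measurable W')
    (hWW : ∀ᵐ x, 1 ≤ W x * W' x)
    (hA2 : ∀ (z : Space d) (R : ℝ), 0 < R →
      (∫⁻ x in Metric.ball z R, W x) * (∫⁻ x in Metric.ball z R, W' x) ≤
        ENNReal.ofReal (CA * R ^ (2 * d)))
    (hg : Measurable g) (hR : 0 < R) {t : ℝ} (ht : t ∈ Ioc (0 : ℝ) 1) :
    ∫⁻ x in Metric.ball x₀ R, (∫⁻ y in Metric.ball x₀ R, g (x + t • (y - x))) ^ 2 * W x ≤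
      ENNReal.ofReal (CA * (4 * R) ^ (2 * d)) * ∫⁻ x in Metric.ball x₀ R, g x ^ 2 * W x := by
  set D := Metric.ball x₀ R with hD
  have hDm : MeasurableSet D := Metric.isOpen_ball.measurableSet
  have ht0 : 0 < t := ht.1
  have hgW : Measurable fun p => g p ^ 2 * W p := (hg.pow_const 2).mul hW
  set S : Set (Space d × Space d) := {q | dist q.1 q.2 < 2 * R * t} with hS
  have hSm : MeasurableSet S :=
    measurableSet_lt (measurable_fst.dist measurable_snd) measurable_const
  set J : Space d → ENNReal := fun x => ∫⁻ p in Metric.ball x (2 * R * t), W' p with hJ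
  have hJm : Measurable J := by
    have h1 : ∀ x, J x = ∫⁻ p, S.indicator (fun q => W' q.2) (x, p) := by
      intro x
      rw [hJ]
      simp only
      rw [← lintegral_indicator Metric.isOpen_ball.measurableSet]
      refine lintegral_congr fun p => ?_
      simp only [indicator, hS, Metric.mem_ball, mem_ofPred_eq, dist_comm x p]
    rw [funext h1]
    exact ((hW'.comp measurable_snd).indicator hSm).lintegral_prod_right'
  have hcov : ∀ x ∈ D, ∫⁻ y in D, g (x + t • (y - x)) ≤
      ENNReal.ofReal ((t ^ d)⁻¹) * ∫⁻ p in D ∩ Metric.ball x (2 * R * t), g p := by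
    intro x hx
    have hm : MeasurableSet (D ∩ Metric.ball x (2 * R * t)) :=
      hDm.inter Metric.isOpen_ball.measurableSet
    rw [← lintegral_indicator hm, ← lintegral_comp_homothety (hg.indicator hm) x ht0,
      ← lintegral_indicator hDm]
    refine lintegral_mono fun y => ?_
    by_cases hy : y ∈ D
    · rw [indicator_of_mem hy, indicator_of_mem]
      constructor
      · have : x + t • (y - x) = (1 - t) • x + t • y := by module
        rw [this]
        exact (convex_ball x₀ R) hx hy (by linarith [ht.2]) ht0.le (by ring)
      · rw [Metric.mem_ball, dist_eq_norm, add_sub_cancel_left, norm_smul,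
          Real.norm_of_nonneg ht0.le, mul_comm]
        have : ‖y - x‖ < 2 * R := by
          rw [← dist_eq_norm]
          have h1 := Metric.mem_ball.1 hx
          have h2 := Metric.mem_ball.1 hy
          linarith [dist_triangle_right y x x₀]
        gcongr
    · rw [indicator_of_notMem hy]; exact zero_le
  have hpt : ∀ x ∈ D, (∫⁻ y in D, g (x + t • (y - x))) ^ 2 * W x ≤
      ENNReal.ofReal ((t ^ d)⁻¹) ^ 2 *
        ∫⁻ p in D, S.indicator (fun q => (g q.2 ^ 2 * W q.2) * (J q.1 * W q.1)) (x, p) := by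
    intro x hx
    have h1 : (∫⁻ p in D ∩ Metric.ball x (2 * R * t), g p) ^ 2 ≤
        (∫⁻ p in D ∩ Metric.ball x (2 * R * t), g p ^ 2 * W p) * J x := by
      refine (sq_lintegral_le_of_one_le_mul _ hg.aemeasurable hW.aemeasurable hW'.aemeasurable
        (ae_restrict_of_ae hWW)).trans ?_
      exact mul_le_mul_right (lintegral_mono_set inter_subset_right) _
    calc _ ≤ (ENNReal.ofReal ((t ^ d)⁻¹) * ∫⁻ p in D ∩ Metric.ball x (2 * R * t), g p) ^ 2 * W x := by
          gcongr; exact hcov x hx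
      _ ≤ ENNReal.ofReal ((t ^ d)⁻¹) ^ 2 *
          ((∫⁻ p in D ∩ Metric.ball x (2 * R * t), g p ^ 2 * W p) * J x) * W x := by
          rw [mul_pow]; gcongr
      _ = ENNReal.ofReal ((t ^ d)⁻¹) ^ 2 *
          ((∫⁻ p in D ∩ Metric.ball x (2 * R * t), g p ^ 2 * W p) * (J x * W x)) := by ring
      _ = _ := by
          congr 1
          rw [inter_comm, ← Measure.restrict_restrict Metric.isOpen_ball.measurableSet,
            ← lintegral_mul_const _ hgW,
            ← lintegral_indicator Metric.isOpen_ball.measurableSet]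
          refine lintegral_congr fun p => ?_
          simp only [indicator, hS, Metric.mem_ball, mem_ofPred_eq, dist_comm x p]
  calc ∫⁻ x in D, (∫⁻ y in D, g (x + t • (y - x))) ^ 2 * W x
      ≤ ∫⁻ x in D, ENNReal.ofReal ((t ^ d)⁻¹) ^ 2 *
        ∫⁻ p in D, S.indicator (fun q => (g q.2 ^ 2 * W q.2) * (J q.1 * W q.1)) (x, p) :=
        setLIntegral_mono' hDm hpt
    _ = ENNReal.ofReal ((t ^ d)⁻¹) ^ 2 * ∫⁻ p in D, ∫⁻ x in D,
        S.indicator (fun q => (g q.2 ^ 2 * W q.2) * (J q.1 * W q.1)) (x, p) := by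
        rw [lintegral_const_mul' _ _ (by finiteness), lintegral_lintegral_swap]
        refine Measurable.aemeasurable (Measurable.indicator ?_ hSm)
        exact (((hg.comp measurable_snd).pow_const 2).mul (hW.comp measurable_snd)).mul
          ((hJm.comp measurable_fst).mul (hW.comp measurable_fst))
    _ ≤ ENNReal.ofReal ((t ^ d)⁻¹) ^ 2 * ∫⁻ p in D, (g p ^ 2 * W p) *
          ENNReal.ofReal (CA * (4 * R * t) ^ (2 * d)) := by
        gcongr with p
        have hb : ∫⁻ x in D, S.indicator (fun q => (g q.2 ^ 2 * W q.2) * (J q.1 * W q.1)) (x, p) ≤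
            ∫⁻ x in Metric.ball p (4 * R * t), (g p ^ 2 * W p) *
              ((∫⁻ y in Metric.ball p (4 * R * t), W' y) * W x) := by
          refine (setLIntegral_le_lintegral _ _).trans ?_
          rw [← lintegral_indicator Metric.isOpen_ball.measurableSet]
          refine lintegral_mono fun x => ?_
          by_cases hx : (x, p) ∈ S
          · have hx' : dist x p < 2 * R * t := hx
            have hRt : 0 < R * t := by positivity
            rw [indicator_of_mem hx, indicator_of_mem
              (by rw [Metric.mem_ball]; linarith)]
            simp only
            gcongr
            refine lintegral_mono_set (Metric.ball_subset_ball' ?_)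
            linarith
          · rw [indicator_of_notMem hx]; exact zero_le
        refine hb.trans ?_
        rw [lintegral_const_mul _ (hW.const_mul _), lintegral_const_mul _ hW]
        gcongr
        rw [mul_comm]
        exact hA2 p _ (by have := ht.1; positivity)
    _ = ENNReal.ofReal (CA * (4 * R) ^ (2 * d)) * ∫⁻ x in D, g x ^ 2 * W x := by
        rw [lintegral_mul_const _ hgW, ← ENNReal.ofReal_pow (by positivity)]
        rw [mul_comm (∫⁻ p in D, g p ^ 2 * W p), ← mul_assoc, ← ENNReal.ofReal_mul (by positivity)]
        congr 2
        rw [mul_pow (4 * R) t, mul_comm 2 d, pow_mul t]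
        field_simp

theorem lintegral_sq_lintegral_sub_le (hW : Measurable W) (hW' : Measurable W')
    (hWW : ∀ᵐ x, 1 ≤ W x * W' x)
    (hA2 : ∀ (z : Space d) (R : ℝ), 0 < R →
      (∫⁻ x in Metric.ball z R, W x) * (∫⁻ x in Metric.ball z R, W' x) ≤
        ENNReal.ofReal (CA * R ^ (2 * d)))
    (hR : 0 < R) {u : Space d → ℝ} (hu : ContDiff ℝ 1 u) {E : Set (Space d)}
    (hE : E ⊆ Metric.ball x₀ R) :
    ∫⁻ x in Metric.ball x₀ R, (∫⁻ y in E, ‖u x - u y‖ₑ) ^ 2 * W x ≤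
      ENNReal.ofReal (4 * R ^ 2) * ENNReal.ofReal (CA * (4 * R) ^ (2 * d)) *
        ∫⁻ x in Metric.ball x₀ R, ‖fderiv ℝ u x‖ₑ ^ 2 * W x := by
  set D := Metric.ball x₀ R with hD
  have hDm : MeasurableSet D := Metric.isOpen_ball.measurableSet
  set g : Space d → ENNReal := fun x => ‖fderiv ℝ u x‖ₑ with hg
  have hgc : Continuous (fderiv ℝ u) := hu.continuous_fderiv one_ne_zero
  have hgm : Measurable g := hgc.enorm.measurable
  set Φ : Space d × ℝ → ENNReal := fun q => ∫⁻ y in D, g (q.1 + q.2 • (y - q.1)) with hΦ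
  have hΦm : Measurable Φ := by
    have : Measurable fun q : (Space d × ℝ) × Space d => g (q.1.1 + q.1.2 • (q.2 - q.1.1)) :=
      hgm.comp (by fun_prop)
    exact this.lintegral_prod_right'
  have h1 : ∀ x ∈ D, ∫⁻ y in E, ‖u x - u y‖ₑ ≤
      ENNReal.ofReal (2 * R) * ∫⁻ t in Ioc (0 : ℝ) 1, Φ (x, t) := by
    intro x hx
    calc ∫⁻ y in E, ‖u x - u y‖ₑ ≤ ∫⁻ y in D, ‖u x - u y‖ₑ := lintegral_mono_set hE
      _ ≤ ∫⁻ y in D, ENNReal.ofReal (2 * R) *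
          ∫⁻ t in Ioc (0 : ℝ) 1, ‖fderiv ℝ u (x + t • (y - x))‖ₑ := by
          refine setLIntegral_mono' hDm fun y hy => ?_
          refine (enorm_sub_le_lintegral_fderiv hu x y).trans ?_
          gcongr
          rw [← ofReal_norm]
          refine ENNReal.ofReal_le_ofReal ?_
          rw [← dist_eq_norm]
          have h1 := Metric.mem_ball.1 hx
          have h2 := Metric.mem_ball.1 hy
          linarith [dist_triangle_right y x x₀]
      _ = _ := by
          rw [lintegral_const_mul' _ _ ENNReal.ofReal_ne_top, lintegral_lintegral_swap]
          refine Measurable.aemeasurable ?_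
          exact hgm.comp (g := g) (f := fun q : Space d × ℝ => x + q.2 • (q.1 - x)) (by fun_prop)
  have h2 : ∀ x, (∫⁻ t in Ioc (0 : ℝ) 1, Φ (x, t)) ^ 2 ≤ ∫⁻ t in Ioc (0 : ℝ) 1, Φ (x, t) ^ 2 := by
    intro x
    have hm : Measurable fun t => Φ (x, t) := hΦm.comp measurable_prodMk_left
    have := sq_lintegral_mul_le (volume.restrict (Ioc (0 : ℝ) 1)) hm.aemeasurable
      (aemeasurable_const (b := (1 : ENNReal)))
    simpa using this
  calc ∫⁻ x in D, (∫⁻ y in E, ‖u x - u y‖ₑ) ^ 2 * W x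
      ≤ ∫⁻ x in D, ENNReal.ofReal (4 * R ^ 2) * ∫⁻ t in Ioc (0 : ℝ) 1, Φ (x, t) ^ 2 * W x := by
        refine setLIntegral_mono' hDm fun x hx => ?_
        have hm : Measurable fun t => Φ (x, t) := hΦm.comp measurable_prodMk_left
        rw [lintegral_mul_const _ (hm.pow_const 2), ← mul_assoc]
        gcongr
        calc _ ≤ (ENNReal.ofReal (2 * R) * ∫⁻ t in Ioc (0 : ℝ) 1, Φ (x, t)) ^ 2 := by
              gcongr; exact h1 x hx
          _ ≤ _ := by
              rw [mul_pow, ← ENNReal.ofReal_pow (by positivity)]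
              gcongr
              · exact le_of_eq (by ring)
              · exact h2 x
    _ = ENNReal.ofReal (4 * R ^ 2) * ∫⁻ t in Ioc (0 : ℝ) 1, ∫⁻ x in D, Φ (x, t) ^ 2 * W x := by
        rw [lintegral_const_mul' _ _ ENNReal.ofReal_ne_top, lintegral_lintegral_swap]
        exact ((hΦm.pow_const 2).mul (hW.comp measurable_fst)).aemeasurable
    _ ≤ ENNReal.ofReal (4 * R ^ 2) * ∫⁻ t in Ioc (0 : ℝ) 1,
          ENNReal.ofReal (CA * (4 * R) ^ (2 * d)) * ∫⁻ x in D, g x ^ 2 * W x := by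
        gcongr 1
        refine setLIntegral_mono' measurableSet_Ioc fun t ht => ?_
        exact lintegral_homothety_average_le hW hW' hWW hA2 hgm hR ht
    _ = _ := by
        rw [setLIntegral_const, Real.volume_Ioc]; simp [mul_assoc, hg]

end

theorem IsMuckenhoupt.one_le_mul {Λ : Set (Space d)} {β CA : ℝ} (h : IsMuckenhoupt Λ β CA) :
    ∀ᵐ x, 1 ≤ eweight Λ β x * eweight Λ (-β) x := by
  have h0 : ∀ᵐ x, Metric.infDist x Λ ≠ 0 := by
    rw [ae_iff]; simpa using h.null
  filter_upwards [h0] with x hx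
  have hx0 : 0 < Metric.infDist x Λ := lt_of_le_of_ne Metric.infDist_nonneg hx.symm
  rw [eweight, eweight, ← ENNReal.ofReal_mul (weight_nonneg _ _ _), weight, weight,
    ← Real.rpow_add hx0]
  simp

/-- Weighted Poincaré inequality on a ball, with the average over a smaller ball. -/
theorem IsMuckenhoupt.poincare_ball {Λ : Set (Space d)} {β CA : ℝ} (h : IsMuckenhoupt Λ β CA)
    {u : Space d → ℝ} (hu : ContDiff ℝ 1 u) {x₀ y₀ : Space d} {R κ : ℝ} (hR : 0 < R) (hκ : 0 < κ)
    (hE : Metric.ball y₀ (κ * R) ⊆ Metric.ball x₀ R) :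
    ∃ c : ℝ, ((∀ y ∈ Metric.ball y₀ (κ * R), u y = 0) → c = 0) ∧
      ∫⁻ x in Metric.ball x₀ R, ‖u x - c‖ₑ ^ 2 * eweight Λ β x ≤
        ENNReal.ofReal (4 * CA * 4 ^ (2 * d) / (unitBallVolume d * κ ^ d) ^ 2 * R ^ 2) *
          ∫⁻ x in Metric.ball x₀ R, ‖fderiv ℝ u x‖ₑ ^ 2 * eweight Λ β x := by
  set E := Metric.ball y₀ (κ * R) with hEd
  have hEm : MeasurableSet E := Metric.isOpen_ball.measurableSet
  have hκR : 0 < κ * R := by positivity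
  have hEv : volume E = ENNReal.ofReal (unitBallVolume d * (κ * R) ^ d) := volume_ball_eq y₀ hκR
  have hV := unitBallVolume_pos d
  have hE0 : volume E ≠ 0 := (Metric.measure_ball_pos _ _ hκR).ne'
  have hEt : volume E ≠ ⊤ := measure_ball_lt_top.ne
  have hui : IntegrableOn u E :=
    ((hu.continuous.locallyIntegrable.integrableOn_isCompact
      (isCompact_closedBall y₀ (κ * R))).mono_set Metric.ball_subset_closedBall)
  refine ⟨⨍ y in E, u y, fun h0 => ?_, ?_⟩
  · rw [setAverage_eq, setIntegral_congr_fun hEm h0]; simp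
  · have hpt : ∀ x, ‖u x - ⨍ y in E, u y‖ₑ ≤ (volume E)⁻¹ * ∫⁻ y in E, ‖u x - u y‖ₑ := by
      intro x
      have h1 : u x - ⨍ y in E, u y = (volume.real E)⁻¹ • ∫ y in E, (u x - u y) := by
        rw [integral_sub (integrableOn_const (C := u x) hEt).integrable hui, setAverage_eq, setIntegral_const, smul_sub,
          smul_smul, inv_mul_cancel₀, one_smul]
        exact (ENNReal.toReal_pos hE0 hEt).ne'
      rw [h1, enorm_smul]
      gcongr
      · rw [Real.enorm_eq_ofReal (by positivity), Measure.real, ENNReal.ofReal_inv_of_pos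
          (ENNReal.toReal_pos hE0 hEt), ENNReal.ofReal_toReal hEt]
      · exact enorm_integral_le_lintegral_enorm _
    calc ∫⁻ x in Metric.ball x₀ R, ‖u x - ⨍ y in E, u y‖ₑ ^ 2 * eweight Λ β x
        ≤ ∫⁻ x in Metric.ball x₀ R, ((volume E)⁻¹) ^ 2 *
          ((∫⁻ y in E, ‖u x - u y‖ₑ) ^ 2 * eweight Λ β x) := by
          refine lintegral_mono fun x => ?_
          rw [← mul_assoc, ← mul_pow]
          gcongr
          exact hpt x
      _ ≤ ((volume E)⁻¹) ^ 2 * (ENNReal.ofReal (4 * R ^ 2) * ENNReal.ofReal (CA * (4 * R) ^ (2 * d)) *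
          ∫⁻ x in Metric.ball x₀ R, ‖fderiv ℝ u x‖ₑ ^ 2 * eweight Λ β x) := by
          rw [lintegral_const_mul' _ _ (by finiteness)]
          gcongr
          exact lintegral_sq_lintegral_sub_le (measurable_eweight _ _) (measurable_eweight _ _)
            h.one_le_mul h.a2 hR hu hE
      _ = _ := by
          rw [← mul_assoc, hEv, ← ENNReal.ofReal_inv_of_pos (by positivity),
            ← ENNReal.ofReal_pow (by positivity), ← ENNReal.ofReal_mul (by positivity),
            ← ENNReal.ofReal_mul (by positivity)]
          congr 2
          simp only [mul_pow, mul_comm 2 d, pow_mul]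
          field_simp

end Poincare

end WeightedLOD

end

noncomputable section

namespace WeightedLOD

/-! ### Barycentric coordinates and nodal basis functions -/

theorem affineMap_sum_smul {d : ℕ} (a : Space d →ᵃ[ℝ] ℝ) {t : Finset (Space d)} {w : Space d → ℝ}
    (hw : ∑ y ∈ t, w y = 1) : a (∑ y ∈ t, w y • y) = ∑ y ∈ t, w y * a y := by
  have h : ∀ x, a x = a.linear x + a 0 := fun x => by
    have := congrFun a.decomp x
    simpa using this
  have hy : ∀ y, w y * a y = w y * a.linear y + w y * a 0 := fun y => by rw [h y, mul_add]
  rw [h, map_sum, Finset.sum_congr rfl fun y _ => hy y, Finset.sum_add_distrib, ← Finset.sum_mul,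
    hw, one_mul]
  simp

namespace Mesh

variable {d : ℕ} {Ω : Set (Space d)} (M : Mesh Ω)

theorem finite_cells : M.cells.Finite := M.finite_faces.subset fun _ h => h.1

/-- The corners of a cell form an affine basis. -/
def cellBasis {t : Finset (Space d)} (ht : t ∈ M.cells) : AffineBasis t ℝ (Space d) where
  toFun := (↑)
  ind' := M.indep ht.1
  tot' := by
    rw [(M.indep ht.1).affineSpan_eq_top_iff_card_eq_finrank_add_one]
    simp [ht.2]

open Classical in
/-- The barycentric coordinate with respect to `p` on the cell `t` (zero if `p` is no corner). -/
def bary {t : Finset (Space d)} (ht : t ∈ M.cells) (p : Space d) : Space d →ᵃ[ℝ] ℝ :=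
  if hp : p ∈ t then (M.cellBasis ht).coord ⟨p, hp⟩ else 0

variable {M} {t t' : Finset (Space d)} {ht : t ∈ M.cells} {ht' : t' ∈ M.cells}

theorem bary_of_notMem {p : Space d} (hp : p ∉ t) (x : Space d) : M.bary ht p x = 0 := by
  simp [bary, hp]

theorem bary_of_mem {p : Space d} (hp : p ∈ t) : M.bary ht p = (M.cellBasis ht).coord ⟨p, hp⟩ := by
  simp [bary, hp]

theorem bary_self {p : Space d} (hp : p ∈ t) : M.bary ht p p = 1 := by
  rw [bary_of_mem hp]
  exact (M.cellBasis ht).coord_apply_eq ⟨p, hp⟩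

theorem bary_ne {p q : Space d} (hq : q ∈ t) (hpq : p ≠ q) : M.bary ht p q = 0 := by
  by_cases hp : p ∈ t
  · rw [bary_of_mem hp]
    exact (M.cellBasis ht).coord_apply_ne (i := ⟨p, hp⟩) (j := ⟨q, hq⟩) (by simpa using hpq)
  · exact bary_of_notMem hp q

theorem sum_bary (x : Space d) : ∑ p ∈ t, M.bary ht p x = 1 := by
  rw [← (M.cellBasis ht).sum_coord_apply_eq_one x, ← Finset.sum_coe_sort]
  exact Finset.sum_congr rfl fun p _ => by rw [bary_of_mem p.2]

theorem sum_bary_smul (x : Space d) : ∑ p ∈ t, M.bary ht p x • p = x := by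
  conv_rhs => rw [← (M.cellBasis ht).linear_combination_coord_eq_self x]
  rw [← Finset.sum_coe_sort]
  exact Finset.sum_congr rfl fun p _ => by rw [bary_of_mem p.2]; rfl

theorem range_cellBasis : range (M.cellBasis ht) = (t : Set (Space d)) := Subtype.range_coe

theorem mem_cell_iff (ht : t ∈ M.cells) {x : Space d} :
    x ∈ convexHull ℝ (t : Set (Space d)) ↔ ∀ p ∈ t, 0 ≤ M.bary ht p x := by
  rw [← range_cellBasis (ht := ht), AffineBasis.convexHull_eq_nonneg_coord]
  exact ⟨fun h p hp => by rw [bary_of_mem hp]; exact h _,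
    fun h p => by have := h p.1 p.2; rwa [bary_of_mem p.2] at this⟩

theorem mem_interior_cell_iff (ht : t ∈ M.cells) {x : Space d} :
    x ∈ interior (convexHull ℝ (t : Set (Space d))) ↔ ∀ p ∈ t, 0 < M.bary ht p x := by
  rw [← range_cellBasis (ht := ht), AffineBasis.interior_convexHull]
  exact ⟨fun h p hp => by rw [bary_of_mem hp]; exact h _,
    fun h p => by have := h p.1 p.2; rwa [bary_of_mem p.2] at this⟩

theorem bary_nonneg {x : Space d} (hx : x ∈ convexHull ℝ (t : Set (Space d))) (p : Space d) :
    0 ≤ M.bary ht p x := by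
  by_cases hp : p ∈ t
  · exact (mem_cell_iff ht).1 hx p hp
  · rw [bary_of_notMem hp]

theorem bary_le_one {x : Space d} (hx : x ∈ convexHull ℝ (t : Set (Space d))) (p : Space d) :
    M.bary ht p x ≤ 1 := by
  by_cases hp : p ∈ t
  · rw [← sum_bary (ht := ht) x]
    exact Finset.single_le_sum (f := fun q => M.bary ht q x) (fun q _ => bary_nonneg hx q) hp
  · rw [bary_of_notMem hp]; exact zero_le_one

theorem affine_eq_sum_bary (ht : t ∈ M.cells) (a : Space d →ᵃ[ℝ] ℝ) (x : Space d) :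
    a x = ∑ p ∈ t, M.bary ht p x * a p := by
  conv_lhs => rw [← sum_bary_smul (ht := ht) x]
  exact affineMap_sum_smul a (sum_bary x)

theorem bary_combination {s : Finset (Space d)} (hst : s ⊆ t) {w : Space d → ℝ}
    (hw : ∑ y ∈ s, w y = 1) {p : Space d} (hp : p ∈ s) :
    M.bary ht p (∑ y ∈ s, w y • y) = w p := by
  rw [affineMap_sum_smul _ hw, Finset.sum_eq_single p]
  · rw [bary_self (hst hp), mul_one]
  · intro q hq hqp
    rw [bary_ne (hst hq) hqp.symm, mul_zero]
  · exact fun h => absurd hp h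

theorem bary_combination_of_notMem {s : Finset (Space d)} (hst : s ⊆ t) {w : Space d → ℝ}
    (hw : ∑ y ∈ s, w y = 1) {p : Space d} (hp : p ∉ s) :
    M.bary ht p (∑ y ∈ s, w y • y) = 0 := by
  rw [affineMap_sum_smul _ hw]
  refine Finset.sum_eq_zero fun q hq => ?_
  rw [bary_ne (hst hq) (by rintro rfl; exact hp hq), mul_zero]

theorem bary_congr (ht : t ∈ M.cells) (ht' : t' ∈ M.cells) {x : Space d}
    (hx : x ∈ convexHull ℝ (t : Set (Space d)))
    (hx' : x ∈ convexHull ℝ (t' : Set (Space d))) (p : Space d) :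
    M.bary ht p x = M.bary ht' p x := by
  classical
  have h := M.inter_subset_convexHull ht.1 ht'.1 ⟨hx, hx'⟩
  rw [← Finset.coe_inter, Finset.mem_convexHull'] at h
  obtain ⟨w, -, hw, rfl⟩ := h
  by_cases hp : p ∈ t ∩ t'
  · rw [bary_combination Finset.inter_subset_left hw hp,
      bary_combination Finset.inter_subset_right hw hp]
  · rw [bary_combination_of_notMem Finset.inter_subset_left hw hp,
      bary_combination_of_notMem Finset.inter_subset_right hw hp]

theorem hat_eq_bary (ht : t ∈ M.cells) {x : Space d} (hx : x ∈ convexHull ℝ (t : Set (Space d)))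
    (v : Space d) : M.hat v x = M.bary ht v x := by
  have hsub : {c | ∃ t ∈ M.cells, v ∈ t ∧ ∃ w : Space d → ℝ,
      (∀ y ∈ t, 0 ≤ w y) ∧ ∑ y ∈ t, w y = 1 ∧ ∑ y ∈ t, w y • y = x ∧ c = w v} ⊆
      {M.bary ht v x} := by
    rintro c ⟨t', ht', hv, w, hw0, hw1, rfl, rfl⟩
    have hx' : ∑ y ∈ t', w y • y ∈ convexHull ℝ (t' : Set (Space d)) :=
      Finset.mem_convexHull'.2 ⟨w, hw0, hw1, rfl⟩
    rw [mem_singleton_iff, bary_congr ht ht' hx hx', bary_combination subset_rfl hw1 hv]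
  rw [hat]
  rcases subset_singleton_iff_eq.1 hsub with h | h
  · rw [h, Real.sSup_empty]
    by_cases hv : v ∈ t
    · exfalso
      refine notMem_empty (M.bary ht v x) (h ▸ ?_)
      exact ⟨t, ht, hv, fun p => M.bary ht p x, fun y _ => bary_nonneg hx y, sum_bary x,
        sum_bary_smul x, rfl⟩
    · rw [bary_of_notMem hv]
  · rw [h, csSup_singleton]

theorem exists_cell_of_hat_ne_zero {v x : Space d} (h : M.hat v x ≠ 0) :
    ∃ t ∈ M.cells, v ∈ t ∧ x ∈ convexHull ℝ (t : Set (Space d)) := by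
  by_contra! hcon
  refine h ?_
  rw [hat]
  convert Real.sSup_empty
  refine eq_empty_of_forall_notMem ?_
  rintro c ⟨t, ht, hv, w, hw0, hw1, hwx, -⟩
  exact hcon t ht hv (Finset.mem_convexHull'.2 ⟨w, hw0, hw1, hwx⟩)

variable (M) in
theorem exists_cell {x : Space d} (hx : x ∈ closure Ω) :
    ∃ t ∈ M.cells, x ∈ convexHull ℝ (t : Set (Space d)) := by
  rw [← M.space_eq, Geometry.SimplicialComplex.mem_space_iff] at hx
  obtain ⟨s, hs, hxs⟩ := hx
  obtain ⟨t, ht, hst, hc⟩ := M.pure s hs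
  exact ⟨t, ⟨ht, hc⟩, convexHull_mono (by exact_mod_cast hst) hxs⟩

theorem cell_subset_closure (ht : t ∈ M.cells) :
    convexHull ℝ (t : Set (Space d)) ⊆ closure Ω := by
  rw [← M.space_eq]
  exact Geometry.SimplicialComplex.convexHull_subset_space ht.1

theorem isCompact_cell (t : Finset (Space d)) : IsCompact (convexHull ℝ (t : Set (Space d))) :=
  t.finite_toSet.isCompact_convexHull (𝕜 := ℝ)

theorem isClosed_cell (t : Finset (Space d)) : IsClosed (convexHull ℝ (t : Set (Space d))) :=
  (isCompact_cell t).isClosed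

theorem corner_mem_cell {p : Space d} (hp : p ∈ t) : p ∈ convexHull ℝ (t : Set (Space d)) :=
  subset_convexHull ℝ _ hp

theorem corner_mem_vertices (ht : t ∈ M.cells) {p : Space d} (hp : p ∈ t) : p ∈ M.vertices :=
  M.down_closed ht.1 (Finset.singleton_subset_iff.2 hp) (Finset.singleton_nonempty p)

theorem exists_cell_of_mem_vertices {p : Space d} (hp : p ∈ M.vertices) :
    ∃ t ∈ M.cells, p ∈ t := by
  obtain ⟨t, ht, hst, hc⟩ := M.pure {p} hp
  exact ⟨t, ⟨ht, hc⟩, hst (Finset.mem_singleton_self p)⟩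

theorem mem_innerNodes {v : Space d} : v ∈ M.innerNodes ↔ v ∈ M.vertices ∧ v ∈ Ω := by
  simp [innerNodes]

theorem hat_nonneg (v x : Space d) : 0 ≤ M.hat v x := by
  by_cases h : M.hat v x = 0
  · exact h.ge
  · obtain ⟨t, ht, -, hx⟩ := exists_cell_of_hat_ne_zero h
    rw [hat_eq_bary ht hx]; exact bary_nonneg hx v

theorem hat_self {v : Space d} (hv : v ∈ M.vertices) : M.hat v v = 1 := by
  obtain ⟨t, ht, hvt⟩ := exists_cell_of_mem_vertices hv
  rw [hat_eq_bary ht (corner_mem_cell hvt), bary_self hvt]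

theorem hat_ne {v v' : Space d} (hv' : v' ∈ M.vertices) (h : v ≠ v') : M.hat v v' = 0 := by
  obtain ⟨t, ht, hvt⟩ := exists_cell_of_mem_vertices hv'
  rw [hat_eq_bary ht (corner_mem_cell hvt), bary_ne hvt h]

/-- The nodal basis functions of the inner nodes vanish outside `Ω`. -/
theorem hat_eq_zero_of_notMem (hΩ : interior (closure Ω) = Ω) {v : Space d} (hv : v ∈ Ω)
    {x : Space d} (hx : x ∉ Ω) : M.hat v x = 0 := by
  by_contra h
  obtain ⟨t₀, ht₀, hvt₀, hx₀⟩ := exists_cell_of_hat_ne_zero h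
  have hpos : 0 < M.bary ht₀ v x := by
    rw [← hat_eq_bary ht₀ hx₀]; exact (hat_nonneg v x).lt_of_ne' h
  have hΩo : IsOpen Ω := hΩ ▸ isOpen_interior
  obtain ⟨ε, hε0, hε1, hεΩ⟩ : ∃ ε : ℝ, 0 < ε ∧ ε ≤ 1 ∧ AffineMap.lineMap v x ε ∈ Ω := by
    have hc : Tendsto (fun ε : ℝ => AffineMap.lineMap v x ε) (𝓝[>] 0) (𝓝 v) := by
      have : Continuous fun ε : ℝ => (AffineMap.lineMap v x ε : Space d) :=
        AffineMap.lineMap_continuous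
      simpa using (this.tendsto 0).mono_left nhdsWithin_le_nhds
    obtain ⟨ε, h1, h2⟩ := ((hc.eventually (hΩo.mem_nhds hv)).and
      (Ioc_mem_nhdsGT (zero_lt_one' ℝ))).exists
    exact ⟨ε, h2.1, h2.2, h1⟩
  set y : Space d → Space d := fun x' => AffineMap.lineMap v x' ε with hy
  have hyc : Continuous y := by
    simp only [hy, AffineMap.lineMap_apply_module]; fun_prop
  have hbary : ∀ (t : Finset (Space d)) (ht : t ∈ M.cells) (p x' : Space d),
      M.bary ht p (y x') = (1 - ε) * M.bary ht p v + ε * M.bary ht p x' := by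
    intro t ht p x'
    rw [hy]
    simp only
    rw [AffineMap.apply_lineMap, AffineMap.lineMap_apply_module]; simp
  have hy₀ : y x ∈ convexHull ℝ (t₀ : Set (Space d)) := by
    have := (convex_convexHull ℝ (t₀ : Set (Space d))) (corner_mem_cell hvt₀) hx₀
      (show 0 ≤ 1 - ε by linarith) hε0.le (by ring)
    rwa [← AffineMap.lineMap_apply_module] at this
  have hev : ∀ t ∈ M.cells, ∀ᶠ x' in 𝓝 x, y x' ∈ convexHull ℝ (t : Set (Space d)) →
      x' ∈ convexHull ℝ (t : Set (Space d)) := by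
    intro t ht
    by_cases hyt : y x ∈ convexHull ℝ (t : Set (Space d))
    · have h1 := bary_congr ht₀ ht hy₀ hyt v
      have hvt : v ∈ t := by
        by_contra hvt
        rw [bary_of_notMem hvt, hbary, bary_self hvt₀] at h1
        nlinarith
      rw [hbary, hbary, bary_self hvt₀, bary_self hvt] at h1
      have h2 : 0 < M.bary ht v x := by
        have : ε * M.bary ht₀ v x = ε * M.bary ht v x := by linarith
        rwa [← mul_left_cancel₀ hε0.ne' this]
      have hcont : Continuous (M.bary ht v) := (M.bary ht v).continuous_of_finiteDimensional
      filter_upwards [hcont.continuousAt.eventually (lt_mem_nhds h2)] with x' hx' hyx'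
      rw [mem_cell_iff ht] at hyx' ⊢
      intro p hp
      by_cases hpv : p = v
      · rw [hpv]; exact hx'.le
      · have := hyx' p hp
        rw [hbary, bary_ne hvt hpv, mul_zero, zero_add] at this
        exact nonneg_of_mul_nonneg_right this hε0
    · filter_upwards [hyc.continuousAt.eventually ((isClosed_cell t).isOpen_compl.mem_nhds hyt)]
        with x' hx' h
      exact absurd h hx'
  refine hx (hΩ ▸ mem_interior_iff_mem_nhds.2 ?_)
  filter_upwards [(M.finite_cells.eventually_all).2 hev,
    hyc.continuousAt.eventually (hΩo.mem_nhds hεΩ)] with x' h1 h2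
  obtain ⟨t, ht, hyt⟩ := M.exists_cell (subset_closure h2)
  exact cell_subset_closure ht (h1 t ht hyt)

theorem hat_mem_coarseSpace (hΩ : interior (closure Ω) = Ω) {v : Space d} (hv : v ∈ Ω) :
    M.hat v ∈ M.coarseSpace :=
  ⟨fun _ ht => ⟨M.bary ht v, fun _ hx => hat_eq_bary ht hx v⟩,
    fun _ hx => hat_eq_zero_of_notMem hΩ hv hx⟩

theorem coarseSpace_eq_sum {u : Space d → ℝ} (hu : u ∈ M.coarseSpace)
    (hΩ : interior (closure Ω) = Ω) (x : Space d) :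
    u x = ∑ v ∈ M.innerNodes, u v * M.hat v x := by
  classical
  by_cases hx : x ∈ Ω
  · obtain ⟨t, ht, hxt⟩ := M.exists_cell (subset_closure hx)
    obtain ⟨a, ha⟩ := hu.1 t ht
    rw [ha hxt, affine_eq_sum_bary ht a x]
    have h1 : ∀ v ∈ M.innerNodes, v ∉ M.innerNodes ∩ t → u v * M.hat v x = 0 := by
      intro v hv hv'
      have : v ∉ t := fun h => hv' (Finset.mem_inter.2 ⟨hv, h⟩)
      rw [hat_eq_bary ht hxt, bary_of_notMem this, mul_zero]
    rw [← Finset.sum_subset Finset.inter_subset_left h1]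
    have h2 : ∀ v ∈ t, v ∉ M.innerNodes ∩ t → M.bary ht v x * a v = 0 := by
      intro v hv hv'
      have : v ∉ Ω := fun h => hv' (Finset.mem_inter.2
        ⟨mem_innerNodes.2 ⟨corner_mem_vertices ht hv, h⟩, hv⟩)
      rw [← ha (corner_mem_cell hv), hu.2 v this, mul_zero]
    rw [← Finset.sum_subset Finset.inter_subset_right h2]
    refine Finset.sum_congr rfl fun v hv => ?_
    rw [hat_eq_bary ht hxt, ← ha (corner_mem_cell (Finset.mem_inter.1 hv).2), mul_comm]
  · rw [hu.2 x hx, Finset.sum_eq_zero]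
    intro v hv
    rw [hat_eq_zero_of_notMem hΩ (mem_innerNodes.1 hv).2 hx, mul_zero]

variable (M) in
/-- The coarse space as a linear subspace. -/
def coarseSubmodule : Submodule ℝ (Space d → ℝ) where
  carrier := M.coarseSpace
  zero_mem' := ⟨fun _ _ => ⟨0, fun _ _ => by simp⟩, fun _ _ => rfl⟩
  add_mem' := by
    rintro u w ⟨hu, hu'⟩ ⟨hw, hw'⟩
    refine ⟨fun t ht => ?_, fun x hx => by simp [hu' x hx, hw' x hx]⟩
    obtain ⟨a, ha⟩ := hu t ht
    obtain ⟨b, hb⟩ := hw t ht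
    exact ⟨a + b, fun x hx => by simp [ha hx, hb hx]⟩
  smul_mem' := by
    rintro c u ⟨hu, hu'⟩
    refine ⟨fun t ht => ?_, fun x hx => by simp [hu' x hx]⟩
    obtain ⟨a, ha⟩ := hu t ht
    exact ⟨c • a, fun x hx => by simp [ha hx]⟩

theorem mem_coarseSubmodule {u : Space d → ℝ} : u ∈ M.coarseSubmodule ↔ u ∈ M.coarseSpace :=
  Iff.rfl

end Mesh

/-! ### Functions that are Lipschitz on the pieces of a finite closed cover -/

theorem abs_sub_le_of_finite_closed_cover {ι : Type*} [DecidableEq ι] (s : Finset ι) (F : ι → Set ℝ)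
    (hF : ∀ i ∈ s, IsClosed (F i)) (g : ℝ → ℝ) (L : ℝ) (b : ℝ)
    (hg : ∀ i ∈ s, ∀ p ∈ F i, ∀ q ∈ F i, |g p - g q| ≤ L * |p - q|) :
    ∀ a ≤ b, Icc a b ⊆ ⋃ i ∈ s, F i → |g a - g b| ≤ L * (b - a) := by
  induction s using Finset.strongInduction with
  | H s ih =>
    intro a hab hcov
    rcases hab.eq_or_lt with rfl | hlt
    · simp
    obtain ⟨i, hi, hai⟩ := mem_iUnion₂.1 (hcov (left_mem_Icc.2 hab))
    have hcomp : IsCompact (F i ∩ Icc a b) := isCompact_Icc.inter_left (hF i hi)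
    have hne : (F i ∩ Icc a b).Nonempty := ⟨a, hai, left_mem_Icc.2 hab⟩
    set c := sSup (F i ∩ Icc a b) with hc
    have hcm : c ∈ F i ∩ Icc a b := hcomp.sSup_mem hne
    have h1 : |g a - g c| ≤ L * (c - a) := by
      have := hg i hi a hai c hcm.1
      rwa [abs_sub_comm a c, abs_of_nonneg (sub_nonneg.2 hcm.2.1)] at this
    have h2 : |g c - g b| ≤ L * (b - c) := by
      rcases hcm.2.2.eq_or_lt with hcb | hcb
      · rw [hcb]; simp
      refine ih (s.erase i) (Finset.erase_ssubset hi) (fun j hj => hF j (Finset.mem_of_mem_erase hj))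
        (fun j hj => hg j (Finset.mem_of_mem_erase hj)) c hcm.2.2 ?_
      have hcl : IsClosed (⋃ j ∈ s.erase i, F j) :=
        isClosed_biUnion_finset fun j hj => hF j (Finset.mem_of_mem_erase hj)
      rw [← closure_Ioc hcb.ne]
      refine hcl.closure_subset_iff.2 fun p hp => ?_
      obtain ⟨j, hj, hpj⟩ := mem_iUnion₂.1 (hcov ⟨hcm.2.1.trans hp.1.le, hp.2⟩)
      refine mem_iUnion₂.2 ⟨j, Finset.mem_erase.2 ⟨?_, hj⟩, hpj⟩
      rintro rfl
      have : p ≤ c := le_csSup hcomp.bddAbove ⟨hpj, hcm.2.1.trans hp.1.le, hp.2⟩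
      exact absurd hp.1 (not_lt.2 this)
    calc |g a - g b| ≤ |g a - g c| + |g c - g b| := abs_sub_le _ _ _
      _ ≤ _ := by linarith

theorem abs_sub_le_of_finite_closed_cover_segment {d : ℕ} (𝒮 : Set (Set (Space d)))
    (hfin : 𝒮.Finite) (hcl : ∀ S ∈ 𝒮, IsClosed S) (f : Space d → ℝ) (L : ℝ)
    (hf : ∀ S ∈ 𝒮, ∀ p ∈ S, ∀ q ∈ S, |f p - f q| ≤ L * dist p q) (x y : Space d)
    (hxy : segment ℝ x y ⊆ ⋃ S ∈ 𝒮, S) : |f x - f y| ≤ L * dist x y := by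
  classical
  set γ : ℝ → Space d := fun s => AffineMap.lineMap x y s with hγ
  have hγc : Continuous γ := AffineMap.lineMap_continuous
  have hd : ∀ p q : ℝ, dist (γ p) (γ q) = |p - q| * dist x y := fun p q => by
    rw [hγ]; simp only; rw [dist_lineMap_lineMap, Real.dist_eq]
  have := abs_sub_le_of_finite_closed_cover hfin.toFinset (fun S => γ ⁻¹' S)
    (fun S hS => (hcl S (hfin.mem_toFinset.1 hS)).preimage hγc) (f ∘ γ) (L * dist x y) 1
    (fun S hS p hp q hq => by
      have := hf S (hfin.mem_toFinset.1 hS) _ hp _ hq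
      rw [hd] at this
      simp only [Function.comp_apply]
      linarith) 0 zero_le_one (fun s hs => by
        have : γ s ∈ segment ℝ x y := by
          rw [segment_eq_image_lineMap]; exact ⟨s, hs, rfl⟩
        obtain ⟨S, hS, h⟩ := mem_iUnion₂.1 (hxy this)
        exact mem_iUnion₂.2 ⟨S, hfin.mem_toFinset.2 hS, h⟩)
  simpa [hγ] using this

end WeightedLOD

end

noncomputable section

namespace WeightedLOD

/-! ### Quantitative properties of quasi-uniform meshes -/

theorem integrable_exp_neg_mul_norm (d : ℕ) {a : ℝ} (ha : 0 < a) :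
    Integrable fun x : Space d => Real.exp (-(a * ‖x‖)) := by
  set n : ℕ := d + 1 with hn
  have h1 : Integrable fun x : Space d =>
      (Real.exp a * n.factorial / a ^ n) * (1 + ‖x‖) ^ (-(n : ℝ)) := by
    refine (integrable_one_add_norm ?_).const_mul _
    rw [finrank_euclideanSpace_fin, hn]; push_cast; linarith
  refine h1.mono' (by fun_prop) (Eventually.of_forall fun x => ?_)
  rw [Real.norm_of_nonneg (Real.exp_pos _).le]
  have h0 : 0 < 1 + ‖x‖ := by positivity
  have h2 := Real.pow_div_factorial_le_exp (a * (1 + ‖x‖)) (by positivity) n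
  rw [Real.rpow_neg h0.le, Real.rpow_natCast]
  have hf : (0 : ℝ) < n.factorial := by positivity
  rw [div_le_iff₀ hf, mul_pow, mul_add, mul_one, Real.exp_add] at h2
  rw [Real.exp_neg]
  rw [div_mul_eq_mul_div, le_div_iff₀ (by positivity), inv_mul_le_iff₀ (Real.exp_pos _)]
  have h3 : a ^ n = a ^ n * (1 + ‖x‖) ^ n * ((1 + ‖x‖) ^ n)⁻¹ := by field_simp
  rw [h3]
  calc a ^ n * (1 + ‖x‖) ^ n * ((1 + ‖x‖) ^ n)⁻¹
      ≤ (Real.exp a * Real.exp (a * ‖x‖) * n.factorial) * ((1 + ‖x‖) ^ n)⁻¹ := by gcongr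
    _ = _ := by ring

namespace Mesh

variable {d : ℕ} {Ω : Set (Space d)} {M : Mesh Ω} {H σ : ℝ} {t : Finset (Space d)}

theorem IsQuasiUniform.dist_le (hM : M.IsQuasiUniform H σ) (ht : t ∈ M.cells) {x y : Space d}
    (hx : x ∈ convexHull ℝ (t : Set (Space d))) (hy : y ∈ convexHull ℝ (t : Set (Space d))) :
    dist x y ≤ H :=
  (Metric.dist_le_diam_of_mem (isCompact_cell t).isBounded hx hy).trans (hM.2 t ht).1

theorem IsQuasiUniform.abs_sub_le_of_affine (hM : M.IsQuasiUniform H σ) (hσ : 1 ≤ σ)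
    (ht : t ∈ M.cells) (a : Space d →ᵃ[ℝ] ℝ) {m w : ℝ}
    (ha : ∀ x ∈ convexHull ℝ (t : Set (Space d)), a x ∈ Icc m (m + w)) (x y : Space d) :
    |a x - a y| ≤ σ / H * w * dist x y := by
  obtain ⟨z, hz⟩ := (hM.2 t ht).2
  have hH := hM.1
  have hσ0 : 0 < σ := one_pos.trans_le hσ
  have hρ : 0 < H / σ := by positivity
  have hlin : ∀ p q : Space d, a p - a q = a.linear (p - q) := fun p q => by
    have := a.linearMap_vsub p q
    simpa using this.symm
  rw [hlin]
  rcases eq_or_ne x y with rfl | hxy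
  · simp
  have hn : 0 < ‖x - y‖ := norm_pos_iff.2 (sub_ne_zero.2 hxy)
  set h := ((H / σ) / ‖x - y‖) • (x - y) with hh
  have hnorm : ‖h‖ = H / σ := by
    rw [hh, norm_smul, Real.norm_of_nonneg (by positivity)]; field_simp
  have h1 : z + h ∈ Metric.closedBall z (H / σ) := by
    rw [Metric.mem_closedBall, dist_eq_norm, add_sub_cancel_left, hnorm]
  have h2 := ha _ (hz h1)
  have h3 := ha _ (hz (Metric.mem_closedBall_self hρ.le))
  have h4 : a (z + h) - a z = (H / σ) / ‖x - y‖ * a.linear (x - y) := by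
    rw [hlin, add_sub_cancel_left, hh, map_smul, smul_eq_mul]
  have h5 : |(H / σ) / ‖x - y‖ * a.linear (x - y)| ≤ w := by
    rw [← h4, abs_le]; constructor <;> linarith [h2.1, h2.2, h3.1, h3.2]
  rw [abs_mul, abs_of_pos (by positivity)] at h5
  rw [dist_eq_norm]
  calc |a.linear (x - y)| = σ / H * ‖x - y‖ * ((H / σ) / ‖x - y‖ * |a.linear (x - y)|) := by
        field_simp
    _ ≤ σ / H * ‖x - y‖ * w := by gcongr
    _ = _ := by ring

theorem IsQuasiUniform.abs_hat_sub_le_on_cell (hM : M.IsQuasiUniform H σ) (hσ : 1 ≤ σ)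
    (v : Space d) (ht : t ∈ M.cells) {x y : Space d} (hx : x ∈ convexHull ℝ (t : Set (Space d)))
    (hy : y ∈ convexHull ℝ (t : Set (Space d))) : |M.hat v x - M.hat v y| ≤ σ / H * dist x y := by
  rw [hat_eq_bary ht hx, hat_eq_bary ht hy]
  have := hM.abs_sub_le_of_affine hσ ht (M.bary ht v) (m := 0) (w := 1)
    (fun p hp => ⟨bary_nonneg hp v, by simpa using bary_le_one hp v⟩) x y
  simpa using this

/-- A function vanishing off `Ω` that is `L`-Lipschitz on the cells is `L`-Lipschitz. -/
theorem abs_sub_le_of_cells (hΩ : IsOpen Ω) {f : Space d → ℝ} {L : ℝ} (hL : 0 ≤ L)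
    (hf : ∀ t ∈ M.cells, ∀ p ∈ convexHull ℝ (t : Set (Space d)),
      ∀ q ∈ convexHull ℝ (t : Set (Space d)), |f p - f q| ≤ L * dist p q)
    (hf0 : ∀ x, x ∉ Ω → f x = 0) (x y : Space d) : |f x - f y| ≤ L * dist x y := by
  refine abs_sub_le_of_finite_closed_cover_segment
    (insert Ωᶜ ((fun t : Finset (Space d) => convexHull ℝ (t : Set (Space d))) '' M.cells))
    ((M.finite_cells.image _).insert _) ?_ f L ?_ x y ?_
  · rintro S (rfl | ⟨t, -, rfl⟩)
    · exact hΩ.isClosed_compl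
    · exact isClosed_cell t
  · rintro S (rfl | ⟨t, ht, rfl⟩) p hp q hq
    · rw [hf0 p hp, hf0 q hq]; simp; positivity
    · exact hf t ht p hp q hq
  · intro p _
    by_cases hp : p ∈ Ω
    · obtain ⟨t, ht, hpt⟩ := M.exists_cell (subset_closure hp)
      exact mem_biUnion (mem_insert_of_mem _ ⟨t, ht, rfl⟩) hpt
    · exact mem_biUnion (mem_insert _ _) hp

theorem IsQuasiUniform.abs_hat_sub_le (hM : M.IsQuasiUniform H σ) (hσ : 1 ≤ σ)
    (hΩ : IsLipschitzDomain Ω) {v : Space d} (hv : v ∈ Ω) (x y : Space d) :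
    |M.hat v x - M.hat v y| ≤ σ / H * dist x y := by
  have hH := hM.1
  exact abs_sub_le_of_cells hΩ.isOpen (by positivity)
    (fun t ht p hp q hq => hM.abs_hat_sub_le_on_cell hσ v ht hp hq)
    (fun x hx => hat_eq_zero_of_notMem hΩ.interior_closure_eq hv hx) x y

theorem IsQuasiUniform.lipschitzWith_hat (hM : M.IsQuasiUniform H σ) (hσ : 1 ≤ σ)
    (hΩ : IsLipschitzDomain Ω) {v : Space d} (hv : v ∈ Ω) :
    LipschitzWith (σ / H).toNNReal (M.hat v) :=
  LipschitzWith.of_dist_le_mul fun x y => by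
    have hH := hM.1
    rw [Real.coe_toNNReal _ (by positivity)]
    exact hM.abs_hat_sub_le hσ hΩ hv x y

theorem exists_lipschitzWith_of_mem_coarseSpace (hΩ : IsOpen Ω) {u : Space d → ℝ}
    (hu : u ∈ M.coarseSpace) : ∃ L, LipschitzWith L u := by
  have h1 : ∀ t ∈ M.cells, ∃ L : ℝ, 0 ≤ L ∧ ∀ p ∈ convexHull ℝ (t : Set (Space d)),
      ∀ q ∈ convexHull ℝ (t : Set (Space d)), |u p - u q| ≤ L * dist p q := by
    intro t ht
    obtain ⟨a, ha⟩ := hu.1 t ht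
    set A := LinearMap.toContinuousLinearMap a.linear with hA
    refine ⟨‖A‖, norm_nonneg _, fun p hp q hq => ?_⟩
    rw [ha hp, ha hq, dist_eq_norm]
    have : a p - a q = A (p - q) := by
      have := a.linearMap_vsub p q
      simpa [hA] using this.symm
    rw [this]
    exact A.le_opNorm _
  choose! L hL0 hL using h1
  have hL' : ∀ t ∈ M.finite_cells.toFinset, 0 ≤ L t := fun t ht =>
    hL0 t (M.finite_cells.mem_toFinset.1 ht)
  refine ⟨(∑ t ∈ M.finite_cells.toFinset, L t).toNNReal, LipschitzWith.of_dist_le_mul fun x y => ?_⟩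
  rw [Real.coe_toNNReal _ (Finset.sum_nonneg hL')]
  refine abs_sub_le_of_cells (M := M) hΩ (Finset.sum_nonneg hL') (fun t ht p hp q hq => ?_) hu.2 x y
  refine (hL t ht p hp q hq).trans ?_
  gcongr
  exact Finset.single_le_sum hL' (M.finite_cells.mem_toFinset.2 ht)

theorem IsQuasiUniform.le_dist_of_ne (hM : M.IsQuasiUniform H σ) (hσ : 1 ≤ σ)
    (hΩ : IsLipschitzDomain Ω) {v v' : Space d} (hv : v ∈ M.innerNodes) (hv' : v' ∈ M.innerNodes)
    (h : v ≠ v') : H / σ ≤ dist v v' := by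
  have h1 := hM.abs_hat_sub_le hσ hΩ (mem_innerNodes.1 hv).2 v v'
  rw [hat_self (mem_innerNodes.1 hv).1, hat_ne (mem_innerNodes.1 hv').1 h, sub_zero, abs_one] at h1
  have hH := hM.1
  have hσ0 : 0 < σ := by linarith
  calc H / σ = H / σ * 1 := by ring
    _ ≤ H / σ * (σ / H * dist v v') := by gcongr
    _ = dist v v' := by field_simp

/-- Exponential sums over the inner nodes are bounded uniformly in the mesh. -/
theorem exists_sum_exp_le (d : ℕ) {σ a : ℝ} (hσ : 1 ≤ σ) (ha : 0 < a) :
    ∃ C > (0 : ℝ), ∀ {Ω : Set (Space d)} {M : Mesh Ω} {H : ℝ}, IsLipschitzDomain Ω →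
      M.IsQuasiUniform H σ → ∀ x : Space d,
        ∑ v ∈ M.innerNodes, Real.exp (-(a * (dist x v / H))) ≤ C := by
  set I := ∫ x : Space d, Real.exp (-(a * ‖x‖)) with hI
  have hint := integrable_exp_neg_mul_norm d ha
  have hI0 : 0 ≤ I := integral_nonneg fun x => (Real.exp_pos _).le
  have hV := unitBallVolume_pos d
  have hσ0 : 0 < σ := by linarith
  refine ⟨Real.exp (a / 2) * I * (2 * σ) ^ d / unitBallVolume d + 1, by positivity,
    fun {Ω M H} hΩ hM x => le_trans ?_ (le_add_of_nonneg_right zero_le_one)⟩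
  have hH := hM.1
  set r := H / (2 * σ) with hr
  have hr0 : 0 < r := by positivity
  have hrH : r ≤ H / 2 := by rw [hr]; gcongr; linarith
  have hF : Measurable fun p : Space d => ENNReal.ofReal (Real.exp (-(a * ‖p - x‖))) := by fun_prop
  have hdisj : Set.PairwiseDisjoint (M.innerNodes : Set (Space d)) fun v => Metric.ball v r := by
    intro v hv v' hv' hne
    refine Metric.ball_disjoint_ball ?_
    have := hM.le_dist_of_ne hσ hΩ hv hv' hne
    have h2 : r + r = H / σ := by rw [hr]; field_simp; ring
    linarith
  have key : ENNReal.ofReal (∑ v ∈ M.innerNodes, Real.exp (-(a * (dist x v / H)))) *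
      ENNReal.ofReal (unitBallVolume d * r ^ d) ≤
      ENNReal.ofReal (Real.exp (a / 2)) * (ENNReal.ofReal (((1 / H) ^ d)⁻¹) * ENNReal.ofReal I) := by
    calc _ = ∑ v ∈ M.innerNodes, ∫⁻ _ in Metric.ball v r,
            ENNReal.ofReal (Real.exp (-(a * (dist x v / H)))) := by
          rw [ENNReal.ofReal_sum_of_nonneg fun v _ => (Real.exp_pos _).le, Finset.sum_mul]
          refine Finset.sum_congr rfl fun v _ => ?_
          rw [setLIntegral_const, volume_ball_eq v hr0]
      _ ≤ ∑ v ∈ M.innerNodes, ∫⁻ y in Metric.ball v r, ENNReal.ofReal (Real.exp (a / 2)) *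
            ENNReal.ofReal (Real.exp (-(a * ‖x + (1 / H) • (y - x) - x‖))) := by
          refine Finset.sum_le_sum fun v _ => setLIntegral_mono' Metric.isOpen_ball.measurableSet
            fun y hy => ?_
          rw [← ENNReal.ofReal_mul (Real.exp_pos _).le, ← Real.exp_add]
          refine ENNReal.ofReal_le_ofReal (Real.exp_le_exp.2 ?_)
          rw [add_sub_cancel_left, norm_smul, Real.norm_of_nonneg (by positivity), ← dist_eq_norm]
          have h1 : dist y x ≤ dist x v + H / 2 := by
            have := Metric.mem_ball.1 hy
            linarith [dist_triangle y v x, dist_comm v x]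
          have h2 : 1 / H * dist y x ≤ dist x v / H + 1 / 2 := by
            rw [one_div_mul_eq_div, div_le_iff₀ hH]
            field_simp
            linarith
          nlinarith
      _ = ∫⁻ y in ⋃ v ∈ M.innerNodes, Metric.ball v r, ENNReal.ofReal (Real.exp (a / 2)) *
            ENNReal.ofReal (Real.exp (-(a * ‖x + (1 / H) • (y - x) - x‖))) :=
          (lintegral_biUnion_finset hdisj (fun v _ => Metric.isOpen_ball.measurableSet) _).symm
      _ ≤ ∫⁻ y, ENNReal.ofReal (Real.exp (a / 2)) *
            ENNReal.ofReal (Real.exp (-(a * ‖x + (1 / H) • (y - x) - x‖))) :=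
          setLIntegral_le_lintegral _ _
      _ = _ := by
          rw [lintegral_const_mul' _ _ ENNReal.ofReal_ne_top,
            lintegral_comp_homothety hF x (by positivity : 0 < 1 / H),
            lintegral_sub_right_eq_self (μ := (volume : Measure (Space d)))
              (fun p => ENNReal.ofReal (Real.exp (-(a * ‖p‖)))) x,
            ofReal_integral_eq_lintegral_ofReal hint
              (Eventually.of_forall fun x => (Real.exp_pos _).le)]
  rw [← ENNReal.ofReal_mul (Finset.sum_nonneg fun v _ => (Real.exp_pos _).le),
    ← ENNReal.ofReal_mul (by positivity), ← ENNReal.ofReal_mul (by positivity),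
    ENNReal.ofReal_le_ofReal_iff (by positivity), ← le_div_iff₀ (by positivity)] at key
  refine key.trans (le_of_eq ?_)
  rw [hr, div_pow, div_pow, one_pow]
  field_simp

/-! ### Patches -/

theorem interior_cell_subset (hΩ : IsLipschitzDomain Ω) (ht : t ∈ M.cells) :
    interior (convexHull ℝ (t : Set (Space d))) ⊆ Ω := by
  conv_rhs => rw [← hΩ.interior_closure_eq]
  exact interior_mono (cell_subset_closure ht)

theorem IsQuasiUniform.interior_cell_nonempty (hM : M.IsQuasiUniform H σ) (hσ : 1 ≤ σ)
    (ht : t ∈ M.cells) : (interior (convexHull ℝ (t : Set (Space d)))).Nonempty := by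
  obtain ⟨z, hz⟩ := (hM.2 t ht).2
  have hH := hM.1
  have hρ : 0 < H / σ := by positivity
  exact ⟨z, interior_mono hz (by
    rw [mem_interior_iff_mem_nhds]; exact Metric.closedBall_mem_nhds z hρ)⟩

theorem IsQuasiUniform.cell_subset_closure_interior (hM : M.IsQuasiUniform H σ) (hσ : 1 ≤ σ)
    (ht : t ∈ M.cells) : convexHull ℝ (t : Set (Space d)) ⊆
      closure (interior (convexHull ℝ (t : Set (Space d)))) := by
  rw [(convex_convexHull ℝ _).closure_interior_eq_closure_of_nonempty_interior
    (hM.interior_cell_nonempty hσ ht)]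
  exact subset_closure

theorem ae_mem_interior_cell (M : Mesh Ω) :
    ∀ᵐ x ∂(volume : Measure (Space d)), x ∈ Ω →
      ∃ t ∈ M.cells, x ∈ interior (convexHull ℝ (t : Set (Space d))) := by
  have h : ∀ᵐ x ∂(volume : Measure (Space d)), ∀ t ∈ M.cells,
      x ∉ frontier (convexHull ℝ (t : Set (Space d))) := by
    rw [ae_ball_iff M.finite_cells.countable]
    intro t _
    exact measure_eq_zero_iff_ae_notMem.1 ((convex_convexHull ℝ _).addHaar_frontier volume)
  filter_upwards [h] with x hx hxΩ
  obtain ⟨t, ht, hxt⟩ := M.exists_cell (subset_closure hxΩ)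
  refine ⟨t, ht, ?_⟩
  by_contra hcon
  exact hx t ht ⟨subset_closure hxt, hcon⟩

/-- The cells that make up the `k`-th patch around `v`. -/
def InLayer (M : Mesh Ω) (v : Space d) : ℕ → Finset (Space d) → Prop
  | 0, t => v ∈ t
  | k + 1, t => (convexHull ℝ (t : Set (Space d)) ∩ closure (M.patch v k)).Nonempty

theorem patch_subset (v : Space d) (k : ℕ) : M.patch v k ⊆ Ω := by
  cases k <;> exact inter_subset_right

theorem measurableSet_patch (hΩ : IsOpen Ω) (v : Space d) (k : ℕ) :
    MeasurableSet (M.patch v k) := by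
  cases k with
  | zero =>
    refine MeasurableSet.inter ?_ hΩ.measurableSet
    exact (M.finite_cells.subset fun t ht => ht.1).measurableSet_biUnion
      fun t _ => (isClosed_cell t).measurableSet
  | succ k => exact isOpen_interior.measurableSet.inter hΩ.measurableSet

theorem interior_cell_subset_patch (hΩ : IsLipschitzDomain Ω) {v : Space d} {k : ℕ}
    (ht : t ∈ M.cells) (h : M.InLayer v k t) :
    interior (convexHull ℝ (t : Set (Space d))) ⊆ M.patch v k := by
  cases k with
  | zero =>
    refine fun x hx => ⟨?_, interior_cell_subset hΩ ht hx⟩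
    exact mem_biUnion (show t ∈ {t | t ∈ M.cells ∧ v ∈ t} from ⟨ht, h⟩) (interior_subset hx)
  | succ k =>
    refine fun x hx => ⟨?_, interior_cell_subset hΩ ht hx⟩
    exact interior_mono (subset_biUnion_of_mem
      (u := fun t : Finset (Space d) => convexHull ℝ (t : Set (Space d)))
      (show t ∈ {t | t ∈ M.cells ∧ (convexHull ℝ (t : Set (Space d)) ∩
        closure (patch M v k)).Nonempty} from ⟨ht, h⟩)) hx

theorem IsQuasiUniform.cell_subset_closure_patch (hM : M.IsQuasiUniform H σ) (hσ : 1 ≤ σ)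
    (hΩ : IsLipschitzDomain Ω) {v : Space d} {k : ℕ} (ht : t ∈ M.cells) (h : M.InLayer v k t) :
    convexHull ℝ (t : Set (Space d)) ⊆ closure (M.patch v k) :=
  (hM.cell_subset_closure_interior hσ ht).trans
    (closure_mono (interior_cell_subset_patch hΩ ht h))

theorem IsQuasiUniform.inLayer_succ (hM : M.IsQuasiUniform H σ) (hσ : 1 ≤ σ)
    (hΩ : IsLipschitzDomain Ω) {v : Space d} {k : ℕ} {t' : Finset (Space d)} (ht : t ∈ M.cells)
    (h : M.InLayer v k t) {p : Space d} (hp : p ∈ t) (hp' : p ∈ t') : M.InLayer v (k + 1) t' :=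
  ⟨p, corner_mem_cell hp', hM.cell_subset_closure_patch hσ hΩ ht h (corner_mem_cell hp)⟩

theorem cell_nonempty (ht : t ∈ M.cells) : t.Nonempty := by
  rw [← Finset.card_pos, ht.2]; omega

theorem IsQuasiUniform.inLayer_mono (hM : M.IsQuasiUniform H σ) (hσ : 1 ≤ σ)
    (hΩ : IsLipschitzDomain Ω) {v : Space d} {j k : ℕ} (hjk : j ≤ k) (ht : t ∈ M.cells)
    (h : M.InLayer v j t) : M.InLayer v k t := by
  induction hjk with
  | refl => exact h
  | step _ ih =>
    obtain ⟨p, hp⟩ := cell_nonempty ht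
    exact hM.inLayer_succ hσ hΩ ht ih hp hp

theorem IsQuasiUniform.patch_subset_closedBall (hM : M.IsQuasiUniform H σ) (v : Space d) (k : ℕ) :
    M.patch v k ⊆ Metric.closedBall v ((k + 1) * H) := by
  induction k with
  | zero =>
    rintro x ⟨hx, -⟩
    obtain ⟨t, ⟨ht, hv⟩, hxt⟩ := mem_iUnion₂.1 hx
    rw [Metric.mem_closedBall]
    simpa using hM.dist_le ht hxt (corner_mem_cell hv)
  | succ k ih =>
    rintro x ⟨hx, -⟩
    obtain ⟨t, ⟨ht, p, hpt, hp⟩, hxt⟩ := mem_iUnion₂.1 (interior_subset hx)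
    have h1 := closure_minimal ih Metric.isClosed_closedBall hp
    rw [Metric.mem_closedBall] at *
    have := hM.dist_le ht hxt hpt
    push_cast
    linarith [dist_triangle x p v]

open Classical in
/-- The index of the first layer around `v` that contains the vertex `p`, truncated at `k`. -/
def layerIndex (M : Mesh Ω) (v : Space d) (k : ℕ) (p : Space d) : ℕ :=
  sInf {j | j = k ∨ ∃ t ∈ M.cells, p ∈ t ∧ M.InLayer v j t}

theorem layerIndex_mem (v : Space d) (k : ℕ) (p : Space d) :
    M.layerIndex v k p = k ∨ ∃ t ∈ M.cells, p ∈ t ∧ M.InLayer v (M.layerIndex v k p) t :=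
  Nat.sInf_mem (s := {j | j = k ∨ ∃ t ∈ M.cells, p ∈ t ∧ M.InLayer v j t}) ⟨k, Or.inl rfl⟩

theorem layerIndex_le {v : Space d} {k j : ℕ} {p : Space d} (ht : t ∈ M.cells) (hp : p ∈ t)
    (h : M.InLayer v j t) : M.layerIndex v k p ≤ j :=
  Nat.sInf_le (Or.inr ⟨t, ht, hp, h⟩)

theorem layerIndex_le_self (v : Space d) (k : ℕ) (p : Space d) : M.layerIndex v k p ≤ k :=
  Nat.sInf_le (Or.inl rfl)

theorem IsQuasiUniform.layerIndex_le_succ (hM : M.IsQuasiUniform H σ) (hσ : 1 ≤ σ)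
    (hΩ : IsLipschitzDomain Ω) (v : Space d) (k : ℕ) {p q : Space d} (ht : t ∈ M.cells)
    (hp : p ∈ t) (hq : q ∈ t) : M.layerIndex v k q ≤ M.layerIndex v k p + 1 := by
  rcases layerIndex_mem (M := M) v k p with h | ⟨t', ht', hpt', h⟩
  · rw [h]; exact (layerIndex_le_self v k q).trans (Nat.le_succ k)
  · exact layerIndex_le ht hq (hM.inLayer_succ hσ hΩ ht' h hpt' hp)

theorem finset_sum_hat_of_mem_cell (ht : t ∈ M.cells) (c : Space d → ℝ) {x : Space d}
    (hx : x ∈ convexHull ℝ (t : Set (Space d))) :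
    ∑ p ∈ M.finite_vertices.toFinset, c p * M.hat p x = ∑ p ∈ t, c p * M.bary ht p x := by
  have h1 : t ⊆ M.finite_vertices.toFinset := fun p hp =>
    M.finite_vertices.mem_toFinset.2 (corner_mem_vertices ht hp)
  rw [← Finset.sum_subset h1]
  · exact Finset.sum_congr rfl fun p _ => by rw [hat_eq_bary ht hx]
  · intro p _ hp
    rw [hat_eq_bary ht hx, bary_of_notMem hp, mul_zero]

/-- The patches contain balls (relative to `Ω`) of comparable radius. -/
theorem exists_ball_subset_patch (hΩ : IsLipschitzDomain Ω) {σ : ℝ} (hσ : 1 ≤ σ) :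
    ∃ c > (0 : ℝ), c ≤ 1 ∧ ∀ {M : Mesh Ω} {H : ℝ}, M.IsQuasiUniform H σ →
      ∀ v ∈ M.innerNodes, ∀ k : ℕ, ∀ᵐ x ∂(volume : Measure (Space d)), x ∈ Ω →
        dist x v ≤ (c * k - 1) * H → x ∈ M.patch v k := by
  obtain ⟨C, hC0, hC⟩ := hΩ.quasiconvex
  set B : ℝ := max (C * σ) 1 with hB
  have hB1 : 1 ≤ B := le_max_right _ _
  have hB0 : 0 < B := by linarith
  refine ⟨1 / B, by positivity, by rw [div_le_one hB0]; exact hB1, fun {M H} hM v hv k => ?_⟩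
  have hH := hM.1
  have hσ0 : 0 < σ := by linarith
  obtain ⟨hvv, hvΩ⟩ := mem_innerNodes.1 hv
  set n : Space d → ℝ := fun p => (M.layerIndex v k p : ℝ) with hn
  set D : Space d → ℝ := fun x => ∑ p ∈ M.finite_vertices.toFinset, n p * M.hat p x with hD
  have hDcell : ∀ t ∈ M.cells, ∀ p ∈ convexHull ℝ (t : Set (Space d)),
      ∀ q ∈ convexHull ℝ (t : Set (Space d)), |D p - D q| ≤ σ / H * dist p q := by
    intro t ht p hp q hq
    obtain ⟨p₀, hp₀, hmin⟩ := t.exists_min_image n (cell_nonempty ht)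
    have haff : ∀ s : Finset (Space d),
        ∃ a : Space d →ᵃ[ℝ] ℝ, ∀ x, a x = ∑ p ∈ s, n p * M.bary ht p x := by
      intro s
      induction s using Finset.induction_on with
      | empty => exact ⟨0, fun x => by simp⟩
      | insert p s hp ih =>
        obtain ⟨a, ha⟩ := ih
        exact ⟨n p • M.bary ht p + a, fun x => by simp [Finset.sum_insert hp, ha]⟩
    obtain ⟨a, ha⟩ := haff t
    have hDa : ∀ x ∈ convexHull ℝ (t : Set (Space d)), D x = a x := fun x hx => by
      rw [ha, hD]; exact finset_sum_hat_of_mem_cell ht n hx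
    rw [hDa p hp, hDa q hq]
    have := hM.abs_sub_le_of_affine hσ ht a (m := n p₀) (w := 1) (fun x hx => ?_) p q
    · simpa using this
    · rw [ha]
      have e1 : ∀ c : ℝ, c = ∑ p ∈ t, c * M.bary ht p x := fun c => by
        rw [← Finset.mul_sum, sum_bary, mul_one]
      constructor
      · rw [e1 (n p₀)]
        exact Finset.sum_le_sum fun p hp =>
          mul_le_mul_of_nonneg_right (hmin p hp) (bary_nonneg hx p)
      · rw [e1 (n p₀ + 1)]
        refine Finset.sum_le_sum fun p hp => mul_le_mul_of_nonneg_right ?_ (bary_nonneg hx p)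
        have := hM.layerIndex_le_succ hσ hΩ v k ht hp₀ hp
        simp only [hn]
        exact_mod_cast this
  have hDseg : NonexpansiveAlongSegments (closure Ω) fun x => H / σ * D x := by
    intro x y hxy
    have := abs_sub_le_of_finite_closed_cover_segment
      ((fun t : Finset (Space d) => convexHull ℝ (t : Set (Space d))) '' M.cells)
      (M.finite_cells.image _) (by rintro S ⟨t, -, rfl⟩; exact isClosed_cell t) D (σ / H)
      (by rintro S ⟨t, ht, rfl⟩; exact hDcell t ht) x y (fun p hp => by
        obtain ⟨t, ht, hpt⟩ := M.exists_cell (hxy hp)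
        exact mem_biUnion ⟨t, ht, rfl⟩ hpt)
    rw [← mul_sub, abs_mul, abs_of_pos (by positivity)]
    calc H / σ * |D x - D y| ≤ H / σ * (σ / H * dist x y) := by gcongr
      _ = dist x y := by field_simp
  have hDv : D v = 0 := by
    obtain ⟨t, ht, hvt⟩ := exists_cell_of_mem_vertices hvv
    rw [hD]
    simp only
    rw [finset_sum_hat_of_mem_cell ht n (corner_mem_cell hvt)]
    refine Finset.sum_eq_zero fun p hp => ?_
    by_cases hpv : p = v
    · have h0 : M.layerIndex v k p ≤ 0 := layerIndex_le ht hp (show v ∈ t from hvt)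
      have : n p = 0 := by simp only [hn]; exact_mod_cast Nat.le_zero.1 h0
      rw [this, zero_mul]
    · rw [bary_ne hvt hpv, mul_zero]
  filter_upwards [ae_mem_interior_cell M] with x hx hxΩ hxv
  obtain ⟨t, ht, hxt⟩ := hx hxΩ
  have h1 := hC _ hDseg x hxΩ v hvΩ
  rw [hDv, mul_zero, sub_zero, abs_mul, abs_of_pos (by positivity)] at h1
  have h2 : D x ≤ k - 1 := by
    have h3 : |D x| ≤ B * (dist x v / H) := by
      calc |D x| = σ / H * (H / σ * |D x|) := by field_simp
        _ ≤ σ / H * (C * dist x v) := by gcongr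
        _ = C * σ * (dist x v / H) := by ring
        _ ≤ _ := by gcongr; exact le_max_left _ _
    have h4 : B * (dist x v / H) ≤ B * (1 / B * k - 1) := by
      gcongr; rwa [div_le_iff₀ hH]
    have h5 : B * (1 / B * k - 1) = k - B := by field_simp
    linarith [le_abs_self (D x)]
  obtain ⟨p, hp, hpn⟩ : ∃ p ∈ t, n p ≤ k - 1 := by
    by_contra! hcon
    have h6 : (k : ℝ) - 1 < D x := by
      rw [hD]
      simp only
      rw [finset_sum_hat_of_mem_cell ht n (interior_subset hxt)]
      calc (k : ℝ) - 1 = ∑ p ∈ t, (k - 1) * M.bary ht p x := by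
            rw [← Finset.mul_sum, sum_bary, mul_one]
        _ < _ := Finset.sum_lt_sum_of_nonempty (cell_nonempty ht) fun p hp =>
            mul_lt_mul_of_pos_right (hcon p hp) ((mem_interior_cell_iff ht).1 hxt p hp)
    linarith
  have hlt : M.layerIndex v k p + 1 ≤ k := by
    have : (M.layerIndex v k p : ℝ) + 1 ≤ k := by simp only [hn] at hpn; linarith
    exact_mod_cast this
  rcases layerIndex_mem (M := M) v k p with h | ⟨t', ht', hpt', h⟩
  · omega
  · exact interior_cell_subset_patch hΩ ht
      (hM.inLayer_mono hσ hΩ hlt ht (hM.inLayer_succ hσ hΩ ht' h hpt' hp)) hxt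

/-! ### The normalized nodal basis functions -/

theorem hatNormalized_nonneg (v x : Space d) : 0 ≤ M.hatNormalized v x :=
  div_nonneg (hat_nonneg v x) (Finset.sum_nonneg fun _ _ => hat_nonneg _ x)

theorem sum_hatNormalized_le_one (x : Space d) :
    ∑ v ∈ M.innerNodes, M.hatNormalized v x ≤ 1 := by
  simp only [hatNormalized]
  rw [← Finset.sum_div]
  exact div_self_le_one _

theorem hatNormalized_le_one {v : Space d} (hv : v ∈ M.innerNodes) (x : Space d) :
    M.hatNormalized v x ≤ 1 :=
  (Finset.single_le_sum (f := fun v => M.hatNormalized v x)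
    (fun _ _ => hatNormalized_nonneg _ x) hv).trans (sum_hatNormalized_le_one x)

theorem hatNormalized_eq_zero_of_notMem_patch {v x : Space d} (hx : x ∈ Ω)
    (hxp : x ∉ M.patch v 0) : M.hatNormalized v x = 0 := by
  have : M.hat v x = 0 := by
    by_contra h
    obtain ⟨t, ht, hv, hxt⟩ := exists_cell_of_hat_ne_zero h
    exact hxp ⟨mem_biUnion (show t ∈ {t | t ∈ M.cells ∧ v ∈ t} from ⟨ht, hv⟩) hxt, hx⟩
  rw [hatNormalized, this, zero_div]

theorem IsQuasiUniform.dist_le_of_hat_ne_zero (hM : M.IsQuasiUniform H σ) {v x : Space d}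
    (h : M.hat v x ≠ 0) : dist x v ≤ H := by
  obtain ⟨t, ht, hv, hxt⟩ := exists_cell_of_hat_ne_zero h
  exact hM.dist_le ht hxt (corner_mem_cell hv)

theorem IsQuasiUniform.dist_le_of_hatNormalized_ne_zero (hM : M.IsQuasiUniform H σ) {v x : Space d}
    (h : M.hatNormalized v x ≠ 0) : dist x v ≤ H :=
  hM.dist_le_of_hat_ne_zero fun h0 => h (by rw [hatNormalized, h0, zero_div])

theorem IsQuasiUniform.measurable_hatNormalized (hM : M.IsQuasiUniform H σ) (hσ : 1 ≤ σ)
    (hΩ : IsLipschitzDomain Ω) {v : Space d} (hv : v ∈ M.innerNodes) :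
    Measurable (M.hatNormalized v) := by
  have h1 : ∀ v ∈ M.innerNodes, Measurable (M.hat v) := fun v hv =>
    (hM.lipschitzWith_hat hσ hΩ (mem_innerNodes.1 hv).2).continuous.measurable
  exact (h1 v hv).div (Finset.measurable_fun_sum _ h1)

/-- Almost everywhere, either the normalized basis functions sum up to one, or every coarse
function vanishes nearby. -/
theorem ae_sum_hatNormalized_eq_one (M : Mesh Ω) :
    ∀ᵐ x ∂(volume : Measure (Space d)), x ∈ Ω →
      (∑ v ∈ M.innerNodes, M.hatNormalized v x = 1) ∨
        ∀ u ∈ M.coarseSpace, u =ᶠ[𝓝 x] 0 := by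
  filter_upwards [ae_mem_interior_cell M] with x hx hxΩ
  obtain ⟨t, ht, hxt⟩ := hx hxΩ
  by_cases h : ∃ p ∈ t, p ∈ Ω
  · obtain ⟨p, hp, hpΩ⟩ := h
    left
    have hpi : p ∈ M.innerNodes := mem_innerNodes.2 ⟨corner_mem_vertices ht hp, hpΩ⟩
    have h1 : 0 < ∑ v ∈ M.innerNodes, M.hat v x := by
      refine Finset.sum_pos' (fun v _ => hat_nonneg v x) ⟨p, hpi, ?_⟩
      rw [hat_eq_bary ht (interior_subset hxt)]
      exact (mem_interior_cell_iff ht).1 hxt p hp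
    simp only [hatNormalized]
    rw [← Finset.sum_div, div_self h1.ne']
  · right
    push Not at h
    intro u hu
    obtain ⟨a, ha⟩ := hu.1 t ht
    filter_upwards [isOpen_interior.mem_nhds hxt] with y hy
    rw [ha (interior_subset hy), affine_eq_sum_bary ht a y]
    refine Finset.sum_eq_zero fun p hp => ?_
    rw [← ha (corner_mem_cell hp), hu.2 p (h p hp), mul_zero]

end Mesh

end WeightedLOD

end

noncomputable section

namespace WeightedLOD

/-! ### The weighted measure -/

section WeightedMeasure

variable {d : ℕ} {Ω Λ : Set (Space d)} {β CA : ℝ}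

theorem IsMuckenhoupt.neg_iff : IsMuckenhoupt Λ (-β) CA ↔ IsMuckenhoupt Λ β CA :=
  ⟨fun h => h.neg, fun h => IsMuckenhoupt.neg (by simpa using h)⟩

theorem IsMuckenhoupt.ae_weight_pos (h : IsMuckenhoupt Λ β CA) : ∀ᵐ x, 0 < weight Λ β x := by
  have h0 : ∀ᵐ x, Metric.infDist x Λ ≠ 0 := by
    rw [ae_iff]; simpa using h.null
  filter_upwards [h0] with x hx
  exact Real.rpow_pos_of_pos (Metric.infDist_nonneg.lt_of_ne' hx) _

theorem IsMuckenhoupt.ae_eweight_ne_zero (h : IsMuckenhoupt Λ β CA) :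
    ∀ᵐ x, eweight Λ β x ≠ 0 := by
  filter_upwards [h.ae_weight_pos] with x hx
  simpa [eweight] using hx

theorem IsMuckenhoupt.lintegral_ball_pos (h : IsMuckenhoupt Λ β CA) (z : Space d) {R : ℝ}
    (hR : 0 < R) : 0 < ∫⁻ x in Metric.ball z R, eweight Λ β x := by
  rw [pos_iff_ne_zero, Ne, lintegral_eq_zero_iff (measurable_eweight _ _)]
  intro h0
  have h1 : ∀ᵐ x ∂volume.restrict (Metric.ball z R), False := by
    filter_upwards [h0, ae_restrict_of_ae h.ae_eweight_ne_zero] with x h2 h3 using h3 h2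
  rw [ae_iff] at h1
  simp only [not_false_eq_true, ofPred_true, Measure.restrict_apply_univ] at h1
  exact (Metric.measure_ball_pos volume z hR).ne' h1

theorem IsMuckenhoupt.lintegral_ball_lt_top (h : IsMuckenhoupt Λ β CA) (z : Space d) (R : ℝ) :
    ∫⁻ x in Metric.ball z R, eweight Λ β x < ⊤ := by
  rcases le_or_gt R 0 with hR | hR
  · simp [Metric.ball_eq_empty.2 hR]
  · have h1 := h.a2 z R hR
    have h2 := (IsMuckenhoupt.neg_iff.2 h).lintegral_ball_pos z hR
    rw [lt_top_iff_ne_top]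
    intro h3
    rw [h3, ENNReal.top_mul h2.ne'] at h1
    exact absurd h1 (by simp)

theorem weightedMeasure_eq : weightedMeasure Ω Λ β = (volume.restrict Ω).withDensity
    (eweight Λ β) := rfl

theorem lintegral_weightedMeasure (f : Space d → ENNReal) :
    ∫⁻ x, f x ∂weightedMeasure Ω Λ β = ∫⁻ x in Ω, f x * eweight Λ β x := by
  rw [weightedMeasure_eq, lintegral_withDensity_eq_lintegral_mul_non_measurable _ (measurable_eweight _ _)
    (Eventually.of_forall fun x => ENNReal.ofReal_lt_top)]
  simp [mul_comm]

theorem weightedMeasure_restrict {D : Set (Space d)} (hD : MeasurableSet D) (h : D ⊆ Ω) :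
    (weightedMeasure Ω Λ β).restrict D = weightedMeasure D Λ β := by
  rw [weightedMeasure_eq, restrict_withDensity hD, Measure.restrict_restrict hD,
    inter_eq_left.2 h, weightedMeasure_eq]

theorem setLIntegral_weightedMeasure {D : Set (Space d)} (hD : MeasurableSet D)
    (f : Space d → ENNReal) :
    ∫⁻ x in D, f x ∂weightedMeasure Ω Λ β = ∫⁻ x in D ∩ Ω, f x * eweight Λ β x := by
  rw [weightedMeasure_eq, restrict_withDensity hD, Measure.restrict_restrict hD,
    ← weightedMeasure_eq, lintegral_weightedMeasure]

/-- Functions vanishing off `Ω` do not see the restriction of the measure to `Ω`. -/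
theorem setLIntegral_weightedMeasure_of_eq_zero {D : Set (Space d)} (hD : MeasurableSet D)
    (hΩ : MeasurableSet Ω) {f : Space d → ENNReal} (h : ∀ x, x ∉ Ω → f x = 0) :
    ∫⁻ x in D, f x ∂weightedMeasure Ω Λ β = ∫⁻ x in D, f x * eweight Λ β x := by
  rw [setLIntegral_weightedMeasure hD, inter_comm, ← Measure.restrict_restrict hΩ]
  refine setLIntegral_eq_of_support_subset fun x hx => ?_
  by_contra hxΩ
  exact hx (by simp [h x hxΩ])

theorem weightedMeasure_ae (hΛ : IsMuckenhoupt Λ β CA) :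
    ae (weightedMeasure Ω Λ β) = ae (volume.restrict Ω) := by
  apply le_antisymm
  · exact (withDensity_absolutelyContinuous _ _).ae_le
  · exact (withDensity_absolutelyContinuous' (measurable_eweight _ _).aemeasurable
      (ae_restrict_of_ae hΛ.ae_eweight_ne_zero)).ae_le

theorem isFiniteMeasure_weightedMeasure (hΛ : IsMuckenhoupt Λ β CA)
    (hΩ : Bornology.IsBounded Ω) : IsFiniteMeasure (weightedMeasure Ω Λ β) := by
  obtain ⟨R, hR⟩ := hΩ.subset_ball 0
  refine ⟨?_⟩
  rw [← lintegral_one, lintegral_weightedMeasure]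
  simp only [one_mul]
  exact (lintegral_mono_set hR).trans_lt (hΛ.lintegral_ball_lt_top 0 R)

theorem integral_weightedMeasure {F : Type*} [NormedAddCommGroup F] [NormedSpace ℝ F]
    {D : Set (Space d)} (hD : MeasurableSet D) (hDΩ : D ⊆ Ω) (f : Space d → F) :
    ∫ x in D, f x ∂weightedMeasure Ω Λ β = ∫ x in D, weight Λ β x • f x := by
  rw [weightedMeasure_restrict hD hDΩ, weightedMeasure_eq,
    integral_withDensity_eq_integral_toReal_smul (measurable_eweight _ _)
      (Eventually.of_forall fun x => ENNReal.ofReal_lt_top)]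
  refine integral_congr_ae (Eventually.of_forall fun x => ?_)
  simp only [eweight, ENNReal.toReal_ofReal (weight_nonneg _ _ _)]

theorem eLpNorm_two_sq {α F : Type*} [MeasurableSpace α] [NormedAddCommGroup F] (μ : Measure α)
    (f : α → F) : eLpNorm f 2 μ ^ 2 = ∫⁻ x, ‖f x‖ₑ ^ 2 ∂μ := by
  have := eLpNorm_nnreal_pow_eq_lintegral (μ := μ) (f := f) (p := 2) (by norm_num)
  simpa using this

/-- `L²` with respect to the weighted measure embeds into `L¹(Ω)`. -/
theorem exists_lintegral_le_eLpNorm (hΛ : IsMuckenhoupt Λ β CA) (hΩ : Bornology.IsBounded Ω) :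
    ∃ C : ENNReal, C ≠ ⊤ ∧ ∀ {F : Type} [NormedAddCommGroup F] (f : Space d → F),
      AEStronglyMeasurable f (volume.restrict Ω) →
      ∫⁻ x in Ω, ‖f x‖ₑ ≤ C * eLpNorm f 2 (weightedMeasure Ω Λ β) := by
  obtain ⟨R, hR⟩ := hΩ.subset_ball 0
  have h1 : ∫⁻ x in Ω, eweight Λ (-β) x < ⊤ :=
    (lintegral_mono_set hR).trans_lt ((IsMuckenhoupt.neg_iff.2 hΛ).lintegral_ball_lt_top 0 R)
  refine ⟨(∫⁻ x in Ω, eweight Λ (-β) x) ^ (1 / 2 : ℝ), by finiteness, fun f hf => ?_⟩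
  refine (ENNReal.pow_le_pow_left_iff (n := 2) two_ne_zero).1 ?_
  have hs : ((∫⁻ x in Ω, eweight Λ (-β) x) ^ (1 / 2 : ℝ)) ^ 2 = ∫⁻ x in Ω, eweight Λ (-β) x := by
    rw [← ENNReal.rpow_natCast, ← ENNReal.rpow_mul]; norm_num
  rw [mul_pow, eLpNorm_two_sq, lintegral_weightedMeasure, hs, mul_comm]
  exact sq_lintegral_le_of_one_le_mul _ hf.enorm (measurable_eweight _ _).aemeasurable
    (measurable_eweight _ _).aemeasurable (ae_restrict_of_ae hΛ.one_le_mul)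

theorem aestronglyMeasurable_weightedMeasure_iff {F : Type*} [NormedAddCommGroup F]
    (hΛ : IsMuckenhoupt Λ β CA) {f : Space d → F} :
    AEStronglyMeasurable f (weightedMeasure Ω Λ β) ↔
      AEStronglyMeasurable f (volume.restrict Ω) := by
  constructor
  · intro h
    exact h.mono_ac (withDensity_absolutelyContinuous' (measurable_eweight _ _).aemeasurable
      (ae_restrict_of_ae hΛ.ae_eweight_ne_zero))
  · intro h
    exact h.mono_ac (withDensity_absolutelyContinuous _ _)

theorem MemLp.integrableOn_of_weighted {F : Type} [NormedAddCommGroup F]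
    (hΛ : IsMuckenhoupt Λ β CA) (hΩ : Bornology.IsBounded Ω) {f : Space d → F}
    (hf : MemLp f 2 (weightedMeasure Ω Λ β)) : IntegrableOn f Ω := by
  obtain ⟨C, hC, h⟩ := exists_lintegral_le_eLpNorm (Ω := Ω) hΛ hΩ
  have hm := (aestronglyMeasurable_weightedMeasure_iff hΛ).1 hf.1
  exact ⟨hm, (h f hm).trans_lt (ENNReal.mul_lt_top hC.lt_top hf.2)⟩

end WeightedMeasure

end WeightedLOD

end

noncomputable section

namespace WeightedLOD

/-! ### Functions with a gradient in the closure of the test functions -/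

section Gradient

variable {d : ℕ}

theorem inner_gradient (f : Space d → ℝ) (x e : Space d) : ⟪gradient f x, e⟫ = fderiv ℝ f x e := by
  simp [gradient]

theorem norm_gradient (f : Space d → ℝ) (x : Space d) : ‖gradient f x‖ = ‖fderiv ℝ f x‖ := by
  simp [gradient]

theorem enorm_gradient (f : Space d → ℝ) (x : Space d) : ‖gradient f x‖ₑ = ‖fderiv ℝ f x‖ₑ := by
  rw [← ofReal_norm, norm_gradient, ofReal_norm]

theorem gradient_add {f g : Space d → ℝ} {x : Space d} (hf : DifferentiableAt ℝ f x)
    (hg : DifferentiableAt ℝ g x) : gradient (f + g) x = gradient f x + gradient g x := by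
  simp [gradient, fderiv_add hf hg]

theorem gradient_const_smul {f : Space d → ℝ} {x : Space d} (c : ℝ)
    (hf : DifferentiableAt ℝ f x) : gradient (c • f) x = c • gradient f x := by
  simp [gradient, fderiv_const_smul hf]

theorem gradient_mul {f g : Space d → ℝ} {x : Space d} (hf : DifferentiableAt ℝ f x)
    (hg : DifferentiableAt ℝ g x) :
    gradient (fun x => f x * g x) x = f x • gradient g x + g x • gradient f x := by
  simp [gradient, fderiv_fun_mul hf hg]

theorem continuous_gradient {f : Space d → ℝ} (hf : ContDiff ℝ ∞ f) :
    Continuous (gradient f) := by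
  unfold gradient
  exact (InnerProductSpace.toDual ℝ (Space d)).symm.continuous.comp
    (hf.continuous_fderiv (by simp))

theorem measurable_gradient (f : Space d → ℝ) : Measurable (gradient f) := by
  unfold gradient
  exact (InnerProductSpace.toDual ℝ (Space d)).symm.continuous.measurable.comp
    (measurable_fderiv ℝ f)

theorem tsupport_gradient_subset (f : Space d → ℝ) : tsupport (gradient f) ⊆ tsupport f := by
  refine closure_minimal (fun x hx => ?_) (isClosed_tsupport f)
  refine support_fderiv_subset (𝕜 := ℝ) (f := f) ?_
  intro h
  exact hx (by simp [gradient, h])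

theorem gradient_eq_zero_of_notMem_tsupport {f : Space d → ℝ} {x : Space d}
    (hx : x ∉ tsupport f) : gradient f x = 0 := by
  by_contra h
  exact hx (tsupport_gradient_subset f (subset_tsupport _ h))

end Gradient

section Sobolev

variable {d : ℕ} {Ω Λ : Set (Space d)} {β CA : ℝ}

theorem IsTestFunction.add {φ ψ : Space d → ℝ} (hφ : IsTestFunction Ω φ)
    (hψ : IsTestFunction Ω ψ) : IsTestFunction Ω (φ + ψ) :=
  ⟨hφ.1.add hψ.1, hφ.2.1.add hψ.2.1, (tsupport_add φ ψ).trans (union_subset hφ.2.2 hψ.2.2)⟩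

theorem IsTestFunction.const_smul {φ : Space d → ℝ} (hφ : IsTestFunction Ω φ) (c : ℝ) :
    IsTestFunction Ω (c • φ) := by
  have h : tsupport (c • φ) ⊆ tsupport φ := closure_mono (Function.support_const_smul_subset c φ)
  exact ⟨hφ.1.const_smul c, hφ.2.1.mono' ((subset_tsupport _).trans h), h.trans hφ.2.2⟩

theorem IsTestFunction.differentiable {φ : Space d → ℝ} (hφ : IsTestFunction Ω φ) :
    Differentiable ℝ φ := hφ.1.differentiable (by simp)

theorem IsTestFunction.eq_zero {φ : Space d → ℝ} (hφ : IsTestFunction Ω φ) {x : Space d}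
    (hx : x ∉ Ω) : φ x = 0 := image_eq_zero_of_notMem_tsupport fun h => hx (hφ.2.2 h)

theorem IsTestFunction.gradient_eq_zero {φ : Space d → ℝ} (hφ : IsTestFunction Ω φ) {x : Space d}
    (hx : x ∉ Ω) : gradient φ x = 0 :=
  gradient_eq_zero_of_notMem_tsupport fun h => hx (hφ.2.2 h)

theorem IsTestFunction.hasCompactSupport_gradient {φ : Space d → ℝ} (hφ : IsTestFunction Ω φ) :
    HasCompactSupport (gradient φ) :=
  hφ.2.1.mono' ((subset_tsupport _).trans (tsupport_gradient_subset φ))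

theorem memLp_of_continuous_of_hasCompactSupport {F : Type*} [NormedAddCommGroup F]
    {μ : Measure (Space d)} [IsFiniteMeasure μ] {f : Space d → F}
    (hf : Continuous f) (hc : HasCompactSupport f) : MemLp f 2 μ :=
  hf.memLp_of_hasCompactSupport hc

/-- `g` is the gradient of `u`, and `(u, g)` is a limit of pairs `(φ, ∇φ)` in `L²_β`, with `φ` a
test function. -/
structure HasH10Gradient (Ω Λ : Set (Space d)) (β : ℝ) (u : Space d → ℝ)
    (g : Space d → Space d) : Prop where
  memLp : MemLp u 2 (weightedMeasure Ω Λ β)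
  memLp_grad : MemLp g 2 (weightedMeasure Ω Λ β)
  approx : ∀ ε : ENNReal, ε ≠ 0 → ∃ φ, IsTestFunction Ω φ ∧
    eLpNorm (u - φ) 2 (weightedMeasure Ω Λ β) ≤ ε ∧
    eLpNorm (g - gradient φ) 2 (weightedMeasure Ω Λ β) ≤ ε

theorem IsTestFunction.memLp (hΛ : IsMuckenhoupt Λ β CA) (hb : Bornology.IsBounded Ω)
    {φ : Space d → ℝ} (hφ : IsTestFunction Ω φ) : MemLp φ 2 (weightedMeasure Ω Λ β) :=
  have := isFiniteMeasure_weightedMeasure hΛ hb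
  memLp_of_continuous_of_hasCompactSupport hφ.1.continuous hφ.2.1

theorem IsTestFunction.memLp_gradient (hΛ : IsMuckenhoupt Λ β CA) (hb : Bornology.IsBounded Ω)
    {φ : Space d → ℝ} (hφ : IsTestFunction Ω φ) :
    MemLp (gradient φ) 2 (weightedMeasure Ω Λ β) :=
  have := isFiniteMeasure_weightedMeasure hΛ hb
  memLp_of_continuous_of_hasCompactSupport (continuous_gradient hφ.1)
    hφ.hasCompactSupport_gradient

namespace HasH10Gradient

variable {u u' : Space d → ℝ} {g g' : Space d → Space d}

theorem of_limit (hu : MemLp u 2 (weightedMeasure Ω Λ β)) (hg : MemLp g 2 (weightedMeasure Ω Λ β))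
    (h : ∀ ε : ENNReal, ε ≠ 0 → ∃ u' g', HasH10Gradient Ω Λ β u' g' ∧
      eLpNorm (u - u') 2 (weightedMeasure Ω Λ β) ≤ ε ∧
      eLpNorm (g - g') 2 (weightedMeasure Ω Λ β) ≤ ε) : HasH10Gradient Ω Λ β u g := by
  refine ⟨hu, hg, fun ε hε => ?_⟩
  have hε2 : ε / 2 ≠ 0 := by simpa using hε
  obtain ⟨u', g', hu', h1, h2⟩ := h (ε / 2) hε2
  obtain ⟨φ, hφ, h3, h4⟩ := hu'.approx (ε / 2) hε2
  have hφc := hφ.1.continuous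
  refine ⟨φ, hφ, ?_, ?_⟩
  · rw [← sub_add_sub_cancel u u' φ, ← ENNReal.add_halves ε]
    exact (eLpNorm_add_le (hu.1.sub hu'.memLp.1)
      (hu'.memLp.1.sub hφc.aestronglyMeasurable) one_le_two).trans (add_le_add h1 h3)
  · rw [← sub_add_sub_cancel g g' (gradient φ), ← ENNReal.add_halves ε]
    exact (eLpNorm_add_le (hg.1.sub hu'.memLp_grad.1) (hu'.memLp_grad.1.sub
      (continuous_gradient hφ.1).aestronglyMeasurable) one_le_two).trans (add_le_add h2 h4)

theorem congr_ae (h : HasH10Gradient Ω Λ β u g) (hu : u =ᵐ[weightedMeasure Ω Λ β] u')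
    (hg : g =ᵐ[weightedMeasure Ω Λ β] g') : HasH10Gradient Ω Λ β u' g' := by
  refine of_limit (h.memLp.ae_eq hu) (h.memLp_grad.ae_eq hg) fun ε _ => ⟨u, g, h, ?_, ?_⟩
  · rw [eLpNorm_congr_ae (g := 0) (by filter_upwards [hu] with x hx; simp [hx])]; simp
  · rw [eLpNorm_congr_ae (g := 0) (by filter_upwards [hg] with x hx; simp [hx])]; simp

theorem add (h : HasH10Gradient Ω Λ β u g) (h' : HasH10Gradient Ω Λ β u' g') :
    HasH10Gradient Ω Λ β (u + u') (g + g') := by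
  refine ⟨h.memLp.add h'.memLp, h.memLp_grad.add h'.memLp_grad, fun ε hε => ?_⟩
  have hε2 : ε / 2 ≠ 0 := by simpa using hε
  obtain ⟨φ, hφ, h1, h2⟩ := h.approx (ε / 2) hε2
  obtain ⟨ψ, hψ, h3, h4⟩ := h'.approx (ε / 2) hε2
  refine ⟨φ + ψ, hφ.add hψ, ?_, ?_⟩
  · rw [add_sub_add_comm, ← ENNReal.add_halves ε]
    exact (eLpNorm_add_le (h.memLp.1.sub hφ.1.continuous.aestronglyMeasurable)
      (h'.memLp.1.sub hψ.1.continuous.aestronglyMeasurable) one_le_two).trans (add_le_add h1 h3)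
  · have : gradient (φ + ψ) = gradient φ + gradient ψ := by
      ext1 x; exact gradient_add (hφ.differentiable x) (hψ.differentiable x)
    rw [this, add_sub_add_comm, ← ENNReal.add_halves ε]
    exact (eLpNorm_add_le (h.memLp_grad.1.sub (continuous_gradient hφ.1).aestronglyMeasurable)
      (h'.memLp_grad.1.sub (continuous_gradient hψ.1).aestronglyMeasurable) one_le_two).trans
      (add_le_add h2 h4)

theorem const_smul (h : HasH10Gradient Ω Λ β u g) (c : ℝ) :
    HasH10Gradient Ω Λ β (c • u) (c • g) := by
  refine ⟨h.memLp.const_smul c, h.memLp_grad.const_smul c, fun ε hε => ?_⟩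
  have hc : ‖c‖ₑ ≠ ⊤ := by simp
  obtain ⟨φ, hφ, h1, h2⟩ := h.approx (ε / ‖c‖ₑ) (by simp [ENNReal.div_eq_zero_iff, hε])
  have h3 : ‖c‖ₑ * (ε / ‖c‖ₑ) ≤ ε := ENNReal.mul_div_le
  refine ⟨c • φ, hφ.const_smul c, ?_, ?_⟩
  · rw [← smul_sub, eLpNorm_const_smul]
    exact (mul_le_mul_right h1 _).trans h3
  · have : gradient (c • φ) = c • gradient φ := by
      ext1 x; exact gradient_const_smul c (hφ.differentiable x)
    rw [this, ← smul_sub, eLpNorm_const_smul]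
    exact (mul_le_mul_right h2 _).trans h3

theorem sub (h : HasH10Gradient Ω Λ β u g) (h' : HasH10Gradient Ω Λ β u' g') :
    HasH10Gradient Ω Λ β (u - u') (g - g') := by
  simpa [sub_eq_add_neg] using h.add (h'.const_smul (-1))

theorem zero : HasH10Gradient Ω Λ β (0 : Space d → ℝ) 0 := by
  have h0 : gradient (0 : Space d → ℝ) = 0 := by ext1 x; simp [gradient]
  refine ⟨MemLp.zero, MemLp.zero, fun ε _ => ⟨0, ⟨contDiff_const, HasCompactSupport.zero, ?_⟩,
    by simp, by simp [h0]⟩⟩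
  simp [tsupport]

theorem sum {ι : Type*} (s : Finset ι) {u : ι → Space d → ℝ} {g : ι → Space d → Space d}
    (h : ∀ i ∈ s, HasH10Gradient Ω Λ β (u i) (g i)) :
    HasH10Gradient Ω Λ β (∑ i ∈ s, u i) (∑ i ∈ s, g i) := by
  classical
  induction s using Finset.induction_on with
  | empty => simpa using zero
  | insert a s ha ih =>
    rw [Finset.sum_insert ha, Finset.sum_insert ha]
    exact (h a (by simp)).add (ih fun i hi => h i (by simp [hi]))

end HasH10Gradient

/-! ### Weak gradients -/

theorem eq_zero_of_forall_le_mul {a K : ENNReal} (hK : K ≠ ⊤) (h : ∀ ε, ε ≠ 0 → a ≤ K * ε) :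
    a = 0 := by
  have h1 : Tendsto (fun n : ℕ => K * (n : ENNReal)⁻¹) atTop (𝓝 (K * 0)) :=
    ENNReal.Tendsto.const_mul ENNReal.tendsto_inv_nat_nhds_zero (Or.inr hK)
  rw [mul_zero] at h1
  exact le_antisymm (ge_of_tendsto' h1 fun n => h _ (by simp)) bot_le

theorem IsTestFunction.integral_by_parts {φ ψ : Space d → ℝ}
    (hφ : IsTestFunction Ω φ) (hψ : IsTestFunction Ω ψ) (e : Space d) :
    ∫ x in Ω, φ x * fderiv ℝ ψ x e = -∫ x in Ω, ⟪gradient φ x, e⟫ * ψ x := by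
  have hcφ := hφ.1.continuous
  have hcψ := hψ.1.continuous
  have hdφ := hφ.1.continuous_fderiv (by simp)
  have hdψ := hψ.1.continuous_fderiv (by simp)
  have h1 : Integrable fun x => fderiv ℝ φ x e * ψ x :=
    (by fun_prop : Continuous _).integrable_of_hasCompactSupport (hψ.2.1.mul_left)
  have h2 : Integrable fun x => φ x * fderiv ℝ ψ x e :=
    (by fun_prop : Continuous _).integrable_of_hasCompactSupport (hφ.2.1.mul_right)
  have h3 : Integrable fun x => φ x * ψ x :=
    (by fun_prop : Continuous _).integrable_of_hasCompactSupport (hφ.2.1.mul_right)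
  have h4 := integral_mul_fderiv_eq_neg_fderiv_mul_of_integrable h1 h2 h3
    (fun x _ => hφ.differentiable x) (fun x _ => hψ.differentiable x)
  rw [setIntegral_eq_integral_of_forall_compl_eq_zero (fun x hx => by simp [hφ.eq_zero hx]),
    setIntegral_eq_integral_of_forall_compl_eq_zero (fun x hx => by simp [hψ.eq_zero hx]), h4]
  simp only [inner_gradient]

theorem IsTestFunction.exists_bound {φ : Space d → ℝ} (hφ : IsTestFunction Ω φ) :
    ∃ B : ℝ, ∀ x, ‖φ x‖ ≤ B ∧ ‖fderiv ℝ φ x‖ ≤ B := by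
  obtain ⟨B, hB⟩ := hφ.2.1.exists_bound_of_continuous hφ.1.continuous
  obtain ⟨B', hB'⟩ := hφ.hasCompactSupport_gradient.exists_bound_of_continuous
    (continuous_gradient hφ.1)
  exact ⟨max B B', fun x => ⟨(hB x).trans (le_max_left _ _),
    (norm_gradient φ x ▸ hB' x).trans (le_max_right _ _)⟩⟩

theorem HasH10Gradient.hasWeakGradient (hΛ : IsMuckenhoupt Λ β CA) (hb : Bornology.IsBounded Ω)
    {u : Space d → ℝ} {g : Space d → Space d} (h : HasH10Gradient Ω Λ β u g) :
    HasWeakGradient Ω u g := by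
  have hui := MemLp.integrableOn_of_weighted hΛ hb h.memLp
  have hgi := MemLp.integrableOn_of_weighted hΛ hb h.memLp_grad
  refine ⟨hui.locallyIntegrableOn, hgi.locallyIntegrableOn, fun ψ hψ e => ?_⟩
  obtain ⟨B, hB⟩ := hψ.exists_bound
  obtain ⟨C, hC, hCle⟩ := exists_lintegral_le_eLpNorm (Ω := Ω) hΛ hb
  have hcψ := hψ.1.continuous
  have hdψ := hψ.1.continuous_fderiv (by simp)
  have hB0 : 0 ≤ B := (norm_nonneg _).trans (hB 0).1
  -- both integrals are bounded by the `L²` norm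
  have i1 : ∀ w : Space d → ℝ, IntegrableOn w Ω →
      IntegrableOn (fun x => w x * fderiv ℝ ψ x e) Ω := fun w hw =>
    Integrable.mul_bdd (c := B * ‖e‖) hw (by fun_prop : Continuous _).aestronglyMeasurable
      (Eventually.of_forall fun x => ((fderiv ℝ ψ x).le_opNorm e).trans (by
        gcongr; exact (hB x).2))
  have i2 : ∀ w : Space d → Space d, IntegrableOn w Ω →
      IntegrableOn (fun x => ⟪w x, e⟫ * ψ x) Ω := fun w hw =>
    Integrable.mul_bdd (c := B) (hw.inner_const e) hcψ.aestronglyMeasurable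
      (Eventually.of_forall fun x => (hB x).1)
  have b1 : ∀ w : Space d → ℝ, AEStronglyMeasurable w (volume.restrict Ω) →
      ‖∫ x in Ω, w x * fderiv ℝ ψ x e‖ₑ ≤
        ENNReal.ofReal (B * ‖e‖) * C * eLpNorm w 2 (weightedMeasure Ω Λ β) := fun w hw => by
    rw [mul_assoc]
    refine (enorm_integral_le_lintegral_enorm _).trans
      (le_trans ?_ (mul_le_mul_right (hCle w hw) _))
    rw [← lintegral_const_mul' _ _ ENNReal.ofReal_ne_top]
    refine lintegral_mono fun x => ?_
    rw [enorm_mul, mul_comm]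
    gcongr
    rw [← ofReal_norm]
    exact ENNReal.ofReal_le_ofReal (((fderiv ℝ ψ x).le_opNorm e).trans (by
      gcongr; exact (hB x).2))
  have b2 : ∀ w : Space d → Space d, AEStronglyMeasurable w (volume.restrict Ω) →
      ‖∫ x in Ω, ⟪w x, e⟫ * ψ x‖ₑ ≤
        ENNReal.ofReal (B * ‖e‖) * C * eLpNorm w 2 (weightedMeasure Ω Λ β) := fun w hw => by
    rw [mul_assoc]
    refine (enorm_integral_le_lintegral_enorm _).trans
      (le_trans ?_ (mul_le_mul_right (hCle w hw) _))
    rw [← lintegral_const_mul' _ _ ENNReal.ofReal_ne_top]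
    refine lintegral_mono fun x => ?_
    rw [← ofReal_norm, ← ofReal_norm, ← ENNReal.ofReal_mul (by positivity)]
    refine ENNReal.ofReal_le_ofReal ?_
    rw [norm_mul]
    calc ‖⟪w x, e⟫‖ * ‖ψ x‖ ≤ (‖w x‖ * ‖e‖) * B :=
          mul_le_mul (norm_inner_le_norm _ _) (hB x).1 (norm_nonneg _) (by positivity)
      _ = _ := by ring
  rw [eq_neg_iff_add_eq_zero, ← enorm_eq_zero]
  refine eq_zero_of_forall_le_mul
    (K := ENNReal.ofReal (B * ‖e‖) * C + ENNReal.ofReal (B * ‖e‖) * C) (by finiteness)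
    fun ε hε => ?_
  obtain ⟨φ, hφ, h1, h2⟩ := h.approx ε hε
  have hφi := MemLp.integrableOn_of_weighted hΛ hb (hφ.memLp hΛ hb)
  have hφgi := MemLp.integrableOn_of_weighted hΛ hb (hφ.memLp_gradient hΛ hb)
  have key : (∫ x in Ω, u x * fderiv ℝ ψ x e) + ∫ x in Ω, ⟪g x, e⟫ * ψ x =
      (∫ x in Ω, (u - φ) x * fderiv ℝ ψ x e) + ∫ x in Ω, ⟪(g - gradient φ) x, e⟫ * ψ x := by
    simp only [Pi.sub_apply, sub_mul, inner_sub_left]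
    rw [integral_sub (i1 u hui) (i1 φ hφi), integral_sub (i2 g hgi) (i2 _ hφgi),
      hφ.integral_by_parts hψ e]
    ring
  rw [key, add_mul]
  refine (enorm_add_le _ _).trans (add_le_add ?_ ?_)
  · refine (b1 _ (hui.1.sub hφi.1)).trans ?_
    gcongr
  · refine (b2 _ (hgi.1.sub hφgi.1)).trans ?_
    gcongr

/-- Weak gradients are local. -/
theorem HasWeakGradient.ae_eq_zero {U : Set (Space d)} (hU : IsOpen U) (hUΩ : U ⊆ Ω)
    {u : Space d → ℝ} {g : Space d → Space d} (h : HasWeakGradient Ω u g)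
    (hu : ∀ᵐ x, x ∈ U → u x = 0) : ∀ᵐ x, x ∈ U → g x = 0 := by
  refine hU.ae_eq_zero_of_integral_contDiff_smul_eq_zero (h.2.1.mono_set hUΩ) fun φ h1 h2 h3 => ?_
  by_cases hi : Integrable (fun x => φ x • g x)
  swap
  · exact integral_undef hi
  refine ext_inner_left ℝ fun e => ?_
  rw [← integral_inner hi, inner_zero_right]
  have h4 := h.2.2 φ ⟨h1, h2, h3.trans hUΩ⟩ e
  have hz : ∀ x, x ∉ U → φ x = 0 := fun x hx => image_eq_zero_of_notMem_tsupport fun hx' =>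
    hx (h3 hx')
  have hz' : ∀ x, x ∉ U → fderiv ℝ φ x = 0 := fun x hx => by
    by_contra h5
    exact hx (h3 (support_fderiv_subset ℝ h5))
  have h5 : ∫ x in Ω, u x * fderiv ℝ φ x e = 0 := by
    refine integral_eq_zero_of_ae (ae_restrict_of_ae ?_)
    filter_upwards [hu] with x hx
    by_cases hxU : x ∈ U
    · simp [hx hxU]
    · simp [hz' x hxU]
  rw [h5, zero_eq_neg, setIntegral_eq_integral_of_forall_compl_eq_zero
    (fun x hx => by simp [hz x fun h => hx (hUΩ h)])] at h4
  rw [← h4]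
  refine integral_congr_ae (Eventually.of_forall fun x => ?_)
  simp only [inner_smul_right, real_inner_comm e]
  ring

theorem IsTestFunction.integrable_smul {F : Type*} [NormedAddCommGroup F] [NormedSpace ℝ F]
    {φ : Space d → ℝ} (hφ : IsTestFunction Ω φ) {f : Space d → F}
    (hf : LocallyIntegrableOn f Ω) : Integrable fun x => φ x • f x := by
  obtain ⟨B, hB⟩ := hφ.exists_bound
  have h1 : IntegrableOn f (tsupport φ) := hf.integrableOn_compact_subset hφ.2.2 hφ.2.1
  have h2 : IntegrableOn (fun x => φ x • f x) (tsupport φ) :=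
    Integrable.bdd_smul (C := B) (hf := h1) hφ.1.continuous.aestronglyMeasurable
      (Eventually.of_forall fun x => (hB x).1)
  rwa [integrableOn_iff_integrable_of_support_subset] at h2
  exact (Function.support_smul_subset_left φ f).trans (subset_tsupport φ)

theorem HasWeakGradient.ae_eq (hΩ : IsOpen Ω) {u u' : Space d → ℝ} {g g' : Space d → Space d}
    (h : HasWeakGradient Ω u g) (h' : HasWeakGradient Ω u' g')
    (hu : u =ᵐ[volume.restrict Ω] u') : g =ᵐ[volume.restrict Ω] g' := by
  have key : ∀ᵐ x, x ∈ Ω → (g - g') x = 0 := by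
    refine hΩ.ae_eq_zero_of_integral_contDiff_smul_eq_zero (h.2.1.sub h'.2.1)
      fun φ h1 h2 h3 => ?_
    have hφ : IsTestFunction Ω φ := ⟨h1, h2, h3⟩
    have hi := hφ.integrable_smul h.2.1
    have hi' := hφ.integrable_smul h'.2.1
    simp only [Pi.sub_apply, smul_sub]
    rw [integral_sub hi hi', sub_eq_zero]
    have aux : ∀ (f : Space d → Space d) (hf : Integrable fun x => φ x • f x) (e : Space d),
        ⟪e, ∫ x, φ x • f x⟫ = ∫ x in Ω, ⟪f x, e⟫ * φ x := fun f hf e => by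
      rw [← integral_inner hf, setIntegral_eq_integral_of_forall_compl_eq_zero
        (fun x hx => by simp [hφ.eq_zero hx])]
      refine integral_congr_ae (Eventually.of_forall fun x => ?_)
      simp only [inner_smul_right, real_inner_comm e]
      ring
    refine ext_inner_left ℝ fun e => ?_
    rw [aux g hi, aux g' hi', ← neg_inj, ← h.2.2 φ hφ e, ← h'.2.2 φ hφ e]
    refine integral_congr_ae ?_
    filter_upwards [hu] with x hx
    rw [hx]
  rw [Filter.EventuallyEq, ae_restrict_iff' hΩ.measurableSet]
  filter_upwards [key] with x hx hxΩ
  exact sub_eq_zero.1 (hx hxΩ)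

theorem HasWeakGradient.hasWeakGradient_weakGradient {u : Space d → ℝ} {g : Space d → Space d}
    (h : HasWeakGradient Ω u g) : HasWeakGradient Ω u (weakGradient Ω u) := by
  have h' : ∃ g, HasWeakGradient Ω u g := ⟨g, h⟩
  rw [weakGradient, dif_pos h']
  exact h'.choose_spec

theorem HasH10Gradient.weakGradient_ae_eq (hΛ : IsMuckenhoupt Λ β CA)
    (hb : Bornology.IsBounded Ω) (hΩ : IsOpen Ω) {u : Space d → ℝ} {g : Space d → Space d}
    (h : HasH10Gradient Ω Λ β u g) : weakGradient Ω u =ᵐ[weightedMeasure Ω Λ β] g := by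
  rw [Filter.EventuallyEq, weightedMeasure_ae hΛ]
  have h1 := h.hasWeakGradient hΛ hb
  exact h1.hasWeakGradient_weakGradient.ae_eq hΩ h1 ae_eq_rfl

theorem HasH10Gradient.memH10 (hΛ : IsMuckenhoupt Λ β CA)
    (hb : Bornology.IsBounded Ω) (hΩ : IsOpen Ω) {u : Space d → ℝ} {g : Space d → Space d}
    (h : HasH10Gradient Ω Λ β u g) : MemH10 Ω Λ β u := by
  have h1 := (h.hasWeakGradient hΛ hb).hasWeakGradient_weakGradient
  have h2 := h.weakGradient_ae_eq hΛ hb hΩ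
  refine ⟨⟨h.memLp, h1, h.memLp_grad.ae_eq h2.symm⟩, ?_⟩
  choose! φ hφ h3 h4 using h.approx
  refine ⟨fun n : ℕ => φ (n : ENNReal)⁻¹, fun n => hφ _ (by simp), ?_, ?_⟩
  · exact tendsto_of_tendsto_of_tendsto_of_le_of_le tendsto_const_nhds
      ENNReal.tendsto_inv_nat_nhds_zero (fun n => bot_le) fun n => h3 _ (by simp)
  · refine tendsto_of_tendsto_of_tendsto_of_le_of_le tendsto_const_nhds
      ENNReal.tendsto_inv_nat_nhds_zero (fun n => bot_le) fun n => ?_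
    rw [eLpNorm_congr_ae (h2.sub ae_eq_rfl)]
    exact h4 _ (by simp)

theorem MemH10.hasH10Gradient {u : Space d → ℝ} (h : MemH10 Ω Λ β u) :
    HasH10Gradient Ω Λ β u (weakGradient Ω u) := by
  obtain ⟨φ, hφ, h1, h2⟩ := h.approx
  refine ⟨h.memLp, h.memLp_grad, fun ε hε => ?_⟩
  have h3 := ENNReal.tendsto_nhds_zero.1 h1 ε (pos_iff_ne_zero.2 hε)
  have h4 := ENNReal.tendsto_nhds_zero.1 h2 ε (pos_iff_ne_zero.2 hε)
  obtain ⟨n, h5, h6⟩ := (h3.and h4).exists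
  exact ⟨φ n, hφ n, h5, h6⟩

/-- The gradient of a function in `H¹_{0,β}` vanishes on open sets where the function does. -/
theorem HasH10Gradient.ae_eq_zero (hΛ : IsMuckenhoupt Λ β CA) (hb : Bornology.IsBounded Ω)
    {U : Set (Space d)} (hU : IsOpen U) (hUΩ : U ⊆ Ω) {u : Space d → ℝ} {g : Space d → Space d}
    (h : HasH10Gradient Ω Λ β u g) (hu : ∀ᵐ x ∂weightedMeasure Ω Λ β, x ∈ U → u x = 0) :
    ∀ᵐ x ∂weightedMeasure Ω Λ β, x ∈ U → g x = 0 := by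
  rw [weightedMeasure_ae hΛ] at *
  refine ae_restrict_of_ae ((h.hasWeakGradient hΛ hb).ae_eq_zero hU hUΩ ?_)
  have h1 : ∀ᵐ x ∂volume.restrict U, x ∈ U → u x = 0 :=
    ae_mono (Measure.restrict_mono hUΩ le_rfl) hu
  rw [ae_restrict_iff' hU.measurableSet] at h1
  filter_upwards [h1] with x hx hxU using hx hxU hxU

end Sobolev

end WeightedLOD

end

noncomputable section

namespace WeightedLOD

/-! ### Lipschitz functions -/

theorem tendsto_eLpNorm_zero_of_bounded {α F : Type*} [MeasurableSpace α] [NormedAddCommGroup F]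
    {μ : Measure α} [IsFiniteMeasure μ] {f : ℕ → α → F} {B : ℝ}
    (hm : ∀ n, AEStronglyMeasurable (f n) μ) (hB : ∀ n, ∀ᵐ x ∂μ, ‖f n x‖ ≤ B)
    (hlim : ∀ᵐ x ∂μ, Tendsto (fun n => f n x) atTop (𝓝 0)) :
    Tendsto (fun n => eLpNorm (f n) 2 μ) atTop (𝓝 0) := by
  have h1 : Tendsto (fun n => ∫⁻ x, ‖f n x‖ₑ ^ 2 ∂μ) atTop (𝓝 (∫⁻ _, 0 ∂μ)) := by
    refine tendsto_lintegral_of_dominated_convergence' (fun _ => ENNReal.ofReal B ^ 2)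
      (fun n => (hm n).enorm.pow_const 2) (fun n => ?_) ?_ ?_
    · filter_upwards [hB n] with x hx
      rw [← ofReal_norm]
      gcongr
    · rw [lintegral_const]
      exact ENNReal.mul_ne_top (by finiteness) (measure_ne_top _ _)
    · filter_upwards [hlim] with x hx
      have h2 : Tendsto (fun n => ‖f n x‖ₑ ^ 2) atTop (𝓝 (‖(0 : F)‖ₑ ^ 2)) :=
        ((ENNReal.continuous_pow 2).tendsto _).comp ((continuous_enorm.tendsto _).comp hx)
      simpa using h2
  have h2 := ((ENNReal.continuous_rpow_const (y := 1 / 2)).tendsto _).comp h1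
  rw [lintegral_zero, ENNReal.zero_rpow_of_pos (by norm_num)] at h2
  refine h2.congr fun n => ?_
  simp only [Function.comp, ← eLpNorm_two_sq]
  rw [← ENNReal.rpow_natCast, ← ENNReal.rpow_mul]; norm_num

section Lipschitz

variable {d : ℕ} {Ω Λ : Set (Space d)} {β CA : ℝ} {L : NNReal} {f : Space d → ℝ}

theorem norm_gradient_le_of_lipschitzWith (hf : LipschitzWith L f) (x : Space d) :
    ‖gradient f x‖ ≤ L := by
  rw [norm_gradient]; exact norm_fderiv_le_of_lipschitz ℝ hf

theorem hasFDerivAt_convolution_of_lipschitzWith (hf : LipschitzWith L f)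
    (φ : ContDiffBump (0 : Space d)) (x : Space d) :
    HasFDerivAt (convolution (φ.normed volume) f (ContinuousLinearMap.lsmul ℝ ℝ) volume)
      (convolution (φ.normed volume) (fderiv ℝ f) (ContinuousLinearMap.lsmul ℝ ℝ) volume x) x := by
  have hφi : Integrable (φ.normed volume) := φ.integrable_normed
  have hφc : Continuous (φ.normed (volume : Measure (Space d))) := φ.continuous_normed
  have := (hasFDerivAt_integral_of_dominated_loc_of_lip (𝕜 := ℝ) (μ := volume) (x₀ := x)
    (F := fun x t => φ.normed volume t • f (x - t))
    (F' := fun t => φ.normed volume t • fderiv ℝ f (x - t))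
    (bound := fun t => φ.normed volume t * L) (s := univ) univ_mem ?_ ?_ ?_ ?_ ?_ ?_).2
  · exact this
  · refine Eventually.of_forall fun y => ?_
    have := hf.continuous
    exact (by fun_prop : Continuous _).aestronglyMeasurable
  · have := hf.continuous
    exact (by fun_prop : Continuous _).integrable_of_hasCompactSupport
      (φ.hasCompactSupport_normed.smul_right)
  · exact (hφc.measurable.smul ((measurable_fderiv ℝ f).comp
      (measurable_const.sub measurable_id))).aestronglyMeasurable
  · refine Eventually.of_forall fun t => ?_
    refine LipschitzOnWith.of_dist_le_mul fun y _ z _ => ?_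
    have h0 : 0 ≤ φ.normed (volume : Measure (Space d)) t := φ.nonneg_normed t
    have h1 := hf.dist_le_mul (y - t) (z - t)
    rw [dist_sub_right] at h1
    rw [Real.coe_nnabs, abs_of_nonneg (by positivity), dist_eq_norm, ← smul_sub, norm_smul,
      Real.norm_of_nonneg h0, mul_assoc, ← dist_eq_norm]
    gcongr
  · exact hφi.mul_const _
  · have h1 : ∀ᵐ t : Space d, DifferentiableAt ℝ f (x - t) :=
      (Measure.measurePreserving_sub_left volume x).quasiMeasurePreserving.ae
        hf.ae_differentiableAt
    filter_upwards [h1] with t ht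
    have h2 : HasFDerivAt (fun y => f (y - t)) (fderiv ℝ f (x - t)) x := by
      exact ht.hasFDerivAt.comp x ((hasFDerivAt_id x).sub_const t)
    exact h2.fun_const_smul _

theorem norm_fderiv_convolution_le (hf : LipschitzWith L f) (φ : ContDiffBump (0 : Space d))
    (x : Space d) : ‖convolution (φ.normed volume) (fderiv ℝ f)
      (ContinuousLinearMap.lsmul ℝ ℝ) volume x‖ ≤ L := by
  have hφi : Integrable (φ.normed (volume : Measure (Space d))) := φ.integrable_normed
  rw [convolution_def]
  refine (norm_integral_le_of_norm_le (hφi.mul_const (L : ℝ))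
    (Eventually.of_forall fun t => ?_)).trans_eq ?_
  · rw [ContinuousLinearMap.lsmul_apply, norm_smul,
      Real.norm_of_nonneg (φ.nonneg_normed t)]
    gcongr
    · exact φ.nonneg_normed t
    · exact norm_fderiv_le_of_lipschitz ℝ hf
  · rw [integral_mul_const, φ.integral_normed, one_mul]

theorem hasH10Gradient_of_lipschitzWith_of_hasCompactSupport (hΛ : IsMuckenhoupt Λ β CA)
    (hb : Bornology.IsBounded Ω) (hΩ : IsOpen Ω) (hf : LipschitzWith L f)
    (hc : HasCompactSupport f) (hs : tsupport f ⊆ Ω) :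
    HasH10Gradient Ω Λ β f (gradient f) := by
  have := isFiniteMeasure_weightedMeasure hΛ hb
  obtain ⟨δ, hδ, hδΩ⟩ := IsCompact.exists_cthickening_subset_open hc hΩ hs
  set φ : ℕ → ContDiffBump (0 : Space d) := fun n =>
    ⟨1 / (n + 1 : ℝ) / 2, 1 / (n + 1 : ℝ), by positivity, half_lt_self (by positivity)⟩ with hφ
  have hout : ∀ n, (φ n).rOut = 1 / (n + 1 : ℝ) := fun n => rfl
  have hin : ∀ n, (φ n).rIn = 1 / (n + 1 : ℝ) / 2 := fun n => rfl
  have hout0 : Tendsto (fun n => (φ n).rOut) atTop (𝓝 0) := tendsto_one_div_add_atTop_nhds_zero_nat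
  set F : ℕ → Space d → ℝ := fun n =>
    convolution ((φ n).normed volume) f (ContinuousLinearMap.lsmul ℝ ℝ) volume with hF
  have hcd : ∀ n, ContDiff ℝ ∞ (F n) := fun n =>
    (φ n).hasCompactSupport_normed.contDiff_convolution_left _ (φ n).contDiff_normed
      hf.continuous.locallyIntegrable
  have htest : ∀ᶠ n in atTop, IsTestFunction Ω (F n) := by
    filter_upwards [hout0.eventually (gt_mem_nhds hδ)] with n hn
    have h1 : Function.support (F n) ⊆ Metric.cthickening δ (tsupport f) := by
      refine (support_convolution_subset (L := ContinuousLinearMap.lsmul ℝ ℝ)).trans ?_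
      rintro _ ⟨a, ha, b, hb, rfl⟩
      rw [(φ n).support_normed_eq] at ha
      refine Metric.mem_cthickening_of_dist_le _ b δ _ (subset_tsupport _ hb) ?_
      simp only [Metric.mem_ball, dist_zero_right] at ha
      simpa using (ha.trans hn).le
    refine ⟨hcd n, ?_, ?_⟩
    · exact HasCompactSupport.of_support_subset_isCompact (IsCompact.cthickening hc) h1
    · exact (closure_minimal h1 Metric.isClosed_cthickening).trans hδΩ
  have hgrad : ∀ n x, fderiv ℝ (F n) x = convolution ((φ n).normed volume) (fderiv ℝ f)
      (ContinuousLinearMap.lsmul ℝ ℝ) volume x := fun n x =>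
    (hasFDerivAt_convolution_of_lipschitzWith hf (φ n) x).fderiv
  have hL : ∀ x, ‖gradient f x‖ ≤ L := norm_gradient_le_of_lipschitzWith hf
  have l1 : Tendsto (fun n => eLpNorm (f - F n) 2 (weightedMeasure Ω Λ β)) atTop (𝓝 0) := by
    have hd : ∀ n x, dist (F n x) (f x) ≤ L * (1 / (n + 1 : ℝ)) := fun n x => by
      refine (φ n).dist_normed_convolution_le hf.continuous.aestronglyMeasurable fun y hy => ?_
      exact (hf.dist_le_mul y x).trans (by gcongr; exact (Metric.mem_ball.1 hy).le)
    refine tendsto_eLpNorm_zero_of_bounded (B := L)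
      (fun n => (hf.continuous.sub (hcd n).continuous).aestronglyMeasurable)
      (fun n => Eventually.of_forall fun x => ?_) (Eventually.of_forall fun x => ?_)
    · rw [Pi.sub_apply, ← dist_eq_norm, dist_comm]
      refine (hd n x).trans (mul_le_of_le_one_right L.2 ?_)
      rw [div_le_one (by positivity)]; linarith [(Nat.cast_nonneg n : (0 : ℝ) ≤ n)]
    · have h2 : Tendsto (fun n : ℕ => (L : ℝ) * (1 / (n + 1 : ℝ))) atTop (𝓝 (L * 0)) :=
        tendsto_one_div_add_atTop_nhds_zero_nat.const_mul _
      rw [mul_zero] at h2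
      refine squeeze_zero_norm (fun n => ?_) h2
      rw [Pi.sub_apply, ← dist_eq_norm, dist_comm]
      exact hd n x
  have l2 : Tendsto (fun n => eLpNorm (gradient f - gradient (F n)) 2 (weightedMeasure Ω Λ β))
      atTop (𝓝 0) := by
    have hli : LocallyIntegrable (fderiv ℝ f) (volume : Measure (Space d)) := by
      refine (locallyIntegrable_const (L : ℝ)).mono (measurable_fderiv ℝ f).aestronglyMeasurable
        (Eventually.of_forall fun x => ?_)
      rw [Real.norm_of_nonneg L.coe_nonneg]
      exact norm_fderiv_le_of_lipschitz ℝ hf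
    have hae := ContDiffBump.ae_convolution_tendsto_right_of_locallyIntegrable (K := 2) hout0
      (Eventually.of_forall fun n => by rw [hout, hin]; linarith) hli
    refine tendsto_eLpNorm_zero_of_bounded (B := L + L)
      (fun n => ((measurable_gradient f).sub (measurable_gradient _)).aestronglyMeasurable)
      (fun n => Eventually.of_forall fun x => ?_) ?_
    · refine (norm_sub_le _ _).trans (add_le_add (hL x) ?_)
      rw [norm_gradient, hgrad]
      exact norm_fderiv_convolution_le hf (φ n) x
    · rw [weightedMeasure_ae hΛ]
      refine ae_restrict_of_ae ?_
      filter_upwards [hae] with x hx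
      have h3 : Tendsto (fun n => gradient (F n) x) atTop (𝓝 (gradient f x)) := by
        have h4 := ((InnerProductSpace.toDual ℝ (Space d)).symm.continuous.tendsto _).comp hx
        refine h4.congr fun n => ?_
        simp only [Function.comp, gradient, hgrad]
      simpa using (tendsto_const_nhds (x := gradient f x)).sub h3
  refine ⟨memLp_of_continuous_of_hasCompactSupport hf.continuous hc,
    MemLp.of_bound (measurable_gradient f).aestronglyMeasurable L (Eventually.of_forall hL),
    fun ε hε => ?_⟩
  have e1 := ENNReal.tendsto_nhds_zero.1 l1 ε (pos_iff_ne_zero.2 hε)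
  have e2 := ENNReal.tendsto_nhds_zero.1 l2 ε (pos_iff_ne_zero.2 hε)
  obtain ⟨n, h1, h2, h3⟩ := (htest.and (e1.and e2)).exists
  exact ⟨F n, h1, h2, h3⟩

/-- Soft thresholding. -/
def softThreshold (ε t : ℝ) : ℝ := t - max (-ε) (min t ε)

theorem softThreshold_of_abs_le {ε t : ℝ} (h : |t| ≤ ε) : softThreshold ε t = 0 := by
  rw [abs_le] at h
  rw [softThreshold, min_eq_left h.2, max_eq_right h.1, sub_self]

theorem lipschitzWith_softThreshold {ε : ℝ} (hε : 0 ≤ ε) : LipschitzWith 1 (softThreshold ε) := by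
  refine LipschitzWith.of_dist_le_mul fun a b => ?_
  simp only [softThreshold, Real.dist_eq, NNReal.coe_one, one_mul]
  rcases le_total a b with hab | hab
  · rw [abs_sub_comm, abs_sub_comm a b, abs_of_nonneg (sub_nonneg.2 hab), abs_le]
    constructor <;> grind
  · rw [abs_of_nonneg (sub_nonneg.2 hab), abs_le]
    constructor <;> grind

theorem abs_softThreshold_sub_le {ε : ℝ} (hε : 0 ≤ ε) (t : ℝ) : |t - softThreshold ε t| ≤ ε := by
  simp only [softThreshold, sub_sub_cancel, abs_le]
  exact ⟨le_max_left _ _, max_le (by linarith) (min_le_right _ _)⟩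

theorem gradient_softThreshold_eq {ε : ℝ} (hε : 0 < ε) (hf : Continuous f) {x : Space d}
    (hx : ε < |f x|) : gradient (fun y => softThreshold ε (f y)) x = gradient f x := by
  rcases lt_abs.1 hx with h | h
  · have h1 : (fun y => softThreshold ε (f y)) =ᶠ[𝓝 x] fun y => f y - ε := by
      filter_upwards [hf.continuousAt.eventually (lt_mem_nhds h)] with y hy
      rw [softThreshold, min_eq_right hy.le, max_eq_right (by linarith)]
    rw [h1.gradient_eq]
    simp [gradient, fderiv_sub_const]
  · have h1 : (fun y => softThreshold ε (f y)) =ᶠ[𝓝 x] fun y => f y - (-ε) := by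
      have h' : f x < -ε := by linarith
      filter_upwards [hf.continuousAt.eventually (gt_mem_nhds h')] with y hy
      rw [softThreshold, max_eq_left ((min_le_left _ _).trans hy.le)]
    rw [h1.gradient_eq]
    simp [gradient]

theorem hasH10Gradient_of_lipschitzWith (hΛ : IsMuckenhoupt Λ β CA) (hb : Bornology.IsBounded Ω)
    (hΩ : IsOpen Ω) (hf : LipschitzWith L f) (h0 : ∀ x, x ∉ Ω → f x = 0) :
    HasH10Gradient Ω Λ β f ({x | f x ≠ 0}.indicator (gradient f)) := by
  have := isFiniteMeasure_weightedMeasure hΛ hb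
  have hfc := hf.continuous
  have hL := norm_gradient_le_of_lipschitzWith hf
  have hmG : Measurable ({x | f x ≠ 0}.indicator (gradient f)) :=
    (measurable_gradient f).indicator (isOpen_ne_fun hfc continuous_const).measurableSet
  have hGL : ∀ x, ‖{x | f x ≠ 0}.indicator (gradient f) x‖ ≤ L := fun x =>
    (norm_indicator_le_norm_self _ _).trans (hL x)
  set ε : ℕ → ℝ := fun n => 1 / (n + 1 : ℝ) with hεd
  have hε : ∀ n, 0 < ε n := fun n => by positivity
  have hε0 : Tendsto ε atTop (𝓝 0) := tendsto_one_div_add_atTop_nhds_zero_nat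
  set F : ℕ → Space d → ℝ := fun n x => softThreshold (ε n) (f x) with hF
  have hFl : ∀ n, LipschitzWith L (F n) := fun n => by
    have := (lipschitzWith_softThreshold (hε n).le).comp hf
    rwa [one_mul] at this
  have hts : ∀ n, tsupport (F n) ⊆ {x | ε n ≤ |f x|} := fun n => by
    refine closure_minimal (fun x hx => ?_) (isClosed_le continuous_const hfc.abs)
    by_contra h
    exact hx (softThreshold_of_abs_le (not_le.1 h).le)
  have htsΩ : ∀ n, tsupport (F n) ⊆ Ω := fun n x hx => by
    by_contra h
    have h1 : ε n ≤ |f x| := hts n hx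
    rw [h0 x h, abs_zero] at h1
    exact absurd (hε n) (not_lt.2 h1)
  have hcomp : ∀ n, HasCompactSupport (F n) := fun n =>
    Metric.isCompact_of_isClosed_isBounded (isClosed_tsupport _) (hb.subset (htsΩ n))
  have hFh := fun n => hasH10Gradient_of_lipschitzWith_of_hasCompactSupport hΛ hb hΩ (hFl n)
    (hcomp n) (htsΩ n)
  have l1 : Tendsto (fun n => eLpNorm (f - F n) 2 (weightedMeasure Ω Λ β)) atTop (𝓝 0) := by
    refine tendsto_eLpNorm_zero_of_bounded (B := 1)
      (fun n => (hfc.sub (hFl n).continuous).aestronglyMeasurable)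
      (fun n => Eventually.of_forall fun x => ?_) (Eventually.of_forall fun x => ?_)
    · refine (abs_softThreshold_sub_le (hε n).le (f x)).trans ?_
      rw [hεd, div_le_one (by positivity)]; linarith [(Nat.cast_nonneg n : (0 : ℝ) ≤ n)]
    · exact squeeze_zero_norm (fun n => abs_softThreshold_sub_le (hε n).le (f x)) hε0
  have l2 : Tendsto (fun n => eLpNorm ({x | f x ≠ 0}.indicator (gradient f) - gradient (F n)) 2
      (weightedMeasure Ω Λ β)) atTop (𝓝 0) := by
    refine tendsto_eLpNorm_zero_of_bounded (B := L + L)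
      (fun n => (hmG.sub (measurable_gradient _)).aestronglyMeasurable)
      (fun n => Eventually.of_forall fun x => ?_) (Eventually.of_forall fun x => ?_)
    · exact (norm_sub_le _ _).trans
        (add_le_add (hGL x) (norm_gradient_le_of_lipschitzWith (hFl n) x))
    · refine tendsto_const_nhds.congr' ?_
      by_cases hx : f x = 0
      · refine Eventually.of_forall fun n => ?_
        have h1 : gradient (F n) x = 0 := gradient_eq_zero_of_notMem_tsupport fun h => by
          have h2 : ε n ≤ |f x| := hts n h
          rw [hx, abs_zero] at h2
          exact absurd (hε n) (not_lt.2 h2)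
        simp [h1, hx]
      · filter_upwards [hε0.eventually (gt_mem_nhds (abs_pos.2 hx))] with n hn
        rw [Pi.sub_apply, hF, gradient_softThreshold_eq (hε n) hfc hn,
          indicator_of_mem (by exact hx), sub_self]
  have hfm : MemLp f 2 (weightedMeasure Ω Λ β) := by
    have h1 : HasCompactSupport f := by
      refine HasCompactSupport.of_support_subset_isCompact
        (Metric.isCompact_of_isClosed_isBounded isClosed_closure hb.closure)
        (fun x hx => subset_closure ?_)
      by_contra h
      exact hx (h0 x h)
    exact memLp_of_continuous_of_hasCompactSupport hfc h1
  refine HasH10Gradient.of_limit hfm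
    (MemLp.of_bound hmG.aestronglyMeasurable L (Eventually.of_forall hGL)) fun η hη => ?_
  have e1 := ENNReal.tendsto_nhds_zero.1 l1 η (pos_iff_ne_zero.2 hη)
  have e2 := ENNReal.tendsto_nhds_zero.1 l2 η (pos_iff_ne_zero.2 hη)
  obtain ⟨n, h1, h2⟩ := (e1.and e2).exists
  exact ⟨F n, _, hFh n, h1, h2⟩

/-- The product rule with a bounded Lipschitz factor. -/
theorem HasH10Gradient.mul_lipschitzWith (hΛ : IsMuckenhoupt Λ β CA)
    (hb : Bornology.IsBounded Ω) (hΩ : IsOpen Ω) {u : Space d → ℝ} {g : Space d → Space d}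
    (h : HasH10Gradient Ω Λ β u g) (hf : LipschitzWith L f) {B : ℝ} (hB : ∀ x, |f x| ≤ B) :
    HasH10Gradient Ω Λ β (fun x => f x * u x) (fun x => f x • g x + u x • gradient f x) := by
  have hfc := hf.continuous
  have hL := norm_gradient_le_of_lipschitzWith hf
  have hB0 : 0 ≤ B := (abs_nonneg _).trans (hB 0)
  have htest : ∀ φ, IsTestFunction Ω φ → HasH10Gradient Ω Λ β (fun x => f x * φ x)
      (fun x => f x • gradient φ x + φ x • gradient f x) := fun φ hφ => by
    obtain ⟨B', hB'⟩ := hφ.exists_bound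
    have hB'0 : 0 ≤ B' := (norm_nonneg _).trans (hB' 0).1
    have hφl : LipschitzWith B'.toNNReal φ := by
      refine lipschitzWith_of_nnnorm_fderiv_le hφ.differentiable fun x => ?_
      rw [← NNReal.coe_le_coe, coe_nnnorm, Real.coe_toNNReal _ hB'0]
      exact (hB' x).2
    have hl : LipschitzWith (B * B' + B' * L).toNNReal fun x => f x * φ x := by
      refine LipschitzWith.of_dist_le_mul fun x y => ?_
      have h1 := hφl.dist_le_mul x y
      have h2 := hf.dist_le_mul x y
      rw [Real.coe_toNNReal _ (by positivity)] at h1 ⊢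
      rw [Real.dist_eq] at h1 h2 ⊢
      calc |f x * φ x - f y * φ y| = |f x * (φ x - φ y) + φ y * (f x - f y)| := by ring_nf
        _ ≤ |f x| * |φ x - φ y| + |φ y| * |f x - f y| := by
            rw [← abs_mul, ← abs_mul]; exact abs_add_le _ _
        _ ≤ B * (B' * dist x y) + B' * (L * dist x y) := by
            gcongr
            · exact hB x
            · exact (hB' y).1
        _ = _ := by ring
    have hsub : tsupport (fun x => f x * φ x) ⊆ tsupport φ :=
      closure_mono (Function.support_mul_subset_right f φ)
    have h3 := hasH10Gradient_of_lipschitzWith_of_hasCompactSupport hΛ hb hΩ hl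
      (hφ.2.1.mono' ((subset_tsupport _).trans hsub)) (hsub.trans hφ.2.2)
    refine h3.congr_ae ae_eq_rfl ?_
    rw [Filter.EventuallyEq, weightedMeasure_ae hΛ]
    refine ae_restrict_of_ae ?_
    filter_upwards [hf.ae_differentiableAt] with x hx
    exact gradient_mul hx (hφ.differentiable x)
  have n1 : ∀ w : Space d → ℝ, eLpNorm (fun x => f x * w x) 2 (weightedMeasure Ω Λ β) ≤
      ENNReal.ofReal B * eLpNorm w 2 (weightedMeasure Ω Λ β) := fun w =>
    eLpNorm_le_mul_eLpNorm_of_ae_le_mul (Eventually.of_forall fun x => by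
      rw [norm_mul]; gcongr; exact hB x) 2
  have n2 : ∀ w : Space d → Space d, eLpNorm (fun x => f x • w x) 2 (weightedMeasure Ω Λ β) ≤
      ENNReal.ofReal B * eLpNorm w 2 (weightedMeasure Ω Λ β) := fun w =>
    eLpNorm_le_mul_eLpNorm_of_ae_le_mul (Eventually.of_forall fun x => by
      rw [norm_smul]; gcongr; exact hB x) 2
  have n3 : ∀ w : Space d → ℝ, eLpNorm (fun x => w x • gradient f x) 2
      (weightedMeasure Ω Λ β) ≤
      ENNReal.ofReal L * eLpNorm w 2 (weightedMeasure Ω Λ β) := fun w =>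
    eLpNorm_le_mul_eLpNorm_of_ae_le_mul (Eventually.of_forall fun x => by
      rw [norm_smul, mul_comm]; gcongr; exact hL x) 2
  have hmf : AEStronglyMeasurable f (weightedMeasure Ω Λ β) := hfc.aestronglyMeasurable
  have hmg : AEStronglyMeasurable (gradient f) (weightedMeasure Ω Λ β) :=
    (measurable_gradient f).aestronglyMeasurable
  have m1 : MemLp (fun x => f x * u x) 2 (weightedMeasure Ω Λ β) :=
    ⟨hmf.mul h.memLp.1, (n1 u).trans_lt (ENNReal.mul_lt_top (by simp) h.memLp.2)⟩
  have m2 : MemLp (fun x => f x • g x) 2 (weightedMeasure Ω Λ β) :=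
    ⟨hmf.smul h.memLp_grad.1, (n2 g).trans_lt (ENNReal.mul_lt_top (by simp) h.memLp_grad.2)⟩
  have m3 : MemLp (fun x => u x • gradient f x) 2 (weightedMeasure Ω Λ β) :=
    ⟨h.memLp.1.smul hmg, (n3 u).trans_lt (ENNReal.mul_lt_top (by simp) h.memLp.2)⟩
  refine HasH10Gradient.of_limit m1 (m2.add m3) fun ε hε => ?_
  have hK : ENNReal.ofReal B + ENNReal.ofReal L ≠ ⊤ := by finiteness
  obtain ⟨φ, hφ, h1, h2⟩ := h.approx (ε / (ENNReal.ofReal B + ENNReal.ofReal L))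
    (by simp [ENNReal.div_eq_zero_iff, hε])
  have hKε : (ENNReal.ofReal B + ENNReal.ofReal L) *
      (ε / (ENNReal.ofReal B + ENNReal.ofReal L)) ≤ ε := ENNReal.mul_div_le
  rw [add_mul] at hKε
  refine ⟨_, _, htest φ hφ, ?_, ?_⟩
  · have : (fun x => f x * u x) - (fun x => f x * φ x) = fun x => f x * (u - φ) x := by
      ext x; simp [mul_sub]
    rw [this]
    exact (n1 _).trans ((mul_le_mul_right h1 _).trans (le_self_add.trans hKε))
  · have : (fun x => f x • g x + u x • gradient f x) -
        (fun x => f x • gradient φ x + φ x • gradient f x) =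
        (fun x => f x • (g - gradient φ) x) + fun x => (u - φ) x • gradient f x := by
      ext1 x; simp only [Pi.sub_apply, Pi.add_apply, smul_sub, sub_smul]; abel
    have hφ1 : AEStronglyMeasurable φ (weightedMeasure Ω Λ β) :=
      hφ.1.continuous.aestronglyMeasurable
    have hφ2 : AEStronglyMeasurable (gradient φ) (weightedMeasure Ω Λ β) :=
      (continuous_gradient hφ.1).aestronglyMeasurable
    rw [this]
    refine (eLpNorm_add_le (hmf.smul (h.memLp_grad.1.sub hφ2))
      ((h.memLp.1.sub hφ1).smul hmg) one_le_two).trans (le_trans ?_ hKε)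
    exact add_le_add ((n2 _).trans (mul_le_mul_right h2 _))
      ((n3 _).trans (mul_le_mul_right h1 _))

end Lipschitz

end WeightedLOD

end

noncomputable section

namespace WeightedLOD

/-! ### The inverse inequality and local projections -/

theorem IsMuckenhoupt.lintegral_ball_le_mul {d : ℕ} {Λ : Set (Space d)} {β CA : ℝ}
    (h : IsMuckenhoupt Λ β CA) {x y : Space d} {R s : ℝ} (hs : 0 < s)
    (hsub : Metric.ball y s ⊆ Metric.ball x R) :
    ∫⁻ z in Metric.ball x R, eweight Λ β z ≤
      ENNReal.ofReal (CA * R ^ (2 * d) / (unitBallVolume d * s ^ d) ^ 2) *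
        ∫⁻ z in Metric.ball y s, eweight Λ β z := by
  have hR : 0 < R := by
    by_contra hR
    rw [Metric.ball_eq_empty.2 (not_lt.1 hR)] at hsub
    exact hsub (Metric.mem_ball_self hs)
  have hV := unitBallVolume_pos d
  have hv : 0 < unitBallVolume d * s ^ d := by positivity
  have h1 := sq_lintegral_le_of_one_le_mul (volume.restrict (Metric.ball y s)) (g := fun _ => 1)
    aemeasurable_const (measurable_eweight Λ β).aemeasurable
    (measurable_eweight Λ (-β)).aemeasurable (ae_restrict_of_ae h.one_le_mul)
  simp only [lintegral_const, one_pow, one_mul, Measure.restrict_apply_univ,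
    volume_ball_eq y hs] at h1
  rw [ENNReal.ofReal_div_of_pos (by positivity), ENNReal.ofReal_pow hv.le, div_eq_mul_inv, mul_assoc,
    mul_comm (_ ^ 2)⁻¹, ← mul_assoc, ← div_eq_mul_inv,
    ENNReal.le_div_iff_mul_le (Or.inl (by positivity)) (Or.inl (by finiteness))]
  calc _ ≤ (∫⁻ z in Metric.ball x R, eweight Λ β z) *
        ((∫⁻ z in Metric.ball y s, eweight Λ β z) *
          ∫⁻ z in Metric.ball x R, eweight Λ (-β) z) := by
        gcongr
        exact h1.trans (mul_le_mul_right (lintegral_mono_set hsub) _)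
    _ = ((∫⁻ z in Metric.ball x R, eweight Λ β z) * ∫⁻ z in Metric.ball x R, eweight Λ (-β) z) *
        ∫⁻ z in Metric.ball y s, eweight Λ β z := by ring
    _ ≤ _ := by gcongr; exact h.a2 x R hR

/-- An affine function is, on a large part of a ball, at least comparable to its value at a
nearby point. -/
theorem exists_ball_abs_affine_ge {d : ℕ} (a : Space d →ᵃ[ℝ] ℝ) {z v : Space d} {r σ : ℝ}
    (hr : 0 < r) (hv : dist v z ≤ σ * r) :
    ∃ z', Metric.ball z' (r / 8) ⊆ Metric.ball z r ∧
      ∀ x ∈ Metric.ball z' (r / 8), |a v| ≤ 8 * (1 + σ) * |a x| := by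
  set g : Space d := (InnerProductSpace.toDual ℝ (Space d)).symm a.linear.toContinuousLinearMap
    with hg
  have ha : ∀ x y, a x = a y + ⟪g, x - y⟫ := fun x y => by
    have h1 := a.linearMap_vsub x y
    simp only [vsub_eq_sub] at h1
    simp only [hg, InnerProductSpace.toDual_symm_apply, LinearMap.coe_toContinuousLinearMap', h1]
    ring
  have hin : ∀ x y, |⟪g, x - y⟫| ≤ ‖g‖ * dist x y := fun x y => by
    rw [dist_eq_norm]; exact abs_real_inner_le_norm g _
  have hσ : 0 ≤ σ := nonneg_of_mul_nonneg_left (dist_nonneg.trans hv) hr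
  have hav : |a v| ≤ |a z| + σ * (‖g‖ * r) := by
    rw [ha v z]
    refine (abs_add_le _ _).trans (add_le_add_right ?_ _)
    refine (hin v z).trans ?_
    calc ‖g‖ * dist v z ≤ ‖g‖ * (σ * r) := by gcongr
      _ = _ := by ring
  rcases le_or_gt (‖g‖ * r / 2) |a z| with h | h
  · refine ⟨z, Metric.ball_subset_ball (by linarith), fun x hx => ?_⟩
    have h1 : |a z| - ‖g‖ * (r / 8) ≤ |a x| := by
      have h2 := abs_sub_abs_le_abs_sub (a z) (a x)
      have h3 : |a z - a x| ≤ ‖g‖ * (r / 8) := by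
        rw [abs_sub_comm, ha x z, add_sub_cancel_left]
        refine (hin x z).trans ?_
        gcongr
        exact (Metric.mem_ball.1 hx).le
      linarith
    have hg0 : 0 ≤ ‖g‖ * r := by positivity
    nlinarith [abs_nonneg (a z), abs_nonneg (a x)]
  · have hg0 : 0 < ‖g‖ := by
      rcases (norm_nonneg g).eq_or_lt with h0 | h0
      · rw [← h0] at h; simp at h; exact absurd h (not_lt.2 (abs_nonneg _))
      · exact h0
    set z' := z + (3 / 4 * r / ‖g‖) • g with hz'
    have hzd : dist z' z = 3 / 4 * r := by
      rw [hz', dist_eq_norm, add_sub_cancel_left, norm_smul, Real.norm_of_nonneg (by positivity)]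
      field_simp
    refine ⟨z', Metric.ball_subset_ball' (by linarith), fun x hx => ?_⟩
    have h1 : a z' = a z + 3 / 4 * (‖g‖ * r) := by
      rw [ha z' z, hz', add_sub_cancel_left, inner_smul_right, real_inner_self_eq_norm_sq]
      field_simp
    have h2 : a z' - ‖g‖ * (r / 8) ≤ a x := by
      have h3 : |a x - a z'| ≤ ‖g‖ * (r / 8) := by
        rw [ha x z', add_sub_cancel_left]
        refine (hin x z').trans ?_
        gcongr
        exact (Metric.mem_ball.1 hx).le
      linarith [(abs_le.1 h3).1]
    have h3 : ‖g‖ * r / 8 ≤ |a x| := by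
      linarith [le_abs_self (a x), (abs_lt.1 h).1]
    have h4 : 0 < ‖g‖ * r := by positivity
    nlinarith

namespace Mesh

variable {d : ℕ} {Ω Λ : Set (Space d)} {β CA H σ : ℝ} {M : Mesh Ω}

/-- The inverse inequality for the values of finite element functions at interior nodes. -/
theorem exists_inverse_inequality (d : ℕ) (CA : ℝ) {σ ρ : ℝ} (hσ : 1 ≤ σ) (hρ : 0 < ρ) :
    ∃ C : NNReal, ∀ {Ω Λ : Set (Space d)} {β : ℝ} {M : Mesh Ω} {H : ℝ}, IsLipschitzDomain Ω →
      IsMuckenhoupt Λ β CA → M.IsQuasiUniform H σ → ∀ p ∈ M.coarseSpace, ∀ v ∈ M.innerNodes,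
      ‖p v‖ₑ ^ 2 * ∫⁻ x in Metric.ball v (ρ * H), eweight Λ β x ≤
        C * ∫⁻ x in M.patch v 0, ‖p x‖ₑ ^ 2 ∂weightedMeasure Ω Λ β := by
  have hV := unitBallVolume_pos d
  refine ⟨Real.toNNReal (CA * (ρ + 2) ^ (2 * d) * (8 * σ) ^ (2 * d) / unitBallVolume d ^ 2) *
    Real.toNNReal (8 * (1 + σ)) ^ 2, fun {Ω Λ β M H} hΩ hΛ hM p hp v hv => ?_⟩
  obtain ⟨hvv, hvΩ⟩ := mem_innerNodes.1 hv
  obtain ⟨t, ht, hvt⟩ := exists_cell_of_mem_vertices hvv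
  have hH := hM.1
  obtain ⟨z, hz⟩ := (hM.2 t ht).2
  obtain ⟨a, ha⟩ := hp.1 t ht
  have hvc : v ∈ convexHull ℝ (t : Set (Space d)) := corner_mem_cell hvt
  have hr : 0 < H / σ := by positivity
  have hzc := hz (Metric.mem_closedBall_self hr.le)
  obtain ⟨z', hz', hza⟩ := exists_ball_abs_affine_ge a (z := z) (v := v) (σ := σ) hr
    ((hM.dist_le ht hvc hzc).trans_eq (by field_simp))
  have hbc : Metric.ball z' (H / σ / 8) ⊆ convexHull ℝ (t : Set (Space d)) :=
    hz'.trans (Metric.ball_subset_closedBall.trans hz)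
  have hbΩ : Metric.ball z' (H / σ / 8) ⊆ Ω :=
    (interior_maximal hbc Metric.isOpen_ball).trans (interior_cell_subset hΩ ht)
  have hbp : Metric.ball z' (H / σ / 8) ⊆ M.patch v 0 := fun x hx =>
    ⟨mem_biUnion (show t ∈ {t | t ∈ M.cells ∧ v ∈ t} from ⟨ht, hvt⟩) (hbc hx), hbΩ hx⟩
  have hσH : H / σ / 8 ≤ H := by
    rw [div_div, div_le_iff₀ (by positivity)]; nlinarith
  have hz'c : z' ∈ convexHull ℝ (t : Set (Space d)) := hbc (Metric.mem_ball_self (by positivity))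
  have hdz : dist z' v ≤ H := hM.dist_le ht hz'c hvc
  have hsub : Metric.ball z' (H / σ / 8) ⊆ Metric.ball v ((ρ + 2) * H) :=
    Metric.ball_subset_ball' (by nlinarith)
  have hW := hΛ.lintegral_ball_le_mul (by positivity) hsub
  have hconst : CA * ((ρ + 2) * H) ^ (2 * d) / (unitBallVolume d * (H / σ / 8) ^ d) ^ 2 =
      CA * (ρ + 2) ^ (2 * d) * (8 * σ) ^ (2 * d) / unitBallVolume d ^ 2 := by
    have e1 : (H / σ / 8) = H / (8 * σ) := by field_simp
    rw [e1, mul_pow, mul_pow, div_pow, div_pow, ← pow_mul, ← pow_mul, mul_comm d 2]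
    field_simp
  rw [hconst] at hW
  have h1 : ‖p v‖ₑ ^ 2 * ∫⁻ x in Metric.ball z' (H / σ / 8), eweight Λ β x ≤
      ENNReal.ofReal (8 * (1 + σ)) ^ 2 *
        ∫⁻ x in M.patch v 0, ‖p x‖ₑ ^ 2 ∂weightedMeasure Ω Λ β := by
    calc ‖p v‖ₑ ^ 2 * ∫⁻ x in Metric.ball z' (H / σ / 8), eweight Λ β x
        = ∫⁻ x in Metric.ball z' (H / σ / 8), ‖p v‖ₑ ^ 2 * eweight Λ β x :=
          (lintegral_const_mul _ (measurable_eweight Λ β)).symm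
      _ ≤ ∫⁻ x in Metric.ball z' (H / σ / 8),
            ENNReal.ofReal (8 * (1 + σ)) ^ 2 * (‖p x‖ₑ ^ 2 * eweight Λ β x) := by
          refine setLIntegral_mono' Metric.isOpen_ball.measurableSet fun x hx => ?_
          rw [← mul_assoc, ← mul_pow]
          gcongr
          rw [ha hvc, ha (hbc hx), ← ofReal_norm, ← ofReal_norm,
            ← ENNReal.ofReal_mul (by positivity)]
          exact ENNReal.ofReal_le_ofReal (hza x hx)
      _ = ENNReal.ofReal (8 * (1 + σ)) ^ 2 *
            ∫⁻ x in Metric.ball z' (H / σ / 8), ‖p x‖ₑ ^ 2 ∂weightedMeasure Ω Λ β := by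
          rw [lintegral_const_mul' _ _ (by finiteness),
            setLIntegral_weightedMeasure Metric.isOpen_ball.measurableSet, inter_eq_left.2 hbΩ]
      _ ≤ _ := by gcongr
  calc ‖p v‖ₑ ^ 2 * ∫⁻ x in Metric.ball v (ρ * H), eweight Λ β x
      ≤ ‖p v‖ₑ ^ 2 * ∫⁻ x in Metric.ball v ((ρ + 2) * H), eweight Λ β x := by
        gcongr; linarith
    _ ≤ ‖p v‖ₑ ^ 2 * _ := mul_le_mul_right hW _
    _ = _ := mul_left_comm _ _ _
    _ ≤ _ := mul_le_mul_right h1 _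
    _ = _ := by
        rw [ENNReal.coe_mul, ENNReal.coe_pow, mul_assoc (ENNReal.ofNNReal _)]; rfl

theorem memLp_of_mem_coarseSpace (hΛ : IsMuckenhoupt Λ β CA) (hΩ : IsLipschitzDomain Ω)
    {p : Space d → ℝ} (hp : p ∈ M.coarseSpace) : MemLp p 2 (weightedMeasure Ω Λ β) := by
  have := isFiniteMeasure_weightedMeasure hΛ hΩ.isBounded
  obtain ⟨L, hL⟩ := exists_lipschitzWith_of_mem_coarseSpace hΩ.isOpen hp
  refine memLp_of_continuous_of_hasCompactSupport hL.continuous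
    (HasCompactSupport.of_support_subset_isCompact (Metric.isCompact_of_isClosed_isBounded
      isClosed_closure hΩ.isBounded.closure) (fun x hx => subset_closure ?_))
  by_contra h
  exact hx (hp.2 x h)

theorem isLocalProjection_iff (hΩ : IsOpen Ω) {v : Space d} {u p : Space d → ℝ} :
    M.IsLocalProjection Λ β v u p ↔ p ∈ M.coarseSpace ∧ ∀ q ∈ M.coarseSpace,
      ∫ x in M.patch v 0, p x * q x ∂weightedMeasure Ω Λ β =
        ∫ x in M.patch v 0, u x * q x ∂weightedMeasure Ω Λ β := by
  have h : ∀ f q : Space d → ℝ, ∫ x in M.patch v 0, f x * q x ∂weightedMeasure Ω Λ β =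
      ∫ x in M.patch v 0, f x * q x * weight Λ β x := fun f q => by
    rw [integral_weightedMeasure (measurableSet_patch hΩ v 0) (patch_subset v 0)]
    simp only [smul_eq_mul, mul_comm (weight Λ β _)]
  simp only [IsLocalProjection, h]

theorem finiteDimensional_coarseSubmodule (hΩ : interior (closure Ω) = Ω) :
    FiniteDimensional ℝ M.coarseSubmodule := by
  have := FiniteDimensional.span_of_finite ℝ (M.innerNodes.finite_toSet.image M.hat)
  refine Submodule.finiteDimensional_of_le
    (S₂ := Submodule.span ℝ (M.hat '' (M.innerNodes : Set (Space d)))) fun p hp => ?_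
  have h : p = ∑ v ∈ M.innerNodes, p v • M.hat v := by
    ext x
    rw [coarseSpace_eq_sum hp hΩ x]
    simp
  rw [h]
  exact Submodule.sum_mem _ fun v hv =>
    Submodule.smul_mem _ _ (Submodule.subset_span (mem_image_of_mem _ hv))

theorem exists_isLocalProjection (hΛ : IsMuckenhoupt Λ β CA) (hΩ : IsLipschitzDomain Ω)
    (v : Space d) {u : Space d → ℝ} (hu : MemLp u 2 (weightedMeasure Ω Λ β)) :
    ∃ p, M.IsLocalProjection Λ β v u p ∧
      ∫⁻ x in M.patch v 0, ‖p x‖ₑ ^ 2 ∂weightedMeasure Ω Λ β ≤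
        ∫⁻ x in M.patch v 0, ‖u x‖ₑ ^ 2 ∂weightedMeasure Ω Λ β := by
  set ν := (weightedMeasure Ω Λ β).restrict (M.patch v 0) with hν
  have hm : ∀ p : M.coarseSubmodule, MemLp (p : Space d → ℝ) 2 ν := fun p =>
    (memLp_of_mem_coarseSpace hΛ hΩ p.2).restrict _
  have := finiteDimensional_coarseSubmodule (M := M) hΩ.interior_closure_eq
  set T : M.coarseSubmodule →ₗ[ℝ] Lp ℝ 2 ν :=
    { toFun := fun p => (hm p).toLp
      map_add' := fun p q => MemLp.toLp_add (hm p) (hm q)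
      map_smul' := fun c p => MemLp.toLp_const_smul c (hm p) } with hT
  set U := (hu.restrict (M.patch v 0)).toLp with hU
  obtain ⟨p, hp⟩ := (LinearMap.range T).starProjection_apply_mem U
  have hpT : T p = (hm p).toLp := rfl
  refine ⟨p, (isLocalProjection_iff hΩ.isOpen).2 ⟨p.2, fun q hq => ?_⟩, ?_⟩
  · have h1 := (LinearMap.range T).starProjection_inner_eq_zero U (T ⟨q, hq⟩) ⟨_, rfl⟩
    rw [← hp, inner_sub_left, sub_eq_zero, L2.inner_def, L2.inner_def] at h1
    have hqT : T ⟨q, hq⟩ = (hm ⟨q, hq⟩).toLp := rfl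
    rw [hpT, hqT] at h1
    have e1 := (hm p).coeFn_toLp
    have e2 := (hm ⟨q, hq⟩).coeFn_toLp
    have e3 := (hu.restrict (M.patch v 0)).coeFn_toLp
    calc ∫ x, (p : Space d → ℝ) x * q x ∂ν = _ := integral_congr_ae (by
          filter_upwards [e1, e2] with x h1 h2
          rw [h1, h2]; exact mul_comm _ _)
      _ = _ := h1.symm
      _ = _ := integral_congr_ae (by
          filter_upwards [e3, e2] with x h1 h2
          rw [h1, h2]; exact mul_comm _ _)
  · rw [← eLpNorm_two_sq, ← eLpNorm_two_sq]
    gcongr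
    rw [← Lp.enorm_toLp (hm p), ← Lp.enorm_toLp (hu.restrict (M.patch v 0)), ← hpT, hp,
      ← ofReal_norm, ← ofReal_norm]
    exact ENNReal.ofReal_le_ofReal ((LinearMap.range T).norm_starProjection_apply_le U)

theorem IsLocalProjection.sub {v : Space d} (hΛ : IsMuckenhoupt Λ β CA)
    (hΩ : IsLipschitzDomain Ω) {u u' p p' : Space d → ℝ}
    (hu : MemLp u 2 (weightedMeasure Ω Λ β)) (hu' : MemLp u' 2 (weightedMeasure Ω Λ β))
    (h : M.IsLocalProjection Λ β v u p) (h' : M.IsLocalProjection Λ β v u' p') :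
    M.IsLocalProjection Λ β v (u - u') (p - p') := by
  rw [isLocalProjection_iff hΩ.isOpen] at *
  have hi : ∀ w q : Space d → ℝ, MemLp w 2 (weightedMeasure Ω Λ β) → q ∈ M.coarseSpace →
      IntegrableOn (fun x => w x * q x) (M.patch v 0) (weightedMeasure Ω Λ β) := fun w q hw hq =>
    (hw.integrable_mul (memLp_of_mem_coarseSpace hΛ hΩ hq)).integrableOn
  refine ⟨M.coarseSubmodule.sub_mem h.1 h'.1, fun q hq => ?_⟩
  have m := memLp_of_mem_coarseSpace hΛ hΩ h.1
  have m' := memLp_of_mem_coarseSpace hΛ hΩ h'.1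
  simp only [Pi.sub_apply, sub_mul]
  rw [integral_sub (hi _ q m hq) (hi _ q m' hq), integral_sub (hi _ q hu hq) (hi _ q hu' hq),
    h.2 q hq, h'.2 q hq]

theorem IsLocalProjection.const_smul {v : Space d} (hΩ : IsOpen Ω) {u p : Space d → ℝ} (c : ℝ)
    (h : M.IsLocalProjection Λ β v u p) : M.IsLocalProjection Λ β v (c • u) (c • p) := by
  rw [isLocalProjection_iff hΩ] at *
  refine ⟨M.coarseSubmodule.smul_mem c h.1, fun q hq => ?_⟩
  simp only [Pi.smul_apply, smul_eq_mul, mul_assoc, integral_const_mul, h.2 q hq]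

theorem isLocalProjection_localProjection (hΛ : IsMuckenhoupt Λ β CA) (hΩ : IsLipschitzDomain Ω)
    (v : Space d) {u : Space d → ℝ} (hu : MemLp u 2 (weightedMeasure Ω Λ β)) :
    M.IsLocalProjection Λ β v u (M.localProjection Λ β v u) := by
  obtain ⟨p, hp, -⟩ := exists_isLocalProjection (M := M) hΛ hΩ v hu
  have h : ∃ p, M.IsLocalProjection Λ β v u p := ⟨p, hp⟩
  rw [localProjection, dif_pos h]
  exact h.choose_spec

/-- Local projections are unique at the central node. -/
theorem IsLocalProjection.apply_eq (hσ : 1 ≤ σ) (hM : M.IsQuasiUniform H σ)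
    (hΛ : IsMuckenhoupt Λ β CA) (hΩ : IsLipschitzDomain Ω) {v : Space d} (hv : v ∈ M.innerNodes)
    {u p p' : Space d → ℝ} (hu : MemLp u 2 (weightedMeasure Ω Λ β))
    (h : M.IsLocalProjection Λ β v u p) (h' : M.IsLocalProjection Λ β v u p') : p v = p' v := by
  have h1 := IsLocalProjection.sub hΛ hΩ hu hu h h'
  rw [isLocalProjection_iff hΩ.isOpen] at h1
  have h2 := h1.2 _ h1.1
  simp only [sub_self, Pi.zero_apply, zero_mul, integral_zero] at h2
  have m := memLp_of_mem_coarseSpace (Λ := Λ) hΛ hΩ h1.1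
  rw [integral_eq_zero_iff_of_nonneg (fun x => mul_self_nonneg _)
    (m.integrable_mul m).integrableOn] at h2
  obtain ⟨C, hC⟩ := exists_inverse_inequality d CA hσ one_pos
  have h3 := hC hΩ hΛ hM _ h1.1 v hv
  have h5 : ∫⁻ x in M.patch v 0, ‖(p - p') x‖ₑ ^ 2 ∂weightedMeasure Ω Λ β = 0 := by
    rw [← lintegral_zero]
    refine lintegral_congr_ae ?_
    filter_upwards [h2] with x hx
    have : (p - p') x = 0 := by simpa using hx
    simp [this]
  have h4 := hΛ.lintegral_ball_pos v (R := 1 * H) (by linarith [hM.1])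
  rw [h5, mul_zero, le_zero_iff, mul_eq_zero, or_iff_left h4.ne', pow_eq_zero_iff two_ne_zero,
    enorm_eq_zero] at h3
  exact sub_eq_zero.1 h3

theorem localProjection_sub (hσ : 1 ≤ σ) (hM : M.IsQuasiUniform H σ)
    (hΛ : IsMuckenhoupt Λ β CA) (hΩ : IsLipschitzDomain Ω) {v : Space d} (hv : v ∈ M.innerNodes)
    {u u' : Space d → ℝ} (hu : MemLp u 2 (weightedMeasure Ω Λ β))
    (hu' : MemLp u' 2 (weightedMeasure Ω Λ β)) :
    M.localProjection Λ β v (u - u') v =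
      M.localProjection Λ β v u v - M.localProjection Λ β v u' v :=
  IsLocalProjection.apply_eq hσ hM hΛ hΩ hv (hu.sub hu')
    (isLocalProjection_localProjection hΛ hΩ v (hu.sub hu'))
    (IsLocalProjection.sub hΛ hΩ hu hu' (isLocalProjection_localProjection hΛ hΩ v hu)
      (isLocalProjection_localProjection hΛ hΩ v hu'))

theorem localProjection_const_smul (hσ : 1 ≤ σ) (hM : M.IsQuasiUniform H σ)
    (hΛ : IsMuckenhoupt Λ β CA) (hΩ : IsLipschitzDomain Ω) {v : Space d} (hv : v ∈ M.innerNodes)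
    {u : Space d → ℝ} (hu : MemLp u 2 (weightedMeasure Ω Λ β)) (c : ℝ) :
    M.localProjection Λ β v (c • u) v = c * M.localProjection Λ β v u v :=
  IsLocalProjection.apply_eq hσ hM hΛ hΩ hv (hu.const_smul c)
    (isLocalProjection_localProjection hΛ hΩ v (hu.const_smul c))
    (IsLocalProjection.const_smul hΩ.isOpen c (isLocalProjection_localProjection hΛ hΩ v hu))

theorem localProjection_of_mem_coarseSpace (hσ : 1 ≤ σ) (hM : M.IsQuasiUniform H σ)
    (hΛ : IsMuckenhoupt Λ β CA) (hΩ : IsLipschitzDomain Ω) {v : Space d} (hv : v ∈ M.innerNodes)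
    {p : Space d → ℝ} (hp : p ∈ M.coarseSpace) : M.localProjection Λ β v p v = p v :=
  have hm := memLp_of_mem_coarseSpace hΛ hΩ hp
  IsLocalProjection.apply_eq hσ hM hΛ hΩ hv hm
    (isLocalProjection_localProjection hΛ hΩ v hm) ⟨hp, fun _ _ => rfl⟩

theorem localProjection_congr (hσ : 1 ≤ σ) (hM : M.IsQuasiUniform H σ)
    (hΛ : IsMuckenhoupt Λ β CA) (hΩ : IsLipschitzDomain Ω) {v : Space d} (hv : v ∈ M.innerNodes)
    {u u' : Space d → ℝ} (hu : MemLp u 2 (weightedMeasure Ω Λ β))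
    (hu' : MemLp u' 2 (weightedMeasure Ω Λ β))
    (h : ∀ᵐ x ∂weightedMeasure Ω Λ β, x ∈ M.patch v 0 → u x = u' x) :
    M.localProjection Λ β v u v = M.localProjection Λ β v u' v := by
  refine IsLocalProjection.apply_eq hσ hM hΛ hΩ hv hu
    (isLocalProjection_localProjection hΛ hΩ v hu) ?_
  have h1 := isLocalProjection_localProjection (M := M) hΛ hΩ v hu'
  rw [isLocalProjection_iff hΩ.isOpen] at h1 ⊢
  refine ⟨h1.1, fun q hq => (h1.2 q hq).trans (setIntegral_congr_ae
    (measurableSet_patch hΩ.isOpen v 0) ?_)⟩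
  filter_upwards [h] with x hx hxp
  rw [hx hxp]

theorem exists_localProjection_le (d : ℕ) (CA : ℝ) {σ ρ : ℝ} (hσ : 1 ≤ σ) (hρ : 0 < ρ) :
    ∃ C : NNReal, ∀ {Ω Λ : Set (Space d)} {β : ℝ} {M : Mesh Ω} {H : ℝ}, IsLipschitzDomain Ω →
      IsMuckenhoupt Λ β CA → M.IsQuasiUniform H σ → ∀ u, MemLp u 2 (weightedMeasure Ω Λ β) →
      ∀ v ∈ M.innerNodes,
      ‖M.localProjection Λ β v u v‖ₑ ^ 2 * ∫⁻ x in Metric.ball v (ρ * H), eweight Λ β x ≤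
        C * ∫⁻ x in M.patch v 0, ‖u x‖ₑ ^ 2 ∂weightedMeasure Ω Λ β := by
  obtain ⟨C, hC⟩ := exists_inverse_inequality d CA hσ hρ
  refine ⟨C, fun {Ω Λ β M H} hΩ hΛ hM u hu v hv => ?_⟩
  obtain ⟨p, hp, hle⟩ := exists_isLocalProjection (M := M) hΛ hΩ v hu
  rw [IsLocalProjection.apply_eq hσ hM hΛ hΩ hv hu
    (isLocalProjection_localProjection hΛ hΩ v hu) hp]
  exact (hC hΩ hΛ hM p hp.1 v hv).trans (mul_le_mul_right hle _)

theorem quasiInterpolation_apply_node {u : Space d → ℝ} {v : Space d} (hv : v ∈ M.innerNodes) :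
    M.quasiInterpolation Λ β u v = M.localProjection Λ β v u v := by
  rw [quasiInterpolation, Finset.sum_eq_single_of_mem v hv fun w hw hwv => ?_,
    hat_self (mem_innerNodes.1 hv).1, mul_one]
  rw [hat_ne (mem_innerNodes.1 hv).1 hwv, mul_zero]

/-- The kernel of the quasi-interpolation. -/
theorem quasiInterpolation_eq_zero_iff {u : Space d → ℝ} :
    (∀ x, M.quasiInterpolation Λ β u x = 0) ↔
      ∀ v ∈ M.innerNodes, M.localProjection Λ β v u v = 0 := by
  constructor
  · intro h v hv
    rw [← quasiInterpolation_apply_node hv, h v]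
  · intro h x
    exact Finset.sum_eq_zero fun v hv => by rw [h v hv, zero_mul]

theorem quasiInterpolation_mem_coarseSpace (hΩ : interior (closure Ω) = Ω) (u : Space d → ℝ) :
    M.quasiInterpolation Λ β u ∈ M.coarseSpace := by
  have h : M.quasiInterpolation Λ β u =
      ∑ v ∈ M.innerNodes, M.localProjection Λ β v u v • M.hat v := by
    ext x; simp [quasiInterpolation]
  rw [h, ← mem_coarseSubmodule]
  exact Submodule.sum_mem _ fun v hv => Submodule.smul_mem _ _
    (hat_mem_coarseSpace hΩ (mem_innerNodes.1 hv).2)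

end Mesh

end WeightedLOD

end

noncomputable section

namespace WeightedLOD

/-! ### The Poincaré inequality for fine-scale functions -/

theorem enorm_add_sq_le {F : Type*} [NormedAddCommGroup F] (a b : F) :
    ‖a + b‖ₑ ^ 2 ≤ 2 * ‖a‖ₑ ^ 2 + 2 * ‖b‖ₑ ^ 2 := by
  rw [← ofReal_norm, ← ofReal_norm, ← ofReal_norm, ← ENNReal.ofReal_pow (norm_nonneg _),
    ← ENNReal.ofReal_pow (norm_nonneg _), ← ENNReal.ofReal_pow (norm_nonneg _),
    ← ENNReal.ofReal_ofNat, ← ENNReal.ofReal_mul (by norm_num), ← ENNReal.ofReal_mul (by norm_num),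
    ← ENNReal.ofReal_add (by positivity) (by positivity)]
  refine ENNReal.ofReal_le_ofReal ?_
  have := norm_add_le a b
  nlinarith [norm_nonneg (a + b), sq_nonneg (‖a‖ - ‖b‖)]

theorem lintegral_enorm_add_sq_le {α F : Type*} [MeasurableSpace α] [NormedAddCommGroup F]
    {μ : Measure α} {f : α → F} (hf : AEStronglyMeasurable f μ) (g : α → F) :
    ∫⁻ x, ‖f x + g x‖ₑ ^ 2 ∂μ ≤ 2 * ∫⁻ x, ‖f x‖ₑ ^ 2 ∂μ + 2 * ∫⁻ x, ‖g x‖ₑ ^ 2 ∂μ := by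
  rw [← lintegral_const_mul' _ _ (by simp), ← lintegral_const_mul' _ _ (by simp),
    ← lintegral_add_left' ((hf.enorm.pow_const 2).const_mul 2)]
  exact lintegral_mono fun x => enorm_add_sq_le _ _

theorem le_of_forall_le_add_mul_sq {a b K : ENNReal} (hK : K ≠ ⊤)
    (h : ∀ ε, ε ≠ 0 → a ≤ b + K * ε ^ 2) : a ≤ b := by
  have h1 : Tendsto (fun n : ℕ => b + K * ((n : ENNReal)⁻¹) ^ 2) atTop (𝓝 (b + K * 0 ^ 2)) :=
    tendsto_const_nhds.add (ENNReal.Tendsto.const_mul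
      (((ENNReal.continuous_pow 2).tendsto _).comp ENNReal.tendsto_inv_nat_nhds_zero) (Or.inr hK))
  have h2 := ge_of_tendsto' h1 fun n => h _ (by simp)
  simpa using h2

theorem inter_frontier_nonempty_of_isPreconnected {α : Type*} [TopologicalSpace α]
    {t s : Set α}
    (ht : IsPreconnected t) (h : (t ∩ s).Nonempty) (h' : (t ∩ sᶜ).Nonempty) :
    (t ∩ frontier s).Nonempty := by
  by_contra hne
  rw [not_nonempty_iff_eq_empty] at hne
  have hf : ∀ x ∈ t, x ∉ frontier s := fun x hx hxf => by
    have : x ∈ t ∩ frontier s := ⟨hx, hxf⟩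
    simp [hne] at this
  obtain ⟨x, hx, hxs⟩ := h
  obtain ⟨y, hy, hys⟩ := h'
  have hi : ∀ z ∈ t, z ∈ closure s → z ∈ interior s := fun z hz hzs => by
    by_contra hzi
    exact hf z hz ⟨hzs, hzi⟩
  obtain ⟨z, -, hz1, hz2⟩ := ht (interior s) (closure s)ᶜ isOpen_interior
    isClosed_closure.isOpen_compl (fun z hz => (em (z ∈ closure s)).imp (hi z hz) id)
    ⟨x, hx, hi x hx (subset_closure hxs)⟩
    ⟨y, hy, fun hyc => hys (interior_subset (hi y hy hyc))⟩
  exact hz2 (interior_subset_closure hz1)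

section Poincare

variable {d : ℕ} {Ω Λ : Set (Space d)} {β CA : ℝ}

theorem HasH10Gradient.poincare_ball (hΛ : IsMuckenhoupt Λ β CA) (hΩ : IsOpen Ω)
    {u : Space d → ℝ} {g : Space d → Space d}
    (h : HasH10Gradient Ω Λ β u g) {x₀ y₀ : Space d} {R κ : ℝ} (hR : 0 < R) (hκ : 0 < κ)
    (hE : Metric.ball y₀ (κ * R) ⊆ Metric.ball x₀ R) {ε : ENNReal} (hε : ε ≠ 0) :
    ∃ c : ℝ, (Disjoint (Metric.ball y₀ (κ * R)) Ω → c = 0) ∧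
      ∫⁻ x in Metric.ball x₀ R, ‖u x - c‖ₑ ^ 2 ∂weightedMeasure Ω Λ β ≤
        4 * ENNReal.ofReal (4 * CA * 4 ^ (2 * d) / (unitBallVolume d * κ ^ d) ^ 2 * R ^ 2) *
          ∫⁻ x in Metric.ball x₀ R, ‖g x‖ₑ ^ 2 ∂weightedMeasure Ω Λ β +
        (2 + 4 * ENNReal.ofReal
          (4 * CA * 4 ^ (2 * d) / (unitBallVolume d * κ ^ d) ^ 2 * R ^ 2)) * ε ^ 2 := by
  set P := ENNReal.ofReal (4 * CA * 4 ^ (2 * d) / (unitBallVolume d * κ ^ d) ^ 2 * R ^ 2) with hP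
  set μ := weightedMeasure Ω Λ β with hμ
  obtain ⟨φ, hφ, h1, h2⟩ := h.approx ε hε
  obtain ⟨c, hc, hle⟩ := hΛ.poincare_ball (hφ.1.of_le (by simp)) hR hκ hE
  have hB : MeasurableSet (Metric.ball x₀ R) := Metric.isOpen_ball.measurableSet
  refine ⟨c, fun hd => hc fun y hy => hφ.eq_zero (disjoint_left.1 hd hy), ?_⟩
  have s1 : ∫⁻ x in Metric.ball x₀ R, ‖(u - φ) x‖ₑ ^ 2 ∂μ ≤ ε ^ 2 := by
    refine (setLIntegral_le_lintegral _ _).trans ?_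
    rw [← eLpNorm_two_sq]
    gcongr
  have s2 : ∫⁻ x in Metric.ball x₀ R, ‖(g - gradient φ) x‖ₑ ^ 2 ∂μ ≤ ε ^ 2 := by
    refine (setLIntegral_le_lintegral _ _).trans ?_
    rw [← eLpNorm_two_sq]
    gcongr
  have hφm : AEStronglyMeasurable φ μ := hφ.1.continuous.aestronglyMeasurable
  have hgm : AEStronglyMeasurable (gradient φ) μ :=
    (continuous_gradient hφ.1).aestronglyMeasurable
  have s3 : ∫⁻ x in Metric.ball x₀ R, ‖φ x - c‖ₑ ^ 2 ∂μ ≤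
      P * ∫⁻ x in Metric.ball x₀ R, ‖gradient φ x‖ₑ ^ 2 ∂μ := by
    rw [setLIntegral_weightedMeasure hB, setLIntegral_weightedMeasure_of_eq_zero hB
      hΩ.measurableSet (fun x hx => by simp [hφ.gradient_eq_zero hx])]
    refine (lintegral_mono_set inter_subset_left).trans ?_
    simpa only [enorm_gradient] using hle
  have s4 : ∫⁻ x in Metric.ball x₀ R, ‖gradient φ x‖ₑ ^ 2 ∂μ ≤
      2 * ∫⁻ x in Metric.ball x₀ R, ‖g x‖ₑ ^ 2 ∂μ + 2 * ε ^ 2 := by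
    have := lintegral_enorm_add_sq_le (μ := μ.restrict (Metric.ball x₀ R)) (f := g)
      h.memLp_grad.1.restrict (fun x => -(g - gradient φ) x)
    simp only [Pi.sub_apply, neg_sub, add_sub_cancel] at this
    refine this.trans (add_le_add_right (mul_le_mul_right ?_ _) _)
    refine le_trans (le_of_eq ?_) s2
    refine lintegral_congr fun x => ?_
    rw [Pi.sub_apply, ← neg_sub, enorm_neg]
  have s5 := lintegral_enorm_add_sq_le (μ := μ.restrict (Metric.ball x₀ R)) (f := u - φ)
    (h.memLp.1.sub hφm).restrict (fun x => φ x - c)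
  simp only [Pi.sub_apply, sub_add_sub_cancel] at s5
  calc _ ≤ _ := s5
    _ ≤ 2 * ε ^ 2 + 2 * (P * (2 * ∫⁻ x in Metric.ball x₀ R, ‖g x‖ₑ ^ 2 ∂μ + 2 * ε ^ 2)) := by
        gcongr
        · exact s1
        · exact s3.trans (mul_le_mul_right s4 _)
    _ = _ := by ring

end Poincare

namespace Mesh

variable {d : ℕ} {Ω Λ : Set (Space d)} {β CA H σ : ℝ} {M : Mesh Ω}

theorem IsQuasiUniform.le_diam (hd : 0 < d) (hσ : 1 ≤ σ) (hΩ : IsLipschitzDomain Ω)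
    (hM : M.IsQuasiUniform H σ) : H ≤ σ * Metric.diam (closure Ω) := by
  obtain ⟨x, hx⟩ := hΩ.isConnected.nonempty
  obtain ⟨t, ht, hxt⟩ := M.exists_cell (subset_closure hx)
  obtain ⟨z, hz⟩ := (hM.2 t ht).2
  have hr : 0 < H / σ := div_pos hM.1 (by linarith)
  have h1 : z + EuclideanSpace.single ⟨0, hd⟩ (H / σ) ∈ Metric.closedBall z (H / σ) := by
    rw [mem_closedBall_iff_norm, add_sub_cancel_left, PiLp.norm_single, Real.norm_of_nonneg hr.le]
  have h2 := Metric.dist_le_diam_of_mem hΩ.isBounded.closure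
    (cell_subset_closure ht (hz h1)) (cell_subset_closure ht (hz (Metric.mem_closedBall_self hr.le)))
  rw [dist_eq_norm, add_sub_cancel_left, PiLp.norm_single,
    Real.norm_of_nonneg hr.le, div_le_iff₀' (by linarith)] at h2
  exact h2

/-- The sum of the nodal basis functions is one away from the boundary. -/
theorem sum_hat_eq_one {t : Finset (Space d)} (ht : t ∈ M.cells) (htΩ : (t : Set (Space d)) ⊆ Ω)
    {y : Space d} (hy : y ∈ convexHull ℝ (t : Set (Space d))) :
    ∑ v ∈ M.innerNodes, M.hat v y = 1 := by
  have hsub : t ⊆ M.innerNodes := fun p hp =>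
    mem_innerNodes.2 ⟨corner_mem_vertices ht hp, htΩ hp⟩
  rw [← Finset.sum_subset hsub fun p _ hp => by
    rw [hat_eq_bary ht hy, bary_of_notMem hp]]
  simp only [hat_eq_bary ht hy]
  exact sum_bary y

theorem exists_fine_poincare_ball (hd : 0 < d) (hΩ : IsLipschitzDomain Ω) (CA : ℝ)
    (hσ : 1 ≤ σ) : ∃ C : NNReal, ∀ {Λ : Set (Space d)} {β : ℝ} {M : Mesh Ω} {H : ℝ},
      IsMuckenhoupt Λ β CA → M.IsQuasiUniform H σ → ∀ {u : Space d → ℝ} {g : Space d → Space d},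
      HasH10Gradient Ω Λ β u g → (∀ v ∈ M.innerNodes, M.localProjection Λ β v u v = 0) →
      ∀ x, ∫⁻ y in Metric.ball x H, ‖u y‖ₑ ^ 2 ∂weightedMeasure Ω Λ β ≤
        C * ENNReal.ofReal (H ^ 2) *
          ∫⁻ y in Metric.ball x (4 * H), ‖g y‖ₑ ^ 2 ∂weightedMeasure Ω Λ β := by
  have hV := unitBallVolume_pos d
  obtain ⟨C₁, hC₁⟩ := exists_localProjection_le d CA hσ two_pos
  obtain ⟨c₀, hc₀, hext⟩ := hΩ.exists_exterior_ball (max (σ * Metric.diam (closure Ω)) 1)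
    (by positivity)
  set P₁ := Real.toNNReal (4 * CA * 4 ^ (2 * d) / (unitBallVolume d * 1 ^ d) ^ 2 * 9) with hP₁
  set P₂ := Real.toNNReal (4 * CA * 4 ^ (2 * d) / (unitBallVolume d * (c₀ / 4) ^ d) ^ 2 * 16)
    with hP₂
  refine ⟨(2 + 2 * C₁) * (4 * P₁) + 4 * P₂, fun {Λ β M H} hΛ hM u g h hu x => ?_⟩
  have hH := hM.1
  set μ := weightedMeasure Ω Λ β with hμ
  have hmu : AEStronglyMeasurable u μ := h.memLp.1
  push_cast
  by_cases hxB : Metric.ball x (3 * H) ⊆ Ω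
  · -- interior balls
    refine le_trans ?_ (mul_le_mul_left (mul_le_mul_left le_self_add _) _)
    refine le_of_forall_le_add_mul_sq (K := (2 + 2 * C₁) * (2 + 4 * (P₁ * ENNReal.ofReal (H ^ 2))))
      (by finiteness) fun ε hε => ?_
    obtain ⟨c, -, hc⟩ := h.poincare_ball hΛ hΩ.isOpen (x₀ := x) (y₀ := x) (R := 3 * H) (κ := 1)
      (by positivity) one_pos (by rw [one_mul]) hε
    have hPe : ENNReal.ofReal (4 * CA * 4 ^ (2 * d) / (unitBallVolume d * 1 ^ d) ^ 2 *
        (3 * H) ^ 2) = P₁ * ENNReal.ofReal (H ^ 2) := by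
      rw [hP₁, ← ENNReal.ofReal, ← ENNReal.ofReal_mul' (by positivity)]
      congr 1; ring
    rw [hPe] at hc
    have hxΩ : x ∈ Ω := hxB (Metric.mem_ball_self (by positivity))
    obtain ⟨t, ht, hxt⟩ := M.exists_cell (subset_closure hxΩ)
    obtain ⟨v, hvt⟩ : t.Nonempty := by
      rw [← Finset.card_pos, ht.2]; omega
    have hvx : dist v x ≤ H := hM.dist_le ht (corner_mem_cell hvt) hxt
    have hvΩ : v ∈ Ω := hxB (Metric.mem_ball.2 (by linarith))
    have hv : v ∈ M.innerNodes := mem_innerNodes.2 ⟨corner_mem_vertices ht hvt, hvΩ⟩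
    set p : Space d → ℝ := ∑ w ∈ M.innerNodes, M.hat w with hp
    have hpc : p ∈ M.coarseSpace := by
      rw [← mem_coarseSubmodule]
      exact Submodule.sum_mem _ fun w hw =>
        hat_mem_coarseSpace hΩ.interior_closure_eq (mem_innerNodes.1 hw).2
    have hcell : ∀ t' ∈ M.cells, v ∈ t' → (t' : Set (Space d)) ⊆ Ω := fun t' ht' hvt' w hw => by
      have := hM.dist_le ht' (corner_mem_cell (Finset.mem_coe.1 hw)) (corner_mem_cell hvt')
      exact hxB (Metric.mem_ball.2 (by linarith [dist_triangle w v x]))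
    have hp1 : ∀ y ∈ M.patch v 0, p y = 1 := by
      rintro y ⟨hy, -⟩
      simp only [mem_iUnion] at hy
      obtain ⟨t', ⟨ht', hvt'⟩, hyt'⟩ := hy
      rw [hp, Finset.sum_apply]
      exact sum_hat_eq_one ht' (hcell t' ht' hvt') hyt'
    have hpv : p v = 1 := by
      rw [hp, Finset.sum_apply]
      exact sum_hat_eq_one ht (hcell t ht hvt) (corner_mem_cell hvt)
    have hpm := memLp_of_mem_coarseSpace hΛ hΩ hpc
    have hℓ : M.localProjection Λ β v (u - c • p) v = -c := by
      rw [localProjection_sub hσ hM hΛ hΩ hv h.memLp (hpm.const_smul c),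
        localProjection_const_smul hσ hM hΛ hΩ hv hpm,
        localProjection_of_mem_coarseSpace hσ hM hΛ hΩ hv hpc, hu v hv, hpv]
      ring
    have k1 := hC₁ hΩ hΛ hM _ (h.memLp.sub (hpm.const_smul c)) v hv
    rw [hℓ, enorm_neg] at k1
    have hpsub : M.patch v 0 ⊆ Metric.ball x (3 * H) := fun y hy => by
      have := hM.patch_subset_closedBall v 0 hy
      rw [Metric.mem_closedBall] at this
      simp only [Nat.cast_zero, zero_add, one_mul] at this
      exact Metric.mem_ball.2 (by linarith [dist_triangle y v x])
    have k2 : ∫⁻ y in M.patch v 0, ‖(u - c • p) y‖ₑ ^ 2 ∂μ ≤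
        ∫⁻ y in Metric.ball x (3 * H), ‖u y - c‖ₑ ^ 2 ∂μ := by
      refine le_trans (le_of_eq ?_) (lintegral_mono_set hpsub)
      refine setLIntegral_congr_fun (measurableSet_patch hΩ.isOpen v 0) fun y hy => ?_
      simp [hp1 y hy]
    have k3 : ∫⁻ y in Metric.ball x H, ‖c‖ₑ ^ 2 ∂μ ≤
        C₁ * ∫⁻ y in Metric.ball x (3 * H), ‖u y - c‖ₑ ^ 2 ∂μ := by
      refine le_trans ?_ (k1.trans (mul_le_mul_right k2 _))
      rw [setLIntegral_weightedMeasure Metric.isOpen_ball.measurableSet,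
        lintegral_const_mul _ (measurable_eweight Λ β)]
      refine mul_le_mul_right (lintegral_mono_set (inter_subset_left.trans ?_)) _
      exact Metric.ball_subset_ball' (by rw [dist_comm]; linarith)
    have k4 := lintegral_enorm_add_sq_le (μ := μ.restrict (Metric.ball x H))
      (f := fun y => u y - c) (hmu.sub aestronglyMeasurable_const).restrict (fun _ => c)
    simp only [sub_add_cancel] at k4
    calc _ ≤ _ := k4
      _ ≤ 2 * (∫⁻ y in Metric.ball x (3 * H), ‖u y - c‖ₑ ^ 2 ∂μ) +
          2 * (C₁ * ∫⁻ y in Metric.ball x (3 * H), ‖u y - c‖ₑ ^ 2 ∂μ) := by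
          gcongr
          linarith
      _ = (2 + 2 * C₁) * ∫⁻ y in Metric.ball x (3 * H), ‖u y - c‖ₑ ^ 2 ∂μ := by ring
      _ ≤ (2 + 2 * C₁) * _ := mul_le_mul_right hc _
      _ ≤ (2 + 2 * C₁) * (4 * (P₁ * ENNReal.ofReal (H ^ 2)) *
            (∫⁻ y in Metric.ball x (4 * H), ‖g y‖ₑ ^ 2 ∂μ) +
            (2 + 4 * (P₁ * ENNReal.ofReal (H ^ 2))) * ε ^ 2) := by
          gcongr
          linarith
      _ = _ := by ring
  · by_cases hxΩ : Disjoint (Metric.ball x H) Ω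
    · rw [setLIntegral_weightedMeasure Metric.isOpen_ball.measurableSet,
        disjoint_iff_inter_eq_empty.1 hxΩ]
      simp
    · -- balls near the boundary
      refine le_trans ?_ (mul_le_mul_left (mul_le_mul_left le_add_self _) _)
      refine le_of_forall_le_add_mul_sq (K := 2 + 4 * (P₂ * ENNReal.ofReal (H ^ 2)))
        (by finiteness) fun ε hε => ?_
      obtain ⟨z₁, hz₁, hz₁Ω⟩ := not_disjoint_iff.1 hxΩ
      obtain ⟨z₂, hz₂, hz₂Ω⟩ := not_subset.1 hxB
      obtain ⟨z, hz, hzf⟩ := inter_frontier_nonempty_of_isPreconnected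
        (convex_ball x (3 * H)).isPreconnected
        ⟨z₁, Metric.ball_subset_ball (by linarith) hz₁, hz₁Ω⟩ ⟨z₂, hz₂, hz₂Ω⟩
      obtain ⟨y, hy⟩ := hext z hzf H hH ((hM.le_diam hd hσ hΩ).trans (le_max_left _ _))
      have he : c₀ / 4 * (4 * H) = c₀ * H := by ring
      have hsub : Metric.ball y (c₀ / 4 * (4 * H)) ⊆ Metric.ball x (4 * H) := by
        rw [he]
        refine hy.trans (sdiff_subset.trans (Metric.ball_subset_ball' ?_))
        linarith [Metric.mem_ball.1 hz]
      obtain ⟨c, hc0, hc⟩ := h.poincare_ball hΛ hΩ.isOpen (R := 4 * H) (κ := c₀ / 4)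
        (by positivity) (by positivity) hsub hε
      rw [hc0 (by rw [he]; exact disjoint_left.2 fun w hw => (hy hw).2)] at hc
      have hPe : ENNReal.ofReal (4 * CA * 4 ^ (2 * d) / (unitBallVolume d * (c₀ / 4) ^ d) ^ 2 *
          (4 * H) ^ 2) = P₂ * ENNReal.ofReal (H ^ 2) := by
        rw [hP₂, ← ENNReal.ofReal, ← ENNReal.ofReal_mul' (by positivity)]
        congr 1; ring
      rw [hPe] at hc
      simp only [sub_zero] at hc
      refine (lintegral_mono_set (Metric.ball_subset_ball (by linarith))).trans
        (hc.trans (le_of_eq ?_))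
      ring

end Mesh

/-! ### Slowly varying weights -/

/-- Nonnegative functions that vary by at most a factor `e` on the scale `H`. -/
structure IsSlow {d : ℕ} (H : ℝ) (m : Space d → ℝ) : Prop where
  continuous : Continuous m
  nonneg : ∀ x, 0 ≤ m x
  le_exp : ∀ x y, m x ≤ Real.exp (dist x y / H) * m y

theorem lintegral_setLIntegral_ball {d : ℕ} (μ : Measure (Space d)) [SFinite μ] {R : ℝ}
    {F : Space d → ENNReal} (hF : AEMeasurable F μ) :
    ∫⁻ x, ∫⁻ y in Metric.ball x R, F y ∂μ = volume (Metric.ball (0 : Space d) R) * ∫⁻ y, F y ∂μ := by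
  have hms : MeasurableSet {p : Space d × Space d | dist p.2 p.1 < R} :=
    measurableSet_lt (measurable_snd.dist measurable_fst) measurable_const
  have h1 : ∀ x, ∫⁻ y in Metric.ball x R, F y ∂μ =
      ∫⁻ y, {p : Space d × Space d | dist p.2 p.1 < R}.indicator (fun p => F p.2) (x, y) ∂μ :=
    fun x => by
      rw [← lintegral_indicator Metric.isOpen_ball.measurableSet]
      rfl
  simp only [h1]
  rw [lintegral_lintegral_swap]
  · rw [← lintegral_const_mul'' _ hF]
    refine lintegral_congr fun y => ?_
    classical
    have h2 : ∀ x, {p : Space d × Space d | dist p.2 p.1 < R}.indicator (fun p => F p.2) (x, y) =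
        (Metric.ball y R).indicator (fun _ => F y) x := fun x => by
      rw [indicator_apply, indicator_apply, Metric.mem_ball, dist_comm x y]
      rfl
    simp only [h2]
    rw [lintegral_indicator Metric.isOpen_ball.measurableSet, setLIntegral_const,
      Measure.addHaar_ball_center, mul_comm]
  · exact (hF.comp_snd).indicator hms

namespace Mesh

variable {d : ℕ} {Ω : Set (Space d)} {σ : ℝ}

theorem exists_fine_poincare (hd : 0 < d) (hΩ : IsLipschitzDomain Ω) (CA : ℝ)
    (hσ : 1 ≤ σ) : ∃ C : NNReal, ∀ {Λ : Set (Space d)} {β : ℝ} {M : Mesh Ω} {H : ℝ},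
      IsMuckenhoupt Λ β CA → M.IsQuasiUniform H σ → ∀ {u : Space d → ℝ} {g : Space d → Space d},
      HasH10Gradient Ω Λ β u g → (∀ v ∈ M.innerNodes, M.localProjection Λ β v u v = 0) →
      ∀ {m : Space d → ℝ}, IsSlow H m →
      ∫⁻ y, ‖m y * u y‖ₑ ^ 2 ∂weightedMeasure Ω Λ β ≤
        C * ENNReal.ofReal (H ^ 2) * ∫⁻ y, ‖m y • g y‖ₑ ^ 2 ∂weightedMeasure Ω Λ β := by
  obtain ⟨C, hC⟩ := exists_fine_poincare_ball hd hΩ CA hσ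
  refine ⟨C * Real.toNNReal (Real.exp 5) ^ 2 * 4 ^ d,
    fun {Λ β M H} hΛ hM u g h hu m hm => ?_⟩
  have hH := hM.1
  have := isFiniteMeasure_weightedMeasure hΛ hΩ.isBounded
  set μ := weightedMeasure Ω Λ β with hμ
  have hmm : AEStronglyMeasurable m μ := hm.continuous.aestronglyMeasurable
  have hslow : ∀ x y, ‖m x‖ₑ ≤ ENNReal.ofReal (Real.exp (dist x y / H)) * ‖m y‖ₑ := fun x y => by
    rw [← ofReal_norm, ← ofReal_norm, Real.norm_of_nonneg (hm.nonneg _),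
      Real.norm_of_nonneg (hm.nonneg _), ← ENNReal.ofReal_mul (Real.exp_pos _).le]
    exact ENNReal.ofReal_le_ofReal (hm.le_exp x y)
  have key : ∀ x, ∫⁻ y in Metric.ball x H, ‖m y * u y‖ₑ ^ 2 ∂μ ≤
      C * ENNReal.ofReal (H ^ 2) * ENNReal.ofReal (Real.exp 5) ^ 2 *
        ∫⁻ y in Metric.ball x (4 * H), ‖m y • g y‖ₑ ^ 2 ∂μ := fun x => by
    have a1 : ∫⁻ y in Metric.ball x H, ‖m y * u y‖ₑ ^ 2 ∂μ ≤
        (ENNReal.ofReal (Real.exp 1) * ‖m x‖ₑ) ^ 2 * ∫⁻ y in Metric.ball x H, ‖u y‖ₑ ^ 2 ∂μ := by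
      rw [← lintegral_const_mul' _ _ (by finiteness)]
      refine setLIntegral_mono' Metric.isOpen_ball.measurableSet fun y hy => ?_
      rw [enorm_mul, mul_pow]
      gcongr
      refine (hslow y x).trans ?_
      gcongr
      rw [div_le_one hH]
      exact (Metric.mem_ball.1 hy).le
    have a2 : ‖m x‖ₑ ^ 2 * ∫⁻ y in Metric.ball x (4 * H), ‖g y‖ₑ ^ 2 ∂μ ≤
        ENNReal.ofReal (Real.exp 4) ^ 2 * ∫⁻ y in Metric.ball x (4 * H), ‖m y • g y‖ₑ ^ 2 ∂μ := by
      rw [← lintegral_const_mul' _ _ (by finiteness), ← lintegral_const_mul' _ _ (by finiteness)]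
      refine setLIntegral_mono' Metric.isOpen_ball.measurableSet fun y hy => ?_
      rw [enorm_smul, ← mul_pow, ← mul_pow, ← mul_assoc]
      gcongr
      refine (hslow x y).trans ?_
      gcongr
      rw [div_le_iff₀ hH, dist_comm]
      exact (Metric.mem_ball.1 hy).le
    calc _ ≤ _ := a1
      _ ≤ (ENNReal.ofReal (Real.exp 1) * ‖m x‖ₑ) ^ 2 * (C * ENNReal.ofReal (H ^ 2) *
          ∫⁻ y in Metric.ball x (4 * H), ‖g y‖ₑ ^ 2 ∂μ) := by gcongr; exact hC hΛ hM h hu x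
      _ = C * ENNReal.ofReal (H ^ 2) * ENNReal.ofReal (Real.exp 1) ^ 2 *
          (‖m x‖ₑ ^ 2 * ∫⁻ y in Metric.ball x (4 * H), ‖g y‖ₑ ^ 2 ∂μ) := by ring
      _ ≤ C * ENNReal.ofReal (H ^ 2) * ENNReal.ofReal (Real.exp 1) ^ 2 * _ :=
          mul_le_mul_right a2 _
      _ = _ := by
          rw [show (5 : ℝ) = 1 + 4 by norm_num, Real.exp_add,
            ENNReal.ofReal_mul (Real.exp_pos _).le]
          ring
  have i1 := lintegral_setLIntegral_ball μ (R := H) (F := fun y => ‖m y * u y‖ₑ ^ 2)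
    ((hmm.mul h.memLp.1).enorm.pow_const 2)
  have i2 := lintegral_setLIntegral_ball μ (R := 4 * H) (F := fun y => ‖m y • g y‖ₑ ^ 2)
    ((hmm.smul h.memLp_grad.1).enorm.pow_const 2)
  have i3 := lintegral_mono (μ := volume) key
  rw [i1, lintegral_const_mul' _ _ (by finiteness), i2] at i3
  have hvol : volume (Metric.ball (0 : Space d) (4 * H)) =
      4 ^ d * volume (Metric.ball (0 : Space d) H) := by
    rw [volume_ball_eq 0 (by positivity), volume_ball_eq 0 hH, mul_pow, ← ENNReal.ofReal_ofNat,
      ← ENNReal.ofReal_pow (by norm_num), ← ENNReal.ofReal_mul (by positivity)]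
    congr 1; ring
  rw [hvol] at i3
  have hv0 : volume (Metric.ball (0 : Space d) H) ≠ 0 := (Metric.measure_ball_pos _ _ hH).ne'
  have hv1 : volume (Metric.ball (0 : Space d) H) ≠ ⊤ := measure_ball_lt_top.ne
  rw [← ENNReal.mul_le_mul_iff_right hv0 hv1]
  refine i3.trans (le_of_eq ?_)
  push_cast
  rw [show ((Real.toNNReal (Real.exp 5) : NNReal) : ENNReal) = ENNReal.ofReal (Real.exp 5) from rfl]
  ring

end Mesh

end WeightedLOD

end

noncomputable section

namespace WeightedLOD

/-! ### Multiplication by cut-off functions and the quasi-interpolation -/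

namespace Mesh

variable {d : ℕ} {Ω Λ : Set (Space d)} {β CA H σ : ℝ} {M : Mesh Ω}

theorem exists_sum_indicator_closedBall_le (d : ℕ) (hσ : 1 ≤ σ) :
    ∃ C > 0, ∀ {Ω : Set (Space d)} {M : Mesh Ω} {H : ℝ}, IsLipschitzDomain Ω →
      M.IsQuasiUniform H σ → ∀ x,
      ∑ v ∈ M.innerNodes, (Metric.closedBall v H).indicator (fun _ => (1 : ℝ)) x ≤ C := by
  obtain ⟨C, hC, h⟩ := exists_sum_exp_le d hσ one_pos
  refine ⟨Real.exp 1 * C, by positivity, fun {Ω M H} hΩ hM x => ?_⟩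
  refine le_trans ?_ (mul_le_mul_of_nonneg_left (h hΩ hM x) (Real.exp_pos 1).le)
  rw [Finset.mul_sum]
  refine Finset.sum_le_sum fun v _ => ?_
  by_cases hx : x ∈ Metric.closedBall v H
  · rw [indicator_of_mem hx, ← Real.exp_add, Real.one_le_exp_iff]
    have : dist x v / H ≤ 1 := (div_le_one hM.1).2 hx
    linarith
  · rw [indicator_of_notMem hx]
    positivity

theorem quasiInterpolation_eq_zero_of_eq_zero (hσ : 1 ≤ σ) (hM : M.IsQuasiUniform H σ)
    (hΛ : IsMuckenhoupt Λ β CA) (hΩ : IsLipschitzDomain Ω) {u : Space d → ℝ}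
    (hu : MemLp u 2 (weightedMeasure Ω Λ β)) {x : Space d}
    (h : ∀ y, dist y x ≤ 2 * H → u y = 0) : M.quasiInterpolation Λ β u x = 0 := by
  refine Finset.sum_eq_zero fun v hv => ?_
  by_cases hx : M.hat v x = 0
  · rw [hx, mul_zero]
  · have hvx := hM.dist_le_of_hat_ne_zero hx
    rw [localProjection_congr hσ hM hΛ hΩ hv hu (u' := 0) MemLp.zero
      (Eventually.of_forall fun y hy => ?_),
      localProjection_of_mem_coarseSpace hσ hM hΛ hΩ hv M.coarseSubmodule.zero_mem]
    · simp
    · have := hM.patch_subset_closedBall v 0 hy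
      rw [Metric.mem_closedBall] at this
      simp only [Nat.cast_zero, zero_add, one_mul] at this
      exact h y (by linarith [dist_triangle y v x, dist_comm v x])

theorem exists_commutator_le (hd : 0 < d) (hΩ : IsLipschitzDomain Ω) (CA : ℝ)
    (hσ : 1 ≤ σ) : ∃ C : NNReal, ∀ {Λ : Set (Space d)} {β : ℝ} {M : Mesh Ω} {H : ℝ},
      IsMuckenhoupt Λ β CA → M.IsQuasiUniform H σ → ∀ {q : Space d → ℝ} {g : Space d → Space d},
      HasH10Gradient Ω Λ β q g → (∀ v ∈ M.innerNodes, M.localProjection Λ β v q v = 0) →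
      ∀ {η ρ m : Space d → ℝ} {L : NNReal} {B : ℝ}, LipschitzWith L η → (∀ x, |η x| ≤ B) →
      IsSlow H ρ → IsSlow H m →
      (∀ x y, dist x y ≤ H → ρ x * |η x - η y| ≤ dist x y / H * m x) →
      ∃ gw, HasH10Gradient Ω Λ β
          (fun x => η x * q x - M.quasiInterpolation Λ β (fun y => η y * q y) x) gw ∧
        (∀ v ∈ M.innerNodes, M.localProjection Λ β v
          (fun x => η x * q x - M.quasiInterpolation Λ β (fun y => η y * q y) x) v = 0) ∧
        ∫⁻ x, ‖ρ x • (gw x - η x • g x)‖ₑ ^ 2 ∂weightedMeasure Ω Λ β ≤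
          C * ∫⁻ x, ‖m x • g x‖ₑ ^ 2 ∂weightedMeasure Ω Λ β := by
  obtain ⟨C₁, hC₁⟩ := exists_fine_poincare hd hΩ CA hσ
  obtain ⟨C₂, hC₂⟩ := exists_localProjection_le d CA hσ two_pos
  obtain ⟨n₀, hn₀, hn⟩ := exists_sum_indicator_closedBall_le d hσ
  have he := Real.exp_pos 1
  refine ⟨(2 + 2 * (n₀.toNNReal ^ 2 * Real.toNNReal (Real.exp 1 * σ) ^ 2 *
    (C₂ * Real.toNNReal (Real.exp 1) ^ 2))) * C₁,
    fun {Λ β M H} hΛ hM q g h hq η ρ m L B hη hB hρ hm hcond => ?_⟩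
  have hH := hM.1
  have := isFiniteMeasure_weightedMeasure hΛ hΩ.isBounded
  set μ := weightedMeasure Ω Λ β with hμ
  have hηm : AEStronglyMeasurable η μ := hη.continuous.aestronglyMeasurable
  have hρm : AEStronglyMeasurable ρ μ := hρ.continuous.aestronglyMeasurable
  have hmm : AEStronglyMeasurable m μ := hm.continuous.aestronglyMeasurable
  have hηq := h.mul_lipschitzWith hΛ hΩ.isBounded hΩ.isOpen hη hB
  set f : Space d → ℝ := fun y => η y * q y with hf
  set ℓ : Space d → ℝ := fun v => M.localProjection Λ β v f v with hℓ
  set G : Space d → Space d → Space d := fun v => {x | M.hat v x ≠ 0}.indicator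
    (gradient (M.hat v)) with hG
  have hhat : ∀ v ∈ M.innerNodes, HasH10Gradient Ω Λ β (M.hat v) (G v) := fun v hv =>
    hasH10Gradient_of_lipschitzWith hΛ hΩ.isBounded hΩ.isOpen
      (hM.lipschitzWith_hat hσ hΩ (mem_innerNodes.1 hv).2)
      (fun x hx => hat_eq_zero_of_notMem hΩ.interior_closure_eq (mem_innerNodes.1 hv).2 hx)
  have hGle : ∀ v ∈ M.innerNodes, ∀ x,
      ‖G v x‖ ≤ σ / H * (Metric.closedBall v H).indicator (fun _ => (1 : ℝ)) x := fun v hv x => by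
    by_cases hx : M.hat v x = 0
    · rw [hG]
      simp only [mem_ofPred_eq, hx, ne_eq, not_true_eq_false, not_false_eq_true,
        indicator_of_notMem, norm_zero]
      exact mul_nonneg (by positivity) (indicator_nonneg (fun _ _ => zero_le_one) _)
    · have h1 : x ∈ Metric.closedBall v H := by
        rw [Metric.mem_closedBall]; exact hM.dist_le_of_hat_ne_zero hx
      rw [indicator_of_mem h1, mul_one, hG]
      refine (norm_indicator_le_norm_self _ _).trans ?_
      refine (norm_gradient_le_of_lipschitzWith
        (hM.lipschitzWith_hat hσ hΩ (mem_innerNodes.1 hv).2) x).trans_eq ?_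
      exact Real.coe_toNNReal _ (by positivity)
  have hI : HasH10Gradient Ω Λ β (M.quasiInterpolation Λ β f)
      (∑ v ∈ M.innerNodes, ℓ v • G v) := by
    have h1 : M.quasiInterpolation Λ β f = ∑ v ∈ M.innerNodes, ℓ v • M.hat v := by
      ext x; simp [quasiInterpolation, hℓ]
    rw [h1]
    exact HasH10Gradient.sum _ fun v hv => (hhat v hv).const_smul (ℓ v)
  refine ⟨_, hηq.sub hI, fun v hv => ?_, ?_⟩
  · have h1 : (fun x => η x * q x - M.quasiInterpolation Λ β (fun y => η y * q y) x) =
        f - M.quasiInterpolation Λ β f := rfl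
    have hIc := quasiInterpolation_mem_coarseSpace (Λ := Λ) (β := β) (M := M)
      hΩ.interior_closure_eq f
    rw [h1, localProjection_sub hσ hM hΛ hΩ hv hηq.memLp hI.memLp,
      localProjection_of_mem_coarseSpace hσ hM hΛ hΩ hv hIc, quasiInterpolation_apply_node hv,
      sub_self]
  -- the two parts of the error
  set J := ∫⁻ x, ‖m x * q x‖ₑ ^ 2 ∂μ with hJ
  have hJle : J ≤ C₁ * ENNReal.ofReal (H ^ 2) * ∫⁻ x, ‖m x • g x‖ₑ ^ 2 ∂μ := hC₁ hΛ hM h hq hm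
  have t1 : ∫⁻ x, ‖ρ x • (q x • gradient η x)‖ₑ ^ 2 ∂μ ≤ ENNReal.ofReal (1 / H ^ 2) * J := by
    rw [← lintegral_const_mul' _ _ ENNReal.ofReal_ne_top]
    refine lintegral_mono fun x => ?_
    have h1 : ρ x * ‖gradient η x‖ ≤ m x / H := by
      rcases (hρ.nonneg x).eq_or_lt with h0 | h0
      · rw [← h0, zero_mul]; exact div_nonneg (hm.nonneg x) hH.le
      · rw [norm_gradient, mul_comm, ← le_div_iff₀ h0]
        refine norm_fderiv_le_of_lip' ℝ (div_nonneg (div_nonneg (hm.nonneg x) hH.le) h0.le) ?_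
        filter_upwards [Metric.closedBall_mem_nhds x hH] with y hy
        have h2 := hcond x y (by rw [dist_comm]; exact hy)
        rw [div_mul_eq_mul_div, le_div_iff₀ h0, ← dist_eq_norm y x, dist_comm, Real.norm_eq_abs,
          abs_sub_comm, mul_comm]
        refine h2.trans_eq ?_
        ring
    rw [← ofReal_norm, ← ofReal_norm, ← ENNReal.ofReal_pow (norm_nonneg _),
      ← ENNReal.ofReal_pow (norm_nonneg _), ← ENNReal.ofReal_mul (by positivity)]
    refine ENNReal.ofReal_le_ofReal ?_
    rw [norm_smul, norm_smul, norm_mul, Real.norm_of_nonneg (hρ.nonneg x),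
      Real.norm_of_nonneg (hm.nonneg x)]
    calc (ρ x * (‖q x‖ * ‖gradient η x‖)) ^ 2 = (ρ x * ‖gradient η x‖) ^ 2 * ‖q x‖ ^ 2 := by ring
      _ ≤ (m x / H) ^ 2 * ‖q x‖ ^ 2 := by
          have := hρ.nonneg x
          gcongr
      _ = _ := by ring
  have hℓle : ∀ v ∈ M.innerNodes, ENNReal.ofReal (ρ v ^ 2) * (‖ℓ v‖ₑ ^ 2 *
      ∫⁻ x in Metric.ball v (2 * H), eweight Λ β x) ≤
      C₂ * ENNReal.ofReal (Real.exp 1) ^ 2 *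
        ∫⁻ x in Metric.closedBall v H, ‖m x * q x‖ₑ ^ 2 ∂μ := fun v hv => by
    have h1 : ℓ v = M.localProjection Λ β v (f - η v • q) v := by
      rw [localProjection_sub hσ hM hΛ hΩ hv hηq.memLp (h.memLp.const_smul _),
        localProjection_const_smul hσ hM hΛ hΩ hv h.memLp, hq v hv, mul_zero, sub_zero]
    rw [h1]
    have h2 := hC₂ hΩ hΛ hM _ (hηq.memLp.sub (h.memLp.const_smul (η v))) v hv
    refine (mul_le_mul_right h2 _).trans ?_
    rw [mul_left_comm, mul_assoc]
    refine mul_le_mul_right ?_ _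
    rw [← lintegral_const_mul' _ _ ENNReal.ofReal_ne_top,
      ← lintegral_const_mul' _ _ (by finiteness)]
    have hsub : M.patch v 0 ⊆ Metric.closedBall v H := by
      have := hM.patch_subset_closedBall v 0
      simpa using this
    refine le_trans ?_ (lintegral_mono_set hsub)
    refine setLIntegral_mono' (measurableSet_patch hΩ.isOpen v 0) fun x hx => ?_
    have hxv : dist v x ≤ H := by rw [dist_comm]; exact hsub hx
    have h3 : ρ v * |η v - η x| ≤ Real.exp 1 * m x := by
      calc ρ v * |η v - η x| ≤ dist v x / H * m v := hcond v x hxv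
        _ ≤ 1 * m v := by
            have := hm.nonneg v
            gcongr
            exact (div_le_one hH).2 hxv
        _ ≤ Real.exp (dist v x / H) * m x := by rw [one_mul]; exact hm.le_exp v x
        _ ≤ _ := by
            have := hm.nonneg x
            gcongr
            exact (div_le_one hH).2 hxv
    rw [← ofReal_norm, ← ofReal_norm, ← ENNReal.ofReal_pow (norm_nonneg _),
      ← ENNReal.ofReal_pow (norm_nonneg _), ← ENNReal.ofReal_pow he.le,
      ← ENNReal.ofReal_mul (by positivity), ← ENNReal.ofReal_mul (by positivity)]
    refine ENNReal.ofReal_le_ofReal ?_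
    have h4 : (f - η v • q) x = (η x - η v) * q x := by
      simp only [hf, Pi.sub_apply, Pi.smul_apply, smul_eq_mul]; ring
    rw [h4, norm_mul, norm_mul, Real.norm_of_nonneg (hm.nonneg x), Real.norm_eq_abs (η x - η v),
      abs_sub_comm]
    calc ρ v ^ 2 * (|η v - η x| * ‖q x‖) ^ 2 = (ρ v * |η v - η x|) ^ 2 * ‖q x‖ ^ 2 := by ring
      _ ≤ (Real.exp 1 * m x) ^ 2 * ‖q x‖ ^ 2 := by
          have := hρ.nonneg v
          gcongr
      _ = _ := by ring
  have hcov : ∑ v ∈ M.innerNodes, ∫⁻ x in Metric.closedBall v H, ‖m x * q x‖ₑ ^ 2 ∂μ ≤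
      ENNReal.ofReal n₀ * J := by
    simp only [← lintegral_indicator Metric.isClosed_closedBall.measurableSet]
    have hmq : AEMeasurable (fun x => ‖m x * q x‖ₑ ^ 2) μ := (hmm.mul h.memLp.1).enorm.pow_const 2
    rw [← lintegral_finsetSum' _ fun v _ => hmq.indicator
      Metric.isClosed_closedBall.measurableSet, ← lintegral_const_mul' _ _ ENNReal.ofReal_ne_top]
    refine lintegral_mono fun x => ?_
    have h1 : ∀ v, (Metric.closedBall v H).indicator (fun x => ‖m x * q x‖ₑ ^ 2) x =
        ENNReal.ofReal ((Metric.closedBall v H).indicator (fun _ => (1 : ℝ)) x) *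
          ‖m x * q x‖ₑ ^ 2 := fun v => by
      by_cases hx : x ∈ Metric.closedBall v H <;> simp [hx]
    simp only [h1]
    rw [← Finset.sum_mul, ← ENNReal.ofReal_sum_of_nonneg
      fun v _ => indicator_nonneg (fun _ _ => zero_le_one) _]
    gcongr
    exact hn hΩ hM x
  have t2 : ∫⁻ x, ‖ρ x • ∑ v ∈ M.innerNodes, ℓ v • G v x‖ₑ ^ 2 ∂μ ≤
      ENNReal.ofReal n₀ ^ 2 * (ENNReal.ofReal (Real.exp 1 * σ) ^ 2 *
        (C₂ * ENNReal.ofReal (Real.exp 1) ^ 2)) * (ENNReal.ofReal (1 / H ^ 2) * J) := by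
    have p1 : ∀ x, ‖ρ x • ∑ v ∈ M.innerNodes, ℓ v • G v x‖ₑ ^ 2 ≤
        ENNReal.ofReal n₀ * ∑ v ∈ M.innerNodes,
          (ENNReal.ofReal ((Real.exp 1 * σ / H) ^ 2) * (ENNReal.ofReal (ρ v ^ 2) * ‖ℓ v‖ₑ ^ 2)) *
            (Metric.closedBall v H).indicator 1 x := fun x => by
      set χ : Space d → ℝ := fun v => (Metric.closedBall v H).indicator (fun _ => (1 : ℝ)) x
        with hχ
      have hχ0 : ∀ v, 0 ≤ χ v := fun v => indicator_nonneg (fun _ _ => zero_le_one) _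
      have hχ2 : ∀ v, χ v * χ v = χ v := fun v => by
        simp only [hχ]
        by_cases hx : x ∈ Metric.closedBall v H <;> simp [hx]
      have b1 : ‖ρ x • ∑ v ∈ M.innerNodes, ℓ v • G v x‖ ≤
          ∑ v ∈ M.innerNodes, χ v * (Real.exp 1 * σ / H * (ρ v * ‖ℓ v‖) * χ v) := by
        rw [Finset.smul_sum]
        refine (norm_sum_le _ _).trans (Finset.sum_le_sum fun v hv => ?_)
        rw [norm_smul, norm_smul, Real.norm_of_nonneg (hρ.nonneg x), mul_left_comm (χ v), hχ2]
        have h1 := hGle v hv x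
        by_cases hx : x ∈ Metric.closedBall v H
        · have h2 : ρ x ≤ Real.exp 1 * ρ v := (hρ.le_exp x v).trans (by
            have := hρ.nonneg v
            gcongr
            exact (div_le_one hH).2 hx)
          calc ρ x * (‖ℓ v‖ * ‖G v x‖) ≤ (Real.exp 1 * ρ v) * (‖ℓ v‖ * (σ / H * χ v)) := by
                gcongr
                exact mul_nonneg he.le (hρ.nonneg v)
            _ = _ := by ring
        · have h3 : χ v = 0 := indicator_of_notMem hx _
          have h4 : ‖G v x‖ = 0 := le_antisymm (by
            rw [indicator_of_notMem hx, mul_zero] at h1; exact h1) (norm_nonneg _)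
          rw [h3, h4]; simp
      have b2 : ‖ρ x • ∑ v ∈ M.innerNodes, ℓ v • G v x‖ ^ 2 ≤
          n₀ * ∑ v ∈ M.innerNodes, (Real.exp 1 * σ / H) ^ 2 * (ρ v ^ 2 * ‖ℓ v‖ ^ 2) * χ v := by
        calc _ ≤ (∑ v ∈ M.innerNodes, χ v * (Real.exp 1 * σ / H * (ρ v * ‖ℓ v‖) * χ v)) ^ 2 := by
              gcongr
          _ ≤ (∑ v ∈ M.innerNodes, χ v ^ 2) *
              ∑ v ∈ M.innerNodes, (Real.exp 1 * σ / H * (ρ v * ‖ℓ v‖) * χ v) ^ 2 :=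
            Finset.sum_mul_sq_le_sq_mul_sq _ _ _
          _ ≤ n₀ * ∑ v ∈ M.innerNodes, (Real.exp 1 * σ / H * (ρ v * ‖ℓ v‖) * χ v) ^ 2 := by
              refine mul_le_mul_of_nonneg_right ?_ (Finset.sum_nonneg fun _ _ => sq_nonneg _)
              simp only [sq, hχ2]
              exact hn hΩ hM x
          _ = _ := by
              congr 1
              refine Finset.sum_congr rfl fun v _ => ?_
              rw [mul_pow, sq (χ v), hχ2]; ring
      rw [← ofReal_norm, ← ENNReal.ofReal_pow (norm_nonneg _)]
      refine (ENNReal.ofReal_le_ofReal b2).trans (le_of_eq ?_)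
      rw [ENNReal.ofReal_mul hn₀.le, ENNReal.ofReal_sum_of_nonneg fun v _ =>
        mul_nonneg (by positivity) (hχ0 v)]
      congr 1
      refine Finset.sum_congr rfl fun v _ => ?_
      rw [ENNReal.ofReal_mul (by positivity), ENNReal.ofReal_mul (by positivity),
        ENNReal.ofReal_mul (by positivity), ENNReal.ofReal_pow (norm_nonneg _), ofReal_norm]
      congr 1
      simp only [hχ]
      by_cases hx : x ∈ Metric.closedBall v H <;> simp [hx]
    refine (lintegral_mono p1).trans ?_
    rw [lintegral_const_mul' _ _ ENNReal.ofReal_ne_top, lintegral_finsetSum' _ fun v _ =>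
      (((measurable_one.indicator Metric.isClosed_closedBall.measurableSet)).const_mul
        _).aemeasurable]
    have p2 : ∀ v ∈ M.innerNodes, ∫⁻ x,
        (ENNReal.ofReal ((Real.exp 1 * σ / H) ^ 2) * (ENNReal.ofReal (ρ v ^ 2) * ‖ℓ v‖ₑ ^ 2)) *
            (Metric.closedBall v H).indicator 1 x ∂μ ≤
        ENNReal.ofReal ((Real.exp 1 * σ / H) ^ 2) * (C₂ * ENNReal.ofReal (Real.exp 1) ^ 2 *
          ∫⁻ x in Metric.closedBall v H, ‖m x * q x‖ₑ ^ 2 ∂μ) := fun v hv => by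
      rw [lintegral_const_mul' _ _ (by finiteness), mul_assoc]
      refine mul_le_mul_right (le_trans ?_ (hℓle v hv)) _
      rw [mul_assoc]
      refine mul_le_mul_right (mul_le_mul_right ?_ _) _
      rw [lintegral_indicator Metric.isClosed_closedBall.measurableSet,
        setLIntegral_weightedMeasure Metric.isClosed_closedBall.measurableSet]
      simp only [Pi.one_apply, one_mul]
      exact lintegral_mono_set (inter_subset_left.trans
        (Metric.closedBall_subset_ball (by linarith)))
    have hH2 : ENNReal.ofReal ((Real.exp 1 * σ / H) ^ 2) =
        ENNReal.ofReal (Real.exp 1 * σ) ^ 2 * ENNReal.ofReal (1 / H ^ 2) := by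
      rw [← ENNReal.ofReal_pow (by positivity), ← ENNReal.ofReal_mul (by positivity)]
      congr 1; ring
    calc _ ≤ ENNReal.ofReal n₀ * ∑ v ∈ M.innerNodes, _ :=
          mul_le_mul_right (Finset.sum_le_sum p2) _
      _ = ENNReal.ofReal n₀ * (ENNReal.ofReal ((Real.exp 1 * σ / H) ^ 2) *
          (C₂ * ENNReal.ofReal (Real.exp 1) ^ 2 *
            ∑ v ∈ M.innerNodes, ∫⁻ x in Metric.closedBall v H, ‖m x * q x‖ₑ ^ 2 ∂μ)) := by
          rw [← Finset.mul_sum, ← Finset.mul_sum]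
      _ ≤ ENNReal.ofReal n₀ * (ENNReal.ofReal ((Real.exp 1 * σ / H) ^ 2) *
          (C₂ * ENNReal.ofReal (Real.exp 1) ^ 2 * (ENNReal.ofReal n₀ * J))) := by gcongr
      _ = _ := by rw [hH2]; ring
  have hJ2 : ENNReal.ofReal (1 / H ^ 2) * J ≤ C₁ * ∫⁻ x, ‖m x • g x‖ₑ ^ 2 ∂μ := by
    refine (mul_le_mul_right hJle _).trans (le_of_eq ?_)
    have : ENNReal.ofReal (1 / H ^ 2) * ENNReal.ofReal (H ^ 2) = 1 := by
      rw [← ENNReal.ofReal_mul (by positivity), one_div_mul_cancel (by positivity),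
        ENNReal.ofReal_one]
    rw [mul_comm (C₁ : ENNReal), mul_assoc, ← mul_assoc, this, one_mul]
  have t0 := lintegral_enorm_add_sq_le (μ := μ) (f := fun x => ρ x • (q x • gradient η x))
    (hρm.smul (h.memLp.1.smul (measurable_gradient η).aestronglyMeasurable))
    (fun x => -(ρ x • ∑ v ∈ M.innerNodes, ℓ v • G v x))
  simp only [enorm_neg] at t0
  calc _ = ∫⁻ x, ‖ρ x • (q x • gradient η x) +
        -(ρ x • ∑ v ∈ M.innerNodes, ℓ v • G v x)‖ₑ ^ 2 ∂μ := by
        refine lintegral_congr fun x => ?_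
        rw [← smul_neg, ← smul_add]
        congr 3
        simp only [Pi.sub_apply, Finset.sum_apply, Pi.smul_apply]
        abel
    _ ≤ _ := t0
    _ ≤ 2 * (C₁ * ∫⁻ x, ‖m x • g x‖ₑ ^ 2 ∂μ) + 2 * (ENNReal.ofReal n₀ ^ 2 *
        (ENNReal.ofReal (Real.exp 1 * σ) ^ 2 * (C₂ * ENNReal.ofReal (Real.exp 1) ^ 2)) *
        (C₁ * ∫⁻ x, ‖m x • g x‖ₑ ^ 2 ∂μ)) := by
        gcongr
        · exact t1.trans hJ2
        · exact t2.trans (mul_le_mul_right hJ2 _)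
    _ = _ := by
        have hc : ∀ a : ℝ, ((a.toNNReal : NNReal) : ENNReal) = ENNReal.ofReal a := fun a => rfl
        push_cast
        simp only [hc]
        ring

end Mesh

end WeightedLOD

end

noncomputable section

namespace WeightedLOD

/-! ### Real-valued `L²` norms -/

section L2

variable {α F : Type*} [MeasurableSpace α] [NormedAddCommGroup F] {μ : Measure α} {f g : α → F}

/-- The `L²` norm as a real number. -/
def l2norm (μ : Measure α) (f : α → F) : ℝ := (eLpNorm f 2 μ).toReal

theorem l2norm_nonneg : 0 ≤ l2norm μ f := ENNReal.toReal_nonneg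

theorem l2norm_congr_ae (h : f =ᵐ[μ] g) : l2norm μ f = l2norm μ g := by
  rw [l2norm, l2norm, eLpNorm_congr_ae h]

theorem l2norm_add_le (hf : MemLp f 2 μ) (hg : MemLp g 2 μ) :
    l2norm μ (f + g) ≤ l2norm μ f + l2norm μ g := by
  rw [l2norm, l2norm, l2norm, ← ENNReal.toReal_add hf.2.ne hg.2.ne]
  exact ENNReal.toReal_mono (ENNReal.add_ne_top.2 ⟨hf.2.ne, hg.2.ne⟩)
    (eLpNorm_add_le hf.1 hg.1 one_le_two)

theorem l2norm_le_mul {G : Type*} [NormedAddCommGroup G] {h : α → G} {c : ℝ} (hc : 0 ≤ c)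
    (hh : MemLp h 2 μ) (hle : ∀ᵐ x ∂μ, ‖f x‖ ≤ c * ‖h x‖) : l2norm μ f ≤ c * l2norm μ h := by
  have h1 := eLpNorm_le_mul_eLpNorm_of_ae_le_mul hle 2
  have h2 := ENNReal.toReal_mono (ENNReal.mul_ne_top ENNReal.ofReal_ne_top hh.2.ne) h1
  rwa [ENNReal.toReal_mul, ENNReal.toReal_ofReal hc] at h2

theorem l2norm_sq (hf : MemLp f 2 μ) : l2norm μ f ^ 2 = ∫ x, ‖f x‖ ^ 2 ∂μ := by
  rw [l2norm, ← ENNReal.toReal_pow, eLpNorm_two_sq, integral_eq_lintegral_of_nonneg_ae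
    (Eventually.of_forall fun x => sq_nonneg _) (hf.1.norm.pow 2)]
  congr 1
  refine lintegral_congr fun x => ?_
  rw [ENNReal.ofReal_pow (norm_nonneg _), ofReal_norm]

theorem l2norm_le_sqrt_mul {G : Type*} [NormedAddCommGroup G] {h : α → G} {C : NNReal}
    (hh : MemLp h 2 μ) (hle : ∫⁻ x, ‖f x‖ₑ ^ 2 ∂μ ≤ C * ∫⁻ x, ‖h x‖ₑ ^ 2 ∂μ) :
    l2norm μ f ≤ √C * l2norm μ h := by
  rw [← eLpNorm_two_sq, ← eLpNorm_two_sq] at hle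
  have h1 := ENNReal.toReal_mono (by have := hh.2.ne; finiteness) hle
  rw [ENNReal.toReal_mul, ENNReal.toReal_pow, ENNReal.toReal_pow, ENNReal.coe_toReal] at h1
  refine (pow_le_pow_iff_left₀ l2norm_nonneg (mul_nonneg (Real.sqrt_nonneg _) l2norm_nonneg)
    two_ne_zero).1 ?_
  rw [mul_pow, Real.sq_sqrt C.coe_nonneg]
  exact h1

variable [InnerProductSpace ℝ F]

theorem integrable_inner_of_memLp (hf : MemLp f 2 μ) (hg : MemLp g 2 μ) :
    Integrable (fun x => ⟪f x, g x⟫) μ := by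
  refine (L2.integrable_inner (𝕜 := ℝ) hf.toLp hg.toLp).congr ?_
  filter_upwards [hf.coeFn_toLp, hg.coeFn_toLp] with x h1 h2
  rw [h1, h2]

theorem inner_toLp (hf : MemLp f 2 μ) (hg : MemLp g 2 μ) :
    ⟪hf.toLp, hg.toLp⟫ = ∫ x, ⟪f x, g x⟫ ∂μ := by
  rw [L2.inner_def]
  refine integral_congr_ae ?_
  filter_upwards [hf.coeFn_toLp, hg.coeFn_toLp] with x h1 h2
  rw [h1, h2]

theorem abs_integral_inner_le (hf : MemLp f 2 μ) (hg : MemLp g 2 μ) :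
    |∫ x, ⟪f x, g x⟫ ∂μ| ≤ l2norm μ f * l2norm μ g := by
  rw [← inner_toLp hf hg]
  refine (abs_real_inner_le_norm _ _).trans_eq ?_
  rw [Lp.norm_toLp, Lp.norm_toLp, l2norm, l2norm]

end L2

/-! ### Coefficients -/

section Coefficient

variable {d : ℕ} {Ω Λ : Set (Space d)} {β CA γ₁ γ₂ : ℝ} {A : Space d → Space d →L[ℝ] Space d}

theorem norm_apply_le_of_bounds {T : Space d →L[ℝ] Space d} {Γ : ℝ}
    (hs : ∀ ξ η, ⟪T ξ, η⟫ = ⟪ξ, T η⟫) (h0 : ∀ ξ, 0 ≤ ⟪T ξ, ξ⟫) (h : ∀ ξ, ⟪T ξ, ξ⟫ ≤ Γ * ‖ξ‖ ^ 2)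
    (ξ : Space d) (hΓ : 0 ≤ Γ) : ‖T ξ‖ ≤ Γ * ‖ξ‖ := by
  rcases (norm_nonneg (T ξ)).eq_or_lt with hT | hT
  · rw [← hT]; positivity
  set s := ‖ξ‖ / ‖T ξ‖ with hsd
  have hs0 : 0 ≤ s := by positivity
  have e1 : ⟪T (ξ + s • T ξ), ξ + s • T ξ⟫ - ⟪T (ξ - s • T ξ), ξ - s • T ξ⟫ =
      4 * (s * ‖T ξ‖ ^ 2) := by
    have := hs (T ξ) ξ
    simp only [map_add, map_sub, map_smul, inner_add_left, inner_add_right, inner_sub_left,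
      inner_sub_right, inner_smul_left, inner_smul_right, conj_trivial]
    rw [hs (T ξ) ξ, real_inner_self_eq_norm_sq]
    ring
  have e2 : ‖ξ + s • T ξ‖ ^ 2 ≤ 2 * (‖ξ‖ ^ 2 + (s * ‖T ξ‖) ^ 2) := by
    have h1 := norm_add_le ξ (s • T ξ)
    rw [norm_smul, Real.norm_of_nonneg hs0] at h1
    nlinarith [norm_nonneg (ξ + s • T ξ), sq_nonneg (‖ξ‖ - s * ‖T ξ‖)]
  have e3 : s * ‖T ξ‖ = ‖ξ‖ := by rw [hsd]; field_simp
  have e4 := h (ξ + s • T ξ)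
  have e5 := h0 (ξ - s • T ξ)
  rw [e3] at e2
  have e6 : s * ‖T ξ‖ ^ 2 = ‖ξ‖ * ‖T ξ‖ := by rw [sq, ← mul_assoc, e3]
  rw [e6] at e1
  have e7 : ‖ξ‖ * ‖T ξ‖ ≤ Γ * ‖ξ‖ * ‖ξ‖ := by nlinarith
  rcases (norm_nonneg ξ).eq_or_lt with hξ | hξ
  · have : ξ = 0 := norm_eq_zero.1 hξ.symm
    simp [this] at hT
  · nlinarith

theorem IsCoefficient.ae_bounds (hA : IsCoefficient Ω γ₁ γ₂ A) (hγ : 0 < γ₁)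
    (hΛ : IsMuckenhoupt Λ β CA) : ∀ᵐ x ∂weightedMeasure Ω Λ β,
      (∀ ξ, ‖A x ξ‖ ≤ |γ₂| * ‖ξ‖) ∧ ∀ ξ, γ₁ * ‖ξ‖ ^ 2 ≤ ⟪A x ξ, ξ⟫ := by
  rw [weightedMeasure_ae hΛ]
  filter_upwards [hA.symm, hA.bounds] with x h1 h2
  refine ⟨fun ξ => norm_apply_le_of_bounds h1 (fun ξ => le_trans (by positivity) (h2 ξ).1)
    (fun ξ => (h2 ξ).2.trans ?_) ξ (abs_nonneg _), fun ξ => (h2 ξ).1⟩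
  gcongr
  exact le_abs_self _

theorem IsCoefficient.memLp (hA : IsCoefficient Ω γ₁ γ₂ A) (hγ : 0 < γ₁)
    (hΛ : IsMuckenhoupt Λ β CA) {g : Space d → Space d}
    (hg : MemLp g 2 (weightedMeasure Ω Λ β)) :
    MemLp (fun x => A x (g x)) 2 (weightedMeasure Ω Λ β) := by
  refine hg.of_le_mul (c := |γ₂|) ?_ ?_
  · exact (ContinuousLinearMap.id ℝ (Space d →L[ℝ] Space d)).aestronglyMeasurable_comp₂
      ((aestronglyMeasurable_weightedMeasure_iff hΛ).2 hA.measurable) hg.1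
  · filter_upwards [hA.ae_bounds hγ hΛ] with x hx using hx.1 _

theorem IsCoefficient.l2norm_apply_le (hA : IsCoefficient Ω γ₁ γ₂ A) (hγ : 0 < γ₁)
    (hΛ : IsMuckenhoupt Λ β CA) {g : Space d → Space d}
    (hg : MemLp g 2 (weightedMeasure Ω Λ β)) :
    l2norm (weightedMeasure Ω Λ β) (fun x => A x (g x)) ≤
      |γ₂| * l2norm (weightedMeasure Ω Λ β) g := by
  refine l2norm_le_mul (abs_nonneg _) hg ?_
  filter_upwards [hA.ae_bounds hγ hΛ] with x hx using hx.1 _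

theorem IsCoefficient.mul_l2norm_sq_le (hA : IsCoefficient Ω γ₁ γ₂ A) (hγ : 0 < γ₁)
    (hΛ : IsMuckenhoupt Λ β CA) {g : Space d → Space d}
    (hg : MemLp g 2 (weightedMeasure Ω Λ β)) :
    γ₁ * l2norm (weightedMeasure Ω Λ β) g ^ 2 ≤
      ∫ x, ⟪A x (g x), g x⟫ ∂weightedMeasure Ω Λ β := by
  rw [l2norm_sq hg, ← integral_const_mul]
  refine integral_mono_ae (hg.integrable_norm_pow two_ne_zero |>.const_mul _)
    (integrable_inner_of_memLp (hA.memLp hγ hΛ hg) hg) ?_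
  filter_upwards [hA.ae_bounds hγ hΛ] with x hx using hx.2 _

/-- Multiplication by the coefficient, as an operator on `L²`. -/
theorem IsCoefficient.exists_mulOperator (hA : IsCoefficient Ω γ₁ γ₂ A) (hγ : 0 < γ₁)
    (hΛ : IsMuckenhoupt Λ β CA) :
    ∃ T : Lp (Space d) 2 (weightedMeasure Ω Λ β) →L[ℝ] Lp (Space d) 2 (weightedMeasure Ω Λ β),
      ∀ g, T g =ᵐ[weightedMeasure Ω Λ β] fun x => A x (g x) := by
  have hm : ∀ g : Lp (Space d) 2 (weightedMeasure Ω Λ β), MemLp (fun x => A x (g x)) 2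
    (weightedMeasure Ω Λ β) := fun g => hA.memLp hγ hΛ (Lp.memLp g)
  refine ⟨LinearMap.mkContinuous
    { toFun := fun g => (hm g).toLp
      map_add' := fun g h => ?_
      map_smul' := fun c g => ?_ } |γ₂| fun g => ?_, fun g => ?_⟩
  · rw [← MemLp.toLp_add (hm g) (hm h)]
    refine MemLp.toLp_congr _ _ ?_
    filter_upwards [Lp.coeFn_add g h] with x hx
    rw [hx, Pi.add_apply, map_add]; rfl
  · rw [RingHom.id_apply, ← MemLp.toLp_const_smul c (hm g)]
    refine MemLp.toLp_congr _ _ ?_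
    filter_upwards [Lp.coeFn_smul c g] with x hx
    rw [hx, Pi.smul_apply, map_smul]; rfl
  · have := hA.l2norm_apply_le hγ hΛ (Lp.memLp g)
    rw [LinearMap.coe_mk, AddHom.coe_mk, Lp.norm_toLp]
    exact this
  · exact (hm g).coeFn_toLp

end Coefficient

end WeightedLOD

end

noncomputable section

namespace WeightedLOD

/-! ### Fine-scale functions together with their gradients -/

namespace Mesh

/-- The standing assumptions: a Lipschitz domain, a Muckenhoupt weight and a quasi-uniform mesh. -/
structure IsAdmissible {d : ℕ} {Ω : Set (Space d)} (M : Mesh Ω) (Λ : Set (Space d))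
    (β CA H σ : ℝ) : Prop where
  one_le : 1 ≤ σ
  quasiUniform : M.IsQuasiUniform H σ
  muckenhoupt : IsMuckenhoupt Λ β CA
  domain : IsLipschitzDomain Ω
  pos : 0 < d

/-- `q` is a fine-scale function vanishing off `D`, with gradient `g`. -/
structure IsFine {d : ℕ} {Ω : Set (Space d)} (M : Mesh Ω) (Λ : Set (Space d)) (β : ℝ)
    (D : Set (Space d)) (q : Space d → ℝ) (g : Space d → Space d) : Prop where
  grad : HasH10Gradient Ω Λ β q g
  proj : ∀ v ∈ M.innerNodes, M.localProjection Λ β v q v = 0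
  vanish : ∀ᵐ x ∂weightedMeasure Ω Λ β, x ∉ D → q x = 0

variable {d : ℕ} {Ω Λ D : Set (Space d)} {β CA H σ γ₁ γ₂ : ℝ} {M : Mesh Ω}
  {A : Space d → Space d →L[ℝ] Space d} {q q' : Space d → ℝ} {g g' : Space d → Space d}

namespace IsFine

theorem sub (hS : M.IsAdmissible Λ β CA H σ) (h : M.IsFine Λ β D q g)
    (h' : M.IsFine Λ β D q' g') : M.IsFine Λ β D (q - q') (g - g') := by
  refine ⟨h.grad.sub h'.grad, fun v hv => ?_, ?_⟩
  · rw [localProjection_sub hS.one_le hS.quasiUniform hS.muckenhoupt hS.domain hv h.grad.memLp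
      h'.grad.memLp, h.proj v hv, h'.proj v hv, sub_zero]
  · filter_upwards [h.vanish, h'.vanish] with x hx hx' hxD
    simp [hx hxD, hx' hxD]

theorem const_smul (hS : M.IsAdmissible Λ β CA H σ) (h : M.IsFine Λ β D q g) (c : ℝ) :
    M.IsFine Λ β D (c • q) (c • g) := by
  refine ⟨h.grad.const_smul c, fun v hv => ?_, ?_⟩
  · rw [localProjection_const_smul hS.one_le hS.quasiUniform hS.muckenhoupt hS.domain hv
      h.grad.memLp, h.proj v hv, mul_zero]
  · filter_upwards [h.vanish] with x hx hxD
    simp [hx hxD]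

theorem congr_ae (hS : M.IsAdmissible Λ β CA H σ) (h : M.IsFine Λ β D q g)
    (hq : q =ᵐ[weightedMeasure Ω Λ β] q') (hg : g =ᵐ[weightedMeasure Ω Λ β] g') :
    M.IsFine Λ β D q' g' := by
  have h1 := h.grad.congr_ae hq hg
  refine ⟨h1, fun v hv => ?_, ?_⟩
  · rw [← h.proj v hv]
    refine localProjection_congr hS.one_le hS.quasiUniform hS.muckenhoupt hS.domain hv h1.memLp
      h.grad.memLp ?_
    filter_upwards [hq] with x hx _ using hx.symm
  · filter_upwards [hq, h.vanish] with x h1 h2 hxD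
    rw [← h1, h2 hxD]

theorem zero (hS : M.IsAdmissible Λ β CA H σ) : M.IsFine Λ β D 0 0 :=
  ⟨HasH10Gradient.zero, fun v hv => by
    rw [localProjection_of_mem_coarseSpace hS.one_le hS.quasiUniform hS.muckenhoupt hS.domain hv
      M.coarseSubmodule.zero_mem]; rfl, Eventually.of_forall fun _ _ => rfl⟩

theorem add (hS : M.IsAdmissible Λ β CA H σ) (h : M.IsFine Λ β D q g)
    (h' : M.IsFine Λ β D q' g') : M.IsFine Λ β D (q + q') (g + g') := by
  simpa [sub_eq_add_neg] using h.sub hS (h'.const_smul hS (-1))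

theorem sum (hS : M.IsAdmissible Λ β CA H σ) {ι : Type*} (s : Finset ι) {q : ι → Space d → ℝ}
    {g : ι → Space d → Space d} (h : ∀ i ∈ s, M.IsFine Λ β D (q i) (g i)) :
    M.IsFine Λ β D (∑ i ∈ s, q i) (∑ i ∈ s, g i) := by
  classical
  induction s using Finset.induction_on with
  | empty => simpa using zero hS
  | insert a s ha ih =>
    rw [Finset.sum_insert ha, Finset.sum_insert ha]
    exact (h a (by simp)).add hS (ih fun i hi => h i (by simp [hi]))

theorem mono {D' : Set (Space d)} (h : M.IsFine Λ β D q g) (hD : D ⊆ D') :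
    M.IsFine Λ β D' q g :=
  ⟨h.grad, h.proj, by filter_upwards [h.vanish] with x hx hxD using hx fun h => hxD (hD h)⟩

theorem of_limit (hS : M.IsAdmissible Λ β CA H σ) (hD : MeasurableSet D)
    (hq : MemLp q 2 (weightedMeasure Ω Λ β)) (hg : MemLp g 2 (weightedMeasure Ω Λ β))
    (h : ∀ ε : ENNReal, ε ≠ 0 → ∃ q' g', M.IsFine Λ β D q' g' ∧
      eLpNorm (q - q') 2 (weightedMeasure Ω Λ β) ≤ ε ∧
      eLpNorm (g - g') 2 (weightedMeasure Ω Λ β) ≤ ε) : M.IsFine Λ β D q g := by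
  refine ⟨HasH10Gradient.of_limit hq hg fun ε hε => ?_, fun v hv => ?_, ?_⟩
  · obtain ⟨q', g', h1, h2, h3⟩ := h ε hε
    exact ⟨q', g', h1.grad, h2, h3⟩
  · obtain ⟨C, hC⟩ := exists_localProjection_le d CA hS.one_le one_pos
    have hW := hS.muckenhoupt.lintegral_ball_pos v (R := 1 * H) (by linarith [hS.quasiUniform.1])
    have key : ‖M.localProjection Λ β v q v‖ₑ ^ 2 *
        ∫⁻ x in Metric.ball v (1 * H), eweight Λ β x = 0 := by
      refine le_antisymm (le_of_forall_le_add_mul_sq (K := C) ENNReal.coe_ne_top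
        fun ε hε => ?_) bot_le
      obtain ⟨q', g', h1, h2, -⟩ := h ε hε
      have h3 := hC hS.domain hS.muckenhoupt hS.quasiUniform _ (hq.sub h1.grad.memLp) v hv
      rw [localProjection_sub hS.one_le hS.quasiUniform hS.muckenhoupt hS.domain hv hq
        h1.grad.memLp, h1.proj v hv, sub_zero] at h3
      rw [zero_add]
      refine h3.trans (mul_le_mul_right ((setLIntegral_le_lintegral _ _).trans ?_) _)
      rw [← eLpNorm_two_sq]
      gcongr
    rw [mul_eq_zero, or_iff_left hW.ne', pow_eq_zero_iff two_ne_zero, enorm_eq_zero] at key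
    exact key
  · have key : ∫⁻ x in Dᶜ, ‖q x‖ₑ ^ 2 ∂weightedMeasure Ω Λ β = 0 := by
      refine le_antisymm (le_of_forall_le_add_mul_sq (K := 1) ENNReal.one_ne_top
        fun ε hε => ?_) bot_le
      obtain ⟨q', g', h1, h2, -⟩ := h ε hε
      have h3 : ∫⁻ x in Dᶜ, ‖q x‖ₑ ^ 2 ∂weightedMeasure Ω Λ β =
          ∫⁻ x in Dᶜ, ‖(q - q') x‖ₑ ^ 2 ∂weightedMeasure Ω Λ β := by
        refine setLIntegral_congr_fun_ae hD.compl ?_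
        filter_upwards [h1.vanish] with x hx hxD
        rw [Pi.sub_apply, hx hxD, sub_zero]
      rw [h3, zero_add, one_mul]
      refine (setLIntegral_le_lintegral _ _).trans ?_
      rw [← eLpNorm_two_sq]
      gcongr
    rw [lintegral_eq_zero_iff' (hq.1.restrict.enorm.pow_const 2)] at key
    rw [Filter.EventuallyEq, ae_restrict_iff' hD.compl] at key
    filter_upwards [key] with x hx hxD
    simpa using hx hxD

theorem weakGradient_ae_eq (hS : M.IsAdmissible Λ β CA H σ) (h : M.IsFine Λ β D q g) :
    weakGradient Ω q =ᵐ[weightedMeasure Ω Λ β] g :=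
  h.grad.weakGradient_ae_eq hS.muckenhoupt hS.domain.isBounded hS.domain.isOpen

/-- The gradient of a function supported in a patch is supported there. -/
theorem gradient_ae_eq_zero (hS : M.IsAdmissible Λ β CA H σ) {v : Space d} {k : ℕ}
    (h : M.IsFine Λ β (M.patch v k) q g) :
    ∀ᵐ x ∂weightedMeasure Ω Λ β, x ∉ M.patch v k → g x = 0 := by
  have h1 : ∀ᵐ x ∂weightedMeasure Ω Λ β, ∀ t ∈ M.cells,
      x ∈ interior (convexHull ℝ (t : Set (Space d))) → x ∉ M.patch v k → g x = 0 := by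
    rw [ae_ball_iff M.finite_cells.countable]
    intro t ht
    by_cases hl : M.InLayer v k t
    · refine Eventually.of_forall fun x hx hxp => ?_
      exact absurd (interior_cell_subset_patch hS.domain ht hl hx) hxp
    · have hdisj : ∀ x ∈ interior (convexHull ℝ (t : Set (Space d))), x ∉ M.patch v k := by
        intro x hx hxp
        obtain ⟨t', ht', hl', hxt'⟩ : ∃ t' ∈ M.cells, M.InLayer v k t' ∧
            x ∈ convexHull ℝ (t' : Set (Space d)) := by
          cases k with
          | zero =>
            have h2 := hxp.1
            simp only [mem_iUnion] at h2
            obtain ⟨t', ⟨h3, h4⟩, h5⟩ := h2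
            exact ⟨t', h3, h4, h5⟩
          | succ k =>
            have h2 := interior_subset hxp.1
            simp only [mem_iUnion] at h2
            obtain ⟨t', ⟨h3, h4⟩, h5⟩ := h2
            exact ⟨t', h3, h4, h5⟩
        have hsub : t ⊆ t' := fun p hp => by
          by_contra hp'
          have h2 := (mem_interior_cell_iff ht).1 hx p hp
          rw [bary_congr ht ht' (interior_subset hx) hxt', bary_of_notMem hp'] at h2
          exact lt_irrefl _ h2
        rw [Finset.eq_of_subset_of_card_le hsub (by rw [ht.2, ht'.2])] at hl
        exact hl hl'
      have h2 := h.grad.ae_eq_zero hS.muckenhoupt hS.domain.isBounded isOpen_interior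
        (interior_cell_subset hS.domain ht) (by
          filter_upwards [h.vanish] with x hx hxt using hx (hdisj x hxt))
      filter_upwards [h2] with x hx hxt _ using hx hxt
  have h2 : ∀ᵐ x ∂weightedMeasure Ω Λ β, ∃ t ∈ M.cells,
      x ∈ interior (convexHull ℝ (t : Set (Space d))) := by
    rw [weightedMeasure_ae hS.muckenhoupt, ae_restrict_iff' hS.domain.isOpen.measurableSet]
    exact M.ae_mem_interior_cell
  filter_upwards [h1, h2] with x hx ⟨t, ht, hxt⟩ using hx t ht hxt

end IsFine

theorem exists_l2norm_le (hS : M.IsAdmissible Λ β CA H σ) : ∃ C : NNReal,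
    ∀ {q : Space d → ℝ} {g : Space d → Space d}, M.IsFine Λ β D q g →
      l2norm (weightedMeasure Ω Λ β) q ≤ √C * l2norm (weightedMeasure Ω Λ β) g := by
  obtain ⟨C, hC⟩ := exists_fine_poincare hS.pos hS.domain CA hS.one_le
  refine ⟨C * Real.toNNReal (H ^ 2), fun {q g} h => l2norm_le_sqrt_mul h.grad.memLp_grad ?_⟩
  have h1 := hC hS.muckenhoupt hS.quasiUniform h.grad h.proj (m := fun _ => 1)
    ⟨continuous_const, fun _ => zero_le_one, fun x y => by
      rw [mul_one, Real.one_le_exp_iff]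
      exact div_nonneg dist_nonneg hS.quasiUniform.1.le⟩
  rw [ENNReal.coe_mul]
  simp only [one_mul, one_smul] at h1
  exact h1

theorem exists_inner_eq_of_le {V W : Type*} [NormedAddCommGroup V] [InnerProductSpace ℝ V]
    [CompleteSpace V] [NormedAddCommGroup W] [InnerProductSpace ℝ W] (P : V →L[ℝ] W)
    (T : W →L[ℝ] W) (b : W) {γ C : ℝ} (hγ : 0 < γ) (hC : 0 < C)
    (hP : ∀ p, ‖p‖ ^ 2 ≤ C * ‖P p‖ ^ 2) (hT : ∀ g, γ * ‖g‖ ^ 2 ≤ ⟪T g, g⟫) :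
    ∃ p, ∀ p', ⟪T (P p), P p'⟫ = ⟪b, P p'⟫ := by
  set B : V →L[ℝ] V →L[ℝ] ℝ := (innerSL ℝ).bilinearComp (T.comp P) P with hB
  have hBapp : ∀ p p' : V, B p p' = ⟪T (P p), P p'⟫ := fun p p' => rfl
  have hcoer : IsCoercive B := by
    refine ⟨γ / C, by positivity, fun p => ?_⟩
    rw [hBapp]
    refine le_trans ?_ (hT (P p))
    rw [mul_assoc, ← sq, div_mul_eq_mul_div, div_le_iff₀ hC]
    have := mul_le_mul_of_nonneg_left (hP p) hγ.le
    linarith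
  obtain ⟨p, hp⟩ := hcoer.continuousLinearEquivOfBilin.surjective
    ((InnerProductSpace.toDual ℝ V).symm ((innerSL ℝ b).comp P))
  refine ⟨p, fun p' => ?_⟩
  have h1 := hcoer.continuousLinearEquivOfBilin_apply p p'
  rw [hp, InnerProductSpace.toDual_symm_apply, hBapp] at h1
  exact h1.symm

/-- Pairs of a fine-scale function vanishing off `D` and its gradient. -/
def fineGraph (hS : M.IsAdmissible Λ β CA H σ) (D : Set (Space d)) :
    Submodule ℝ (WithLp 2 (Lp ℝ 2 (weightedMeasure Ω Λ β) ×
      Lp (Space d) 2 (weightedMeasure Ω Λ β))) where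
  carrier := {p | M.IsFine Λ β D p.fst p.snd}
  add_mem' := fun {p p'} h h' => (IsFine.add hS h h').congr_ae hS
    (Lp.coeFn_add p.fst p'.fst).symm (Lp.coeFn_add p.snd p'.snd).symm
  zero_mem' := (IsFine.zero hS).congr_ae hS (Lp.coeFn_zero _ _ _).symm (Lp.coeFn_zero _ _ _).symm
  smul_mem' := fun c p h => (IsFine.const_smul hS h c).congr_ae hS
    (Lp.coeFn_smul c p.fst).symm (Lp.coeFn_smul c p.snd).symm

theorem mem_fineGraph (hS : M.IsAdmissible Λ β CA H σ) {p : WithLp 2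
    (Lp ℝ 2 (weightedMeasure Ω Λ β) × Lp (Space d) 2 (weightedMeasure Ω Λ β))} :
    p ∈ fineGraph hS D ↔ M.IsFine Λ β D p.fst p.snd := Iff.rfl

theorem isClosed_fineGraph (hS : M.IsAdmissible Λ β CA H σ) (hD : MeasurableSet D) :
    IsClosed (fineGraph hS D : Set (WithLp 2 (Lp ℝ 2 (weightedMeasure Ω Λ β) ×
      Lp (Space d) 2 (weightedMeasure Ω Λ β)))) := by
  refine isClosed_of_closure_subset fun p hp => ?_
  refine (mem_fineGraph hS).2 (IsFine.of_limit hS hD (Lp.memLp _) (Lp.memLp _) fun ε hε => ?_)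
  obtain ⟨p', hp', hd⟩ := EMetric.mem_closure_iff.1 hp ε (pos_iff_ne_zero.2 hε)
  refine ⟨_, _, (mem_fineGraph hS).1 hp', ?_, ?_⟩
  · rw [← Lp.edist_def]
    exact (WithLp.edist_fst_le p p').trans hd.le
  · rw [← Lp.edist_def]
    exact (WithLp.edist_snd_le p p').trans hd.le

/-- Existence of correctors. -/
theorem exists_isFine_solution (hS : M.IsAdmissible Λ β CA H σ) (hA : IsCoefficient Ω γ₁ γ₂ A)
    (hγ : 0 < γ₁) (hD : MeasurableSet D) {b : Space d → Space d}
    (hb : MemLp b 2 (weightedMeasure Ω Λ β)) :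
    ∃ q g, M.IsFine Λ β D q g ∧ ∀ w gw, M.IsFine Λ β D w gw →
      ∫ x, ⟪A x (g x), gw x⟫ ∂weightedMeasure Ω Λ β =
        ∫ x, ⟪b x, gw x⟫ ∂weightedMeasure Ω Λ β := by
  obtain ⟨T, hT⟩ := hA.exists_mulOperator hγ hS.muckenhoupt (β := β)
  have hTi : ∀ g h : Lp (Space d) 2 (weightedMeasure Ω Λ β),
      ⟪T g, h⟫ = ∫ x, ⟪A x (g x), h x⟫ ∂weightedMeasure Ω Λ β := fun g h => by
    rw [L2.inner_def]
    refine integral_congr_ae ?_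
    filter_upwards [hT g] with x hx
    rw [hx]
  obtain ⟨C, hC⟩ := exists_l2norm_le (D := D) hS
  have : CompleteSpace (fineGraph hS D) := (isClosed_fineGraph hS hD).completeSpace_coe
  obtain ⟨p, hp⟩ := exists_inner_eq_of_le
    ((WithLp.sndL 2 ℝ (Lp ℝ 2 (weightedMeasure Ω Λ β))
      (Lp (Space d) 2 (weightedMeasure Ω Λ β))).comp (fineGraph hS D).subtypeL) T hb.toLp hγ
    (C := C + 1) (by positivity) (fun p => by
      have h1 := hC ((mem_fineGraph hS).1 p.2)
      have h2 : ‖p‖ ^ 2 = ‖(p : WithLp 2 (Lp ℝ 2 (weightedMeasure Ω Λ β) ×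
          Lp (Space d) 2 (weightedMeasure Ω Λ β))).fst‖ ^ 2 + ‖(p : WithLp 2
          (Lp ℝ 2 (weightedMeasure Ω Λ β) × Lp (Space d) 2 (weightedMeasure Ω Λ β))).snd‖ ^ 2 := by
        rw [Submodule.coe_norm, WithLp.prod_norm_sq_eq_of_L2]
      rw [l2norm, l2norm, ← Lp.norm_def, ← Lp.norm_def] at h1
      rw [h2]
      have h3 := pow_le_pow_left₀ (norm_nonneg _) h1 2
      rw [mul_pow, Real.sq_sqrt C.coe_nonneg] at h3
      rw [add_mul, one_mul]
      exact add_le_add_left h3 _)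
    (fun g => by
      rw [hTi, Lp.norm_def]
      exact hA.mul_l2norm_sq_le hγ hS.muckenhoupt (Lp.memLp g))
  refine ⟨_, _, (mem_fineGraph hS).1 p.2, fun w gw hw => ?_⟩
  have h1 := hp ⟨WithLp.toLp 2 (hw.grad.memLp.toLp, hw.grad.memLp_grad.toLp),
    (mem_fineGraph hS).2 (hw.congr_ae hS hw.grad.memLp.coeFn_toLp.symm
      hw.grad.memLp_grad.coeFn_toLp.symm)⟩
  rw [hTi] at h1
  have h2 : ∫ x, ⟪b x, gw x⟫ ∂weightedMeasure Ω Λ β =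
    ⟪hb.toLp, hw.grad.memLp_grad.toLp⟫ := (inner_toLp hb hw.grad.memLp_grad).symm
  rw [h2]
  refine Eq.trans (integral_congr_ae ?_) h1
  filter_upwards [hw.grad.memLp_grad.coeFn_toLp] with x hx
  exact congrArg (fun y => ⟪A x _, y⟫) hx.symm

/-! ### Correctors -/

theorem mem_fineSpace_iff (hS : M.IsAdmissible Λ β CA H σ) :
    q ∈ M.fineSpace Λ β ↔ M.IsFine Λ β univ q (weakGradient Ω q) := by
  constructor
  · rintro ⟨h1, h2⟩
    exact ⟨h1.hasH10Gradient, quasiInterpolation_eq_zero_iff.1 h2,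
      Eventually.of_forall fun x hx => absurd (mem_univ x) hx⟩
  · intro h
    exact ⟨h.grad.memH10 hS.muckenhoupt hS.domain.isBounded hS.domain.isOpen,
      quasiInterpolation_eq_zero_iff.2 h.proj⟩

theorem mem_localFineSpace_iff (hS : M.IsAdmissible Λ β CA H σ) :
    q ∈ M.localFineSpace Λ β D ↔ M.IsFine Λ β D q (weakGradient Ω q) := by
  rw [localFineSpace, mem_ofPred_eq, mem_fineSpace_iff hS, ← weightedMeasure_ae (β := β)
    hS.muckenhoupt]
  exact ⟨fun h => ⟨h.1.grad, h.1.proj, h.2⟩, fun h => ⟨h.mono (subset_univ _), h.vanish⟩⟩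

theorem IsFine.isFine_weakGradient (hS : M.IsAdmissible Λ β CA H σ) (h : M.IsFine Λ β D q g) :
    M.IsFine Λ β D q (weakGradient Ω q) :=
  h.congr_ae hS ae_eq_rfl (h.weakGradient_ae_eq hS).symm

theorem hasH10Gradient_of_mem_coarseSpace (hS : M.IsAdmissible Λ β CA H σ) {u : Space d → ℝ}
    (hu : u ∈ M.coarseSpace) : HasH10Gradient Ω Λ β u (weakGradient Ω u) := by
  obtain ⟨L, hL⟩ := exists_lipschitzWith_of_mem_coarseSpace hS.domain.isOpen hu
  have h := hasH10Gradient_of_lipschitzWith (Ω := Ω) (Λ := Λ) (β := β) hS.muckenhoupt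
    hS.domain.isBounded hS.domain.isOpen hL hu.2
  exact h.congr_ae ae_eq_rfl (h.weakGradient_ae_eq hS.muckenhoupt hS.domain.isBounded
    hS.domain.isOpen).symm

theorem isIdealCorrector_iff (hS : M.IsAdmissible Λ β CA H σ) {u : Space d → ℝ} :
    M.IsIdealCorrector Λ β A u q ↔ M.IsFine Λ β univ q (weakGradient Ω q) ∧
      ∀ w gw, M.IsFine Λ β univ w gw →
        ∫ x, ⟪A x (weakGradient Ω q x), gw x⟫ ∂weightedMeasure Ω Λ β =
          ∫ x, ⟪A x (weakGradient Ω u x), gw x⟫ ∂weightedMeasure Ω Λ β := by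
  have key : ∀ f w : Space d → Space d, ∫ x in Ω, ⟪A x (f x), w x⟫ * weight Λ β x =
      ∫ x, ⟪A x (f x), w x⟫ ∂weightedMeasure Ω Λ β := fun f w => by
    have h1 : (weightedMeasure Ω Λ β).restrict Ω = weightedMeasure Ω Λ β :=
      weightedMeasure_restrict hS.domain.isOpen.measurableSet subset_rfl
    rw [← h1, integral_weightedMeasure hS.domain.isOpen.measurableSet subset_rfl]
    simp only [smul_eq_mul, mul_comm]
  rw [IsIdealCorrector, mem_fineSpace_iff hS]
  simp only [key]
  refine and_congr_right fun _ => ⟨fun h w gw hw => ?_, fun h w hw => ?_⟩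
  · have h1 := h w ((mem_fineSpace_iff hS).2 (hw.isFine_weakGradient hS))
    have h2 := hw.weakGradient_ae_eq hS
    have h3 : ∀ f : Space d → Space d, ∫ x, ⟪A x (f x), gw x⟫ ∂weightedMeasure Ω Λ β =
        ∫ x, ⟪A x (f x), weakGradient Ω w x⟫ ∂weightedMeasure Ω Λ β := fun f =>
      integral_congr_ae (by filter_upwards [h2] with x hx; rw [hx])
    rw [h3, h3, h1]
  · exact h w _ ((mem_fineSpace_iff hS).1 hw)

theorem isLocalCorrector_iff (hS : M.IsAdmissible Λ β CA H σ) {u : Space d → ℝ} {v : Space d}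
    {k : ℕ} : M.IsLocalCorrector Λ β A v k u q ↔
      M.IsFine Λ β (M.patch v k) q (weakGradient Ω q) ∧
      ∀ w gw, M.IsFine Λ β (M.patch v k) w gw →
        ∫ x, ⟪A x (weakGradient Ω q x), gw x⟫ ∂weightedMeasure Ω Λ β =
          ∫ x, ⟪M.hatNormalized v x • A x (weakGradient Ω u x), gw x⟫
            ∂weightedMeasure Ω Λ β := by
  have hmeas := measurableSet_patch (M := M) hS.domain.isOpen v
  have key : ∀ j, ∀ f : Space d → ℝ, ∫ x in M.patch v j, f x * weight Λ β x =
      ∫ x in M.patch v j, f x ∂weightedMeasure Ω Λ β := fun j f => by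
    rw [integral_weightedMeasure (hmeas j) (patch_subset v j)]
    simp only [smul_eq_mul, mul_comm]
  have k1 : ∀ (f : Space d → Space d) (w : Space d → ℝ) (gw : Space d → Space d), M.IsFine Λ β (M.patch v k) w gw →
      ∫ x in M.patch v k, ⟪A x (f x), gw x⟫ * weight Λ β x =
        ∫ x, ⟪A x (f x), gw x⟫ ∂weightedMeasure Ω Λ β := fun f w gw hw => by
    rw [key]
    refine setIntegral_eq_integral_of_ae_compl_eq_zero ?_
    filter_upwards [hw.gradient_ae_eq_zero hS] with x hx hxp
    rw [hx hxp, inner_zero_right]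
  have k2 : ∀ (f gw : Space d → Space d), ∫ x in M.patch v 0, M.hatNormalized v x *
      ⟪A x (f x), gw x⟫ * weight Λ β x =
        ∫ x, ⟪M.hatNormalized v x • A x (f x), gw x⟫ ∂weightedMeasure Ω Λ β := fun f gw => by
    simp only [inner_smul_left, conj_trivial]
    rw [key]
    refine setIntegral_eq_integral_of_ae_compl_eq_zero ?_
    rw [weightedMeasure_ae hS.muckenhoupt]
    filter_upwards [ae_restrict_mem hS.domain.isOpen.measurableSet] with x hx hxp
    rw [hatNormalized_eq_zero_of_notMem_patch hx hxp, zero_mul]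
  rw [IsLocalCorrector, mem_localFineSpace_iff hS]
  refine and_congr_right fun hq => ⟨fun h w gw hw => ?_, fun h w hw => ?_⟩
  · have h0 := hw.isFine_weakGradient hS
    have h1 := h w ((mem_localFineSpace_iff hS).2 h0)
    rw [k1 _ _ _ h0, k2] at h1
    have h2 := hw.weakGradient_ae_eq hS
    have h3 : ∀ f : Space d → Space d, ∫ x, ⟪f x, gw x⟫ ∂weightedMeasure Ω Λ β =
        ∫ x, ⟪f x, weakGradient Ω w x⟫ ∂weightedMeasure Ω Λ β := fun f =>
      integral_congr_ae (by filter_upwards [h2] with x hx; rw [hx])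
    rw [h3, h3, h1]
  · have hw' := (mem_localFineSpace_iff hS).1 hw
    rw [k1 _ _ _ hw', k2]
    exact h w _ hw'

theorem memLp_hatNormalized_smul (hS : M.IsAdmissible Λ β CA H σ) {v : Space d}
    (hv : v ∈ M.innerNodes) {b : Space d → Space d} (hb : MemLp b 2 (weightedMeasure Ω Λ β)) :
    MemLp (fun x => M.hatNormalized v x • b x) 2 (weightedMeasure Ω Λ β) := by
  refine hb.of_le_mul (c := 1) ((hS.quasiUniform.measurable_hatNormalized hS.one_le hS.domain
    hv).aestronglyMeasurable.smul hb.1) (Eventually.of_forall fun x => ?_)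
  rw [norm_smul, Real.norm_of_nonneg (hatNormalized_nonneg v x)]
  gcongr
  exact hatNormalized_le_one hv x

theorem exists_isIdealCorrector (hS : M.IsAdmissible Λ β CA H σ) (hA : IsCoefficient Ω γ₁ γ₂ A)
    (hγ : 0 < γ₁) {u : Space d → ℝ} (hu : u ∈ M.coarseSpace) :
    ∃ q, M.IsIdealCorrector Λ β A u q := by
  obtain ⟨q, g, h, heq⟩ := exists_isFine_solution hS hA hγ MeasurableSet.univ
    (hA.memLp hγ hS.muckenhoupt (hasH10Gradient_of_mem_coarseSpace hS hu).memLp_grad)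
  refine ⟨q, (isIdealCorrector_iff hS).2 ⟨h.isFine_weakGradient hS, fun w gw hw => ?_⟩⟩
  rw [← heq w gw hw]
  refine integral_congr_ae ?_
  filter_upwards [h.weakGradient_ae_eq hS] with x hx
  rw [hx]

theorem exists_isLocalCorrector (hS : M.IsAdmissible Λ β CA H σ) (hA : IsCoefficient Ω γ₁ γ₂ A)
    (hγ : 0 < γ₁) {u : Space d → ℝ} (hu : u ∈ M.coarseSpace) {v : Space d}
    (hv : v ∈ M.innerNodes) (k : ℕ) : ∃ q, M.IsLocalCorrector Λ β A v k u q := by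
  obtain ⟨q, g, h, heq⟩ := exists_isFine_solution hS hA hγ
    (measurableSet_patch (M := M) hS.domain.isOpen v k)
    (memLp_hatNormalized_smul hS hv
      (hA.memLp hγ hS.muckenhoupt (hasH10Gradient_of_mem_coarseSpace hS hu).memLp_grad))
  refine ⟨q, (isLocalCorrector_iff hS).2 ⟨h.isFine_weakGradient hS, fun w gw hw => ?_⟩⟩
  rw [← heq w gw hw]
  refine integral_congr_ae ?_
  filter_upwards [h.weakGradient_ae_eq hS] with x hx
  rw [hx]

end Mesh

end WeightedLOD

end

noncomputable section

namespace WeightedLOD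

/-! ### Exponential decay of correctors -/

theorem abs_exp_sub_exp_le {a b δ : ℝ} (h : |a - b| ≤ δ) :
    |Real.exp a - Real.exp b| ≤ |a - b| * (Real.exp δ * Real.exp a) := by
  have hδ : 0 ≤ δ := (abs_nonneg _).trans h
  have h1 : Real.exp b ≤ Real.exp δ * Real.exp a := by
    rw [← Real.exp_add]
    exact Real.exp_le_exp.2 (by linarith [neg_abs_le (a - b)])
  have h2 : Real.exp a ≤ Real.exp δ * Real.exp a :=
    le_mul_of_one_le_left (Real.exp_pos _).le (Real.one_le_exp hδ)
  have h3 : Real.exp a - Real.exp b ≤ (a - b) * Real.exp a := by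
    have := Real.add_one_le_exp (b - a)
    have h4 : Real.exp b = Real.exp (b - a) * Real.exp a := by rw [← Real.exp_add]; ring_nf
    rw [h4]
    nlinarith [Real.exp_pos a]
  have h4 : Real.exp b - Real.exp a ≤ (b - a) * Real.exp b := by
    have := Real.add_one_le_exp (a - b)
    have h4 : Real.exp a = Real.exp (a - b) * Real.exp b := by rw [← Real.exp_add]; ring_nf
    rw [h4]
    nlinarith [Real.exp_pos b]
  rw [abs_le]
  constructor
  · have : (b - a) * Real.exp b ≤ |a - b| * (Real.exp δ * Real.exp a) :=
      mul_le_mul (by rw [abs_sub_comm]; exact le_abs_self _) h1 (Real.exp_pos _).le (abs_nonneg _)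
    linarith
  · have : (a - b) * Real.exp a ≤ |a - b| * (Real.exp δ * Real.exp a) :=
      mul_le_mul (le_abs_self _) h2 (Real.exp_pos _).le (abs_nonneg _)
    linarith

theorem MemLp.continuous_smul {d : ℕ} {Ω Λ : Set (Space d)} {β : ℝ} (hΩ : IsLipschitzDomain Ω)
    {g : Space d → Space d} (hg : MemLp g 2 (weightedMeasure Ω Λ β)) {f : Space d → ℝ}
    (hf : Continuous f) : MemLp (fun x => f x • g x) 2 (weightedMeasure Ω Λ β) := by
  obtain ⟨C, hC⟩ := hΩ.isBounded.isCompact_closure.exists_bound_of_continuousOn hf.continuousOn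
  have hΩμ : ∀ᵐ x ∂weightedMeasure Ω Λ β, x ∈ Ω :=
    (withDensity_absolutelyContinuous _ _).ae_le (ae_restrict_mem hΩ.isOpen.measurableSet)
  refine hg.of_le_mul (c := C) (hf.aestronglyMeasurable.smul hg.1) ?_
  filter_upwards [hΩμ] with x hx
  rw [norm_smul]
  gcongr
  exact hC x (subset_closure hx)

theorem isSlow_mul_exp {d : ℕ} {H α c : ℝ} {s : Space d → ℝ} (hc : 0 ≤ c) (hs : Continuous s)
    (hα : α ≤ 1) (hH : 0 < H) (h : ∀ x y, |s x - s y| ≤ α * (dist x y / H)) :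
    IsSlow H (fun x => c * Real.exp (s x)) := by
  refine ⟨by fun_prop, fun x => by positivity, fun x y => ?_⟩
  have h1 : 0 ≤ dist x y / H := by positivity
  have h2 : Real.exp (s x) ≤ Real.exp (dist x y / H) * Real.exp (s y) := by
    rw [← Real.exp_add, Real.exp_le_exp]
    nlinarith [le_abs_self (s x - s y), h x y]
  calc c * Real.exp (s x) ≤ c * (Real.exp (dist x y / H) * Real.exp (s y)) := by gcongr
    _ = _ := by ring

theorem abs_dist_div_sub_le {d : ℕ} {H : ℝ} (hH : 0 < H) (v x y : Space d) :
    |dist x v / H - dist y v / H| ≤ dist x y / H := by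
  rw [← sub_div, abs_div, abs_of_pos hH]
  gcongr
  exact abs_dist_sub_le x y v

namespace Mesh

variable {d : ℕ} {Ω : Set (Space d)}

set_option maxHeartbeats 1000000 in
/-- Solutions of corrector problems with a source near `v` decay exponentially away from `v`. -/
theorem exists_l2norm_exp_smul_le (hd : 0 < d) (hΩ : IsLipschitzDomain Ω) (CA : ℝ) {σ γ₁ : ℝ}
    (γ₂ : ℝ) (hσ : 1 ≤ σ) (hγ : 0 < γ₁) : ∃ α > (0 : ℝ), α ≤ 1 ∧ ∃ K ≥ (0 : ℝ),
    ∀ {Λ : Set (Space d)} {β : ℝ} {M : Mesh Ω} {H : ℝ} {A : Space d → Space d →L[ℝ] Space d},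
      M.IsAdmissible Λ β CA H σ → IsCoefficient Ω γ₁ γ₂ A → ∀ {b : Space d → Space d} {v},
      MemLp b 2 (weightedMeasure Ω Λ β) → (∀ x, H < dist x v → b x = 0) →
      ∀ {q g}, M.IsFine Λ β univ q g →
      (∀ w gw, M.IsFine Λ β univ w gw → ∫ x, ⟪A x (g x), gw x⟫ ∂weightedMeasure Ω Λ β =
        ∫ x, ⟪b x, gw x⟫ ∂weightedMeasure Ω Λ β) →
      l2norm (weightedMeasure Ω Λ β) (fun x => Real.exp (α * (dist x v / H)) • g x) ≤
        K * l2norm (weightedMeasure Ω Λ β) b := by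
  obtain ⟨C, hC⟩ := exists_commutator_le hd hΩ CA hσ
  set κ₀ : ℝ := √C * (2 * Real.exp 2) with hκ₀
  have hκ0 : 0 ≤ κ₀ := by positivity
  set T : ℝ := 1 + κ₀ + 2 * κ₀ * |γ₂| / γ₁ with hT
  have hT0 : 0 ≤ 2 * κ₀ * |γ₂| / γ₁ := by positivity
  have hT1 : 1 ≤ T := by linarith
  have hTpos : 0 < T := by linarith
  refine ⟨1 / T, by positivity, by rw [div_le_one hTpos]; exact hT1,
    4 * Real.exp 1 / γ₁, by positivity,
    fun {Λ β M H A} hS hA {b v} hb hbv {q g} hq heq => ?_⟩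
  set α : ℝ := 1 / T with hα
  have hα0 : 0 < α := by positivity
  have hα1 : α ≤ 1 := by rw [hα, div_le_one hTpos]; exact hT1
  set κ : ℝ := κ₀ * α with hκ
  have hκnn : 0 ≤ κ := by positivity
  have hκ1 : κ ≤ 1 := by
    rw [hκ, hα, mul_one_div, div_le_one hTpos]; linarith
  have hκ2 : κ * |γ₂| ≤ γ₁ / 2 := by
    have h1 : κ₀ * |γ₂| ≤ γ₁ / 2 * T := by
      have : γ₁ / 2 * (2 * κ₀ * |γ₂| / γ₁) = κ₀ * |γ₂| := by field_simp
      rw [hT, mul_add, this]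
      have : 0 ≤ γ₁ / 2 * (1 + κ₀) := by positivity
      linarith
    rw [hκ, hα, mul_one_div, div_mul_eq_mul_div, div_le_iff₀ hTpos]
    exact h1
  have hH := hS.quasiUniform.1
  set μ := weightedMeasure Ω Λ β with hμ
  have hΩμ : ∀ᵐ x ∂μ, x ∈ Ω := by
    rw [hμ, weightedMeasure_ae hS.muckenhoupt]
    exact ae_restrict_mem hΩ.isOpen.measurableSet
  obtain ⟨n, hn0, hn⟩ : ∃ n : ℝ, 0 ≤ n ∧ ∀ x ∈ Ω, dist x v / H ≤ n := by
    obtain ⟨R, hR⟩ := hΩ.isBounded.subset_closedBall v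
    refine ⟨max 0 (R / H), le_max_left _ _, fun x hx => le_trans ?_ (le_max_right _ _)⟩
    gcongr
    exact hR hx
  set s : Space d → ℝ := fun x => α * min (dist x v / H) n with hs
  have hs0 : ∀ x, 0 ≤ s x := fun x => by
    have : 0 ≤ min (dist x v / H) n := le_min (by positivity) hn0
    positivity
  have hsn : ∀ x, s x ≤ α * n := fun x => by
    rw [hs]; dsimp only; gcongr; exact min_le_right _ _
  have hslip : ∀ x y, |s x - s y| ≤ α * (dist x y / H) := fun x y => by
    rw [hs]; dsimp only
    rw [← mul_sub, abs_mul, abs_of_pos hα0]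
    gcongr
    refine (abs_min_sub_min_le_max _ _ _ _).trans ?_
    rw [sub_self, abs_zero, max_eq_left (abs_nonneg _)]
    exact abs_dist_div_sub_le hH v x y
  have hsc : Continuous s := by rw [hs]; fun_prop
  have hsα : ∀ᵐ x ∂μ, s x = α * (dist x v / H) := by
    filter_upwards [hΩμ] with x hx
    rw [hs]; dsimp only; rw [min_eq_left (hn x hx)]
  have hηlip : LipschitzWith (Real.toNNReal (2 * α / H * (Real.exp (2 * (α * n)) *
      Real.exp (2 * (α * n))))) (fun x => Real.exp (2 * s x)) := by
    refine LipschitzWith.of_dist_le_mul fun x y => ?_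
    rw [Real.coe_toNNReal _ (by positivity), Real.dist_eq]
    have h0 : |2 * s x - 2 * s y| = 2 * |s x - s y| := by
      rw [← mul_sub, abs_mul, abs_two]
    have h1 : |2 * s x - 2 * s y| ≤ 2 * (α * n) := by
      rw [h0]
      gcongr
      rw [abs_le]
      constructor <;> linarith [hs0 x, hs0 y, hsn x, hsn y]
    refine (abs_exp_sub_exp_le h1).trans ?_
    calc |2 * s x - 2 * s y| * (Real.exp (2 * (α * n)) * Real.exp (2 * s x))
        ≤ (2 * (α * (dist x y / H))) * (Real.exp (2 * (α * n)) * Real.exp (2 * (α * n))) := by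
          rw [h0]
          gcongr
          · exact hslip x y
          · linarith [hsn x]
      _ = _ := by ring
  obtain ⟨gw, hgw, hproj, hle⟩ := hC hS.muckenhoupt hS.quasiUniform hq.grad hq.proj hηlip
    (B := Real.exp (2 * (α * n)))
    (fun x => by rw [abs_of_pos (Real.exp_pos _), Real.exp_le_exp]; linarith [hsn x])
    (isSlow_mul_exp (s := fun x => -s x) zero_le_one hsc.neg hα1 hH fun x y => by
      rw [← abs_neg]; simpa [sub_eq_add_neg, add_comm] using hslip x y)
    (isSlow_mul_exp (c := 2 * Real.exp 2 * α) (by positivity) hsc hα1 hH hslip)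
    (fun x y hxy => by
      have hxy1 : dist x y / H ≤ 1 := by rw [div_le_one hH]; exact hxy
      have h0 : |2 * s x - 2 * s y| = 2 * |s x - s y| := by
        rw [← mul_sub, abs_mul, abs_two]
      have h1 : |2 * s x - 2 * s y| ≤ 2 := by
        rw [h0]
        have : 0 ≤ dist x y / H := by positivity
        nlinarith [hslip x y]
      calc 1 * Real.exp (-s x) * |Real.exp (2 * s x) - Real.exp (2 * s y)|
          ≤ 1 * Real.exp (-s x) * (|2 * s x - 2 * s y| * (Real.exp 2 * Real.exp (2 * s x))) := by
            gcongr; exact abs_exp_sub_exp_le h1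
        _ ≤ 1 * Real.exp (-s x) * (2 * (α * (dist x y / H)) *
              (Real.exp 2 * Real.exp (2 * s x))) := by
            rw [h0]; gcongr; exact hslip x y
        _ = _ := by
            have : Real.exp (2 * s x) = Real.exp (s x) * Real.exp (s x) := by
              rw [← Real.exp_add]; ring_nf
            have h3 : Real.exp (-s x) * Real.exp (s x) = 1 := by
              rw [← Real.exp_add]; simp
            rw [this]
            linear_combination (2 * α * (dist x y / H) * Real.exp 2 * Real.exp (s x)) * h3)
  have hfine : M.IsFine Λ β univ _ gw := ⟨hgw, hproj, Eventually.of_forall fun x hx =>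
    absurd (mem_univ x) hx⟩
  have hE := heq _ gw hfine
  set P : Space d → Space d := fun x => Real.exp (s x) • g x with hP
  set R : Space d → Space d :=
    fun x => (1 * Real.exp (-s x)) • (gw x - Real.exp (2 * s x) • g x) with hR
  have hgm := hq.grad.memLp_grad
  have hPm : MemLp P 2 μ := MemLp.continuous_smul hΩ hgm (by fun_prop)
  have hRm : MemLp R 2 μ := MemLp.continuous_smul hΩ (hgw.memLp_grad.sub
    (MemLp.continuous_smul hΩ hgm (f := fun x => Real.exp (2 * s x)) (by fun_prop))) (by fun_prop)
  have hgw_eq : ∀ x, gw x = Real.exp (s x) • (P x + R x) := fun x => by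
    have h1 : Real.exp (s x) * Real.exp (s x) = Real.exp (2 * s x) := by
      rw [← Real.exp_add]; ring_nf
    have h3 : Real.exp (s x) * Real.exp (-s x) = 1 := by rw [← Real.exp_add]; simp
    rw [hP, hR]; dsimp only
    rw [smul_add, smul_smul, smul_smul, h1, one_mul, h3, one_smul]
    abel
  set X := l2norm μ P with hX
  have hX0 : 0 ≤ X := l2norm_nonneg
  have hRle : l2norm μ R ≤ κ * X := by
    have hmm : MemLp (fun x => (2 * Real.exp 2 * α * Real.exp (s x)) • g x) 2 μ :=
      MemLp.continuous_smul hΩ hgm (by fun_prop)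
    refine (l2norm_le_sqrt_mul hmm hle).trans ?_
    have h1 : l2norm μ (fun x => (2 * Real.exp 2 * α * Real.exp (s x)) • g x) ≤
        2 * Real.exp 2 * α * X := by
      refine l2norm_le_mul (by positivity) hPm (Eventually.of_forall fun x => ?_)
      rw [hP]; dsimp only
      rw [mul_smul, norm_smul, Real.norm_of_nonneg (by positivity)]
    calc √C * _ ≤ √C * (2 * Real.exp 2 * α * X) := by gcongr
      _ = κ * X := by rw [hκ, hκ₀]; ring
  set Bb : Space d → Space d := fun x => Real.exp (s x) • b x with hBb
  have hBm : MemLp Bb 2 μ := MemLp.continuous_smul hΩ hb (by fun_prop)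
  have hBle : l2norm μ Bb ≤ Real.exp 1 * l2norm μ b := by
    refine l2norm_le_mul (Real.exp_pos _).le hb (Eventually.of_forall fun x => ?_)
    rw [hBb]; dsimp only
    by_cases hx : H < dist x v
    · rw [hbv x hx]; simp
    · rw [norm_smul, Real.norm_of_nonneg (Real.exp_pos _).le]
      gcongr
      calc s x ≤ α * (dist x v / H) := by
            rw [hs]; dsimp only; gcongr; exact min_le_left _ _
        _ ≤ 1 * 1 := by
            gcongr
            rw [div_le_one hH]; exact not_lt.1 hx
        _ = 1 := one_mul 1
  have hAP := hA.memLp hγ hS.muckenhoupt hPm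
  have hL : ∫ x, ⟪A x (g x), gw x⟫ ∂μ = ∫ x, ⟪A x (P x), P x⟫ ∂μ + ∫ x, ⟪A x (P x), R x⟫ ∂μ := by
    rw [← integral_add (integrable_inner_of_memLp hAP hPm) (integrable_inner_of_memLp hAP hRm)]
    refine integral_congr_ae (Eventually.of_forall fun x => ?_)
    dsimp only
    rw [hgw_eq x, ← inner_add_right, inner_smul_right, hP]
    dsimp only
    rw [map_smul, inner_smul_left]; simp
  have hRr : ∫ x, ⟪b x, gw x⟫ ∂μ = ∫ x, ⟪Bb x, (P + R) x⟫ ∂μ := by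
    refine integral_congr_ae (Eventually.of_forall fun x => ?_)
    dsimp only
    rw [hgw_eq x, inner_smul_right, hBb]
    dsimp only
    rw [inner_smul_left]; simp
  have e1 := hA.mul_l2norm_sq_le hγ hS.muckenhoupt hPm
  have e2 := (abs_integral_inner_le hAP hRm).trans
    (mul_le_mul (hA.l2norm_apply_le hγ hS.muckenhoupt hPm) hRle l2norm_nonneg (by positivity))
  have e3 : |∫ x, ⟪Bb x, (P + R) x⟫ ∂μ| ≤ Real.exp 1 * l2norm μ b * (X + κ * X) :=
    (abs_integral_inner_le hBm (hPm.add hRm)).trans (mul_le_mul hBle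
      ((l2norm_add_le hPm hRm).trans (by gcongr)) l2norm_nonneg
      (mul_nonneg (Real.exp_pos _).le l2norm_nonneg))
  rw [hL, hRr] at hE
  have e4 : γ₁ * X ^ 2 ≤ Real.exp 1 * l2norm μ b * (2 * X) + γ₁ / 2 * X ^ 2 := by
    have f1 : Real.exp 1 * l2norm μ b * (X + κ * X) ≤ Real.exp 1 * l2norm μ b * (2 * X) := by
      have := mul_nonneg (Real.exp_pos 1).le (l2norm_nonneg (μ := μ) (f := b))
      refine mul_le_mul_of_nonneg_left ?_ this
      nlinarith
    have f2 : |γ₂| * X * (κ * X) ≤ γ₁ / 2 * X ^ 2 := by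
      have := mul_le_mul_of_nonneg_right hκ2 (sq_nonneg X)
      nlinarith
    have f3 := neg_abs_le (∫ x, ⟪A x (P x), R x⟫ ∂μ)
    have f4 := le_abs_self (∫ x, ⟪Bb x, (P + R) x⟫ ∂μ)
    linarith
  have e5 : l2norm μ (fun x => Real.exp (α * (dist x v / H)) • g x) = X := by
    refine l2norm_congr_ae ?_
    filter_upwards [hsα] with x hx
    rw [hP]; dsimp only; rw [hx]
  rw [e5]
  rcases hX0.eq_or_lt with h0 | h0
  · rw [← h0]
    exact mul_nonneg (by positivity) l2norm_nonneg
  · rw [div_mul_eq_mul_div, le_div_iff₀ hγ]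
    have : γ₁ * X * X ≤ 4 * Real.exp 1 * l2norm μ b * X := by nlinarith
    have := le_of_mul_le_mul_right this h0
    linarith

set_option maxHeartbeats 1000000 in
/-- Truncating the corrector to a patch costs an exponentially small error. -/
theorem exists_l2norm_sub_le (hd : 0 < d) (hΩ : IsLipschitzDomain Ω) (CA : ℝ) {σ γ₁ α c : ℝ}
    (γ₂ : ℝ) (hσ : 1 ≤ σ) (hγ : 0 < γ₁) (hα0 : 0 < α) (hα1 : α ≤ 1)
    (hc : ∀ {M : Mesh Ω} {H : ℝ}, M.IsQuasiUniform H σ →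
      ∀ v ∈ M.innerNodes, ∀ k : ℕ, ∀ᵐ x ∂(volume : Measure (Space d)), x ∈ Ω →
        dist x v ≤ (c * k - 1) * H → x ∈ M.patch v k) : ∃ K ≥ (0 : ℝ),
    ∀ {Λ : Set (Space d)} {β : ℝ} {M : Mesh Ω} {H : ℝ} {A : Space d → Space d →L[ℝ] Space d},
      M.IsAdmissible Λ β CA H σ → IsCoefficient Ω γ₁ γ₂ A → ∀ {b : Space d → Space d} {v},
      v ∈ M.innerNodes → ∀ {q g}, M.IsFine Λ β univ q g →
      (∀ w gw, M.IsFine Λ β univ w gw → ∫ x, ⟪A x (g x), gw x⟫ ∂weightedMeasure Ω Λ β =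
        ∫ x, ⟪b x, gw x⟫ ∂weightedMeasure Ω Λ β) →
      ∀ {k : ℕ} {q' g'}, M.IsFine Λ β (M.patch v k) q' g' →
      (∀ w gw, M.IsFine Λ β (M.patch v k) w gw →
        ∫ x, ⟪A x (g' x), gw x⟫ ∂weightedMeasure Ω Λ β =
        ∫ x, ⟪b x, gw x⟫ ∂weightedMeasure Ω Λ β) →
      l2norm (weightedMeasure Ω Λ β) (g - g') ≤ K * Real.exp (-(α * (c * k))) *
        l2norm (weightedMeasure Ω Λ β) (fun x => Real.exp (α * (dist x v / H)) • g x) := by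
  obtain ⟨C, hC⟩ := exists_commutator_le hd hΩ CA hσ
  refine ⟨|γ₂| / γ₁ * ((1 + √C) * Real.exp (α * 5)), by positivity,
    fun {Λ β M H A} hS hA {b v} hv {q g} hq heq {k q' g'} hq' heq' => ?_⟩
  have hH := hS.quasiUniform.1
  set μ := weightedMeasure Ω Λ β with hμ
  set r : ℝ := c * k - 5 with hr
  set ψ : Space d → ℝ := fun x => dist x v / H with hψ
  set η : Space d → ℝ := fun x => max 0 (min 1 (r + 2 - ψ x)) with hη
  have hψlip : ∀ x y, |ψ x - ψ y| ≤ dist x y / H := abs_dist_div_sub_le hH v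
  have hψc : Continuous ψ := by rw [hψ]; fun_prop
  have hη0 : ∀ x, 0 ≤ η x := fun x => le_max_left _ _
  have hη1 : ∀ x, η x ≤ 1 := fun x => max_le zero_le_one (min_le_left _ _)
  have hηd : ∀ x y, |η x - η y| ≤ dist x y / H := fun x y => by
    rw [hη]; dsimp only
    refine (abs_max_sub_max_le_max _ _ _ _).trans ?_
    rw [sub_self, abs_zero, max_eq_right (abs_nonneg _)]
    refine (abs_min_sub_min_le_max _ _ _ _).trans ?_
    rw [sub_self, abs_zero, max_eq_right (abs_nonneg _)]
    refine le_trans (le_of_eq ?_) (hψlip x y)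
    rw [abs_sub_comm]; congr 1; ring
  have hηone : ∀ x, ψ x ≤ r + 1 → η x = 1 := fun x hx => by
    rw [hη]; dsimp only
    rw [min_eq_left (by linarith), max_eq_right zero_le_one]
  have hηzero : ∀ x, r + 2 ≤ ψ x → η x = 0 := fun x hx => by
    rw [hη]; dsimp only
    exact max_eq_left ((min_le_right _ _).trans (by linarith))
  have hηlip : LipschitzWith (Real.toNNReal (1 / H)) η :=
    LipschitzWith.of_dist_le_mul fun x y => by
      rw [Real.coe_toNNReal _ (by positivity), Real.dist_eq, one_div_mul_eq_div]
      exact hηd x y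
  set s : Space d → ℝ := fun x => α * (ψ x - r) with hs
  have hsc : Continuous s := by rw [hs]; fun_prop
  have hslip : ∀ x y, |s x - s y| ≤ α * (dist x y / H) := fun x y => by
    rw [hs]; dsimp only
    rw [← mul_sub, abs_mul, abs_of_pos hα0, sub_sub_sub_cancel_right]
    gcongr
    exact hψlip x y
  have hmone : ∀ x, r ≤ ψ x → 1 ≤ Real.exp (s x) := fun x hx =>
    Real.one_le_exp (mul_nonneg hα0.le (by linarith))
  obtain ⟨gw, hgw, hproj, hle⟩ := hC hS.muckenhoupt hS.quasiUniform hq.grad hq.proj hηlip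
    (B := 1) (fun x => by rw [abs_of_nonneg (hη0 x)]; exact hη1 x) (ρ := fun _ => 1)
    ⟨continuous_const, fun _ => zero_le_one, fun x y => by
      rw [mul_one, Real.one_le_exp_iff]; positivity⟩
    (isSlow_mul_exp zero_le_one hsc hα1 hH hslip)
    (fun x y hxy => by
      rw [one_mul, one_mul]
      by_cases hx : ψ x < r
      · have hy : ψ y ≤ r + 1 := by
          have h1 := hψlip x y
          have h2 : dist x y / H ≤ 1 := by rw [div_le_one hH]; exact hxy
          linarith [neg_abs_le (ψ x - ψ y)]
        rw [hηone x (by linarith), hηone y hy, sub_self, abs_zero]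
        positivity
      · exact (hηd x y).trans (le_mul_of_one_le_right (by positivity) (hmone x (not_lt.1 hx))))
  have hηc := hηlip.continuous
  have hvan : ∀ᵐ x ∂μ, x ∉ M.patch v k →
      η x * q x - M.quasiInterpolation Λ β (fun y => η y * q y) x = 0 := by
    rw [hμ, weightedMeasure_ae hS.muckenhoupt, ae_restrict_iff' hΩ.isOpen.measurableSet]
    filter_upwards [hc hS.quasiUniform v hv k] with x hx hxΩ hxp
    have h1 : r + 4 < ψ x := by
      have h2 : (c * k - 1) * H < dist x v := not_le.1 fun h => hxp (hx hxΩ h)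
      rw [hψ]; dsimp only
      rw [lt_div_iff₀ hH]
      have : r + 4 = c * k - 1 := by rw [hr]; ring
      rw [this]; exact h2
    have hm : MemLp (fun y => η y * q y) 2 μ := by
      refine hq.grad.memLp.of_le_mul (c := 1) (hηc.aestronglyMeasurable.mul hq.grad.memLp.1)
        (Eventually.of_forall fun y => ?_)
      rw [norm_mul, Real.norm_of_nonneg (hη0 y)]
      gcongr
      exact hη1 y
    rw [quasiInterpolation_eq_zero_of_eq_zero hS.one_le hS.quasiUniform hS.muckenhoupt hS.domain hm
      fun y hy => ?_, hηzero x (by linarith), zero_mul, sub_zero]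
    rw [hηzero y, zero_mul]
    have h2 := hψlip y x
    have h3 : dist y x / H ≤ 2 := by rw [div_le_iff₀ hH]; exact hy
    linarith [neg_abs_le (ψ y - ψ x)]
  have hw : M.IsFine Λ β (M.patch v k) _ gw := ⟨hgw, hproj, hvan⟩
  set mg : Space d → Space d := fun x => (1 * Real.exp (s x)) • g x with hmg
  have hgm := hq.grad.memLp_grad
  have hmgm : MemLp mg 2 μ := MemLp.continuous_smul hΩ hgm (by fun_prop)
  have hηg : MemLp (fun x => η x • g x) 2 μ := MemLp.continuous_smul hΩ hgm hηc
  have h1 : l2norm μ (fun x => gw x - η x • g x) ≤ √C * l2norm μ mg := by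
    refine l2norm_le_sqrt_mul hmgm ?_
    simpa only [one_smul] using hle
  have h2 : l2norm μ (fun x => η x • g x - g x) ≤ 1 * l2norm μ mg := by
    refine l2norm_le_mul zero_le_one hmgm (Eventually.of_forall fun x => ?_)
    have : η x • g x - g x = (η x - 1) • g x := by rw [sub_smul, one_smul]
    rw [this, hmg]
    dsimp only
    rw [norm_smul, norm_smul, one_mul, one_mul, Real.norm_eq_abs, Real.norm_of_nonneg
      (Real.exp_pos _).le]
    gcongr
    by_cases hx : ψ x ≤ r + 1
    · rw [hηone x hx, sub_self, abs_zero]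
      exact (Real.exp_pos _).le
    · refine le_trans ?_ (hmone x (by linarith))
      rw [abs_le]
      constructor <;> linarith [hη0 x, hη1 x]
  have h3 : l2norm μ (gw - g) ≤ (1 + √C) * l2norm μ mg := by
    have : gw - g = (fun x => gw x - η x • g x) + fun x => η x • g x - g x := by
      ext1 x; simp
    rw [this]
    refine (l2norm_add_le (hgw.memLp_grad.sub hηg) (hηg.sub hgm)).trans
      ((add_le_add h1 h2).trans_eq ?_)
    ring
  have h4 : l2norm μ mg ≤ Real.exp (-(α * r)) *
      l2norm μ (fun x => Real.exp (α * (dist x v / H)) • g x) := by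
    refine l2norm_le_mul (Real.exp_pos _).le (MemLp.continuous_smul hΩ hgm (by fun_prop))
      (Eventually.of_forall fun x => le_of_eq ?_)
    rw [hmg, hs]
    dsimp only
    rw [norm_smul, norm_smul, Real.norm_of_nonneg (by positivity),
      Real.norm_of_nonneg (by positivity), ← mul_assoc, ← Real.exp_add, one_mul]
    congr 2
    rw [hψ]; ring
  set e := g - g' with he
  have hem : MemLp e 2 μ := hgm.sub hq'.grad.memLp_grad
  have hdm : MemLp (gw - g) 2 μ := hgw.memLp_grad.sub hgm
  have hAe := hA.memLp hγ hS.muckenhoupt hem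
  have horth : ∀ w gw, M.IsFine Λ β (M.patch v k) w gw → ∫ x, ⟪A x (e x), gw x⟫ ∂μ = 0 := by
    intro w gw hw
    have k1 := heq w gw (hw.mono (subset_univ _))
    rw [← heq' w gw hw] at k1
    rw [← sub_eq_zero, ← integral_sub
      (integrable_inner_of_memLp (hA.memLp hγ hS.muckenhoupt hgm) hw.grad.memLp_grad)
      (integrable_inner_of_memLp (hA.memLp hγ hS.muckenhoupt hq'.grad.memLp_grad)
        hw.grad.memLp_grad)] at k1
    rw [← k1]
    refine integral_congr_ae (Eventually.of_forall fun x => ?_)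
    dsimp only
    rw [← inner_sub_left, he, Pi.sub_apply, map_sub]
  have h5 : ∫ x, ⟪A x (e x), e x⟫ ∂μ = -∫ x, ⟪A x (e x), (gw - g) x⟫ ∂μ := by
    have k1 := horth _ _ (hw.sub hS hq')
    have : ∫ x, ⟪A x (e x), (gw - g') x⟫ ∂μ =
        ∫ x, ⟪A x (e x), (gw - g) x⟫ ∂μ + ∫ x, ⟪A x (e x), e x⟫ ∂μ := by
      rw [← integral_add (integrable_inner_of_memLp hAe hdm) (integrable_inner_of_memLp hAe hem)]
      refine integral_congr_ae (Eventually.of_forall fun x => ?_)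
      dsimp only
      rw [← inner_add_right, he]
      simp
    rw [k1] at this
    linarith
  have h6 := hA.mul_l2norm_sq_le hγ hS.muckenhoupt hem
  have h7 := (abs_integral_inner_le hAe hdm).trans
    (mul_le_mul_of_nonneg_right (hA.l2norm_apply_le hγ hS.muckenhoupt hem) l2norm_nonneg)
  have he0 : 0 ≤ l2norm μ e := l2norm_nonneg
  have h8 : γ₁ * l2norm μ e ^ 2 ≤ |γ₂| * l2norm μ e * l2norm μ (gw - g) := by
    rw [h5] at h6
    exact h6.trans ((neg_le_abs _).trans h7)
  have h9 : γ₁ * l2norm μ e ≤ |γ₂| * l2norm μ (gw - g) := by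
    rcases he0.eq_or_lt with h0 | h0
    · rw [← h0, mul_zero]
      exact mul_nonneg (abs_nonneg _) l2norm_nonneg
    · refine le_of_mul_le_mul_right ?_ h0
      calc γ₁ * l2norm μ e * l2norm μ e = γ₁ * l2norm μ e ^ 2 := by ring
        _ ≤ _ := h8
        _ = _ := by ring
  have hexp : Real.exp (-(α * r)) = Real.exp (α * 5) * Real.exp (-(α * (c * k))) := by
    rw [← Real.exp_add, hr]; ring_nf
  set Y := l2norm μ (fun x => Real.exp (α * (dist x v / H)) • g x) with hY
  calc l2norm μ e = γ₁ * l2norm μ e / γ₁ := by field_simp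
    _ ≤ |γ₂| * ((1 + √C) * (Real.exp (-(α * r)) * Y)) / γ₁ :=
        div_le_div_of_nonneg_right (h9.trans (mul_le_mul_of_nonneg_left (h3.trans
          (mul_le_mul_of_nonneg_left h4 (by positivity))) (abs_nonneg _))) hγ.le
    _ = _ := by rw [hexp]; ring

end Mesh

end WeightedLOD

end

noncomputable section

namespace WeightedLOD

/-! ### The localization error -/

theorem l2norm_le_add {α F G G' : Type*} [MeasurableSpace α] [NormedAddCommGroup F]
    [NormedAddCommGroup G] [NormedAddCommGroup G'] {μ : Measure α} {f : α → F} {g : α → G}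
    {h : α → G'} {a b : ℝ} (ha : 0 ≤ a) (hb : 0 ≤ b) (hg : MemLp g 2 μ) (hh : MemLp h 2 μ)
    (hle : ∀ᵐ x ∂μ, ‖f x‖ ≤ a * ‖g x‖ + b * ‖h x‖) :
    l2norm μ f ≤ a * l2norm μ g + b * l2norm μ h := by
  have hg' : MemLp (fun x => a * ‖g x‖) 2 μ := hg.norm.const_mul a
  have hh' : MemLp (fun x => b * ‖h x‖) 2 μ := hh.norm.const_mul b
  have h1 : l2norm μ f ≤ 1 * l2norm μ ((fun x => a * ‖g x‖) + fun x => b * ‖h x‖) := by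
    refine l2norm_le_mul zero_le_one (hg'.add hh') ?_
    filter_upwards [hle] with x hx
    rw [one_mul]
    exact hx.trans (le_abs_self _)
  rw [one_mul] at h1
  refine h1.trans ((l2norm_add_le hg' hh').trans (add_le_add ?_ ?_))
  · exact l2norm_le_mul ha hg (Eventually.of_forall fun x => by
      rw [norm_mul, norm_norm, Real.norm_of_nonneg ha])
  · exact l2norm_le_mul hb hh (Eventually.of_forall fun x => by
      rw [norm_mul, norm_norm, Real.norm_of_nonneg hb])

/-- Summation of exponentially localized fields. -/
theorem l2norm_sum_sq_le {ι α F : Type*} [MeasurableSpace α] [NormedAddCommGroup F]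
    [NormedSpace ℝ F] {μ : Measure α} {s : Finset ι} {f : ι → α → F} {p : ι → α → ℝ} {C : ℝ}
    (hf : ∀ i ∈ s, MemLp (f i) 2 μ) (hpf : ∀ i ∈ s, MemLp (fun x => Real.exp (p i x) • f i x) 2 μ)
    (hp : ∀ x, ∑ i ∈ s, Real.exp (-(2 * p i x)) ≤ C) :
    l2norm μ (∑ i ∈ s, f i) ^ 2 ≤
      C * ∑ i ∈ s, l2norm μ (fun x => Real.exp (p i x) • f i x) ^ 2 := by
  have hint : ∀ i ∈ s, Integrable (fun x => ‖Real.exp (p i x) • f i x‖ ^ 2) μ :=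
    fun i hi => (hpf i hi).integrable_norm_pow two_ne_zero
  have hsum : MemLp (∑ i ∈ s, f i) 2 μ := memLp_finsetSum' s hf
  have hr : C * ∑ i ∈ s, l2norm μ (fun x => Real.exp (p i x) • f i x) ^ 2 =
      ∫ x, C * ∑ i ∈ s, ‖Real.exp (p i x) • f i x‖ ^ 2 ∂μ := by
    rw [integral_const_mul, integral_finsetSum s hint]
    exact congrArg _ (Finset.sum_congr rfl fun i hi => l2norm_sq (hpf i hi))
  rw [l2norm_sq hsum, hr]
  refine integral_mono (hsum.integrable_norm_pow two_ne_zero)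
    ((integrable_finsetSum s hint).const_mul C) fun x => ?_
  dsimp only
  have h1 : ‖(∑ i ∈ s, f i) x‖ ≤
      ∑ i ∈ s, Real.exp (-p i x) * ‖Real.exp (p i x) • f i x‖ := by
    rw [Finset.sum_apply]
    refine (norm_sum_le _ _).trans_eq (Finset.sum_congr rfl fun i _ => ?_)
    rw [norm_smul, Real.norm_of_nonneg (Real.exp_pos _).le, ← mul_assoc, ← Real.exp_add]
    simp
  calc ‖(∑ i ∈ s, f i) x‖ ^ 2
      ≤ (∑ i ∈ s, Real.exp (-p i x) * ‖Real.exp (p i x) • f i x‖) ^ 2 := by gcongr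
    _ ≤ (∑ i ∈ s, Real.exp (-p i x) ^ 2) * ∑ i ∈ s, ‖Real.exp (p i x) • f i x‖ ^ 2 :=
        Finset.sum_mul_sq_le_sq_mul_sq _ _ _
    _ ≤ C * ∑ i ∈ s, ‖Real.exp (p i x) • f i x‖ ^ 2 := by
        refine mul_le_mul_of_nonneg_right ((Finset.sum_congr rfl fun i _ => ?_).trans_le (hp x))
          (Finset.sum_nonneg fun i _ => sq_nonneg _)
        rw [← Real.exp_nat_mul]
        congr 1
        push_cast
        ring

theorem weightedNorm_eq_l2norm {d : ℕ} {Ω Λ : Set (Space d)} {β : ℝ} (hΩ : MeasurableSet Ω)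
    {g : Space d → Space d} (hg : MemLp g 2 (weightedMeasure Ω Λ β)) :
    weightedNorm Ω Λ β g = l2norm (weightedMeasure Ω Λ β) g := by
  have h1 : (weightedMeasure Ω Λ β).restrict Ω = weightedMeasure Ω Λ β :=
    weightedMeasure_restrict hΩ subset_rfl
  have h2 : ∫ x in Ω, ‖g x‖ ^ 2 * weight Λ β x = l2norm (weightedMeasure Ω Λ β) g ^ 2 := by
    rw [l2norm_sq hg]
    conv_rhs => rw [← h1]
    rw [integral_weightedMeasure hΩ subset_rfl]
    simp only [smul_eq_mul, mul_comm]
  rw [weightedNorm, h2, Real.sqrt_sq l2norm_nonneg]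

namespace Mesh

variable {d : ℕ} {Ω Λ : Set (Space d)} {β CA H σ γ₁ γ₂ : ℝ} {M : Mesh Ω}
  {A : Space d → Space d →L[ℝ] Space d}

theorem sum_hatNormalized_smul_ae_eq (hS : M.IsAdmissible Λ β CA H σ) {u : Space d → ℝ}
    (hu : u ∈ M.coarseSpace) :
    ∀ᵐ x ∂weightedMeasure Ω Λ β, ∑ v ∈ M.innerNodes,
      M.hatNormalized v x • A x (weakGradient Ω u x) = A x (weakGradient Ω u x) := by
  obtain ⟨L, hL⟩ := exists_lipschitzWith_of_mem_coarseSpace hS.domain.isOpen hu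
  have h := (hasH10Gradient_of_lipschitzWith (Ω := Ω) (Λ := Λ) (β := β) hS.muckenhoupt
    hS.domain.isBounded hS.domain.isOpen hL hu.2).weakGradient_ae_eq hS.muckenhoupt
    hS.domain.isBounded hS.domain.isOpen
  have h1 : ∀ᵐ x ∂weightedMeasure Ω Λ β, (∑ v ∈ M.innerNodes, M.hatNormalized v x = 1) ∨
      ∀ u ∈ M.coarseSpace, u =ᶠ[𝓝 x] 0 := by
    rw [weightedMeasure_ae hS.muckenhoupt, ae_restrict_iff' hS.domain.isOpen.measurableSet]
    exact ae_sum_hatNormalized_eq_one M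
  filter_upwards [h, h1] with x hx hx1
  rw [← Finset.sum_smul]
  rcases hx1 with hx1 | hx1
  · rw [hx1, one_smul]
  · have : x ∉ {x | u x ≠ 0} := fun h0 => h0 (hx1 u hu).eq_of_nhds
    rw [hx, indicator_of_notMem this, map_zero, smul_zero]

/-- Corrector problems have at most one solution. -/
theorem IsFine.ae_eq_of_forall_integral_eq (hS : M.IsAdmissible Λ β CA H σ)
    (hA : IsCoefficient Ω γ₁ γ₂ A) (hγ : 0 < γ₁) {D : Set (Space d)} {q q' : Space d → ℝ}
    {g g' : Space d → Space d} (hq : M.IsFine Λ β D q g) (hq' : M.IsFine Λ β D q' g')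
    (h : ∀ w gw, M.IsFine Λ β D w gw → ∫ x, ⟪A x (g x), gw x⟫ ∂weightedMeasure Ω Λ β =
      ∫ x, ⟪A x (g' x), gw x⟫ ∂weightedMeasure Ω Λ β) : g =ᵐ[weightedMeasure Ω Λ β] g' := by
  have hd := hq.sub hS hq'
  have hdm := hd.grad.memLp_grad
  have h1 := hA.mul_l2norm_sq_le hγ hS.muckenhoupt hdm
  have h2 : ∫ x, ⟪A x ((g - g') x), (g - g') x⟫ ∂weightedMeasure Ω Λ β = 0 := by
    have k1 := h _ _ hd
    rw [← sub_eq_zero, ← integral_sub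
      (integrable_inner_of_memLp (hA.memLp hγ hS.muckenhoupt hq.grad.memLp_grad) hdm)
      (integrable_inner_of_memLp (hA.memLp hγ hS.muckenhoupt hq'.grad.memLp_grad) hdm)] at k1
    rw [← k1]
    refine integral_congr_ae (Eventually.of_forall fun x => ?_)
    dsimp only
    rw [← inner_sub_left, Pi.sub_apply, map_sub]
  rw [h2] at h1
  have h3 : l2norm (weightedMeasure Ω Λ β) (g - g') = 0 := by
    have := l2norm_nonneg (μ := weightedMeasure Ω Λ β) (f := g - g')
    by_contra h0
    have : 0 < l2norm (weightedMeasure Ω Λ β) (g - g') ^ 2 := by positivity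
    nlinarith
  rw [l2norm, ENNReal.toReal_eq_zero_iff, or_iff_left hdm.2.ne,
    eLpNorm_eq_zero_iff hdm.1 two_ne_zero] at h3
  filter_upwards [h3] with x hx
  exact sub_eq_zero.1 hx

theorem sum_l2norm_hatNormalized_smul_sq_le (hS : M.IsAdmissible Λ β CA H σ)
    {b : Space d → Space d} (hb : MemLp b 2 (weightedMeasure Ω Λ β)) :
    ∑ v ∈ M.innerNodes, l2norm (weightedMeasure Ω Λ β)
      (fun x => M.hatNormalized v x • b x) ^ 2 ≤ l2norm (weightedMeasure Ω Λ β) b ^ 2 := by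
  have hm := fun v hv => memLp_hatNormalized_smul hS (v := v) hv hb
  have hint := fun v hv => (hm v hv).integrable_norm_pow two_ne_zero
  rw [l2norm_sq hb, Finset.sum_congr rfl fun v hv => l2norm_sq (hm v hv),
    ← integral_finsetSum _ hint]
  refine integral_mono (integrable_finsetSum _ hint) (hb.integrable_norm_pow two_ne_zero)
    fun x => ?_
  dsimp only
  calc ∑ v ∈ M.innerNodes, ‖M.hatNormalized v x • b x‖ ^ 2
      ≤ ∑ v ∈ M.innerNodes, M.hatNormalized v x * ‖b x‖ ^ 2 := by
        refine Finset.sum_le_sum fun v hv => ?_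
        have h0 := hatNormalized_nonneg (M := M) v x
        rw [norm_smul, mul_pow, Real.norm_of_nonneg h0]
        gcongr
        have h1 := hatNormalized_le_one hv x
        nlinarith
    _ = (∑ v ∈ M.innerNodes, M.hatNormalized v x) * ‖b x‖ ^ 2 := by rw [Finset.sum_mul]
    _ ≤ 1 * ‖b x‖ ^ 2 := by
        gcongr
        exact sum_hatNormalized_le_one x
    _ = _ := one_mul _

/-- The weighted local error: the difference of the ideal and the localized contribution of one
node is small, even after multiplication with a slowly growing exponential. -/
theorem exists_l2norm_exp_smul_sub_le (hd : 0 < d) (hΩ : IsLipschitzDomain Ω) (CA : ℝ) {σ γ₁ : ℝ}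
    (γ₂ : ℝ) (hσ : 1 ≤ σ) (hγ : 0 < γ₁) : ∃ ε > (0 : ℝ), ∃ K ≥ (0 : ℝ),
    ∀ {Λ : Set (Space d)} {β : ℝ} {M : Mesh Ω} {H : ℝ} {A : Space d → Space d →L[ℝ] Space d},
      M.IsAdmissible Λ β CA H σ → IsCoefficient Ω γ₁ γ₂ A → ∀ {b : Space d → Space d} {v},
      v ∈ M.innerNodes → MemLp b 2 (weightedMeasure Ω Λ β) → (∀ x, H < dist x v → b x = 0) →
      ∀ {q g}, M.IsFine Λ β univ q g →
      (∀ w gw, M.IsFine Λ β univ w gw → ∫ x, ⟪A x (g x), gw x⟫ ∂weightedMeasure Ω Λ β =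
        ∫ x, ⟪b x, gw x⟫ ∂weightedMeasure Ω Λ β) →
      ∀ {k : ℕ} {q' g'}, M.IsFine Λ β (M.patch v k) q' g' →
      (∀ w gw, M.IsFine Λ β (M.patch v k) w gw →
        ∫ x, ⟪A x (g' x), gw x⟫ ∂weightedMeasure Ω Λ β =
        ∫ x, ⟪b x, gw x⟫ ∂weightedMeasure Ω Λ β) →
      l2norm (weightedMeasure Ω Λ β) (fun x => Real.exp (ε * (dist x v / H)) • (g - g') x) ≤
        K * Real.exp (-ε) ^ k * l2norm (weightedMeasure Ω Λ β) b := by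
  obtain ⟨c, hc0, hc1, hc⟩ := exists_ball_subset_patch hΩ hσ
  obtain ⟨α, hα0, hα1, K₁, hK₁, h₁⟩ := exists_l2norm_exp_smul_le hd hΩ CA γ₂ hσ hγ
  obtain ⟨K₂, hK₂, h₂⟩ := exists_l2norm_sub_le hd hΩ CA γ₂ hσ hγ hα0 hα1 hc
  set ε : ℝ := α * c / 2 with hε
  have hε0 : 0 < ε := by positivity
  refine ⟨ε, hε0, (Real.exp ε * K₂ + 1) * K₁, by positivity,
    fun {Λ β M H A} hS hA {b v} hv hb hbv {q g} hq heq {k q' g'} hq' heq' => ?_⟩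
  have hH := hS.quasiUniform.1
  have a1 := h₁ hS hA hb hbv hq heq
  have a2 := h₂ hS hA hv hq heq hq' heq'
  set μ := weightedMeasure Ω Λ β with hμ
  have hgm := hq.grad.memLp_grad
  have hem : MemLp (g - g') 2 μ := hgm.sub hq'.grad.memLp_grad
  have hEm : MemLp (fun x => Real.exp (α * (dist x v / H)) • g x) 2 μ :=
    MemLp.continuous_smul hΩ hgm (by fun_prop)
  have hεα : 2 * ε ≤ α := by rw [hε]; nlinarith
  have hθ : Real.exp (-ε) ^ k = Real.exp (-(ε * k)) := by
    rw [← Real.exp_nat_mul]; ring_nf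
  have hk0 : (0 : ℝ) ≤ k := k.cast_nonneg
  have a3 : l2norm μ (fun x => Real.exp (ε * (dist x v / H)) • (g - g') x) ≤
      Real.exp (ε * (k + 1)) * l2norm μ (g - g') + Real.exp (-(ε * k)) *
        l2norm μ (fun x => Real.exp (α * (dist x v / H)) • g x) := by
    refine l2norm_le_add (Real.exp_pos _).le (Real.exp_pos _).le hem hEm ?_
    filter_upwards [hq'.gradient_ae_eq_zero hS] with x hx
    rw [norm_smul, norm_smul, Real.norm_of_nonneg (Real.exp_pos _).le,
      Real.norm_of_nonneg (Real.exp_pos _).le]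
    by_cases hxk : dist x v / H ≤ k + 1
    · refine le_trans ?_ (le_add_of_nonneg_right (by positivity))
      gcongr
    · rw [not_le] at hxk
      have hxp : x ∉ M.patch v k := fun h => by
        have := hS.quasiUniform.patch_subset_closedBall v k h
        rw [Metric.mem_closedBall, ← div_le_iff₀ hH] at this
        linarith
      have h0 : (g - g') x = g x := by rw [Pi.sub_apply, hx hxp, sub_zero]
      refine le_trans ?_ (le_add_of_nonneg_left (by positivity))
      rw [h0, ← mul_assoc, ← Real.exp_add]
      gcongr
      nlinarith
  refine a3.trans ?_
  set Y := l2norm μ (fun x => Real.exp (α * (dist x v / H)) • g x) with hY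
  have hY0 : 0 ≤ Y := l2norm_nonneg
  calc _ ≤ Real.exp (ε * (k + 1)) * (K₂ * Real.exp (-(α * (c * k))) * Y) +
        Real.exp (-(ε * k)) * Y := by gcongr
    _ = (Real.exp ε * K₂ + 1) * Real.exp (-(ε * k)) * Y := by
        have : Real.exp (ε * (k + 1)) * Real.exp (-(α * (c * k))) =
            Real.exp ε * Real.exp (-(ε * k)) := by
          rw [← Real.exp_add, ← Real.exp_add, hε]
          ring_nf
        linear_combination K₂ * Y * this
    _ ≤ (Real.exp ε * K₂ + 1) * Real.exp (-(ε * k)) * (K₁ * l2norm μ b) := by gcongr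
    _ = _ := by rw [hθ]; ring

theorem exists_localization_error_le (hd : 0 < d) (hΩ : IsLipschitzDomain Ω) (CA : ℝ) {σ γ₁ : ℝ}
    (γ₂ : ℝ) (hσ : 1 ≤ σ) (hγ : 0 < γ₁) : ∃ C > (0 : ℝ), ∃ θ ∈ Ioo (0 : ℝ) 1,
    ∀ {Λ : Set (Space d)} {β : ℝ} {M : Mesh Ω} {H : ℝ} {A : Space d → Space d →L[ℝ] Space d},
      M.IsAdmissible Λ β CA H σ → IsCoefficient Ω γ₁ γ₂ A → ∀ {u}, u ∈ M.coarseSpace →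
      ∀ {k : ℕ} {q : Space d → ℝ} {qloc : Space d → Space d → ℝ}, M.IsIdealCorrector Λ β A u q →
      (∀ v ∈ M.innerNodes, M.IsLocalCorrector Λ β A v k u (qloc v)) →
      weightedNorm Ω Λ β (weakGradient Ω (fun x => q x - ∑ v ∈ M.innerNodes, qloc v x)) ≤
        C * θ ^ k * weightedNorm Ω Λ β (weakGradient Ω u) := by
  obtain ⟨ε, hε0, K, hK, hloc⟩ := exists_l2norm_exp_smul_sub_le hd hΩ CA γ₂ hσ hγ
  obtain ⟨C₁, hC₁, hsum⟩ := exists_sum_exp_le d hσ (show 0 < 2 * ε by positivity)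
  refine ⟨√C₁ * K * |γ₂| + 1, by positivity, Real.exp (-ε), ⟨Real.exp_pos _, by
    rw [Real.exp_lt_one_iff]; linarith⟩, fun {Λ β M H A} hS hA {u} hu {k q qloc} hq hql => ?_⟩
  set μ := weightedMeasure Ω Λ β with hμ
  rw [isIdealCorrector_iff hS] at hq
  obtain ⟨hqf, hqe⟩ := hq
  have hql1 := fun v hv => (isLocalCorrector_iff hS).1 (hql v hv)
  have hum := (hasH10Gradient_of_mem_coarseSpace hS hu).memLp_grad
  have hAu := hA.memLp hγ hS.muckenhoupt hum
  set b : Space d → Space d → Space d :=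
    fun v x => M.hatNormalized v x • A x (weakGradient Ω u x) with hb
  have hbm : ∀ v ∈ M.innerNodes, MemLp (b v) 2 μ :=
    fun v hv => memLp_hatNormalized_smul hS hv hAu
  have hex : ∀ v, ∃ (p : Space d → ℝ) (g : Space d → Space d), v ∈ M.innerNodes →
      M.IsFine Λ β univ p g ∧ ∀ w gw, M.IsFine Λ β univ w gw →
        ∫ x, ⟪A x (g x), gw x⟫ ∂μ = ∫ x, ⟪b v x, gw x⟫ ∂μ := fun v => by
    by_cases hv : v ∈ M.innerNodes
    · obtain ⟨p, g, h⟩ := exists_isFine_solution hS hA hγ MeasurableSet.univ (hbm v hv)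
      exact ⟨p, g, fun _ => h⟩
    · exact ⟨0, 0, fun h => absurd h hv⟩
  choose p g hpg using hex
  have hpf : M.IsFine Λ β univ (∑ v ∈ M.innerNodes, p v) (∑ v ∈ M.innerNodes, g v) :=
    IsFine.sum hS _ fun v hv => (hpg v hv).1
  have hqp : weakGradient Ω q =ᵐ[μ] ∑ v ∈ M.innerNodes, g v := by
    refine hqf.ae_eq_of_forall_integral_eq hS hA hγ hpf fun w gw hw => ?_
    have hwm := hw.grad.memLp_grad
    have e1 : ∫ x, ⟪A x ((∑ v ∈ M.innerNodes, g v) x), gw x⟫ ∂μ =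
        ∑ v ∈ M.innerNodes, ∫ x, ⟪A x (g v x), gw x⟫ ∂μ := by
      rw [← integral_finsetSum _ fun v hv => integrable_inner_of_memLp
        (hA.memLp hγ hS.muckenhoupt (hpg v hv).1.grad.memLp_grad) hwm]
      refine integral_congr_ae (Eventually.of_forall fun x => ?_)
      dsimp only
      rw [Finset.sum_apply, map_sum, sum_inner]
    rw [hqe w gw hw, e1, Finset.sum_congr rfl fun v hv => (hpg v hv).2 w gw hw,
      ← integral_finsetSum _ fun v hv => integrable_inner_of_memLp (hbm v hv) hwm]
    refine integral_congr_ae ?_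
    filter_upwards [sum_hatNormalized_smul_ae_eq (A := A) hS hu] with x hx
    rw [← sum_inner, hb]
    dsimp only
    rw [hx]
  set E : Space d → Space d → Space d := fun v => g v - weakGradient Ω (qloc v) with hE
  have hEm : ∀ v ∈ M.innerNodes, MemLp (E v) 2 μ := fun v hv =>
    (hpg v hv).1.grad.memLp_grad.sub (hql1 v hv).1.grad.memLp_grad
  have hfin : M.IsFine Λ β univ (fun x => q x - ∑ v ∈ M.innerNodes, qloc v x)
      (∑ v ∈ M.innerNodes, E v) := by
    refine (hqf.sub hS (IsFine.sum hS M.innerNodes fun v hv =>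
      ((hql1 v hv).1.mono (subset_univ _)))).congr_ae hS ?_ ?_
    · refine Eventually.of_forall fun x => ?_
      simp
    · filter_upwards [hqp] with x hx
      rw [Pi.sub_apply, hx, ← Pi.sub_apply, ← Finset.sum_sub_distrib]
  have hΩm := hΩ.isOpen.measurableSet
  rw [weightedNorm_eq_l2norm hΩm (hfin.isFine_weakGradient hS).grad.memLp_grad,
    weightedNorm_eq_l2norm hΩm hum, l2norm_congr_ae (hfin.weakGradient_ae_eq hS)]
  set U := l2norm μ (weakGradient Ω u) with hU
  have hU0 : 0 ≤ U := l2norm_nonneg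
  have hH := hS.quasiUniform.1
  have hY : ∀ v ∈ M.innerNodes, l2norm μ (fun x => Real.exp (ε * (dist x v / H)) • E v x) ≤
      K * Real.exp (-ε) ^ k * l2norm μ (b v) := fun v hv => by
    refine hloc hS hA hv (hbm v hv) (fun x hx => ?_) (hpg v hv).1 (hpg v hv).2 (hql1 v hv).1
      (hql1 v hv).2
    have : M.hatNormalized v x = 0 := by
      by_contra h
      exact absurd (hS.quasiUniform.dist_le_of_hatNormalized_ne_zero h) (not_le.2 hx)
    rw [hb]
    dsimp only
    rw [this, zero_smul]
  have hS2 : l2norm μ (∑ v ∈ M.innerNodes, E v) ^ 2 ≤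
      (√C₁ * (K * Real.exp (-ε) ^ k * (|γ₂| * U))) ^ 2 := by
    calc _ ≤ C₁ * ∑ v ∈ M.innerNodes,
          l2norm μ (fun x => Real.exp (ε * (dist x v / H)) • E v x) ^ 2 := by
          refine l2norm_sum_sq_le hEm (fun v hv => MemLp.continuous_smul hΩ (hEm v hv)
            (by fun_prop)) fun x => ?_
          simpa only [mul_assoc] using hsum hΩ hS.quasiUniform x
      _ ≤ C₁ * ∑ v ∈ M.innerNodes, (K * Real.exp (-ε) ^ k) ^ 2 * l2norm μ (b v) ^ 2 := by
          refine mul_le_mul_of_nonneg_left (Finset.sum_le_sum fun v hv => ?_) hC₁.le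
          rw [← mul_pow]
          exact pow_le_pow_left₀ l2norm_nonneg (hY v hv) 2
      _ ≤ C₁ * ((K * Real.exp (-ε) ^ k) ^ 2 * (|γ₂| * U) ^ 2) := by
          rw [← Finset.mul_sum]
          gcongr
          refine (sum_l2norm_hatNormalized_smul_sq_le hS hAu).trans ?_
          exact pow_le_pow_left₀ l2norm_nonneg (hA.l2norm_apply_le hγ hS.muckenhoupt hum) 2
      _ = _ := by
          rw [mul_pow (√C₁), Real.sq_sqrt hC₁.le]
          ring
  have h3 := (pow_le_pow_iff_left₀ l2norm_nonneg (by positivity) two_ne_zero).1 hS2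
  calc _ ≤ _ := h3
    _ = √C₁ * K * |γ₂| * Real.exp (-ε) ^ k * U := by ring
    _ ≤ _ := by
        gcongr
        linarith

end Mesh

end WeightedLOD

end

open WeightedLOD
theorem lemma5p5 (d ℓ : ℕ) (hd : d = 2 ∨ d = 3) (hℓ : ℓ < d)
    (β : ℝ) (hβ : β ∈ Set.Ioo (-(((d : ℝ) - ℓ) / 2)) (((d : ℝ) - ℓ) / 2))
    (Ω : Set (Space d)) (hΩ : IsLipschitzDomain Ω)
    (γ₁ γ₂ : ℝ) (hγ₁ : 0 < γ₁) (σ : ℝ) (hσ : 1 ≤ σ) (N : ℕ) (K : ℝ) (hK : 1 ≤ K) :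
    ∃ C > (0 : ℝ), ∃ θ ∈ Set.Ioo (0 : ℝ) 1,
      ∀ (Λ : Set (Space d)), IsSource ℓ N K Λ → Λ ⊆ Ω →
      ∀ (A : Space d → Space d →L[ℝ] Space d), IsCoefficient Ω γ₁ γ₂ A →
      ∀ (M : Mesh Ω) (H : ℝ), M.IsQuasiUniform H σ →
      (∃ t ∈ M.cells, Λ ⊆ convexHull ℝ (t : Set (Space d))) →
      ∀ u ∈ M.coarseSpace, ∀ k : ℕ, 1 ≤ k →
        (∃ q, M.IsIdealCorrector Λ β A u q) ∧
        (∀ v ∈ M.innerNodes, ∃ q, M.IsLocalCorrector Λ β A v k u q) ∧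
        ∀ (q : Space d → ℝ) (qloc : Space d → Space d → ℝ),
          M.IsIdealCorrector Λ β A u q →
          (∀ v ∈ M.innerNodes, M.IsLocalCorrector Λ β A v k u (qloc v)) →
          weightedNorm Ω Λ β (weakGradient Ω (fun x => q x - ∑ v ∈ M.innerNodes, qloc v x)) ≤
            C * (k : ℝ) ^ ((d : ℝ) / 2) * θ ^ k * weightedNorm Ω Λ β (weakGradient Ω u) := by
  obtain ⟨CA, -, hCA⟩ := exists_isMuckenhoupt d ℓ hℓ N K hK β hβ
  have hd0 : 0 < d := by omega
  obtain ⟨C, hC, θ, hθ, h⟩ := Mesh.exists_localization_error_le hd0 hΩ CA γ₂ hσ hγ₁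
  refine ⟨C, hC, θ, hθ, fun Λ hΛ _ A hA M H hM _ u hu k hk => ?_⟩
  have hS : M.IsAdmissible Λ β CA H σ := ⟨hσ, hM, hCA Λ hΛ, hΩ, hd0⟩
  refine ⟨Mesh.exists_isIdealCorrector hS hA hγ₁ hu,
    fun v hv => Mesh.exists_isLocalCorrector hS hA hγ₁ hu hv k, fun q qloc hq hql => ?_⟩
  refine (h hS hA hu hq hql).trans ?_
  have h1 : 1 ≤ (k : ℝ) ^ ((d : ℝ) / 2) :=
    Real.one_le_rpow (by exact_mod_cast hk) (by positivity)
  have hθ0 := hθ.1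
  have h2 : 0 ≤ weightedNorm Ω Λ β (weakGradient Ω u) := Real.sqrt_nonneg _
  gcongr
  exact le_mul_of_one_le_right hC.le h1
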